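/- **Setting.** Let $n\ge 2$, $2\le p<q<s<\infty$, $\alpha,\beta\in(0,1]$ with $q\le p+\frac{2\alpha}{n+2}$, $s\le p+\frac{2\beta}{n+2}$, and $0<\nu\le L$. Let $\Omega\subset\mathbb R^n$ be bounded and open, $T>0$, $\Omega_T=\Omega\times(0,T)$. Let $a,b:\mathbb R^{n+1}\to[0,\infty)$ be bounded with $$|a(x,t)-a(y,\tau)|\le [a]_\alpha(|x-y|+\sqrt{|t-\tau|})^\alpha,\qquad |b(x,t)-b(y,\tau)|\le [b]_\beta(|x-y|+\sqrt{|t-\tau|})^\beta ,$$ $[a]_\alpha,[b]_\beta>0$, and put $H(z,\kappa)=\kappa^p+a(z)\kappa^q+b(z)\kappa^s$. Let $\mathcal A(z,v,\xi)$, $\mathcal B(z,\xi)\in\mathbb R^{Nn}$ be Carathéodory fields on $\Omega_T$ with $\nu H(z,|\xi|)\le\mathcal A(z,v,\xi)\cdot\xi$, $|\mathcal A(z,v,\xi)||\xi|\le LH(z,|\xi|)$, $|\mathcal B(z,\xi)||\xi|\le LH(z,|\xi|)$, and let $F$ satisfy $\iint_{\Omega_T}H(z,|F|)\,dz<\infty$.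 Let $u\in C(0,T;L^2(\Omega,\mathbb R^N))\cap L^1(0,T;W^{1,1}(\Omega,\mathbb R^N))$ with $\iint_{\Omega_T}[H(z,|u|)+H(z,|\nabla u|)]\,dz<\infty$ be a weak solution of $u_t-\operatorname{div}\mathcal A(z,u,\nabla u)=-\operatorname{div}\mathcal B(z,F)$, i.e. $\iint_{\Omega_T}[-u\cdot\varphi_t+\mathcal A(z,u,\nabla u)\cdot\nabla\varphi]\,dz=\iint_{\Omega_T}\mathcal B(z,F)\cdot\nabla\varphi\,dz$ for all $\varphi\in C_0^\infty(\Omega_T,\mathbb R^N)$. Write $U_{r,\tau}(x,t)=B_r(x)\times(t-\tau,t+\tau)$. Let $U=U_{R_2,S_2}(z_0)\subset\Omega_T$, $z_0=(x_0,t_0)$, $R_1\in[R_2/2,R_2)$, $S_1\in[S_2/4,S_2)$. Let $u_0$ be the mean of $u$ over $U$, $f=\chi_U(|\nabla u|+|u-u_0|+|F|)$, $d=\frac{s-1+p}{2}$, and $G_f=M\big(f^d+(af^q)^{d/p}+(bf^s)^{d/p}\big)$, where $Mg(z)$ is the supremum of the means of $|g|$ over all cylinders $U_{r,\tau}(w)\ni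 z$, $r,\tau>0$. Put $$K=2+800[a]_\alpha\Big(\tfrac1{|B_1|}\iint_{\mathbb R^{n+1}} G_f^{p/d}\,dz\Big)^{\frac{\alpha}{n+2}}+800[b]_\beta\Big(\tfrac1{|B_1|}\iint_{\mathbb R^{n+1}} G_f^{p/d}\,dz\Big)^{\frac{\beta}{n+2}} .$$ Let $\Lambda_0>1+\|a\|_{L^\infty}+\|b\|_{L^\infty}$ satisfy $\iint_{\mathbb R^{n+1}} G_f^{p/d}\,dz\le\Lambda_0$, let $\Lambda>\Lambda_0$ and $E(\Lambda)=\{z\in\mathbb R^{n+1}:G_f(z)\le\Lambda^{d/p}\}$. For $z\in E(\Lambda)^c$ let $\lambda_z>1$ be the number with $\Lambda=\lambda_z^p+a(z)\lambda_z^q+b(z)\lambda_z^s$; let $\gamma_z$ be the sum of $\lambda_z^p$, of $a(z)\lambda_z^q$ if $K^2\lambda_z^p<a(z)\lambda_z^q$, and of $b(z)\lambda_z^s$ if $K^2\lambda_z^p<b(z)\lambda_z^s$. Put $d_z((x_1,t_1),(x_2,t_2))=\max\{|x_1-x_2|,\sqrt{\gamma_z\lambda_z^{-2}|t_1-t_2|}\}$,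 $4r_z=\inf_{w\in E(\Lambda)}d_z(z,w)$, and, for $\sigma>0$, $\sigma U_z=U_{\sigma r_z,\;\sigma^2r_z^2\lambda_z^2/\gamma_z}(z)$. Let $(U_i)=(U_{z_i})$, with $r_i=r_{z_i}$, be a countable Whitney cover, that is, $z_i\in E(\Lambda)^c$, the $\frac1KU_i$ cover $E(\Lambda)^c$, and the $\frac1{6K^6}U_i$ are pairwise disjoint. Let $\psi_i\in C_0^\infty(\frac2KU_i)$, $0\le\psi_i\le1$, $\psi_i=1$ on $\frac1KU_i$, $|\nabla\psi_i|\le 2Kr_i^{-1}$, $|\partial_t\psi_i|\le 2K^2r_i^{-2}\gamma_{z_i}\lambda_{z_i}^{-2}$, and let $\omega_i=\psi_i/\sum_j\psi_j$ (and $\omega_i=0$ where all $\psi_j$ vanish) be the associated partition of unity. Let $0<h<h_0<\frac{S_2-S_1}{4}$ and let $\eta\in C_0^\infty(B_{R_2}(x_0))$, $\zeta\in C_0^\infty((t_0-S_2+h_0,t_0+S_2-h_0))$ have values in $[0,1]$, $\eta=1$ on $B_{R_1}(x_0)$, $\zeta=1$ on $(t_0-S_1,t_0+S_1)$, $|\nabla\eta|\le\frac3{R_2-R_1}$,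 $|\zeta'|\le\frac3{S_2-S_1}$. Put $v=(u-u_0)\eta\zeta$ and $v_h=[u-u_0]_h\,\eta\zeta$, where $[w]_h(x,t)=\frac1h\int_t^{t+h}w(x,\tau)\,d\tau$. For $w\in\{v,v_h\}$ let $w^i$ be the mean of $w$ over $\frac2KU_i$ if $\frac2KU_i\subset U$, and $w^i=0$ otherwise, and let $w^\Lambda=w-\sum_i(w-w^i)\omega_i$; write $v^\Lambda$ and $v_h^\Lambda$. **Statement.** There are a constant $c$ depending only on $$\mathrm{data}=(n,N,p,q,s,\alpha,\beta,\nu,L,\|a\|_{L^\infty},\|b\|_{L^\infty},[a]_\alpha,[b]_\beta,R_1,R_2,S_1,S_2,K)$$ and a constant $c_\Lambda$ depending only on $\mathrm{data}$ and $\Lambda$ (in particular, neither depends on $h$, $h_0$) such that the following holds. 1. Let $\lambda>1$ be given by $\Lambda=\lambda^p+\|a\|_{L^\infty}\lambda^q+\|b\|_{L^\infty}\lambda^s$. After redefinition on a null subset of $E(\Lambda)$, $v_h^\Lambda$ satisfies, for all $z=(x,t)$ and $w=(y,\tau)$ in $\mathbb R^{n+1}$, $$|v_h^\Lambda(z)-v_h^\Lambda(w)|\le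 c_\Lambda\max\Big\{|x-y|,\sqrt{\lambda^{p-2}|t-\tau|}\Big\}.$$ 2. $v_h^\Lambda$ and $v^\Lambda$ are smooth in $E(\Lambda)^c$, and $$\iint_{E(\Lambda)^c}|v_h-v_h^\Lambda||\partial_tv_h^\Lambda|\,dz\le c_\Lambda|E(\Lambda)^c|,\qquad \iint_{E(\Lambda)^c}|v-v^\Lambda||\partial_tv^\Lambda|\,dz\le c\,\Lambda|E(\Lambda)^c| .$$ 3. $v^\Lambda$ has a weak spatial gradient $\nabla v^\Lambda\in L^1_{loc}(\mathbb R^{n+1})$, and $H(z,|v^\Lambda|)+H(z,|\nabla v^\Lambda|)\le c\,\Lambda$ for almost every $z\in\mathbb R^{n+1}$. -/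

import Mathlib

open MeasureTheory Set Filter Topology
open scoped ENNReal ContDiff

noncomputable section

namespace MultiPhase

/-- The spatial variable, the range of `u`, and all of their Euclidean norms. -/
abbrev Space (n : ℕ) := EuclideanSpace ℝ (Fin n)

/-- Space-time points `z = (x, t)`; the volume is Lebesgue measure on `ℝⁿ⁺¹`. -/
abbrev SpaceTime (n : ℕ) := Space n × ℝ

/-- `ℝ^{Nn}`, matrices with the Frobenius norm and inner product. -/
abbrev Mat (N n : ℕ) := EuclideanSpace ℝ (Fin N × Fin n)

/-- The open cylinder `U_{r,τ}(z) = B_r(x) × (t - τ, t + τ)`. -/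
def cyl {n : ℕ} (z : SpaceTime n) (r τ : ℝ) : Set (SpaceTime n) :=
  Metric.ball z.1 r ×ˢ Ioo (z.2 - τ) (z.2 + τ)

/-- Time derivative. -/
def dt {n : ℕ} {V : Type*} [NormedAddCommGroup V] [NormedSpace ℝ V]
    (w : SpaceTime n → V) (z : SpaceTime n) : V :=
  deriv (fun τ : ℝ => w (z.1, τ)) z.2

/-- Partial derivative in the `k`-th space direction. -/
def dx {n : ℕ} {V : Type*} [NormedAddCommGroup V] [NormedSpace ℝ V]
    (k : Fin n) (w : SpaceTime n → V) (z : SpaceTime n) : V :=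
  fderiv ℝ (fun x : Space n => w (x, z.2)) z.1 (EuclideanSpace.single k 1)

/-- Spatial gradient of a smooth `ℝᴺ`-valued function. -/
def grad {n N : ℕ} (w : SpaceTime n → Space N) (z : SpaceTime n) : Mat N n :=
  WithLp.toLp 2 fun jk => dx jk.2 w z jk.1

/-- `G` is the weak spatial gradient of `w` in the open set `O ⊆ ℝⁿ⁺¹`. -/
def HasWeakGradientOn {n N : ℕ} (O : Set (SpaceTime n))
    (w : SpaceTime n → Space N) (G : SpaceTime n → Mat N n) : Prop :=
  LocallyIntegrableOn w O ∧ LocallyIntegrableOn G O ∧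
    ∀ φ : SpaceTime n → ℝ, ContDiff ℝ ∞ φ → HasCompactSupport φ → tsupport φ ⊆ O →
      ∀ (j : Fin N) (k : Fin n),
        ∫ z in O, w z j * dx k φ z = - ∫ z in O, G z (j, k) * φ z

/-- Strong maximal function, the supremum being over all space-time cylinders
`B_r × (t - τ, t + τ)` that contain the point, with `r` and `τ` independent of each other. -/
def strongMax {n : ℕ} (g : SpaceTime n → ℝ) (z : SpaceTime n) : ℝ≥0∞ :=
  ⨆ (y : SpaceTime n) (r : ℝ) (τ : ℝ) (_ : 0 < r) (_ : 0 < τ) (_ : z ∈ cyl y r τ),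
    ⨍⁻ w in cyl y r τ, ENNReal.ofReal |g w| ∂volume

/-- Forward Steklov average `[w]_h(x,t) = (1/h) ∫_t^{t+h} w(x,τ) dτ`. -/
def steklov {n N : ℕ} (h : ℝ) (w : SpaceTime n → Space N) (z : SpaceTime n) : Space N :=
  h⁻¹ • ∫ τ in z.2..(z.2 + h), w (z.1, τ)

/-- `0 ≤ a`, `‖a‖_{L^∞(ℝⁿ⁺¹)} = M`, and `a` is parabolic `γ`-Hölder continuous with constant `A`.
(As `a` is continuous and nonnegative, its `L^∞` norm is its supremum.) -/
structure IsCoefficient {n : ℕ} (γ M A : ℝ) (a : SpaceTime n → ℝ) : Prop where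
  nonneg : ∀ z, 0 ≤ a z
  isLUB : IsLUB (range a) M
  holder : ∀ z w : SpaceTime n, |a z - a w| ≤ A * (‖z.1 - w.1‖ + √|z.2 - w.2|) ^ γ

/-- The numbers (besides `n` and `N`) on which constants may depend: the paper's `data`.
`normA = ‖a‖_∞`, `normB = ‖b‖_∞`, `holA = [a]_α`, `holB = [b]_β`. -/
structure Data where
  (p q s α β ν L normA normB holA holB R₁ R₂ S₁ S₂ K : ℝ)

/-- The standing assumptions on the numerical parameters. -/
structure Data.Admissible (D : Data) (n : ℕ) : Prop where
  two_le_n : 2 ≤ n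
  two_le_p : 2 ≤ D.p
  p_lt_q : D.p < D.q
  q_lt_s : D.q < D.s
  α_pos : 0 < D.α
  α_le : D.α ≤ 1
  β_pos : 0 < D.β
  β_le : D.β ≤ 1
  q_le : D.q ≤ D.p + 2 * D.α / (n + 2)
  s_le : D.s ≤ D.p + 2 * D.β / (n + 2)
  ν_pos : 0 < D.ν
  ν_le : D.ν ≤ D.L
  holA_pos : 0 < D.holA
  holB_pos : 0 < D.holB
  R₂_pos : 0 < D.R₂
  R₁_ge : D.R₂ / 2 ≤ D.R₁
  R₁_lt : D.R₁ < D.R₂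
  S₂_pos : 0 < D.S₂
  S₁_ge : D.S₂ / 2 ^ 2 ≤ D.S₁
  S₁_lt : D.S₁ < D.S₂

/-- `κ^p + A κ^q + B κ^s`. -/
def Data.Hval (D : Data) (A B κ : ℝ) : ℝ := κ ^ D.p + A * κ ^ D.q + B * κ ^ D.s

/-- The number `κ > 1` with `κ^p + A κ^q + B κ^s = Λ`
(it exists and is unique when `A, B ≥ 0` and `Λ > 1 + A + B`). -/
def Data.root (D : Data) (A B Λ : ℝ) : ℝ :=
  Classical.epsilon fun κ : ℝ => 1 < κ ∧ D.Hval A B κ = Λ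

/-- The exponent `d = (s - 1 + p) / 2`. -/
def Data.d (D : Data) : ℝ := (D.s - 1 + D.p) / 2

/-- `d_{λ^p}(z, w) = max {|x - y|, √(λ^{p-2} |t - s|)}` where
`Λ = λ^p + ‖a‖_∞ λ^q + ‖b‖_∞ λ^s`. -/
def Data.dLam (D : Data) {n : ℕ} (Λ : ℝ) (z w : SpaceTime n) : ℝ :=
  max ‖z.1 - w.1‖ √(D.root D.normA D.normB Λ ^ (D.p - 2) * |z.2 - w.2|)

/-- A Carathéodory vector field in `Q`: measurable in `z`, continuous in the other variable. -/
structure IsCaratheodory {n : ℕ} {X Y : Type*} [TopologicalSpace X] [TopologicalSpace Y]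
    (Q : Set (SpaceTime n)) (A : SpaceTime n → X → Y) : Prop where
  meas : ∀ ξ, AEStronglyMeasurable (fun z => A z ξ) (volume.restrict Q)
  cont : ∀ᵐ z ∂(volume.restrict Q), Continuous (A z)

/-- The parabolic multi-phase system
`u_t - div 𝒜(z,u,∇u) = - div ℬ(z,F)` in `Ω_T = Ω × (0,T)`, a weak solution `u` of it, with weak
spatial gradient `Du`, and a cylinder `U_{R₂,S₂}(z₀) ⊆ Ω_T`. The coefficients are given on all of
`ℝⁿ⁺¹`; of the functions `u`, `Du`, `F` only the values in `Ω_T` matter. -/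
structure Config (n N : ℕ) (D : Data) where
  Ω : Set (Space n)
  T : ℝ
  a : SpaceTime n → ℝ
  b : SpaceTime n → ℝ
  𝒜 : SpaceTime n → Space N → Mat N n → Mat N n
  ℬ : SpaceTime n → Mat N n → Mat N n
  F : SpaceTime n → Mat N n
  u : SpaceTime n → Space N
  Du : SpaceTime n → Mat N n
  z₀ : SpaceTime n
  isOpen_Ω : IsOpen Ω
  isBounded_Ω : Bornology.IsBounded Ω
  T_pos : 0 < T
  a_coeff : IsCoefficient D.α D.normA D.holA a
  b_coeff : IsCoefficient D.β D.normB D.holB b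
  -- structure of the vector fields
  𝒜_car : IsCaratheodory (Ω ×ˢ Ioo 0 T) fun z (vξ : Space N × Mat N n) => 𝒜 z vξ.1 vξ.2
  ℬ_car : IsCaratheodory (Ω ×ˢ Ioo 0 T) ℬ
  𝒜_coercive : ∀ z ∈ Ω ×ˢ Ioo 0 T, ∀ v ξ,
    D.ν * D.Hval (a z) (b z) ‖ξ‖ ≤ inner ℝ (𝒜 z v ξ) ξ
  𝒜_growth : ∀ z ∈ Ω ×ˢ Ioo 0 T, ∀ v ξ,
    ‖𝒜 z v ξ‖ * ‖ξ‖ ≤ D.L * D.Hval (a z) (b z) ‖ξ‖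
  ℬ_growth : ∀ z ∈ Ω ×ˢ Ioo 0 T, ∀ ξ,
    ‖ℬ z ξ‖ * ‖ξ‖ ≤ D.L * D.Hval (a z) (b z) ‖ξ‖
  -- the source term
  F_meas : AEStronglyMeasurable F (volume.restrict (Ω ×ˢ Ioo 0 T))
  F_int : IntegrableOn (fun z => D.Hval (a z) (b z) ‖F z‖) (Ω ×ˢ Ioo 0 T)
  -- `u ∈ C(0,T; L²(Ω))`
  u_memLp : ∀ t ∈ Ioo 0 T, MemLp (fun x => u (x, t)) 2 (volume.restrict Ω)
  u_cont : ∀ t ∈ Ioo 0 T, Tendsto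
    (fun τ => eLpNorm (fun x => u (x, τ) - u (x, t)) 2 (volume.restrict Ω)) (𝓝 t) (𝓝 0)
  -- `u ∈ L¹(0,T; W^{1,1}(Ω))` with gradient `Du`
  u_int : IntegrableOn u (Ω ×ˢ Ioo 0 T)
  Du_int : IntegrableOn Du (Ω ×ˢ Ioo 0 T)
  u_grad : HasWeakGradientOn (Ω ×ˢ Ioo 0 T) u Du
  -- finite energy
  energy : IntegrableOn
    (fun z => D.Hval (a z) (b z) ‖u z‖ + D.Hval (a z) (b z) ‖Du z‖) (Ω ×ˢ Ioo 0 T)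
  -- the weak formulation
  weak : ∀ φ : SpaceTime n → Space N, ContDiff ℝ ∞ φ → HasCompactSupport φ →
    tsupport φ ⊆ Ω ×ˢ Ioo 0 T →
      ∫ z in Ω ×ˢ Ioo 0 T, (-inner ℝ (u z) (dt φ z) + inner ℝ (𝒜 z (u z) (Du z)) (grad φ z)) =
        ∫ z in Ω ×ˢ Ioo 0 T, inner ℝ (ℬ z (F z)) (grad φ z)
  -- the cylinder
  cyl_subset : cyl z₀ D.R₂ D.S₂ ⊆ Ω ×ˢ Ioo 0 T

namespace Config

variable {n N : ℕ} {D : Data} (C : Config n N D)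

/-- `H(z, κ) = κ^p + a(z) κ^q + b(z) κ^s`. -/
def H (z : SpaceTime n) (κ : ℝ) : ℝ := D.Hval (C.a z) (C.b z) κ

/-- The cylinder `U_{R₂,S₂}(z₀)`. -/
def U : Set (SpaceTime n) := cyl C.z₀ D.R₂ D.S₂

/-- The mean value `u₀` of `u` over `U_{R₂,S₂}(z₀)`. -/
def u₀ : Space N := ⨍ z in C.U, C.u z

/-- `f = χ_U (|∇u| + |u - u₀| + |F|)`. -/
def f : SpaceTime n → ℝ :=
  C.U.indicator fun z => ‖C.Du z‖ + ‖C.u z - C.u₀‖ + ‖C.F z‖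

/-- `M(f^d + (a f^q)^{d/p} + (b f^s)^{d/p})`. -/
def maxF : SpaceTime n → ℝ≥0∞ :=
  strongMax fun z => C.f z ^ D.d + (C.a z * C.f z ^ D.q) ^ (D.d / D.p)
    + (C.b z * C.f z ^ D.s) ^ (D.d / D.p)

/-- `∬ M(f^d + (a f^q)^{d/p} + (b f^s)^{d/p})^{p/d} dz`. -/
def maxInt : ℝ≥0∞ := ∫⁻ z, C.maxF z ^ (D.p / D.d)

/-- The number `K` attached to the solution. -/
def Kval : ℝ :=
  2 + 800 * D.holA * ((volume (Metric.ball (0 : Space n) 1)).toReal⁻¹ * C.maxInt.toReal)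
        ^ (D.α / (n + 2))
    + 800 * D.holB * ((volume (Metric.ball (0 : Space n) 1)).toReal⁻¹ * C.maxInt.toReal)
        ^ (D.β / (n + 2))

/-- The good set `E(Λ)`. -/
def good (Λ : ℝ) : Set (SpaceTime n) := {z | C.maxF z ≤ ENNReal.ofReal (Λ ^ (D.d / D.p))}

/-- `λ_z`, the number greater than `1` with `Λ = λ_z^p + a(z) λ_z^q + b(z) λ_z^s`. -/
def lam (Λ : ℝ) (z : SpaceTime n) : ℝ := D.root (C.a z) (C.b z) Λ

open Classical in
/-- The growth function of the phase of `z`, at `λ_z`: the term `a(z) λ^q` counts if and only if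
`K² λ^p < a(z) λ^q`, the term `b(z) λ^s` if and only if `K² λ^p < b(z) λ^s`. So the value is
`λ^p`, `g_q(z,λ)`, `g_s(z,λ)`, `g_{q,s}(z,λ)` in the `p`-, `(p,q)`-, `(p,s)`- and
`(p,q,s)`-phase. -/
def growth (Λ : ℝ) (z : SpaceTime n) : ℝ :=
  C.lam Λ z ^ D.p
    + (if D.K ^ 2 * C.lam Λ z ^ D.p < C.a z * C.lam Λ z ^ D.q then C.a z * C.lam Λ z ^ D.q else 0)
    + (if D.K ^ 2 * C.lam Λ z ^ D.p < C.b z * C.lam Λ z ^ D.s then C.b z * C.lam Λ z ^ D.s else 0)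

/-- The time coefficient `g λ_z⁻²` of the intrinsic geometry at `z`
(this is `λ_z^{p-2}` in the `p`-phase). -/
def coef (Λ : ℝ) (z : SpaceTime n) : ℝ := C.growth Λ z / C.lam Λ z ^ 2

/-- The intrinsic metric `d_z`. -/
def dz (Λ : ℝ) (z z₁ z₂ : SpaceTime n) : ℝ :=
  max ‖z₁.1 - z₂.1‖ √(C.coef Λ z * |z₁.2 - z₂.2|)

/-- `r_z`, defined by `4 r_z = d_z(z, E(Λ))`. -/
def rad (Λ : ℝ) (z : SpaceTime n) : ℝ := (⨅ w : C.good Λ, C.dz Λ z z w) / 4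

/-- The rescaled intrinsic cylinder `σ U_z`, i.e. `B_{σ r_z}(x) × (t ± (σ r_z)² λ_z² / g)`. -/
def wcyl (Λ σ : ℝ) (z : SpaceTime n) : Set (SpaceTime n) :=
  cyl z (σ * C.rad Λ z) ((σ * C.rad Λ z) ^ 2 / C.coef Λ z)

/-- `{U_i}` with centres `z_i ∈ E(Λ)ᶜ` is a Whitney cover of the bad set: the `K⁻¹ U_i` cover
`E(Λ)ᶜ` and the `(6K⁶)⁻¹ U_i` are pairwise disjoint. -/
structure IsWhitney (Λ : ℝ) {ι : Type} (z : ι → SpaceTime n) : Prop where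
  mem : ∀ i, z i ∈ (C.good Λ)ᶜ
  cover : (C.good Λ)ᶜ ⊆ ⋃ i, C.wcyl Λ (1 / D.K) (z i)
  disj : Pairwise fun i j =>
    Disjoint (C.wcyl Λ (1 / (6 * D.K ^ 6)) (z i)) (C.wcyl Λ (1 / (6 * D.K ^ 6)) (z j))

/-- Cutoff functions `ψ_i ∈ C_0^∞(2K⁻¹ U_i)` with `ψ_i = 1` on `K⁻¹ U_i` and the natural bounds. -/
structure IsCutoffFamily (Λ : ℝ) {ι : Type} (z : ι → SpaceTime n)
    (ψ : ι → SpaceTime n → ℝ) : Prop where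
  smooth : ∀ i, ContDiff ℝ ∞ (ψ i)
  compact : ∀ i, HasCompactSupport (ψ i)
  supp : ∀ i, tsupport (ψ i) ⊆ C.wcyl Λ (2 / D.K) (z i)
  nonneg : ∀ i w, 0 ≤ ψ i w
  le_one : ∀ i w, ψ i w ≤ 1
  eq_one : ∀ i, ∀ w ∈ C.wcyl Λ (1 / D.K) (z i), ψ i w = 1
  grad_le : ∀ i (w : SpaceTime n),
    ‖fderiv ℝ (fun x : Space n => ψ i (x, w.2)) w.1‖ ≤ 2 * D.K * (C.rad Λ (z i))⁻¹
  dt_le : ∀ i (w : SpaceTime n),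
    |dt (ψ i) w| ≤ 2 * D.K ^ 2 * (C.rad Λ (z i) ^ 2)⁻¹ * C.coef Λ (z i)

/-- The cutoff functions `η ∈ C_0^∞(B_{R₂}(x₀))` and `ζ ∈ C_0^∞(t₀ ± (S₂ - h₀))`. -/
structure IsCutoffPair (h₀ : ℝ) (η : Space n → ℝ) (ζ : ℝ → ℝ) : Prop where
  η_smooth : ContDiff ℝ ∞ η
  η_compact : HasCompactSupport η
  η_supp : tsupport η ⊆ Metric.ball C.z₀.1 D.R₂
  η_nonneg : ∀ x, 0 ≤ η x
  η_le_one : ∀ x, η x ≤ 1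
  η_eq_one : ∀ x ∈ Metric.ball C.z₀.1 D.R₁, η x = 1
  η_grad : ∀ x, ‖fderiv ℝ η x‖ ≤ 3 / (D.R₂ - D.R₁)
  ζ_smooth : ContDiff ℝ ∞ ζ
  ζ_compact : HasCompactSupport ζ
  ζ_supp : tsupport ζ ⊆ Ioo (C.z₀.2 - (D.S₂ - h₀)) (C.z₀.2 + (D.S₂ - h₀))
  ζ_nonneg : ∀ t, 0 ≤ ζ t
  ζ_le_one : ∀ t, ζ t ≤ 1
  ζ_eq_one : ∀ t ∈ Ioo (C.z₀.2 - D.S₁) (C.z₀.2 + D.S₁), ζ t = 1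
  ζ_deriv : ∀ t, |deriv ζ t| ≤ 3 / (D.S₂ - D.S₁)

/-- `v(z) = (u(z) - u₀) η(x) ζ(t)`. -/
def v (η : Space n → ℝ) (ζ : ℝ → ℝ) (z : SpaceTime n) : Space N :=
  (η z.1 * ζ z.2) • (C.u z - C.u₀)

/-- `v_h(z) = [u - u₀]_h(z) η(x) ζ(t)`. -/
def vh (η : Space n → ℝ) (ζ : ℝ → ℝ) (h : ℝ) (z : SpaceTime n) : Space N :=
  (η z.1 * ζ z.2) • steklov h (fun w => C.u w - C.u₀) z

/-- The partition of unity `ω_i = ψ_i / ∑_j ψ_j` (zero where all `ψ_j` vanish). -/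
def pou {ι : Type} (ψ : ι → SpaceTime n → ℝ) (i : ι) (w : SpaceTime n) : ℝ :=
  ψ i w / ∑' j, ψ j w

open Classical in
/-- The mean value of `w` over `2K⁻¹ U_z` if this cylinder lies in `U_{R₂,S₂}(z₀)`, else `0`. -/
def localMean (Λ : ℝ) (w : SpaceTime n → Space N) (z : SpaceTime n) : Space N :=
  if C.wcyl Λ (2 / D.K) z ⊆ C.U then ⨍ y in C.wcyl Λ (2 / D.K) z, w y else 0

/-- The Lipschitz truncation `w^Λ = w - ∑_i (w - w^i) ω_i` of `w`. -/
def trunc (Λ : ℝ) {ι : Type} (z : ι → SpaceTime n) (ψ : ι → SpaceTime n → ℝ)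
    (w : SpaceTime n → Space N) (y : SpaceTime n) : Space N :=
  w y - ∑' i, pou ψ i y • (w y - C.localMean Λ w (z i))

end Config

end MultiPhase

end

open MultiPhase

namespace MultiPhase

set_option linter.unusedSectionVars false

/-! On the bad set the truncation equals `∑ ω_i m_i`, because the `ω_i` sum to 1 there and `w`
cancels. Every estimate therefore reduces to one approximation property: the mean of `|w - m_i|`
over `2K⁻¹U_i` is at most `A_i r_i`. Neighbouring cylinders are comparable and overlap
substantially, so neighbouring values `m_j`, `m_k` differ by at most `c A_k r_k`. As the derivatives
of the `ω_i` sum to zero, it follows that `|∇w^Λ| ≤ c A_k` and `|∂ₜw^Λ| ≤ c A_k θ_k / r_k`, where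
`θ_k = γ_k λ_k⁻²`. The mean of `|w - w^Λ|` is at most `c A_k r_k`, the radius cancels in the
product, and `A_k² θ_k` remains. For `v` one has `A_k = c λ_k`, so this is `c γ_k ≤ c Λ`; for `v_h`
a constant depending on `Λ` is enough.

The approximation property is a Poincaré inequality for solutions (`exists_weak_poincare`). The time
derivative of `u` is not a function, but by the equation the weighted spatial means of `u` vary in
time by at most the integral of the flux. At intrinsic scale the mean of `f` is at most `c λ` and
that of the flux at most `c Λ / λ` (`average_le`). Since `γ` is comparable with `Λ` in every phase,
a time length `τ = ρ² λ² / γ` turns the flux term `(τ / ρ) Λ / λ` into `c ρ λ`, the same size as the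
gradient term.

The geometry rests on a volume count. The cylinder `4U_z` lies in the bad set, whose volume is at
most `maxInt / Λ`; hence `r_z^(n+2) λ_z²` is bounded by a multiple of `maxInt` (`rad_pow_le`).
Together with Hölder continuity and `q ≤ p + 2α/(n+2)`, `s ≤ p + 2β/(n+2)`, the oscillation of `a`
times `λ_z^q` and that of `b` times `λ_z^s` are at most `K/20 · λ_z^p` on such cylinders (`osc_le`).
This yields comparability of `λ`, `θ` and `r` for neighbours, and it freezes the coefficients in the
average bounds.

The Lipschitz bound for `v_h^Λ` comes from Campanato's criterion (`exists_lipschitz_of_campanato`):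
a parabolic cylinder that is close to the good set relative to its size is handled by comparing the
truncation with `v_h`, any other one lies in a single Whitney cylinder, where the derivative bounds
apply. The weak gradient of `v^Λ` is found by integrating `∑ (v - m_i) ω_i` by parts term by term;
the approximation property makes the series absolutely summable, so no regularity of the boundary of
the good set is needed. The bound on `H` uses Lebesgue differentiation in the good set and `|v^Λ| +
|∇v^Λ| ≤ c λ_k` outside it. -/

instance isAddHaarMeasure_spaceTime (n : ℕ) :
    (volume : Measure (SpaceTime n)).IsAddHaarMeasure :=
  inferInstanceAs ((volume : Measure (Space n)).prod (volume : Measure ℝ)).IsAddHaarMeasure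

/-! ### Cylinders and their volumes -/

/-- The volume of the unit ball of `ℝⁿ`. -/
noncomputable def unitVol (n : ℕ) : ℝ := (volume (Metric.ball (0 : Space n) 1)).toReal

lemma unitVol_pos (n : ℕ) : 0 < unitVol n :=
  ENNReal.toReal_pos (Metric.measure_ball_pos _ _ one_pos).ne' measure_ball_lt_top.ne

lemma ofReal_unitVol (n : ℕ) :
    ENNReal.ofReal (unitVol n) = volume (Metric.ball (0 : Space n) 1) :=
  ENNReal.ofReal_toReal measure_ball_lt_top.ne

lemma volume_ball_space {n : ℕ} (x : Space n) {r : ℝ} (hr : 0 < r) :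
    volume (Metric.ball x r) = ENNReal.ofReal (r ^ n * unitVol n) := by
  rw [Measure.addHaar_ball_of_pos _ _ hr, finrank_euclideanSpace_fin,
    ENNReal.ofReal_mul (by positivity), ofReal_unitVol]

lemma volume_cyl {n : ℕ} (z : SpaceTime n) {r : ℝ} (hr : 0 < r) (τ : ℝ) :
    volume (cyl z r τ) = ENNReal.ofReal (unitVol n * r ^ n * (2 * τ)) := by
  have : volume (cyl z r τ)
      = volume (Metric.ball z.1 r) * volume (Ioo (z.2 - τ) (z.2 + τ)) :=
    Measure.prod_prod _ _
  rw [this, volume_ball_space _ hr, Real.volume_Ioo, ← ENNReal.ofReal_mul (by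
    have := unitVol_pos n; positivity)]
  congr 1; ring

lemma isOpen_cyl {n : ℕ} (z : SpaceTime n) (r τ : ℝ) : IsOpen (cyl z r τ) :=
  Metric.isOpen_ball.prod isOpen_Ioo

lemma measurableSet_cyl {n : ℕ} (z : SpaceTime n) (r τ : ℝ) : MeasurableSet (cyl z r τ) :=
  (isOpen_cyl z r τ).measurableSet

lemma mem_cyl {n : ℕ} {z w : SpaceTime n} {r τ : ℝ} :
    w ∈ cyl z r τ ↔ ‖w.1 - z.1‖ < r ∧ |w.2 - z.2| < τ := by
  simp only [cyl, mem_prod, Metric.mem_ball, dist_eq_norm, mem_Ioo, abs_lt]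
  constructor
  · rintro ⟨h, h1, h2⟩; exact ⟨h, by linarith, by linarith⟩
  · rintro ⟨h, h1, h2⟩; exact ⟨h, by linarith, by linarith⟩

lemma mem_cyl_self {n : ℕ} (z : SpaceTime n) {r τ : ℝ} (hr : 0 < r) (hτ : 0 < τ) :
    z ∈ cyl z r τ := by
  simp [mem_cyl, hr, hτ]

lemma cyl_subset_cyl {n : ℕ} {z w : SpaceTime n} {r τ r' τ' : ℝ}
    (h1 : ‖w.1 - z.1‖ + r ≤ r') (h2 : |w.2 - z.2| + τ ≤ τ') : cyl w r τ ⊆ cyl z r' τ' := by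
  intro y hy
  rw [mem_cyl] at hy ⊢
  constructor
  · have := norm_sub_le_norm_sub_add_norm_sub y.1 w.1 z.1
    linarith [hy.1]
  · have := abs_sub_le y.2 w.2 z.2
    linarith [hy.2]

/-! ### Poincaré inequality on balls, and smooth weights -/

lemma lintegral_comp_add_smul {n : ℕ} (c : Space n) {s : ℝ} (hs : 0 < s)
    (g : Space n → ℝ≥0∞) :
    ∫⁻ y, g (c + s • y) = ENNReal.ofReal ((s ^ n)⁻¹) * ∫⁻ y, g y := by
  have e : MeasurableEmbedding (fun y : Space n => s • y) :=
    (Homeomorph.smulOfNeZero s hs.ne').measurableEmbedding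
  have h := e.lintegral_map (fun y => g (c + y)) (μ := (volume : Measure (Space n)))
  rw [← h, Measure.map_addHaar_smul _ hs.ne', lintegral_smul_measure, finrank_euclideanSpace_fin,
    abs_of_pos (by positivity), lintegral_add_left_eq_self g c, smul_eq_mul]

/-- A convex combination with a fixed point of a convex set, seen as a change of variables. -/
lemma setLIntegral_comp_convex_le {n : ℕ} {B : Set (Space n)} (hB : Convex ℝ B)
    (hBm : MeasurableSet B) {x : Space n} (hx : x ∈ B) {s : ℝ} (hs : 1 / 2 ≤ s) (hs1 : s ≤ 1)
    (F : Space n → ℝ≥0∞) :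
    ∫⁻ y in B, F ((1 - s) • x + s • y) ≤ 2 ^ n * ∫⁻ y in B, F y := by
  have hs0 : 0 < s := by linarith
  calc ∫⁻ y in B, F ((1 - s) • x + s • y)
      = ∫⁻ y, B.indicator (fun y => F ((1 - s) • x + s • y)) y := (lintegral_indicator hBm _).symm
    -- Convexity keeps the image of `B` inside `B`. The change of variables then costs `s⁻ⁿ`, which
    -- is at most `2ⁿ` because `s ≥ 1/2`.
    _ ≤ ∫⁻ y, (B.indicator F) ((1 - s) • x + s • y) := by
        refine lintegral_mono fun y => ?_
        by_cases hy : y ∈ B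
        · rw [indicator_of_mem hy, indicator_of_mem]
          exact hB hx hy (by linarith) hs0.le (by ring)
        · simp [indicator_of_notMem hy]
    _ = ENNReal.ofReal ((s ^ n)⁻¹) * ∫⁻ y in B, F y := by
        rw [lintegral_comp_add_smul _ hs0, lintegral_indicator hBm]
    _ ≤ 2 ^ n * ∫⁻ y in B, F y := by
        gcongr
        rw [show (2 : ℝ≥0∞) ^ n = ENNReal.ofReal (2 ^ n) by
          rw [ENNReal.ofReal_pow (by norm_num)]; norm_num]
        apply ENNReal.ofReal_le_ofReal
        rw [← inv_pow]
        apply pow_le_pow_left₀ (by positivity)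
        rw [inv_le_comm₀ hs0 (by norm_num)]
        linarith

lemma enorm_sub_le_lintegral_fderiv {n : ℕ} {u : Space n → ℝ} (hu : ContDiff ℝ 1 u)
    (x y : Space n) :
    ‖u y - u x‖ₑ ≤ ‖y - x‖ₑ * ∫⁻ s in Ioc (0 : ℝ) 1, ‖fderiv ℝ u ((1 - s) • x + s • y)‖ₑ := by
  have hc : Continuous (fderiv ℝ u) := hu.continuous_fderiv one_ne_zero
  have hd : ∀ s : ℝ, HasDerivAt (fun s : ℝ => u ((1 - s) • x + s • y))
      (fderiv ℝ u ((1 - s) • x + s • y) (y - x)) s := by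
    intro s
    have h1 : HasDerivAt (fun s : ℝ => (1 - s) • x + s • y) (y - x) s := by
      have := (((hasDerivAt_id s).const_sub 1).smul_const x).add ((hasDerivAt_id s).smul_const y)
      refine this.congr_deriv ?_
      simp [sub_eq_neg_add]
    exact ((hu.differentiable one_ne_zero) _).hasFDerivAt.comp_hasDerivAt s h1
  have hci : Continuous fun s : ℝ => fderiv ℝ u ((1 - s) • x + s • y) (y - x) := by fun_prop
  have h := intervalIntegral.integral_eq_sub_of_hasDerivAt (a := 0) (b := 1)
    (fun s _ => hd s) (hci.intervalIntegrable _ _)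
  simp only [sub_zero, one_smul, zero_smul, add_zero, sub_self, zero_add] at h
  rw [← h, intervalIntegral.integral_of_le zero_le_one]
  refine (enorm_integral_le_lintegral_enorm _).trans ?_
  rw [← lintegral_const_mul' _ _ enorm_ne_top]
  refine lintegral_mono fun s => ?_
  rw [mul_comm]
  exact (fderiv ℝ u _).le_opENorm _

/-- The difference is integrated along the segment from `x` to `y`. For `s ≥ 1/2` the point `(1 -
s)x + sy` is used as a new variable in place of `y`, for `s ≤ 1/2` in place of `x`; in both ranges
the Jacobian is at most `2ⁿ`, so no singular kernel appears. -/
lemma poincare_ball {n : ℕ} {u : Space n → ℝ} (hu : ContDiff ℝ 1 u) (x₀ : Space n) (ρ : ℝ) :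
    ∫⁻ x in Metric.ball x₀ ρ, ∫⁻ y in Metric.ball x₀ ρ, ‖u x - u y‖ₑ
      ≤ ENNReal.ofReal (2 * ρ) * (2 ^ n * volume (Metric.ball x₀ ρ) *
        ∫⁻ y in Metric.ball x₀ ρ, ‖fderiv ℝ u y‖ₑ) := by
  set B := Metric.ball x₀ ρ
  have hBm : MeasurableSet B := measurableSet_ball
  have hBc : Convex ℝ B := convex_ball _ _
  set F : Space n → ℝ≥0∞ := fun y => ‖fderiv ℝ u y‖ₑ with hF
  have hFc : Continuous F := (hu.continuous_fderiv one_ne_zero).enorm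
  calc ∫⁻ x in B, ∫⁻ y in B, ‖u x - u y‖ₑ
      ≤ ∫⁻ x in B, ∫⁻ y in B, ENNReal.ofReal (2 * ρ) *
          ∫⁻ s in Ioc (0 : ℝ) 1, F ((1 - s) • x + s • y) := by
        refine setLIntegral_mono' hBm fun x hx => setLIntegral_mono' hBm fun y hy => ?_
        rw [← enorm_neg, neg_sub]
        refine (enorm_sub_le_lintegral_fderiv hu x y).trans ?_
        gcongr
        rw [← ofReal_norm]
        apply ENNReal.ofReal_le_ofReal
        have h1 : dist y x₀ < ρ := hy
        have h2 : dist x x₀ < ρ := hx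
        rw [← dist_eq_norm]
        linarith [dist_triangle_right y x x₀]
    _ = ENNReal.ofReal (2 * ρ) * ∫⁻ s in Ioc (0 : ℝ) 1, ∫⁻ x in B, ∫⁻ y in B,
          F ((1 - s) • x + s • y) := by
        have m1 : Measurable fun p : (Space n × Space n) × ℝ =>
            F ((1 - p.2) • p.1.1 + p.2 • p.1.2) := by
          apply Continuous.measurable; fun_prop
        have m2 : Measurable fun p : (Space n × ℝ) × Space n =>
            F ((1 - p.1.2) • p.1.1 + p.1.2 • p.2) := by
          apply Continuous.measurable; fun_prop
        have m3 : ∀ x, Measurable fun p : Space n × ℝ => F ((1 - p.2) • x + p.2 • p.1) := by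
          intro x; apply Continuous.measurable; fun_prop
        have e1 : ∀ x, ∫⁻ y in B, ENNReal.ofReal (2 * ρ) *
            ∫⁻ s in Ioc (0 : ℝ) 1, F ((1 - s) • x + s • y) = ENNReal.ofReal (2 * ρ) *
            ∫⁻ s in Ioc (0 : ℝ) 1, ∫⁻ y in B, F ((1 - s) • x + s • y) := by
          intro x
          rw [lintegral_const_mul' _ _ ENNReal.ofReal_ne_top, lintegral_lintegral_swap]
          exact (m3 x).aemeasurable
        simp_rw [e1]
        rw [lintegral_const_mul' _ _ ENNReal.ofReal_ne_top, lintegral_lintegral_swap]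
        exact (m2.lintegral_prod_right' (ν := volume.restrict B)).aemeasurable
    _ ≤ ENNReal.ofReal (2 * ρ) * ∫⁻ s in Ioc (0 : ℝ) 1,
          2 ^ n * volume B * ∫⁻ y in B, F y := by
        gcongr ENNReal.ofReal (2 * ρ) * ?_
        refine setLIntegral_mono' measurableSet_Ioc fun s hs => ?_
        rcases le_total (1 / 2) s with h | h
        · calc ∫⁻ x in B, ∫⁻ y in B, F ((1 - s) • x + s • y)
              ≤ ∫⁻ x in B, 2 ^ n * ∫⁻ y in B, F y :=
                setLIntegral_mono' hBm fun x hx => setLIntegral_comp_convex_le hBc hBm hx h hs.2 F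
            _ = _ := by rw [setLIntegral_const]; ring
        · have m2 : Measurable fun p : Space n × Space n => F ((1 - s) • p.1 + s • p.2) := by
            apply Continuous.measurable; fun_prop
          rw [lintegral_lintegral_swap m2.aemeasurable]
          calc ∫⁻ y in B, ∫⁻ x in B, F ((1 - s) • x + s • y)
              ≤ ∫⁻ x in B, 2 ^ n * ∫⁻ y in B, F y := by
                refine setLIntegral_mono' hBm fun y hy => ?_
                have := setLIntegral_comp_convex_le hBc hBm hy (s := 1 - s) (by linarith)
                  (by linarith [hs.1]) F
                simpa only [sub_sub_cancel, add_comm] using this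
            _ = _ := by rw [setLIntegral_const]; ring
    _ = _ := by simp

/-- Smooth weights on balls with the natural bounds. -/
lemma exists_weight (n : ℕ) : ∃ c : ℝ, 0 < c ∧ ∀ (x₀ : Space n) (ρ : ℝ), 0 < ρ →
    ∃ θ : Space n → ℝ, ContDiff ℝ ∞ θ ∧ HasCompactSupport θ ∧
      Function.support θ ⊆ Metric.ball x₀ ρ ∧
      (∀ x, 0 ≤ θ x) ∧ ∫ x, θ x = 1 ∧ (∀ x, θ x ≤ c / ρ ^ n) ∧
      ∀ x, ‖fderiv ℝ θ x‖ ≤ c / ρ ^ (n + 1) := by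
  -- A single normalized bump on the unit ball is rescaled to `ρ⁻ⁿ b(ρ⁻¹(x - x₀))`. Each derivative
  -- costs one further factor `ρ⁻¹`, and `c1 + c2 + 1` serves both bounds.
  let β : ContDiffBump (0 : Space n) := ⟨1 / 2, 1, by norm_num, by norm_num⟩
  set b : Space n → ℝ := β.normed volume with hb
  have hbs : ContDiff ℝ ∞ b := β.contDiff_normed
  have hbc : HasCompactSupport b := β.hasCompactSupport_normed
  obtain ⟨c1, hc1⟩ := hbs.continuous.bounded_above_of_compact_support hbc
  obtain ⟨c2, hc2⟩ := (hbs.continuous_fderiv (by simp)).bounded_above_of_compact_support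
    (hbc.fderiv (𝕜 := ℝ))
  have hc1p : 0 ≤ c1 := (norm_nonneg _).trans (hc1 0)
  have hc2p : 0 ≤ c2 := (norm_nonneg _).trans (hc2 0)
  refine ⟨c1 + c2 + 1, by positivity, fun x₀ ρ hρ => ?_⟩
  let A : Space n ≃ₜ Space n := (Homeomorph.subRight x₀).trans
    (Homeomorph.smulOfNeZero ρ⁻¹ (inv_ne_zero hρ.ne'))
  refine ⟨fun x => (ρ ^ n)⁻¹ * b (ρ⁻¹ • (x - x₀)), ?_, ?_, ?_, ?_, ?_, ?_, ?_⟩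
  · exact contDiff_const.mul (hbs.comp (by fun_prop))
  · exact (hbc.comp_homeomorph A).mul_left
  · intro x hx
    have h1 : b (ρ⁻¹ • (x - x₀)) ≠ 0 := right_ne_zero_of_mul hx
    have h2 : ρ⁻¹ • (x - x₀) ∈ Function.support b := h1
    rw [hb, β.support_normed_eq, mem_ball_zero_iff, norm_smul, norm_inv, Real.norm_of_nonneg hρ.le,
      inv_mul_lt_iff₀ hρ] at h2
    rw [Metric.mem_ball, dist_eq_norm]
    simpa [β] using h2
  · intro x
    have := β.nonneg_normed (μ := volume) (ρ⁻¹ • (x - x₀))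
    positivity
  · rw [integral_const_mul, integral_sub_right_eq_self (fun x => b (ρ⁻¹ • x)) x₀,
      Measure.integral_comp_smul, finrank_euclideanSpace_fin, hb, β.integral_normed]
    rw [inv_pow, inv_inv, abs_of_pos (by positivity), smul_eq_mul, mul_one]
    field_simp
  · intro x
    have := (le_abs_self _).trans (hc1 (ρ⁻¹ • (x - x₀)))
    rw [div_eq_inv_mul]
    exact mul_le_mul_of_nonneg_left (by linarith) (by positivity)
  · intro x
    have hd : HasFDerivAt (fun x => (ρ ^ n)⁻¹ * b (ρ⁻¹ • (x - x₀)))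
        ((ρ ^ n)⁻¹ • ((fderiv ℝ b (ρ⁻¹ • (x - x₀))).comp
          (ρ⁻¹ • ContinuousLinearMap.id ℝ (Space n)))) x := by
      refine HasFDerivAt.const_mul ?_ _
      refine (((hbs.differentiable (by simp)) _).hasFDerivAt).comp x ?_
      exact ((hasFDerivAt_id x).sub_const x₀).const_smul ρ⁻¹
    rw [hd.fderiv, ContinuousLinearMap.comp_smul, ContinuousLinearMap.comp_id, norm_smul, norm_smul,
      Real.norm_of_nonneg (by positivity), Real.norm_of_nonneg (by positivity), pow_succ]
    have := hc2 (ρ⁻¹ • (x - x₀))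
    calc (ρ ^ n)⁻¹ * (ρ⁻¹ * ‖fderiv ℝ b (ρ⁻¹ • (x - x₀))‖)
        ≤ (ρ ^ n)⁻¹ * (ρ⁻¹ * (c1 + c2 + 1)) := by gcongr; linarith
      _ = _ := by field_simp

/-! ### Derivatives along space and time slices -/

section Derivatives
variable {n : ℕ} {V : Type*} [NormedAddCommGroup V] [NormedSpace ℝ V]

lemma hasFDerivAt_slice_space {w : SpaceTime n → V} {z : SpaceTime n}
    (h : DifferentiableAt ℝ w z) :
    HasFDerivAt (fun x : Space n => w (x, z.2))
      ((fderiv ℝ w z).comp (ContinuousLinearMap.inl ℝ (Space n) ℝ)) z.1 := by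
  have h1 : HasFDerivAt w (fderiv ℝ w z) (z.1, z.2) := h.hasFDerivAt
  exact h1.comp z.1 (hasFDerivAt_prodMk_left z.1 z.2)

lemma dx_eq_fderiv {w : SpaceTime n → V} {z : SpaceTime n} (h : DifferentiableAt ℝ w z)
    (k : Fin n) : dx k w z = fderiv ℝ w z (EuclideanSpace.single k 1, 0) := by
  rw [dx, (hasFDerivAt_slice_space h).fderiv]
  simp

lemma hasDerivAt_slice_time {w : SpaceTime n → V} {z : SpaceTime n} (h : DifferentiableAt ℝ w z) :
    HasDerivAt (fun τ : ℝ => w (z.1, τ)) (fderiv ℝ w z (0, 1)) z.2 := by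
  have h1 : HasFDerivAt w (fderiv ℝ w z) (z.1, z.2) := h.hasFDerivAt
  have h2 := (h1.comp z.2 (hasFDerivAt_prodMk_right z.1 z.2)).hasDerivAt
  simp only [ContinuousLinearMap.comp_apply, ContinuousLinearMap.inr_apply] at h2
  exact h2

lemma dt_eq_fderiv {w : SpaceTime n → V} {z : SpaceTime n} (h : DifferentiableAt ℝ w z) :
    dt w z = fderiv ℝ w z (0, 1) :=
  (hasDerivAt_slice_time h).deriv

lemma continuous_dx {w : SpaceTime n → V} (h : ContDiff ℝ 1 w) (k : Fin n) :
    Continuous (dx k w) := by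
  have : dx k w = fun z => fderiv ℝ w z (EuclideanSpace.single k 1, 0) :=
    funext fun z => dx_eq_fderiv (h.differentiable one_ne_zero z) k
  rw [this]
  exact (h.continuous_fderiv one_ne_zero).clm_apply continuous_const

lemma continuous_dt {w : SpaceTime n → V} (h : ContDiff ℝ 1 w) : Continuous (dt w) := by
  have : dt w = fun z => fderiv ℝ w z (0, 1) :=
    funext fun z => dt_eq_fderiv (h.differentiable one_ne_zero z)
  rw [this]
  exact (h.continuous_fderiv one_ne_zero).clm_apply continuous_const

/-- The operator norm is at most the sum of the norms of the partial derivatives. -/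
lemma opNorm_le_sum_single (L : Space n →L[ℝ] V) :
    ‖L‖ ≤ ∑ k, ‖L (EuclideanSpace.single k 1)‖ := by
  refine L.opNorm_le_bound (Finset.sum_nonneg fun _ _ => norm_nonneg _) fun x => ?_
  have hx : x = ∑ k, x k • EuclideanSpace.single k (1 : ℝ) := by
    ext j
    simp [Pi.single_apply]
  calc ‖L x‖ = ‖∑ k, x k • L (EuclideanSpace.single k (1 : ℝ))‖ := by
        conv_lhs => rw [hx]
        simp only [map_sum, map_smul]
    _ ≤ ∑ k, ‖x k • L (EuclideanSpace.single k (1 : ℝ))‖ := norm_sum_le _ _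
    _ ≤ ∑ k, ‖x‖ * ‖L (EuclideanSpace.single k (1 : ℝ))‖ := by
        refine Finset.sum_le_sum fun k _ => ?_
        rw [norm_smul]
        gcongr
        exact PiLp.norm_apply_le x k
    _ = _ := by rw [← Finset.mul_sum, mul_comm]

lemma enorm_fderiv_slice_le (w : SpaceTime n → V) (z : SpaceTime n) :
    ‖fderiv ℝ (fun x : Space n => w (x, z.2)) z.1‖ₑ ≤ ∑ k, ‖dx k w z‖ₑ := by
  have h := opNorm_le_sum_single (fderiv ℝ (fun x : Space n => w (x, z.2)) z.1)
  calc ‖fderiv ℝ (fun x : Space n => w (x, z.2)) z.1‖ₑ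
      = ENNReal.ofReal ‖fderiv ℝ (fun x : Space n => w (x, z.2)) z.1‖ := (ofReal_norm _).symm
    _ ≤ ENNReal.ofReal (∑ k, ‖dx k w z‖) := ENNReal.ofReal_le_ofReal h
    _ = ∑ k, ‖dx k w z‖ₑ := by
        rw [ENNReal.ofReal_sum_of_nonneg fun _ _ => norm_nonneg _]
        simp only [ofReal_norm]

end Derivatives

/-! ### Space-time Poincaré inequality for classical solutions -/

lemma setLIntegral_cyl {n : ℕ} (z : SpaceTime n) (ρ τ : ℝ) {F : SpaceTime n → ℝ≥0∞}
    (hF : Measurable F) :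
    ∫⁻ y in cyl z ρ τ, F y
      = ∫⁻ t in Ioo (z.2 - τ) (z.2 + τ), ∫⁻ x in Metric.ball z.1 ρ, F (x, t) := by
  rw [cyl, Measure.volume_eq_prod, ← Measure.prod_restrict]
  exact lintegral_prod_symm' _ hF

/-- Since `θ` has integral 1, the difference is `∫ θ(y) (u(x) - u(y)) dy`, and `θ ≤ c`. -/
lemma enorm_sub_weighted_mean_le {n : ℕ} {B : Set (Space n)}
    {θ : Space n → ℝ} {c : ℝ} (hθ : Continuous θ) (hθc : HasCompactSupport θ)
    (hsupp : Function.support θ ⊆ B) (h0 : ∀ x, 0 ≤ θ x) (h1 : ∫ x, θ x = 1)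
    (hle : ∀ x, θ x ≤ c) {u : Space n → ℝ} (hu : Continuous u) (x : Space n) :
    ‖u x - ∫ y, θ y * u y‖ₑ ≤ ENNReal.ofReal c * ∫⁻ y in B, ‖u x - u y‖ₑ := by
  have i1 : Integrable fun y => θ y * u x :=
    (hθ.integrable_of_hasCompactSupport hθc).mul_const _
  have i2 : Integrable fun y => θ y * u y :=
    (hθ.mul hu).integrable_of_hasCompactSupport hθc.mul_right
  have e : u x - ∫ y, θ y * u y = ∫ y, θ y * (u x - u y) := by
    simp_rw [mul_sub]
    rw [integral_sub i1 i2, integral_mul_const, h1, one_mul]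
  have e2 : ∫ y, θ y * (u x - u y) = ∫ y in B, θ y * (u x - u y) := by
    refine (setIntegral_eq_integral_of_forall_compl_eq_zero fun y hy => ?_).symm
    rw [Function.notMem_support.1 fun h => hy (hsupp h), zero_mul]
  rw [e, e2, ← lintegral_const_mul' _ _ ENNReal.ofReal_ne_top]
  refine (enorm_integral_le_lintegral_enorm _).trans (lintegral_mono fun y => ?_)
  dsimp only
  rw [enorm_mul, Real.enorm_of_nonneg (h0 y)]
  gcongr
  exact hle y

/-- Time variation of weighted spatial means of a classical solution of
`∂ₜ w = div S + g`. -/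
lemma enorm_weighted_mean_sub_le {n : ℕ} {x₀ : Space n} {ρ a b c c' : ℝ}
    {θ : Space n → ℝ} (hθ : ContDiff ℝ ∞ θ) (hθc : HasCompactSupport θ)
    (hsupp : Function.support θ ⊆ Metric.ball x₀ ρ) (h0 : ∀ x, 0 ≤ θ x)
    (hle : ∀ x, θ x ≤ c) (hle' : ∀ x, ‖fderiv ℝ θ x‖ ≤ c')
    {w : SpaceTime n → ℝ} {S : Fin n → SpaceTime n → ℝ} {g : SpaceTime n → ℝ}
    (hw : ContDiff ℝ 1 w) (hS : ∀ k, ContDiff ℝ 1 (S k)) (hg : Continuous g)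
    (heq : ∀ z, dt w z = ∑ k, dx k (S k) z + g z) {s t : ℝ} (hs : s ∈ Ioo a b)
    (ht : t ∈ Ioo a b) (hst : s ≤ t) :
    ‖(∫ x, θ x * w (x, t)) - ∫ x, θ x * w (x, s)‖ₑ
      ≤ (ENNReal.ofReal c' * ∑ k, ∫⁻ σ in Ioo a b, ∫⁻ x in Metric.ball x₀ ρ, ‖S k (x, σ)‖ₑ)
        + ENNReal.ofReal c * ∫⁻ σ in Ioo a b, ∫⁻ x in Metric.ball x₀ ρ, ‖g (x, σ)‖ₑ := by
  have hwc := hw.continuous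
  have hdt := continuous_dt hw
  have hθ' := hθ.continuous
  have hint : ∀ r : ℝ, Integrable fun x => θ x * w (x, r) := fun r =>
    (hθ'.mul (hwc.comp (by fun_prop))).integrable_of_hasCompactSupport hθc.mul_right
  have hftc : ∀ x, w (x, t) - w (x, s) = ∫ σ in Ioc s t, dt w (x, σ) := by
    intro x
    rw [← intervalIntegral.integral_of_le hst]
    refine (intervalIntegral.integral_eq_sub_of_hasDerivAt (f := fun σ => w (x, σ))
      (fun σ _ => ?_) ?_).symm
    · have := hasDerivAt_slice_time (hw.differentiable one_ne_zero (x, σ))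
      rwa [← dt_eq_fderiv (hw.differentiable one_ne_zero (x, σ))] at this
    · exact (hdt.comp (by fun_prop)).intervalIntegrable _ _
  have hprod : Integrable (Function.uncurry fun (x : Space n) (σ : ℝ) => θ x * dt w (x, σ))
      ((volume : Measure (Space n)).prod (volume.restrict (Ioc s t))) := by
    have hc : Continuous fun z : SpaceTime n => θ z.1 * dt w z := by fun_prop
    have h1 : IntegrableOn (fun z : SpaceTime n => θ z.1 * dt w z) (tsupport θ ×ˢ Icc s t)
        ((volume : Measure (Space n)).prod volume) :=
      hc.continuousOn.integrableOn_compact (hθc.isCompact.prod isCompact_Icc)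
    have h2 : IntegrableOn (fun z : SpaceTime n => θ z.1 * dt w z) (univ ×ˢ Ioc s t)
        ((volume : Measure (Space n)).prod volume) := by
      refine h1.of_forall_sdiff_eq_zero (MeasurableSet.univ.prod measurableSet_Ioc) fun z hz => ?_
      have : z.1 ∉ tsupport θ := fun h =>
        hz.2 ⟨h, Ioc_subset_Icc_self hz.1.2⟩
      rw [image_eq_zero_of_notMem_tsupport this, zero_mul]
    rw [IntegrableOn, ← Measure.prod_restrict, Measure.restrict_univ] at h2
    exact h2
  have e1 : (∫ x, θ x * w (x, t)) - ∫ x, θ x * w (x, s)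
      = ∫ σ in Ioc s t, ∫ x, θ x * dt w (x, σ) := by
    rw [← integral_sub (hint t) (hint s), ← integral_integral_swap hprod]
    congr 1 with x
    rw [← mul_sub, hftc, integral_const_mul]
  -- The equation replaces `∂ₜw` by `div S + g`, and integration by parts moves the divergence onto
  -- the weight `θ`. Hence only `S` itself is needed, not its derivatives.
  have key : ∀ σ, ‖∫ x, θ x * dt w (x, σ)‖ₑ ≤
      (ENNReal.ofReal c' * ∑ k, ∫⁻ x in Metric.ball x₀ ρ, ‖S k (x, σ)‖ₑ)
        + ENNReal.ofReal c * ∫⁻ x in Metric.ball x₀ ρ, ‖g (x, σ)‖ₑ := by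
    intro σ
    have iS : ∀ k, Integrable fun x => θ x * dx k (S k) (x, σ) := fun k =>
      (hθ'.mul ((continuous_dx (hS k) k).comp (by fun_prop))).integrable_of_hasCompactSupport
        hθc.mul_right
    have ig : Integrable fun x => θ x * g (x, σ) :=
      (hθ'.mul (hg.comp (by fun_prop))).integrable_of_hasCompactSupport hθc.mul_right
    have ibp : ∀ k, ∫ x, θ x * dx k (S k) (x, σ)
        = - ∫ x, fderiv ℝ θ x (EuclideanSpace.single k 1) * S k (x, σ) := by
      intro k
      have hSσ : ContDiff ℝ 1 fun x : Space n => S k (x, σ) :=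
        (hS k).comp (contDiff_id.prodMk contDiff_const)
      have hfθ : Continuous fun x => fderiv ℝ θ x (EuclideanSpace.single k 1) :=
        (hθ.continuous_fderiv (by simp)).clm_apply continuous_const
      refine integral_mul_fderiv_eq_neg_fderiv_mul_of_integrable ?_ (iS k) ?_
        (fun x _ => hθ.differentiable (by simp) x) fun x _ => hSσ.differentiable one_ne_zero x
      · refine (hfθ.mul hSσ.continuous).integrable_of_hasCompactSupport ?_
        exact (hθc.fderiv_apply (𝕜 := ℝ) _).mul_right
      · exact (hθ'.mul hSσ.continuous).integrable_of_hasCompactSupport hθc.mul_right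
    have e2 : ∫ x, θ x * dt w (x, σ)
        = (∑ k, - ∫ x, fderiv ℝ θ x (EuclideanSpace.single k 1) * S k (x, σ))
          + ∫ x, θ x * g (x, σ) := by
      simp_rw [heq, mul_add, Finset.mul_sum]
      rw [integral_add (integrable_finsetSum _ fun k _ => iS k) ig,
        integral_finsetSum _ fun k _ => iS k]
      simp_rw [ibp]
    have restr : ∀ f : Space n → ℝ, (∀ x, x ∉ Metric.ball x₀ ρ → f x = 0) →
        ‖∫ x, f x‖ₑ ≤ ∫⁻ x in Metric.ball x₀ ρ, ‖f x‖ₑ := by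
      intro f hf
      rw [← setIntegral_eq_integral_of_forall_compl_eq_zero hf]
      exact enorm_integral_le_lintegral_enorm _
    have hθ0 : ∀ x, x ∉ Metric.ball x₀ ρ → θ x = 0 := fun x hx =>
      Function.notMem_support.1 fun h => hx (hsupp h)
    have hθ1 : ∀ x, x ∉ Metric.ball x₀ ρ → fderiv ℝ θ x = 0 := by
      intro x hx
      -- Only the support of `θ`, not its closure, is known to lie in the ball. At points outside,
      -- including the boundary, `θ` attains its minimum 0, so its derivative vanishes there.
      have hmin : IsLocalMin θ x := by
        refine Filter.Eventually.of_forall fun y => ?_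
        rw [hθ0 x hx]
        exact h0 y
      exact hmin.fderiv_eq_zero
    rw [e2]
    refine (enorm_add_le _ _).trans (add_le_add ?_ ?_)
    · refine (enorm_sum_le _ _).trans ?_
      rw [Finset.mul_sum]
      refine Finset.sum_le_sum fun k _ => ?_
      rw [enorm_neg]
      refine (restr _ fun x hx => by rw [hθ1 x hx]; simp).trans ?_
      rw [← lintegral_const_mul' _ _ ENNReal.ofReal_ne_top]
      refine lintegral_mono fun x => ?_
      dsimp only
      rw [enorm_mul]
      gcongr
      rw [← ofReal_norm]
      apply ENNReal.ofReal_le_ofReal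
      refine ((fderiv ℝ θ x).le_opNorm _).trans ?_
      simpa using hle' x
    · refine (restr _ fun x hx => by rw [hθ0 x hx, zero_mul]).trans ?_
      rw [← lintegral_const_mul' _ _ ENNReal.ofReal_ne_top]
      refine lintegral_mono fun x => ?_
      dsimp only
      rw [enorm_mul, Real.enorm_of_nonneg (h0 x)]
      gcongr
      exact hle x
  have mS : ∀ k, Measurable fun σ => ∫⁻ x in Metric.ball x₀ ρ, ‖S k (x, σ)‖ₑ := fun k =>
    Measurable.lintegral_prod_left' (f := fun z : Space n × ℝ => ‖S k z‖ₑ)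
      (hS k).continuous.measurable.enorm
  have mg : Measurable fun σ => ∫⁻ x in Metric.ball x₀ ρ, ‖g (x, σ)‖ₑ :=
    Measurable.lintegral_prod_left' (f := fun z : Space n × ℝ => ‖g z‖ₑ)
      hg.measurable.enorm
  rw [e1]
  refine (enorm_integral_le_lintegral_enorm _).trans ((lintegral_mono fun σ => key σ).trans ?_)
  refine (lintegral_mono_set (t := Ioo a b) fun σ hσ => ⟨hs.1.trans hσ.1, hσ.2.trans_lt ht.2⟩).trans ?_
  rw [lintegral_add_right _ (mg.const_mul _), lintegral_const_mul _ mg,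
    lintegral_const_mul _ (Finset.measurable_fun_sum _ fun k _ => mS k),
    lintegral_finsetSum _ fun k _ => mS k]

/-- A space-time Poincaré inequality for classical solutions of `∂ₜ w = div S + g`. -/
lemma exists_smooth_poincare (n : ℕ) : ∃ c : ℝ, 0 < c ∧
    ∀ (w : SpaceTime n → ℝ) (S : Fin n → SpaceTime n → ℝ) (g : SpaceTime n → ℝ),
      ContDiff ℝ 1 w → (∀ k, ContDiff ℝ 1 (S k)) → Continuous g →
      (∀ z, dt w z = ∑ k, dx k (S k) z + g z) →
      ∀ (z : SpaceTime n) (ρ τ : ℝ), 0 < ρ → 0 < τ →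
        ∫⁻ y in cyl z ρ τ, ∫⁻ y' in cyl z ρ τ, ‖w y - w y'‖ₑ
          ≤ ENNReal.ofReal c * volume (cyl z ρ τ) *
            ((ENNReal.ofReal ρ * ∑ k, ∫⁻ y in cyl z ρ τ, ‖dx k w y‖ₑ)
              + (ENNReal.ofReal (τ / ρ) * ∑ k, ∫⁻ y in cyl z ρ τ, ‖S k y‖ₑ)
              + ENNReal.ofReal τ * ∫⁻ y in cyl z ρ τ, ‖g y‖ₑ) := by
  obtain ⟨c, hc, hθ⟩ := exists_weight n
  have hV := unitVol_pos n
  refine ⟨2 * c * unitVol n * 2 ^ (n + 1), by positivity, fun w S g hw hS hg heq z ρ τ hρ hτ => ?_⟩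
  obtain ⟨θ, hs, hcs, hsupp, h0, h1, hle, hle'⟩ := hθ z.1 ρ hρ
  set B := Metric.ball z.1 ρ
  set I := Ioo (z.2 - τ) (z.2 + τ)
  set Q := cyl z ρ τ with hQ
  have hwc := hw.continuous
  -- `W` is the weighted mean of the time slice. The oscillation of `w` is split into the spatial
  -- deviations from `W`, controlled slicewise by `poincare_ball`, and the variation of `W` in time,
  -- controlled by `M` through the equation.
  set W : ℝ → ℝ := fun t => ∫ y, θ y * w (y, t) with hW
  set Dx : ℝ≥0∞ := ∑ k, ∫⁻ y in Q, ‖dx k w y‖ₑ with hDx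
  set DS : ℝ≥0∞ := ∑ k, ∫⁻ y in Q, ‖S k y‖ₑ with hDS
  set Dg : ℝ≥0∞ := ∫⁻ y in Q, ‖g y‖ₑ with hDg
  set M : ℝ≥0∞ := ENNReal.ofReal (c / ρ ^ (n + 1)) * DS + ENNReal.ofReal (c / ρ ^ n) * Dg with hM
  have hWt : ∀ s ∈ I, ∀ t ∈ I, ‖W t - W s‖ₑ ≤ M := by
    have hm : ∀ s ∈ I, ∀ t ∈ I, s ≤ t → ‖W t - W s‖ₑ ≤ M := by
      intro s hs' t ht hst
      refine (enorm_weighted_mean_sub_le hs hcs hsupp h0 hle hle' hw hS hg heq hs' ht hst).trans ?_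
      rw [hM, hDS, hDg, hQ, setLIntegral_cyl _ _ _ hg.measurable.enorm]
      simp_rw [fun k => setLIntegral_cyl z ρ τ (hS k).continuous.measurable.enorm]
      rfl
    intro s hs' t ht
    rcases le_total s t with h | h
    · exact hm s hs' t ht h
    · rw [← enorm_neg, neg_sub]
      exact hm t ht s hs' h
  have hWc : Measurable W := by
    have : StronglyMeasurable fun p : ℝ × Space n => θ p.2 * w (p.2, p.1) := by
      apply Continuous.stronglyMeasurable
      have := hs.continuous
      fun_prop
    exact this.integral_prod_right.measurable
  set P : SpaceTime n → ℝ≥0∞ := fun y => ‖w y - W y.2‖ₑ with hP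
  have hPm : Measurable P := (hwc.measurable.sub (hWc.comp measurable_snd)).enorm
  have hPint : ∫⁻ y in Q, P y ≤ ENNReal.ofReal (c * unitVol n * 2 ^ (n + 1) * ρ) * Dx := by
    rw [hQ, setLIntegral_cyl _ _ _ hPm]
    have step : ∀ t, ∫⁻ x in B, P (x, t) ≤ ENNReal.ofReal (c * unitVol n * 2 ^ (n + 1) * ρ) *
        ∫⁻ x in B, ∑ k, ‖dx k w (x, t)‖ₑ := by
      intro t
      have hwt : ContDiff ℝ 1 fun x : Space n => w (x, t) :=
        hw.comp (contDiff_id.prodMk contDiff_const)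
      calc ∫⁻ x in B, P (x, t)
          ≤ ∫⁻ x in B, ENNReal.ofReal (c / ρ ^ n) * ∫⁻ y in B, ‖w (x, t) - w (y, t)‖ₑ :=
            lintegral_mono fun x => enorm_sub_weighted_mean_le hs.continuous hcs hsupp h0 h1 hle
              hwt.continuous x
        _ = ENNReal.ofReal (c / ρ ^ n) * ∫⁻ x in B, ∫⁻ y in B, ‖w (x, t) - w (y, t)‖ₑ :=
            lintegral_const_mul' _ _ ENNReal.ofReal_ne_top
        _ ≤ ENNReal.ofReal (c / ρ ^ n) * (ENNReal.ofReal (2 * ρ) * (2 ^ n * volume B *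
              ∫⁻ x in B, ‖fderiv ℝ (fun x : Space n => w (x, t)) x‖ₑ)) := by
            gcongr
            exact poincare_ball hwt z.1 ρ
        _ ≤ ENNReal.ofReal (c / ρ ^ n) * (ENNReal.ofReal (2 * ρ) * (2 ^ n * volume B *
              ∫⁻ x in B, ∑ k, ‖dx k w (x, t)‖ₑ)) := by
            gcongr with x
            exact enorm_fderiv_slice_le w (x, t)
        _ = _ := by
            rw [volume_ball_space _ hρ, show (2 : ℝ≥0∞) ^ n = ENNReal.ofReal (2 ^ n) by
              rw [ENNReal.ofReal_pow (by norm_num)]; norm_num]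
            rw [← ENNReal.ofReal_mul (by positivity), ← mul_assoc, ← mul_assoc,
              ← ENNReal.ofReal_mul (by positivity), ← ENNReal.ofReal_mul (by positivity)]
            congr 2
            field_simp
            ring
    refine (lintegral_mono step).trans ?_
    rw [lintegral_const_mul' _ _ ENNReal.ofReal_ne_top]
    gcongr
    have md : ∀ k, Measurable fun y => ‖dx k w y‖ₑ := fun k =>
      (continuous_dx hw k).measurable.enorm
    rw [hDx, ← lintegral_finsetSum _ fun k _ => md k,
      hQ, setLIntegral_cyl _ _ _ (Finset.measurable_fun_sum _ fun k _ => md k)]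
  have hQm : MeasurableSet Q := measurableSet_cyl _ _ _
  have main : ∀ y ∈ Q, ∀ y' ∈ Q, ‖w y - w y'‖ₑ ≤ P y + (M + P y') := by
    intro y hy y' hy'
    have e : w y - w y' = (w y - W y.2) + ((W y.2 - W y'.2) + -(w y' - W y'.2)) := by ring
    rw [e]
    refine (enorm_add_le _ _).trans (add_le_add le_rfl ((enorm_add_le _ _).trans
      (add_le_add (hWt _ hy'.2 _ hy.2) ?_)))
    rw [enorm_neg]
  calc ∫⁻ y in Q, ∫⁻ y' in Q, ‖w y - w y'‖ₑ
      ≤ ∫⁻ y in Q, ∫⁻ y' in Q, (P y + (M + P y')) :=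
        setLIntegral_mono' hQm fun y hy => setLIntegral_mono' hQm fun y' hy' => main y hy y' hy'
    _ = 2 * volume Q * (∫⁻ y in Q, P y) + volume Q * volume Q * M := by
        simp_rw [lintegral_add_left measurable_const, setLIntegral_const]
        rw [lintegral_add_left (hPm.mul_const _), lintegral_mul_const _ hPm, setLIntegral_const]
        ring
    _ ≤ 2 * volume Q * (ENNReal.ofReal (c * unitVol n * 2 ^ (n + 1) * ρ) * Dx) +
          volume Q * volume Q * M := by gcongr
    _ ≤ _ := by
        have hv : volume Q * M = ENNReal.ofReal (2 * c * unitVol n) *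
            (ENNReal.ofReal (τ / ρ) * DS + ENNReal.ofReal τ * Dg) := by
          have e1 : unitVol n * ρ ^ n * 2 * τ * (c / ρ ^ (n + 1))
              = 2 * c * unitVol n * (τ / ρ) := by field_simp; ring
          have e2 : unitVol n * ρ ^ n * 2 * τ * (c / ρ ^ n) = 2 * c * unitVol n * τ := by
            field_simp
          rw [hQ, volume_cyl _ hρ, hM, mul_add, mul_add]
          simp only [← mul_assoc]
          rw [← ENNReal.ofReal_mul (by positivity), ← ENNReal.ofReal_mul (by positivity),
            ← ENNReal.ofReal_mul (by positivity), ← ENNReal.ofReal_mul (by positivity), e1, e2]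
        have hk : ENNReal.ofReal (2 * c * unitVol n) ≤
            ENNReal.ofReal (2 * c * unitVol n * 2 ^ (n + 1)) := by
          apply ENNReal.ofReal_le_ofReal
          exact le_mul_of_one_le_right (by positivity) (one_le_pow₀ (by norm_num))
        rw [mul_assoc (volume Q), hv]
        calc 2 * volume Q * (ENNReal.ofReal (c * unitVol n * 2 ^ (n + 1) * ρ) * Dx) +
              volume Q * (ENNReal.ofReal (2 * c * unitVol n) *
                (ENNReal.ofReal (τ / ρ) * DS + ENNReal.ofReal τ * Dg))
            ≤ volume Q * (ENNReal.ofReal (2 * c * unitVol n * 2 ^ (n + 1)) *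
                (ENNReal.ofReal ρ * Dx)) +
              volume Q * (ENNReal.ofReal (2 * c * unitVol n * 2 ^ (n + 1)) *
                (ENNReal.ofReal (τ / ρ) * DS + ENNReal.ofReal τ * Dg)) := by
              refine add_le_add (le_of_eq ?_) (by gcongr)
              have e2 : ENNReal.ofReal (2 * c * unitVol n * 2 ^ (n + 1)) * ENNReal.ofReal ρ
                  = 2 * ENNReal.ofReal (c * unitVol n * 2 ^ (n + 1) * ρ) := by
                have e0 : ENNReal.ofReal 2 = 2 := by norm_num
                rw [← e0, ← ENNReal.ofReal_mul (by positivity),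
                  ← ENNReal.ofReal_mul (by norm_num)]
                congr 1
                ring
              rw [← mul_assoc (ENNReal.ofReal _) (ENNReal.ofReal ρ), e2]
              ring
          _ = _ := by ring

/-! ### Weak solutions and their mollification -/

/-- `G` is the weak spatial gradient of `w` and `∂ₜ w = div S + g` weakly, both tested with
functions supported in `O`. All functions are globally integrable. -/
structure WeakPair {n : ℕ} (O : Set (SpaceTime n)) (w : SpaceTime n → ℝ)
    (G S : Fin n → SpaceTime n → ℝ) (g : SpaceTime n → ℝ) : Prop where
  int_w : Integrable w
  int_G : ∀ k, Integrable (G k)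
  int_S : ∀ k, Integrable (S k)
  int_g : Integrable g
  grad : ∀ φ : SpaceTime n → ℝ, ContDiff ℝ ∞ φ → HasCompactSupport φ → tsupport φ ⊆ O →
    ∀ k, ∫ z, w z * dx k φ z = - ∫ z, G k z * φ z
  time : ∀ φ : SpaceTime n → ℝ, ContDiff ℝ ∞ φ → HasCompactSupport φ → tsupport φ ⊆ O →
    ∫ z, w z * dt φ z = (∑ k, ∫ z, S k z * dx k φ z) - ∫ z, g z * φ z

section Mollification
variable {n : ℕ} (φ : SpaceTime n → ℝ)

/-- Mollification of a scalar function. -/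
noncomputable def moll (f : SpaceTime n → ℝ) : SpaceTime n → ℝ :=
  convolution φ f (ContinuousLinearMap.lsmul ℝ ℝ) volume

variable {φ} {f : SpaceTime n → ℝ}

lemma moll_eq (z : SpaceTime n) : moll φ f z = ∫ y, f y * φ (z - y) := by
  rw [moll, convolution_eq_swap]
  simp [mul_comm]

lemma contDiff_moll (hφ : ContDiff ℝ ∞ φ) (hc : HasCompactSupport φ) (hf : Integrable f) :
    ContDiff ℝ ∞ (moll φ f) :=
  hc.contDiff_convolution_left _ hφ hf.locallyIntegrable

lemma fderiv_moll (hφ : ContDiff ℝ ∞ φ) (hc : HasCompactSupport φ) (hf : Integrable f)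
    (z e : SpaceTime n) :
    fderiv ℝ (moll φ f) z e = ∫ y, f y * fderiv ℝ φ (z - y) e := by
  have hφ1 : ContDiff ℝ 1 φ := hφ.of_le (by simp)
  have h := hc.hasFDerivAt_convolution_left (ContinuousLinearMap.lsmul ℝ ℝ) hφ1
    hf.locallyIntegrable z
  have hex := (hc.fderiv (𝕜 := ℝ)).convolutionExists_left
    ((ContinuousLinearMap.lsmul ℝ ℝ : ℝ →L[ℝ] ℝ →L[ℝ] ℝ).precompL (SpaceTime n))
    (hφ1.continuous_fderiv one_ne_zero) hf.locallyIntegrable z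
  have h2 : fderiv ℝ (moll φ f) z = _ := h.fderiv
  rw [h2, convolution_def, ContinuousLinearMap.integral_apply hex,
    ← integral_sub_left_eq_self _ volume z]
  refine integral_congr_ae (Eventually.of_forall fun y => ?_)
  simp [mul_comm]

/-- A kernel of mass 1 supported in a ball of radius `ε ≤ min ρ τ` only uses values of `f` at points
displaced by less than `ε` in both space and time, and these lie in the doubled cylinder. -/
lemma setLIntegral_moll_le (hφ : ContDiff ℝ ∞ φ) (h0 : ∀ z, 0 ≤ φ z) (h1 : ∫ z, φ z = 1)
    (hi : Integrable φ)
    {ε : ℝ} (hsupp : Function.support φ ⊆ Metric.ball 0 ε) {z : SpaceTime n} {ρ τ : ℝ}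
    (hρ : ε ≤ ρ) (hτ : ε ≤ τ) (hf : Integrable f) :
    ∫⁻ y in cyl z ρ τ, ‖moll φ f y‖ₑ ≤ ∫⁻ y in cyl z (2 * ρ) (2 * τ), ‖f y‖ₑ := by
  have hm : AEMeasurable (Function.uncurry fun y t => ‖φ t * f (y - t)‖ₑ)
      ((volume.restrict (cyl z ρ τ)).prod volume) := by
    have := hφ.continuous.aestronglyMeasurable.convolution_integrand
      (ContinuousLinearMap.lsmul ℝ ℝ) hf.aestronglyMeasurable (μ := volume) (ν := volume)
    exact (this.mono_ac (Measure.restrict_le_self.absolutelyContinuous.prod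
      Measure.AbsolutelyContinuous.rfl)).enorm
  calc ∫⁻ y in cyl z ρ τ, ‖moll φ f y‖ₑ
      ≤ ∫⁻ y in cyl z ρ τ, ∫⁻ t, ‖φ t * f (y - t)‖ₑ :=
        lintegral_mono fun y => enorm_integral_le_lintegral_enorm _
    _ = ∫⁻ t, ∫⁻ y in cyl z ρ τ, ‖φ t * f (y - t)‖ₑ := lintegral_lintegral_swap hm
    _ ≤ ∫⁻ t, ‖φ t‖ₑ * ∫⁻ y in cyl z (2 * ρ) (2 * τ), ‖f y‖ₑ := by
        refine lintegral_mono fun t => ?_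
        simp_rw [enorm_mul]
        rw [lintegral_const_mul' _ _ enorm_ne_top]
        by_cases ht : φ t = 0
        · simp [ht]
        · refine mul_le_mul_right ?_ _
          have ht' : ‖t‖ < ε := by simpa using hsupp ht
          rw [← lintegral_indicator (measurableSet_cyl _ _ _),
            ← lintegral_indicator (measurableSet_cyl _ _ _),
            ← lintegral_sub_right_eq_self
              ((cyl z (2 * ρ) (2 * τ)).indicator fun y => ‖f y‖ₑ) t]
          refine lintegral_mono fun y => ?_
          by_cases hy : y ∈ cyl z ρ τ
          · rw [indicator_of_mem hy, indicator_of_mem]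
            rw [mem_cyl] at hy ⊢
            have a1 : ‖t.1‖ ≤ ‖t‖ := norm_fst_le t
            have a2 : ‖t.2‖ ≤ ‖t‖ := norm_snd_le t
            rw [Real.norm_eq_abs] at a2
            constructor
            · calc ‖(y - t).1 - z.1‖ = ‖(y.1 - z.1) - t.1‖ := by
                    rw [Prod.fst_sub]; congr 1; abel
                _ ≤ ‖y.1 - z.1‖ + ‖t.1‖ := norm_sub_le _ _
                _ < _ := by linarith [hy.1]
            · calc |(y - t).2 - z.2| = |(y.2 - z.2) - t.2| := by
                    rw [Prod.snd_sub]; congr 1; ring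
                _ ≤ |y.2 - z.2| + |t.2| := abs_sub _ _
                _ < _ := by linarith [hy.2]
          · simp [indicator_of_notMem hy]
    _ = _ := by
        rw [lintegral_mul_const _ hφ.continuous.measurable.enorm]
        have : ∫⁻ t, ‖φ t‖ₑ = 1 := by
          calc ∫⁻ t, ‖φ t‖ₑ = ∫⁻ t, ENNReal.ofReal (φ t) :=
                lintegral_congr fun t => Real.enorm_of_nonneg (h0 t)
            _ = ENNReal.ofReal (∫ t, φ t) :=
                (ofReal_integral_eq_lintegral_ofReal hi (Eventually.of_forall h0)).symm
            _ = 1 := by rw [h1, ENNReal.ofReal_one]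
        rw [this, one_mul]

variable {G S : Fin n → SpaceTime n → ℝ} {g : SpaceTime n → ℝ} {w : SpaceTime n → ℝ}

lemma hasFDerivAt_reflect (hφ : ContDiff ℝ ∞ φ) (z y : SpaceTime n) :
    HasFDerivAt (fun y => φ (z - y)) (-(fderiv ℝ φ (z - y))) y := by
  have h := ((hφ.differentiable (by simp) (z - y)).hasFDerivAt).comp y
    ((hasFDerivAt_id y).const_sub z)
  refine h.congr_fderiv ?_
  ext <;> simp

lemma dx_reflect (hφ : ContDiff ℝ ∞ φ) (z y : SpaceTime n) (k : Fin n) :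
    dx k (fun y => φ (z - y)) y = - fderiv ℝ φ (z - y) (EuclideanSpace.single k 1, 0) := by
  rw [dx_eq_fderiv (hasFDerivAt_reflect hφ z y).differentiableAt, (hasFDerivAt_reflect hφ z y).fderiv]
  rfl

lemma dt_reflect (hφ : ContDiff ℝ ∞ φ) (z y : SpaceTime n) :
    dt (fun y => φ (z - y)) y = - fderiv ℝ φ (z - y) (0, 1) := by
  rw [dt_eq_fderiv (hasFDerivAt_reflect hφ z y).differentiableAt, (hasFDerivAt_reflect hφ z y).fderiv]
  rfl

lemma hasCompactSupport_reflect (hc : HasCompactSupport φ) (z : SpaceTime n) :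
    HasCompactSupport fun y => φ (z - y) :=
  hc.comp_homeomorph (Homeomorph.subLeft z)

/-- The weak formulation is tested with the reflected kernel `y ↦ φ (z - y)`, which is admissible
for every `z` because the pair is posed on the whole space. -/
lemma WeakPair.dx_moll (h : WeakPair univ w G S g) (hφ : ContDiff ℝ ∞ φ)
    (hc : HasCompactSupport φ) (k : Fin n) (z : SpaceTime n) :
    dx k (moll φ w) z = moll φ (G k) z := by
  rw [dx_eq_fderiv ((contDiff_moll hφ hc h.int_w).differentiable (by simp) z),
    fderiv_moll hφ hc h.int_w, moll_eq]
  have := h.grad (fun y => φ (z - y)) (hφ.comp (contDiff_const.sub contDiff_id))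
    (hasCompactSupport_reflect hc z) (subset_univ _) k
  simp_rw [dx_reflect hφ, mul_neg, integral_neg] at this
  linarith

lemma WeakPair.dt_moll (h : WeakPair univ w G S g) (hφ : ContDiff ℝ ∞ φ)
    (hc : HasCompactSupport φ) (z : SpaceTime n) :
    dt (moll φ w) z = ∑ k, dx k (moll φ (S k)) z + moll φ g z := by
  rw [dt_eq_fderiv ((contDiff_moll hφ hc h.int_w).differentiable (by simp) z),
    fderiv_moll hφ hc h.int_w, moll_eq]
  have := h.time (fun y => φ (z - y)) (hφ.comp (contDiff_const.sub contDiff_id))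
    (hasCompactSupport_reflect hc z) (subset_univ _)
  simp_rw [dx_reflect hφ, dt_reflect hφ, mul_neg, integral_neg] at this
  have e : ∀ k, dx k (moll φ (S k)) z
      = ∫ y, S k y * fderiv ℝ φ (z - y) (EuclideanSpace.single k 1, 0) := by
    intro k
    rw [dx_eq_fderiv ((contDiff_moll hφ hc (h.int_S k)).differentiable (by simp) z),
      fderiv_moll hφ hc (h.int_S k)]
  simp_rw [e]
  rw [Finset.sum_neg_distrib] at this
  linarith

end Mollification

/-- Space-time Poincaré inequality for weak solutions of `∂ₜ w = div S + g`. -/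
lemma exists_weak_poincare (n : ℕ) : ∃ c : ℝ, 0 < c ∧
    ∀ (w : SpaceTime n → ℝ) (G S : Fin n → SpaceTime n → ℝ) (g : SpaceTime n → ℝ),
      WeakPair univ w G S g → ∀ (z : SpaceTime n) (ρ τ : ℝ), 0 < ρ → 0 < τ →
        ∫⁻ y in cyl z ρ τ, ∫⁻ y' in cyl z ρ τ, ‖w y - w y'‖ₑ
          ≤ ENNReal.ofReal c * volume (cyl z ρ τ) *
            ((ENNReal.ofReal ρ * ∑ k, ∫⁻ y in cyl z (2 * ρ) (2 * τ), ‖G k y‖ₑ)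
              + (ENNReal.ofReal (τ / ρ) * ∑ k, ∫⁻ y in cyl z (2 * ρ) (2 * τ), ‖S k y‖ₑ)
              + ENNReal.ofReal τ * ∫⁻ y in cyl z (2 * ρ) (2 * τ), ‖g y‖ₑ) := by
  obtain ⟨c, hc, H⟩ := exists_smooth_poincare n
  refine ⟨c, hc, fun w G S g h z ρ τ hρ hτ => ?_⟩
  let β : ℕ → ContDiffBump (0 : SpaceTime n) := fun i =>
    ⟨1 / (i + 1) / 2, 1 / (i + 1), by positivity, half_lt_self (by positivity)⟩
  set φ : ℕ → SpaceTime n → ℝ := fun i => (β i).normed volume with hφ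
  have hs : ∀ i, ContDiff ℝ ∞ (φ i) := fun i => (β i).contDiff_normed
  have hcs : ∀ i, HasCompactSupport (φ i) := fun i => (β i).hasCompactSupport_normed
  have hro : Tendsto (fun i => (β i).rOut) atTop (𝓝 0) := tendsto_one_div_add_atTop_nhds_zero_nat
  -- The outer and inner radii of the bumps keep the fixed ratio 2, as required for convergence at
  -- Lebesgue points.
  have hlim : ∀ᵐ y : SpaceTime n, Tendsto (fun i => moll (φ i) w y) atTop (𝓝 (w y)) := by
    refine ContDiffBump.ae_convolution_tendsto_right_of_locallyIntegrable (K := 2) hro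
      (Eventually.of_forall fun i => ?_) h.int_w.locallyIntegrable
    change (1 : ℝ) / (i + 1) ≤ 2 * (1 / (i + 1) / 2)
    linarith
  set Q := cyl z ρ τ with hQ
  have hcont : ∀ i, Continuous (moll (φ i) w) := fun i =>
    (contDiff_moll (hs i) (hcs i) h.int_w).continuous
  have hlimQ := ae_restrict_of_ae (s := Q) hlim
  -- Fatou's lemma is used once in each of the two variables, so almost everywhere convergence of
  -- the mollifications suffices.
  have fatou1 : ∀ᵐ y ∂(volume.restrict Q), ∫⁻ y' in Q, ‖w y - w y'‖ₑ
      ≤ liminf (fun i => ∫⁻ y' in Q, ‖moll (φ i) w y - moll (φ i) w y'‖ₑ) atTop := by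
    filter_upwards [hlimQ] with y hy
    refine le_trans (le_of_eq ?_) (lintegral_liminf_le fun i => ?_)
    · refine lintegral_congr_ae ?_
      filter_upwards [hlimQ] with y' hy'
      exact ((hy.sub hy').enorm).liminf_eq.symm
    · exact (measurable_const.sub (hcont i).measurable).enorm
  refine (lintegral_mono_ae fatou1).trans ((lintegral_liminf_le fun i => ?_).trans ?_)
  · have : Measurable fun p : SpaceTime n × SpaceTime n =>
        ‖moll (φ i) w p.1 - moll (φ i) w p.2‖ₑ := by
      have := hcont i
      apply Continuous.measurable
      fun_prop
    exact this.lintegral_prod_right'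
  -- As soon as the mollification radius is below `ρ` and `τ`, the integrals of the mollified data
  -- are bounded by integrals over the doubled cylinder, independently of `i`.
  · refine liminf_le_of_frequently_le' (Eventually.frequently ?_)
    filter_upwards [hro.eventually_lt_const (lt_min hρ hτ)] with i hi
    have h1 : ∀ {f : SpaceTime n → ℝ}, Integrable f → ContDiff ℝ 1 (moll (φ i) f) := fun hf =>
      (contDiff_moll (hs i) (hcs i) hf).of_le (by simp)
    refine (H (moll (φ i) w) (fun k => moll (φ i) (S k)) (moll (φ i) g) (h1 h.int_w)
      (fun k => h1 (h.int_S k)) (h1 h.int_g).continuous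
      (fun y => h.dt_moll (hs i) (hcs i) y) z ρ τ hρ hτ).trans ?_
    have hb : ∀ f : SpaceTime n → ℝ, Integrable f →
        ∫⁻ y in cyl z ρ τ, ‖moll (φ i) f y‖ₑ ≤ ∫⁻ y in cyl z (2 * ρ) (2 * τ), ‖f y‖ₑ := by
      intro f hf
      refine setLIntegral_moll_le (hs i) (β i).nonneg_normed (β i).integral_normed
        (β i).integrable_normed (ε := (β i).rOut) (le_of_eq ?_) ?_ ?_ hf
      · exact (β i).support_normed_eq
      · exact (hi.trans_le (min_le_left _ _)).le
      · exact (hi.trans_le (min_le_right _ _)).le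
    simp_rw [h.dx_moll (hs i) (hcs i)]
    refine mul_le_mul_right (add_le_add (add_le_add ?_ ?_) ?_) _
    · exact mul_le_mul_right (Finset.sum_le_sum fun k _ => hb _ (h.int_G k)) _
    · exact mul_le_mul_right (Finset.sum_le_sum fun k _ => hb _ (h.int_S k)) _
    · exact mul_le_mul_right (hb _ h.int_g) _

/-! ### Campanato's criterion for the parabolic distance -/

section Campanato
variable {n N : ℕ}

/-- The parabolic distance. -/
noncomputable def pdist (z w : SpaceTime n) : ℝ := max ‖z.1 - w.1‖ √|z.2 - w.2|

lemma pdist_nonneg (z w : SpaceTime n) : 0 ≤ pdist z w :=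
  le_max_of_le_left (norm_nonneg _)

lemma pdist_comm (z w : SpaceTime n) : pdist z w = pdist w z := by
  rw [pdist, pdist, norm_sub_rev, abs_sub_comm]

lemma abs_snd_sub_le_pdist_sq (z w : SpaceTime n) : |z.2 - w.2| ≤ pdist z w ^ 2 := by
  rw [← Real.sqrt_le_left (pdist_nonneg z w)]
  exact le_max_right _ _

lemma norm_fst_sub_le_pdist (z w : SpaceTime n) : ‖z.1 - w.1‖ ≤ pdist z w := le_max_left _ _

lemma pdist_le_iff {z w : SpaceTime n} {R : ℝ} (hR : 0 ≤ R) :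
    pdist z w ≤ R ↔ ‖z.1 - w.1‖ ≤ R ∧ |z.2 - w.2| ≤ R ^ 2 := by
  rw [pdist, max_le_iff, Real.sqrt_le_left hR]

lemma pdist_lt_iff {z w : SpaceTime n} {R : ℝ} (hR : 0 < R) :
    pdist z w < R ↔ ‖z.1 - w.1‖ < R ∧ |z.2 - w.2| < R ^ 2 := by
  rw [pdist, max_lt_iff, Real.sqrt_lt' hR]

lemma pdist_triangle (x y z : SpaceTime n) : pdist x z ≤ pdist x y + pdist y z := by
  have h1 := pdist_nonneg x y
  have h2 := pdist_nonneg y z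
  rw [pdist_le_iff (by positivity)]
  constructor
  · have := norm_sub_le_norm_sub_add_norm_sub x.1 y.1 z.1
    linarith [norm_fst_sub_le_pdist x y, norm_fst_sub_le_pdist y z]
  · have := abs_sub_le x.2 y.2 z.2
    nlinarith [abs_snd_sub_le_pdist_sq x y, abs_snd_sub_le_pdist_sq y z, mul_nonneg h1 h2]

lemma eq_of_pdist_eq_zero {z w : SpaceTime n} (h : pdist z w = 0) : z = w := by
  have h1 := norm_fst_sub_le_pdist z w
  have h2 := abs_snd_sub_le_pdist_sq z w
  rw [h] at h1 h2
  refine Prod.ext ?_ ?_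
  · exact sub_eq_zero.1 (norm_le_zero_iff.1 h1)
  · exact sub_eq_zero.1 (abs_nonpos_iff.1 (by simpa using h2))

/-- The parabolic cylinder of radius `ρ`. -/
noncomputable def pcyl (z : SpaceTime n) (ρ : ℝ) : Set (SpaceTime n) := cyl z ρ (ρ ^ 2)

lemma mem_pcyl {z w : SpaceTime n} {ρ : ℝ} (hρ : 0 < ρ) : w ∈ pcyl z ρ ↔ pdist w z < ρ := by
  rw [pcyl, mem_cyl, pdist_lt_iff hρ]

lemma measurableSet_pcyl (z : SpaceTime n) (ρ : ℝ) : MeasurableSet (pcyl z ρ) :=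
  measurableSet_cyl _ _ _

lemma volume_pcyl (z : SpaceTime n) {ρ : ℝ} (hρ : 0 < ρ) :
    volume (pcyl z ρ) = ENNReal.ofReal (2 * unitVol n * ρ ^ (n + 2)) := by
  rw [pcyl, volume_cyl _ hρ]
  congr 1; ring

lemma continuous_of_pdist_le {g : SpaceTime n → Space N} {A : ℝ}
    (h : ∀ y w, ‖g y - g w‖ ≤ A * pdist y w) : Continuous g := by
  rw [continuous_iff_continuousAt]
  intro z
  rw [ContinuousAt, tendsto_iff_norm_sub_tendsto_zero]
  have hc : Continuous fun w : SpaceTime n => A * pdist w z := by unfold pdist; fun_prop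
  refine squeeze_zero (fun _ => norm_nonneg _) (fun w => h w z) ?_
  have := hc.tendsto z
  simpa [pdist] using this

/-- A function all of whose means over small parabolic cylinders are small vanishes. -/
lemma ae_eq_zero_of_pcyl {k : SpaceTime n → ℝ≥0∞} (hk : AEMeasurable k) {ε : ℝ → ℝ≥0∞}
    (hε : Tendsto (fun i : ℕ => ε ((1 / 2) ^ i)) atTop (𝓝 0))
    (h : ∀ (i : ℕ) z, ∫⁻ y in pcyl z ((1 / 2) ^ i), k y
      ≤ ε ((1 / 2) ^ i) * volume (pcyl z ((1 / 2) ^ i))) : k =ᵐ[volume] 0 := by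
  have key : ∀ R : ℕ, ∫⁻ y in Metric.ball (0 : SpaceTime n) R, k y = 0 := by
    intro R
    set B := Metric.ball (0 : SpaceTime n) R
    set B' := Metric.ball (0 : SpaceTime n) (R + 1)
    have hle : ∀ i : ℕ, ∫⁻ y in B, k y ≤ ε ((1 / 2) ^ i) * volume B' := by
      intro i
      set ρ : ℝ := (1 / 2) ^ i with hρ
      have hρ0 : 0 < ρ := by positivity
      have hρ1 : ρ ≤ 1 := pow_le_one₀ (by norm_num) (by norm_num)
      have hV := volume_pcyl (0 : SpaceTime n) hρ0
      have hVc : ∀ z : SpaceTime n, volume (pcyl z ρ) = volume (pcyl (0 : SpaceTime n) ρ) :=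
        fun z => by rw [volume_pcyl z hρ0, hV]
      have hV0 : volume (pcyl (0 : SpaceTime n) ρ) ≠ 0 := by
        rw [hV, ENNReal.ofReal_ne_zero_iff]
        have := unitVol_pos n
        positivity
      have hVt : volume (pcyl (0 : SpaceTime n) ρ) ≠ ⊤ := by
        rw [hV]; exact ENNReal.ofReal_ne_top
      have hD : MeasurableSet {p : SpaceTime n × SpaceTime n | p.2 ∈ pcyl p.1 ρ} := by
        apply IsOpen.measurableSet
        simp only [mem_pcyl hρ0]
        unfold pdist
        exact isOpen_lt (by fun_prop) continuous_const
      have hm : AEMeasurable (Function.uncurry fun z y => (pcyl z ρ).indicator k y)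
          ((volume.restrict B').prod volume) := by
        have h1 : AEMeasurable (fun p : SpaceTime n × SpaceTime n => k p.2)
            ((volume.restrict B').prod volume) :=
          hk.comp_quasiMeasurePreserving Measure.quasiMeasurePreserving_snd
        exact h1.indicator hD
      -- Double counting: the integrals over the cylinders are integrated over all centres in `B'`.
      -- After exchanging the order of integration, each point of `B` is counted with weight `volume
      -- (pcyl y ρ)`, since the cylinder of centres around it stays inside `B'`.
      have h1 : ∫⁻ z in B', ∫⁻ y, (pcyl z ρ).indicator k y
          ≤ ε ρ * volume (pcyl (0 : SpaceTime n) ρ) * volume B' := by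
        rw [← setLIntegral_const]
        refine lintegral_mono fun z => ?_
        rw [lintegral_indicator (measurableSet_pcyl _ _)]
        refine (h i z).trans ?_
        rw [hVc z]
      rw [lintegral_lintegral_swap hm] at h1
      have h2 : (∫⁻ y in B, k y) * volume (pcyl (0 : SpaceTime n) ρ)
          ≤ ∫⁻ y, ∫⁻ z in B', (pcyl z ρ).indicator k y := by
        rw [← lintegral_mul_const' _ _ hVt, ← lintegral_indicator measurableSet_ball]
        refine lintegral_mono fun y => ?_
        by_cases hy : y ∈ B
        · rw [indicator_of_mem hy]
          have e : ∀ z, (pcyl z ρ).indicator k y = (pcyl y ρ).indicator (fun _ => k y) z := by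
            intro z
            by_cases hz : z ∈ pcyl y ρ
            · rw [indicator_of_mem hz, indicator_of_mem]
              rwa [mem_pcyl hρ0, pdist_comm, ← mem_pcyl hρ0]
            · rw [indicator_of_notMem hz, indicator_of_notMem]
              rwa [mem_pcyl hρ0, pdist_comm, ← mem_pcyl hρ0]
          simp_rw [e]
          rw [lintegral_indicator (measurableSet_pcyl _ _), setLIntegral_const,
            Measure.restrict_apply (measurableSet_pcyl _ _), inter_eq_left.2, hVc y]
          intro z hz
          rw [mem_pcyl hρ0] at hz
          have hy' : ‖y‖ < R := by simpa [B] using hy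
          rw [mem_ball_zero_iff]
          have h3 : ‖z - y‖ ≤ 1 := by
            rw [Prod.norm_def, max_le_iff]
            constructor
            · exact (norm_fst_sub_le_pdist z y).trans (by linarith)
            · rw [Real.norm_eq_abs]
              refine (abs_snd_sub_le_pdist_sq z y).trans ?_
              exact pow_le_one₀ (pdist_nonneg _ _) (by linarith)
          have h4 : ‖z‖ ≤ ‖z - y‖ + ‖y‖ := by simpa using norm_add_le (z - y) y
          linarith
        · rw [indicator_of_notMem hy]
          exact zero_le
      have h3 := h2.trans h1
      rw [mul_right_comm] at h3
      exact (ENNReal.mul_le_mul_iff_left hV0 hVt).1 h3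
    have hlim : Tendsto (fun i : ℕ => ε ((1 / 2) ^ i) * volume B') atTop (𝓝 0) := by
      have := ENNReal.Tendsto.mul_const (b := volume B') hε (Or.inr measure_ball_lt_top.ne)
      simpa using this
    exact le_antisymm (ge_of_tendsto' hlim hle) bot_le
  have hall : ∀ R : ℕ, ∀ᵐ y, y ∈ Metric.ball (0 : SpaceTime n) R → k y = 0 := by
    intro R
    rw [← ae_restrict_iff' measurableSet_ball]
    exact (lintegral_eq_zero_iff' hk.restrict).1 (key R)
  filter_upwards [ae_all_iff.2 hall] with y hy
  obtain ⟨R, hR⟩ := exists_nat_gt ‖y‖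
  exact hy R (by simpa using hR)

variable {g : SpaceTime n → Space N} {A : ℝ} {c : SpaceTime n → ℝ → Space N}

/-- On the smaller cylinder `g` is close in mean to both constants. The estimate on the larger
cylinder loses the ratio of the volumes, `(ρ/σ)^(n+2)`. -/
lemma norm_campanato_const_sub_le (hA : 0 ≤ A)
    (h : ∀ z ρ, 0 < ρ → ∫⁻ y in pcyl z ρ, ‖g y - c z ρ‖ₑ
      ≤ ENNReal.ofReal (A * ρ) * volume (pcyl z ρ))
    (hg : AEStronglyMeasurable g)
    {y z : SpaceTime n} {σ ρ : ℝ} (hσ : 0 < σ) (hρ : 0 < ρ) (hsub : pcyl y σ ⊆ pcyl z ρ) :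
    ‖c y σ - c z ρ‖ ≤ A * σ + A * ρ * (ρ / σ) ^ (n + 2) := by
  have hV := unitVol_pos n
  have h1 : ‖c y σ - c z ρ‖ₑ * volume (pcyl y σ)
      ≤ ENNReal.ofReal (A * σ) * volume (pcyl y σ) + ENNReal.ofReal (A * ρ) * volume (pcyl z ρ) := by
    rw [← setLIntegral_const]
    calc ∫⁻ x in pcyl y σ, ‖c y σ - c z ρ‖ₑ
        ≤ ∫⁻ x in pcyl y σ, (‖g x - c y σ‖ₑ + ‖g x - c z ρ‖ₑ) := by
          refine lintegral_mono fun x => ?_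
          have e : c y σ - c z ρ = -(g x - c y σ) + (g x - c z ρ) := by abel
          rw [e]
          refine (enorm_add_le _ _).trans ?_
          rw [enorm_neg]
      _ = (∫⁻ x in pcyl y σ, ‖g x - c y σ‖ₑ) + ∫⁻ x in pcyl y σ, ‖g x - c z ρ‖ₑ :=
          lintegral_add_left' (hg.restrict.sub aestronglyMeasurable_const).enorm _
      _ ≤ _ := add_le_add (h y σ hσ) ((lintegral_mono_set hsub).trans (h z ρ hρ))
  rw [volume_pcyl _ hσ, volume_pcyl _ hρ, ← ofReal_norm,
    ← ENNReal.ofReal_mul (norm_nonneg _), ← ENNReal.ofReal_mul (by positivity),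
    ← ENNReal.ofReal_mul (by positivity), ← ENNReal.ofReal_add (by positivity) (by positivity),
    ENNReal.ofReal_le_ofReal_iff (by positivity)] at h1
  have h2 : (A * σ + A * ρ * (ρ / σ) ^ (n + 2)) * (2 * unitVol n * σ ^ (n + 2))
      = A * σ * (2 * unitVol n * σ ^ (n + 2)) + A * ρ * (2 * unitVol n * ρ ^ (n + 2)) := by
    rw [div_pow]; field_simp
  rw [← h2] at h1
  exact le_of_mul_le_mul_right h1 (by positivity)

/-- Campanato's characterization of parabolic Lipschitz functions. -/
lemma exists_lipschitz_of_campanato (hA : 0 ≤ A)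
    (h : ∀ z ρ, 0 < ρ → ∫⁻ y in pcyl z ρ, ‖g y - c z ρ‖ₑ
      ≤ ENNReal.ofReal (A * ρ) * volume (pcyl z ρ))
    (hg : AEStronglyMeasurable g) :
    ∃ G : SpaceTime n → Space N, G =ᵐ[volume] g ∧
      ∀ y w, ‖G y - G w‖ ≤ 2 ^ (n + 6) * A * pdist y w := by
  have hsubc : ∀ (z : SpaceTime n) {σ ρ : ℝ}, 0 < σ → σ ≤ ρ → pcyl z σ ⊆ pcyl z ρ := by
    intro z σ ρ hσ hσρ y hy
    rw [mem_pcyl hσ] at hy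
    rw [mem_pcyl (hσ.trans_le hσρ)]
    linarith
  set B : ℝ := 2 ^ (n + 3) with hB
  have hB1 : 1 ≤ B := one_le_pow₀ (by norm_num)
  -- Halving the radius changes the Campanato constant by at most `A ρ B`, so along dyadic radii the
  -- constants form a Cauchy sequence with geometric rate.
  have hstep : ∀ (z : SpaceTime n) (R : ℝ), 0 < R → ∀ k : ℕ,
      dist (c z (R * (1 / 2) ^ k)) (c z (R * (1 / 2) ^ (k + 1))) ≤ (2 * A * B * R) / 2 / 2 ^ k := by
    intro z R hR k
    set ρ := R * (1 / 2) ^ k with hρ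
    have hρ0 : 0 < ρ := by positivity
    have e : R * (1 / 2) ^ (k + 1) = ρ / 2 := by rw [hρ, pow_succ]; ring
    rw [e, dist_comm, dist_eq_norm]
    refine (norm_campanato_const_sub_le hA h hg (by positivity) hρ0
      (hsubc z (by positivity) (by linarith))).trans ?_
    have e1 : ρ / (ρ / 2) = 2 := by field_simp
    have e2 : (2 * A * B * R) / 2 / 2 ^ k = A * ρ * B := by
      rw [hρ, one_div, inv_pow]; field_simp
    have e3 : B = 2 * 2 ^ (n + 2) := by rw [hB]; ring
    rw [e1, e2]
    have : (1 : ℝ) ≤ 2 ^ (n + 2) := one_le_pow₀ (by norm_num)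
    have hAρ : 0 ≤ A * ρ := by positivity
    rw [e3]
    nlinarith
  have hcauchy := fun z => cauchySeq_of_le_geometric_two (hstep z 1 one_pos)
  choose G hG using fun z => cauchySeq_tendsto_of_complete (hcauchy z)
  simp only [one_mul] at hG
  have hpow : Tendsto (fun k : ℕ => ((1 : ℝ) / 2) ^ k) atTop (𝓝 0) :=
    tendsto_pow_atTop_nhds_zero_of_lt_one (by norm_num) (by norm_num)
  -- The limit does not depend on the starting radius: the constants at `R 2⁻ᵏ` and `2⁻ᵏ` belong to
  -- nested cylinders with a fixed ratio of radii, so they differ by `O(2⁻ᵏ)`.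
  have hGR : ∀ (z : SpaceTime n) (R : ℝ), 0 < R →
      Tendsto (fun k : ℕ => c z (R * (1 / 2) ^ k)) atTop (𝓝 (G z)) := by
    intro z R hR
    have hb : ∃ M : ℝ, ∀ k : ℕ, ‖c z (R * (1 / 2) ^ k) - c z ((1 / 2) ^ k)‖ ≤ M * (1 / 2) ^ k := by
      rcases le_total R 1 with hR1 | hR1
      · refine ⟨A * R + A * (1 / R) ^ (n + 2), fun k => ?_⟩
        have hp : (0 : ℝ) < (1 / 2) ^ k := by positivity
        refine (norm_campanato_const_sub_le hA h hg (by positivity) hp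
          (hsubc z (by positivity) (by nlinarith))).trans (le_of_eq ?_)
        have : (1 / 2 : ℝ) ^ k / (R * (1 / 2) ^ k) = 1 / R := by field_simp
        rw [this]; ring
      · refine ⟨A + A * R * R ^ (n + 2), fun k => ?_⟩
        have hp : (0 : ℝ) < (1 / 2) ^ k := by positivity
        rw [norm_sub_rev]
        refine (norm_campanato_const_sub_le hA h hg hp (by positivity)
          (hsubc z hp (by nlinarith))).trans (le_of_eq ?_)
        have : R * (1 / 2 : ℝ) ^ k / (1 / 2) ^ k = R := by field_simp
        rw [this]; ring
    obtain ⟨M, hM⟩ := hb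
    have h0 : Tendsto (fun k : ℕ => c z (R * (1 / 2) ^ k) - c z ((1 / 2) ^ k)) atTop (𝓝 0) := by
      refine squeeze_zero_norm hM ?_
      simpa using hpow.const_mul M
    simpa using h0.add (hG z)
  have hdist : ∀ (z : SpaceTime n) (R : ℝ), 0 < R → ‖c z R - G z‖ ≤ 2 * A * B * R := by
    intro z R hR
    have := dist_le_of_le_geometric_two_of_tendsto₀ (hstep z R hR) (hGR z R hR)
    simpa [dist_eq_norm] using this
  -- The values are connected through the constants on `pcyl y (2R)` and `pcyl w R`, where `R =
  -- pdist y w`. The three pieces contribute `4`, `2` and `2` times `A B R`.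
  have hlip : ∀ y w, ‖G y - G w‖ ≤ 8 * A * B * pdist y w := by
    intro y w
    rcases (pdist_nonneg y w).eq_or_lt with h0 | h0
    · rw [eq_of_pdist_eq_zero h0.symm]; simp [pdist]
    set R := pdist y w with hR
    have hsub : pcyl w R ⊆ pcyl y (2 * R) := by
      intro x hx
      rw [mem_pcyl h0] at hx
      rw [mem_pcyl (by positivity)]
      have := pdist_triangle x w y
      rw [pdist_comm w y] at this
      linarith
    have h1 := hdist y (2 * R) (by positivity)
    have h2 := hdist w R h0
    have h3 := norm_campanato_const_sub_le hA h hg h0 (by positivity) hsub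
    have e1 : 2 * R / R = 2 := by field_simp
    rw [e1] at h3
    have e : G y - G w = -(c y (2 * R) - G y) + (-(c w R - c y (2 * R)) + (c w R - G w)) := by abel
    rw [e]
    have h4 : ‖-(c y (2 * R) - G y) + (-(c w R - c y (2 * R)) + (c w R - G w))‖
        ≤ ‖c y (2 * R) - G y‖ + (‖c w R - c y (2 * R)‖ + ‖c w R - G w‖) := by
      refine (norm_add_le _ _).trans (add_le_add (norm_neg _).le ((norm_add_le _ _).trans ?_))
      rw [norm_neg]
    have e3 : B = 2 * 2 ^ (n + 2) := by rw [hB]; ring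
    have hAR : 0 ≤ A * R := by positivity
    have h5 : A * R ≤ A * R * B := le_mul_of_one_le_right hAR hB1
    have h6 : A * (2 * R) * 2 ^ (n + 2) = A * R * B := by rw [e3]; ring
    rw [h6] at h3
    nlinarith
  have hGc : Continuous G := continuous_of_pdist_le hlip
  refine ⟨G, ?_, fun y w => (hlip y w).trans (le_of_eq ?_)⟩
  · have hz : (fun y => ‖g y - G y‖ₑ) =ᵐ[volume] 0 := by
      -- The factor 11 collects 1 from the Campanato hypothesis, 2 from `hdist` and 8 from `hlip`.
      refine ae_eq_zero_of_pcyl (ε := fun ρ => ENNReal.ofReal (11 * A * B * ρ))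
        (hg.sub hGc.aestronglyMeasurable).enorm ?_ fun i z => ?_
      · have := ENNReal.tendsto_ofReal (hpow.const_mul (11 * A * B))
        simpa using this
      · set ρ : ℝ := (1 / 2) ^ i with hρ
        have hρ0 : 0 < ρ := by positivity
        have hpt : ∀ y ∈ pcyl z ρ, ‖g y - G y‖ₑ ≤ ‖g y - c z ρ‖ₑ + ENNReal.ofReal (10 * A * B * ρ) := by
          intro y hy
          rw [mem_pcyl hρ0] at hy
          have e : g y - G y = (g y - c z ρ) + (c z ρ - G y) := by abel
          rw [e]
          refine (enorm_add_le _ _).trans (add_le_add le_rfl ?_)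
          rw [← ofReal_norm]
          apply ENNReal.ofReal_le_ofReal
          have h1 := hdist z ρ hρ0
          have h2 := hlip z y
          rw [pdist_comm] at h2
          have h3 : 8 * A * B * pdist y z ≤ 8 * A * B * ρ := by gcongr
          have h4 := norm_sub_le_norm_sub_add_norm_sub (c z ρ) (G z) (G y)
          linarith
        refine (setLIntegral_mono' (measurableSet_pcyl _ _) hpt).trans ?_
        rw [lintegral_add_right _ measurable_const, setLIntegral_const]
        refine (add_le_add (h z ρ hρ0) le_rfl).trans ?_
        rw [← add_mul, ← ENNReal.ofReal_add (by positivity) (by positivity)]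
        gcongr
        have : A * ρ ≤ A * ρ * B := le_mul_of_one_le_right (by positivity) hB1
        linarith
    filter_upwards [hz] with y hy
    have : ‖g y - G y‖ₑ = 0 := hy
    exact (sub_eq_zero.1 (enorm_eq_zero.1 this)).symm
  · rw [hB]; ring

end Campanato

/-! ### Whitney families: finite overlap and total volume -/

section Whitney
variable {n N : ℕ} {ι : Type}

/-- The cylinder `σ U_i` with centre `z i`, radius `r i` and time coefficient `θ i`. -/
noncomputable def wc (z : ι → SpaceTime n) (r θ : ι → ℝ) (σ : ℝ) (i : ι) : Set (SpaceTime n) :=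
  cyl (z i) (σ * r i) ((σ * r i) ^ 2 / θ i)

/-- A Whitney cover of `Eᶜ` by cylinders, with comparable neighbours. -/
structure IsWhitneyFamily (E : Set (SpaceTime n)) (K κ : ℝ) (z : ι → SpaceTime n)
    (r θ : ι → ℝ) : Prop where
  two_le_K : 2 ≤ K
  one_le_κ : 1 ≤ κ
  closed : IsClosed E
  r_pos : ∀ i, 0 < r i
  θ_pos : ∀ i, 0 < θ i
  subset : ∀ i, wc z r θ (2 / K) i ⊆ Eᶜ
  cover : Eᶜ ⊆ ⋃ i, wc z r θ (1 / K) i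
  disj : Pairwise fun i j =>
    Disjoint (wc z r θ (1 / (6 * K ^ 6)) i) (wc z r θ (1 / (6 * K ^ 6)) j)
  nbr : ∀ i j, (wc z r θ (2 / K) i ∩ wc z r θ (2 / K) j).Nonempty → r i ≤ κ * r j ∧ θ i ≤ κ * θ j

/-- Cutoff functions adapted to a Whitney cover. -/
structure IsWhitneyCutoff (K : ℝ) (z : ι → SpaceTime n) (r θ : ι → ℝ)
    (ψ : ι → SpaceTime n → ℝ) : Prop where
  smooth : ∀ i, ContDiff ℝ ∞ (ψ i)
  compact : ∀ i, HasCompactSupport (ψ i)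
  supp : ∀ i, tsupport (ψ i) ⊆ wc z r θ (2 / K) i
  nonneg : ∀ i w, 0 ≤ ψ i w
  le_one : ∀ i w, ψ i w ≤ 1
  eq_one : ∀ i, ∀ w ∈ wc z r θ (1 / K) i, ψ i w = 1
  grad_le : ∀ i (w : SpaceTime n),
    ‖fderiv ℝ (fun x : Space n => ψ i (x, w.2)) w.1‖ ≤ 2 * K * (r i)⁻¹
  dt_le : ∀ i (w : SpaceTime n), |dt (ψ i) w| ≤ 2 * K ^ 2 * (r i ^ 2)⁻¹ * θ i

variable {E : Set (SpaceTime n)} {K κ : ℝ} {z : ι → SpaceTime n} {r θ : ι → ℝ}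
  {ψ : ι → SpaceTime n → ℝ}

lemma volume_wc (hr : ∀ i, 0 < r i) {σ : ℝ} (hσ : 0 < σ) (i : ι) :
    volume (wc z r θ σ i)
      = ENNReal.ofReal (2 * unitVol n * σ ^ (n + 2) * (r i ^ (n + 2) / θ i)) := by
  rw [wc, volume_cyl _ (mul_pos hσ (hr i))]
  congr 1
  ring

namespace IsWhitneyFamily
variable (hW : IsWhitneyFamily E K κ z r θ)
include hW

omit hW in
lemma measurableSet_wc (σ : ℝ) (i : ι) : MeasurableSet (wc z r θ σ i) :=
  measurableSet_cyl _ _ _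

lemma K_pos : 0 < K := by linarith [hW.two_le_K]

lemma κ_pos : 0 < κ := by linarith [hW.one_le_κ]

lemma wc_mono {σ σ' : ℝ} (h0 : 0 ≤ σ) (h : σ ≤ σ') (i : ι) :
    wc z r θ σ i ⊆ wc z r θ σ' i := by
  have hr := (hW.r_pos i).le
  have hθ := (hW.θ_pos i).le
  apply cyl_subset_cyl
  · simpa using mul_le_mul_of_nonneg_right h hr
  · simp only [sub_self, abs_zero, zero_add]
    gcongr

lemma wc_one_subset_two (i : ι) : wc z r θ (1 / K) i ⊆ wc z r θ (2 / K) i := by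
  have hK := hW.K_pos
  refine hW.wc_mono (by positivity) ?_ i
  gcongr
  norm_num

lemma exists_mem {y : SpaceTime n} (hy : y ∈ Eᶜ) : ∃ k, y ∈ wc z r θ (1 / K) k :=
  mem_iUnion.1 (hW.cover hy)

lemma mem_compl {y : SpaceTime n} {k : ι} (hy : y ∈ wc z r θ (1 / K) k) : y ∈ Eᶜ :=
  hW.subset k (hW.wc_one_subset_two k hy)

omit hW in
/-- The indices of the cylinders whose double meets `K⁻¹ U_k`. -/
def nbrs (K : ℝ) (z : ι → SpaceTime n) (r θ : ι → ℝ) (k : ι) : Set ι :=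
  {j | (wc z r θ (2 / K) j ∩ wc z r θ (1 / K) k).Nonempty}

lemma comparable {j k : ι} (h : j ∈ nbrs K z r θ k) :
    r j ≤ κ * r k ∧ r k ≤ κ * r j ∧ θ j ≤ κ * θ k ∧ θ k ≤ κ * θ j := by
  obtain ⟨y, h1, h2⟩ := h
  have h2' := hW.wc_one_subset_two k h2
  have a := hW.nbr j k ⟨y, h1, h2'⟩
  have b := hW.nbr k j ⟨y, h2', h1⟩
  exact ⟨a.1, b.1, a.2, b.2⟩

/-- Bound for the number of neighbours. -/
noncomputable def _root_.MultiPhase.overlapConst (n : ℕ) (K κ : ℝ) : ℝ :=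
  (3 * κ ^ 2) ^ (n + 3) * (6 * K ^ 6) ^ (n + 2)

lemma one_le_overlapConst : 1 ≤ overlapConst n K κ := by
  have h1 := hW.one_le_κ
  have h2 := hW.two_le_K
  have a : (1 : ℝ) ≤ K ^ 6 := one_le_pow₀ (by linarith)
  have b : (1 : ℝ) ≤ κ ^ 2 := one_le_pow₀ (by linarith)
  exact one_le_mul_of_one_le_of_one_le (one_le_pow₀ (by linarith)) (one_le_pow₀ (by linarith))

/-- Neighbours satisfy `r_j ≤ κ r_k` and `r_j²/θ_j ≤ κ³ r_k²/θ_k`. Hence the centre of `j`, together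
with its shrunken cylinder, stays in a fixed enlargement of the cylinder of `k`. -/
lemma small_subset {j k : ι} (h : j ∈ nbrs K z r θ k) :
    wc z r θ (1 / (6 * K ^ 6)) j ⊆ cyl (z k) (3 * κ * r k) (3 * κ ^ 3 * (r k ^ 2 / θ k)) := by
  obtain ⟨c1, c2, c3, c4⟩ := hW.comparable h
  obtain ⟨y, hj, hk⟩ := h
  have hK := hW.two_le_K
  have hκ := hW.one_le_κ
  have hrj := hW.r_pos j
  have hrk := hW.r_pos k
  have hθj := hW.θ_pos j
  have hθk := hW.θ_pos k
  rw [wc, mem_cyl] at hj hk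
  have s1 : (2 / K) ≤ 1 := by rw [div_le_one (by linarith)]; exact hK
  have s2 : (1 / K) ≤ 1 := by rw [div_le_one (by linarith)]; linarith
  have s3 : 1 / (6 * K ^ 6) ≤ 1 := by
    have : (1 : ℝ) ≤ K ^ 6 := one_le_pow₀ (by linarith)
    rw [div_le_one (by positivity)]; linarith
  have p1 : 0 ≤ 2 / K := by positivity
  have p2 : 0 ≤ 1 / K := by positivity
  have p3 : 0 ≤ 1 / (6 * K ^ 6) := by positivity
  have tsc : ∀ σ : ℝ, 0 ≤ σ → σ ≤ 1 → ∀ i, (σ * r i) ^ 2 / θ i ≤ r i ^ 2 / θ i := by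
    intro σ h0 h1 i
    have := hW.θ_pos i
    have hri := hW.r_pos i
    gcongr
    nlinarith
  have hjk : r j ^ 2 / θ j ≤ κ ^ 3 * (r k ^ 2 / θ k) := by
    rw [← mul_div_assoc, div_le_div_iff₀ hθj hθk]
    calc r j ^ 2 * θ k ≤ (κ * r k) ^ 2 * (κ * θ j) := by gcongr
      _ = _ := by ring
  have hkk : r k ^ 2 / θ k ≤ κ ^ 3 * (r k ^ 2 / θ k) :=
    le_mul_of_one_le_left (by positivity) (one_le_pow₀ hκ)
  apply cyl_subset_cyl
  · have := norm_sub_le_norm_sub_add_norm_sub (z j).1 y.1 (z k).1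
    rw [norm_sub_rev (z j).1 y.1] at this
    have a1 : 2 / K * r j ≤ r j := by nlinarith
    have a2 : 1 / K * r k ≤ r k := by nlinarith
    have a3 : 1 / (6 * K ^ 6) * r j ≤ r j := by nlinarith
    have a4 : r k ≤ κ * r k := by nlinarith
    linarith [hj.1, hk.1]
  · have := abs_sub_le (z j).2 y.2 (z k).2
    rw [abs_sub_comm (z j).2 y.2] at this
    linarith [hj.2, hk.2, tsc _ p1 s1 j, tsc _ p2 s2 k, tsc _ p3 s3 j]

/-- A packing argument: the shrunken cylinders of the neighbours are disjoint, lie in the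
enlargement from `small_subset`, and have at least a fixed fraction of its volume. The ratio of the
two volumes bounds the number of neighbours. -/
lemma card_le {k : ι} (F : Finset ι) (hF : ∀ j ∈ F, j ∈ nbrs K z r θ k) :
    (F.card : ℝ) ≤ overlapConst n K κ := by
  have hK := hW.two_le_K
  have hκ := hW.one_le_κ
  have hrk := hW.r_pos k
  have hθk := hW.θ_pos k
  have hV := unitVol_pos n
  set δ : ℝ := 1 / (6 * K ^ 6) with hδ
  have hδ0 : 0 < δ := by positivity
  set X := r k ^ (n + 2) / θ k with hX
  have hX0 : 0 < X := by positivity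
  have h1 : ∑ j ∈ F, volume (wc z r θ δ j)
      ≤ volume (cyl (z k) (3 * κ * r k) (3 * κ ^ 3 * (r k ^ 2 / θ k))) := by
    rw [← measure_biUnion_finset (fun i _ j _ hij => hW.disj hij)
      fun j _ => measurableSet_cyl _ _ _]
    exact measure_mono (iUnion₂_subset fun j hj => hW.small_subset (hF j hj))
  have h2 : ∀ j ∈ F, ENNReal.ofReal (2 * unitVol n * δ ^ (n + 2) * (X / κ ^ (n + 3)))
      ≤ volume (wc z r θ δ j) := by
    intro j hj
    obtain ⟨c1, c2, c3, c4⟩ := hW.comparable (hF j hj)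
    have hrj := hW.r_pos j
    have hθj := hW.θ_pos j
    rw [volume_wc hW.r_pos hδ0]
    apply ENNReal.ofReal_le_ofReal
    refine mul_le_mul_of_nonneg_left ?_ (by positivity)
    rw [hX, div_div, div_le_div_iff₀ (by positivity) hθj]
    calc r k ^ (n + 2) * θ j ≤ (κ * r j) ^ (n + 2) * (κ * θ k) := by gcongr
      _ = _ := by ring
  have h3 := (Finset.sum_le_sum h2).trans h1
  rw [Finset.sum_const, nsmul_eq_mul, volume_cyl _ (by positivity),
    ← ENNReal.ofReal_natCast, ← ENNReal.ofReal_mul (by positivity),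
    ENNReal.ofReal_le_ofReal_iff (by positivity)] at h3
  have e : unitVol n * (3 * κ * r k) ^ n * (2 * (3 * κ ^ 3 * (r k ^ 2 / θ k)))
      = 2 * unitVol n * (3 ^ (n + 1) * κ ^ (n + 3)) * X := by
    rw [hX]; field_simp; ring
  have e2 : (F.card : ℝ) * (2 * unitVol n * δ ^ (n + 2) * (X / κ ^ (n + 3)))
      = (F.card * (δ ^ (n + 2) / κ ^ (n + 3))) * (2 * unitVol n * X) := by
    field_simp
  have e3 : 2 * unitVol n * (3 ^ (n + 1) * κ ^ (n + 3)) * X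
      = 3 ^ (n + 1) * κ ^ (n + 3) * (2 * unitVol n * X) := by ring
  rw [e, e2, e3] at h3
  have h4 := le_of_mul_le_mul_right h3 (by positivity)
  rw [hδ, one_div, inv_pow, inv_eq_one_div, div_div, mul_one_div,
    div_le_iff₀ (by positivity)] at h4
  refine h4.trans ?_
  rw [overlapConst]
  have e5 : 3 ^ (n + 1) * κ ^ (n + 3) * ((6 * K ^ 6) ^ (n + 2) * κ ^ (n + 3))
      = (3 ^ (n + 1) * (κ ^ 2) ^ (n + 3)) * (6 * K ^ 6) ^ (n + 2) := by ring
  rw [e5, mul_pow 3]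
  gcongr <;> norm_num

lemma finite_nbrs (k : ι) : (nbrs K z r θ k).Finite := by
  by_contra h
  obtain ⟨M, hM⟩ := exists_nat_gt (overlapConst n K κ)
  obtain ⟨F, hF, hc⟩ := Set.Infinite.exists_subset_card_eq h M
  have := hW.card_le F (fun j hj => hF hj)
  rw [hc] at this
  linarith

/-- The neighbours of `k`, as a finite set. -/
noncomputable def nb (k : ι) : Finset ι := (hW.finite_nbrs k).toFinset

lemma mem_nb {j k : ι} : j ∈ hW.nb k ↔ j ∈ nbrs K z r θ k := by simp [nb]

lemma card_nb_le (k : ι) : ((hW.nb k).card : ℝ) ≤ overlapConst n K κ :=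
  hW.card_le _ fun _ h => hW.mem_nb.1 h

lemma volume_two_eq (k : ι) : volume (wc z r θ (2 / K) k)
    = ENNReal.ofReal ((12 * K ^ 5) ^ (n + 2)) * volume (wc z r θ (1 / (6 * K ^ 6)) k) := by
  have hK := hW.K_pos
  rw [volume_wc hW.r_pos (by positivity), volume_wc hW.r_pos (by positivity),
    ← ENNReal.ofReal_mul (by positivity)]
  congr 1
  have e : (2 / K) ^ (n + 2) = (12 * K ^ 5) ^ (n + 2) * (1 / (6 * K ^ 6)) ^ (n + 2) := by
    rw [← mul_pow]; congr 1; field_simp; norm_num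
  rw [e]; ring

/-- The cylinders `2K⁻¹U_k` overlap, but each has a fixed multiple of the volume of its shrunken
copy, and the shrunken copies are disjoint subsets of `Eᶜ`. -/
lemma tsum_volume_le [Countable ι] :
    ∑' k, volume (wc z r θ (2 / K) k)
      ≤ ENNReal.ofReal ((12 * K ^ 5) ^ (n + 2)) * volume Eᶜ := by
  have hK := hW.K_pos
  simp_rw [hW.volume_two_eq]
  rw [ENNReal.tsum_mul_left, ← measure_iUnion hW.disj fun k => measurableSet_cyl _ _ _]
  gcongr
  refine iUnion_subset fun k => (hW.wc_mono (by positivity) ?_ k).trans (hW.subset k)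
  have : (1 : ℝ) ≤ K ^ 5 := one_le_pow₀ (by linarith [hW.two_le_K])
  rw [div_le_div_iff₀ (by positivity) hK]
  nlinarith

end IsWhitneyFamily

end Whitney

/-! ### The partition of unity and the truncation outside the good set -/

section Truncation
variable {n N : ℕ} {ι : Type} {E : Set (SpaceTime n)} {K κ : ℝ} {z : ι → SpaceTime n}
  {r θ : ι → ℝ} {ψ : ι → SpaceTime n → ℝ}

/-- The truncation `w - ∑ ω_i (w - m_i)` for prescribed values `m_i`. -/
noncomputable def wtrunc (ψ : ι → SpaceTime n → ℝ) (m : ι → Space N) (w : SpaceTime n → Space N)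
    (y : SpaceTime n) : Space N :=
  w y - ∑' i, Config.pou ψ i y • (w y - m i)

namespace IsWhitneyFamily
variable (hW : IsWhitneyFamily E K κ z r θ) (hψ : IsWhitneyCutoff K z r θ ψ)
include hW hψ

lemma notMem_tsupport {y : SpaceTime n} {k j : ι} (hy : y ∈ wc z r θ (1 / K) k)
    (hj : j ∉ hW.nb k) : y ∉ tsupport (ψ j) := fun h =>
  hj (hW.mem_nb.2 ⟨y, hψ.supp j h, hy⟩)

lemma psi_eq_zero {y : SpaceTime n} {k j : ι} (hy : y ∈ wc z r θ (1 / K) k)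
    (hj : j ∉ hW.nb k) : ψ j y = 0 :=
  image_eq_zero_of_notMem_tsupport (hW.notMem_tsupport hψ hy hj)

lemma self_mem_nb (k : ι) : k ∈ hW.nb k := by
  have hK := hW.K_pos
  have hr := hW.r_pos k
  have hθ := hW.θ_pos k
  refine hW.mem_nb.2 ⟨z k, ?_, ?_⟩ <;> exact mem_cyl_self _ (by positivity) (by positivity)

lemma tsum_psi {y : SpaceTime n} {k : ι} (hy : y ∈ wc z r θ (1 / K) k) :
    ∑' j, ψ j y = ∑ j ∈ hW.nb k, ψ j y :=
  tsum_eq_sum fun _ hj => hW.psi_eq_zero hψ hy hj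

lemma one_le_tsum_psi {y : SpaceTime n} {k : ι} (hy : y ∈ wc z r θ (1 / K) k) :
    1 ≤ ∑ j ∈ hW.nb k, ψ j y := by
  rw [← hψ.eq_one k y hy]
  exact Finset.single_le_sum (f := fun j => ψ j y) (fun j _ => hψ.nonneg j y)
    (hW.self_mem_nb hψ k)

lemma pou_eq {y : SpaceTime n} {k : ι} (hy : y ∈ wc z r θ (1 / K) k) (j : ι) :
    Config.pou ψ j y = ψ j y / ∑ i ∈ hW.nb k, ψ i y := by
  rw [Config.pou, hW.tsum_psi hψ hy]

lemma pou_nonneg (j : ι) (y : SpaceTime n) : 0 ≤ Config.pou ψ j y :=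
  div_nonneg (hψ.nonneg j y) (tsum_nonneg fun i => hψ.nonneg i y)

lemma pou_eq_zero_of_notMem_nb {y : SpaceTime n} {k j : ι} (hy : y ∈ wc z r θ (1 / K) k)
    (hj : j ∉ hW.nb k) : Config.pou ψ j y = 0 := by
  rw [Config.pou, hW.psi_eq_zero hψ hy hj, zero_div]

lemma pou_eq_zero_of_mem {y : SpaceTime n} (hy : y ∈ E) (j : ι) : Config.pou ψ j y = 0 := by
  have h : y ∉ tsupport (ψ j) := fun h => hW.subset j (hψ.supp j h) hy
  rw [Config.pou, image_eq_zero_of_notMem_tsupport h, zero_div]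

lemma sum_pou {y : SpaceTime n} {k : ι} (hy : y ∈ wc z r θ (1 / K) k) :
    ∑ j ∈ hW.nb k, Config.pou ψ j y = 1 := by
  simp_rw [hW.pou_eq hψ hy]
  rw [← Finset.sum_div, div_self]
  exact (zero_lt_one.trans_le (hW.one_le_tsum_psi hψ hy)).ne'

lemma pou_eventuallyEq {y : SpaceTime n} {k : ι} (hy : y ∈ wc z r θ (1 / K) k) (j : ι) :
    Config.pou ψ j =ᶠ[𝓝 y] fun y => ψ j y / ∑ i ∈ hW.nb k, ψ i y := by
  filter_upwards [(isOpen_cyl _ _ _).mem_nhds hy] with x hx using hW.pou_eq hψ hx j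

lemma contDiffAt_pou {y : SpaceTime n} (hy : y ∈ Eᶜ) (j : ι) :
    ContDiffAt ℝ ∞ (Config.pou ψ j) y := by
  obtain ⟨k, hk⟩ := hW.exists_mem hy
  refine ContDiffAt.congr_of_eventuallyEq ?_ (hW.pou_eventuallyEq hψ hk j)
  refine (hψ.smooth j).contDiffAt.div ?_ (zero_lt_one.trans_le (hW.one_le_tsum_psi hψ hk)).ne'
  exact (ContDiff.sum fun i _ => hψ.smooth i).contDiffAt

lemma tsupport_pou_subset (j : ι) : tsupport (Config.pou ψ j) ⊆ tsupport (ψ j) := by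
  apply closure_mono
  intro y hy h
  exact hy (by rw [Config.pou, h, zero_div])

lemma hasCompactSupport_pou (j : ι) : HasCompactSupport (Config.pou ψ j) :=
  (hψ.compact j).of_isClosed_subset (isClosed_tsupport _) (hW.tsupport_pou_subset hψ j)

/-- The only possible trouble is at the boundary of `Eᶜ`, where infinitely many cylinders may
accumulate. Each single function is supported in `tsupport (ψ j)`, a subset of `Eᶜ`, and vanishes
near every other point. -/
lemma contDiff_pou (j : ι) : ContDiff ℝ ∞ (Config.pou ψ j) := by
  rw [contDiff_iff_contDiffAt]
  intro y
  by_cases hy : y ∈ tsupport (ψ j)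
  · exact hW.contDiffAt_pou hψ (hW.subset j (hψ.supp j hy)) j
  · have h := fun h' => hy (hW.tsupport_pou_subset hψ j h')
    exact contDiffAt_const.congr_of_eventuallyEq (notMem_tsupport_iff_eventuallyEq.1 h)

lemma fderiv_pou_eq_zero {y : SpaceTime n} {j : ι} (hy : y ∉ tsupport (ψ j)) :
    fderiv ℝ (Config.pou ψ j) y = 0 :=
  image_eq_zero_of_notMem_tsupport fun h =>
    hy (hW.tsupport_pou_subset hψ j (tsupport_fderiv_subset ℝ h))

lemma sum_fderiv_pou {y : SpaceTime n} {k : ι} (hy : y ∈ wc z r θ (1 / K) k)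
    (e : SpaceTime n) : ∑ j ∈ hW.nb k, fderiv ℝ (Config.pou ψ j) y e = 0 := by
  have h1 : (fun y => ∑ j ∈ hW.nb k, Config.pou ψ j y) =ᶠ[𝓝 y] fun _ => (1 : ℝ) := by
    filter_upwards [(isOpen_cyl _ _ _).mem_nhds hy] with x hx using hW.sum_pou hψ hx
  have h2 := h1.fderiv_eq (𝕜 := ℝ)
  rw [fderiv_fun_sum fun j _ => (hW.contDiff_pou hψ j).differentiable (by simp) y] at h2
  have h3 := congrArg (fun L : SpaceTime n →L[ℝ] ℝ => L e) h2
  simpa using h3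

/-- Quotient rule. The denominator is at least 1, because some `ψ_k` equals 1 at the point, and its
derivative is a sum of at most `overlapConst` terms. -/
lemma abs_fderiv_pou_le {y : SpaceTime n} {k : ι} (hy : y ∈ wc z r θ (1 / K) k)
    {e : SpaceTime n} {d : ℝ} (hd : ∀ j ∈ hW.nb k, |fderiv ℝ (ψ j) y e| ≤ d) {j : ι}
    (hj : j ∈ hW.nb k) :
    |fderiv ℝ (Config.pou ψ j) y e| ≤ (1 + overlapConst n K κ) * d := by
  set P : SpaceTime n → ℝ := fun y => ∑ i ∈ hW.nb k, ψ i y with hP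
  have hP1 : 1 ≤ P y := hW.one_le_tsum_psi hψ hy
  have hP0 : 0 < P y := zero_lt_one.trans_le hP1
  have hd0 : 0 ≤ d := (abs_nonneg _).trans (hd j hj)
  have hdψ : ∀ i, HasFDerivAt (ψ i) (fderiv ℝ (ψ i) y) y := fun i =>
    ((hψ.smooth i).differentiable (by simp) y).hasFDerivAt
  have hdP : HasFDerivAt P (∑ i ∈ hW.nb k, fderiv ℝ (ψ i) y) y :=
    HasFDerivAt.fun_sum fun i _ => hdψ i
  have hPe : |(∑ i ∈ hW.nb k, fderiv ℝ (ψ i) y) e| ≤ overlapConst n K κ * d := by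
    rw [sum_apply]
    refine (Finset.abs_sum_le_sum_abs _ _).trans ((Finset.sum_le_sum hd).trans ?_)
    rw [Finset.sum_const, nsmul_eq_mul]
    gcongr
    exact hW.card_nb_le k
  have hinv : HasFDerivAt (fun y => (P y)⁻¹) ((-(P y ^ 2)⁻¹) • ∑ i ∈ hW.nb k, fderiv ℝ (ψ i) y) y :=
    (hasDerivAt_inv hP0.ne').comp_hasFDerivAt y hdP
  have hmul := (hdψ j).fun_mul hinv
  have heq : Config.pou ψ j =ᶠ[𝓝 y] fun y => ψ j y * (P y)⁻¹ := by
    simpa only [div_eq_mul_inv] using hW.pou_eventuallyEq hψ hy j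
  rw [heq.fderiv_eq, hmul.fderiv]
  simp only [add_apply, smul_apply, smul_eq_mul]
  have b1 : (P y)⁻¹ ≤ 1 := inv_le_one_of_one_le₀ hP1
  have b2 : (P y ^ 2)⁻¹ ≤ 1 := inv_le_one_of_one_le₀ (one_le_pow₀ hP1)
  have b3 : 0 ≤ (P y)⁻¹ := by positivity
  have b4 : 0 ≤ (P y ^ 2)⁻¹ := by positivity
  have hM : 0 ≤ overlapConst n K κ * d := (abs_nonneg _).trans hPe
  calc |ψ j y * (-(P y ^ 2)⁻¹ * (∑ i ∈ hW.nb k, fderiv ℝ (ψ i) y) e)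
        + (P y)⁻¹ * fderiv ℝ (ψ j) y e|
      ≤ ψ j y * ((P y ^ 2)⁻¹ * |(∑ i ∈ hW.nb k, fderiv ℝ (ψ i) y) e|)
        + (P y)⁻¹ * |fderiv ℝ (ψ j) y e| := by
        refine (abs_add_le _ _).trans (le_of_eq ?_)
        rw [abs_mul, abs_mul, abs_neg, abs_mul, abs_of_nonneg (hψ.nonneg j y), abs_of_nonneg b3,
          abs_of_nonneg b4]
    _ ≤ 1 * (1 * (overlapConst n K κ * d)) + 1 * d := by
        gcongr
        · exact hψ.le_one j y
        · exact hd j hj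
    _ = _ := by ring

variable {m : ι → Space N} {w : SpaceTime n → Space N}

lemma wtrunc_eq_of_mem {y : SpaceTime n} (hy : y ∈ E) : wtrunc ψ m w y = w y := by
  simp [wtrunc, hW.pou_eq_zero_of_mem hψ hy]

/-- As the partition functions sum to 1, `w` itself drops out. Hence in `Eᶜ` the truncation is a
locally finite combination of smooth functions, however irregular `w` is. -/
lemma wtrunc_eq {y : SpaceTime n} {k : ι} (hy : y ∈ wc z r θ (1 / K) k) :
    wtrunc ψ m w y = ∑ j ∈ hW.nb k, Config.pou ψ j y • m j := by
  have h1 : ∑' i, Config.pou ψ i y • (w y - m i)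
      = ∑ i ∈ hW.nb k, Config.pou ψ i y • (w y - m i) :=
    tsum_eq_sum fun j hj => by rw [hW.pou_eq_zero_of_notMem_nb hψ hy hj, zero_smul]
  rw [wtrunc, h1]
  simp_rw [smul_sub]
  rw [Finset.sum_sub_distrib, ← Finset.sum_smul, hW.sum_pou hψ hy, one_smul, sub_sub_cancel]

lemma wtrunc_eventuallyEq {y : SpaceTime n} {k : ι} (hy : y ∈ wc z r θ (1 / K) k) :
    wtrunc ψ m w =ᶠ[𝓝 y] fun y => ∑ j ∈ hW.nb k, Config.pou ψ j y • m j := by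
  filter_upwards [(isOpen_cyl _ _ _).mem_nhds hy] with x hx using hW.wtrunc_eq hψ hx

lemma contDiffAt_wtrunc {y : SpaceTime n} (hy : y ∈ Eᶜ) : ContDiffAt ℝ ∞ (wtrunc ψ m w) y := by
  obtain ⟨k, hk⟩ := hW.exists_mem hy
  refine ContDiffAt.congr_of_eventuallyEq ?_ (hW.wtrunc_eventuallyEq hψ hk)
  exact (ContDiff.sum fun i _ => (hW.contDiff_pou hψ i).smul contDiff_const).contDiffAt

lemma contDiffOn_wtrunc : ContDiffOn ℝ ∞ (wtrunc ψ m w) Eᶜ := fun _ hy =>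
  (hW.contDiffAt_wtrunc hψ hy).contDiffWithinAt

lemma fderiv_wtrunc {y : SpaceTime n} {k : ι} (hy : y ∈ wc z r θ (1 / K) k) (e : SpaceTime n) :
    fderiv ℝ (wtrunc ψ m w) y e = ∑ j ∈ hW.nb k, fderiv ℝ (Config.pou ψ j) y e • m j := by
  rw [(hW.wtrunc_eventuallyEq hψ hy).fderiv_eq]
  have h : HasFDerivAt (fun y => ∑ j ∈ hW.nb k, Config.pou ψ j y • m j)
      (∑ j ∈ hW.nb k, (fderiv ℝ (Config.pou ψ j) y).smulRight (m j)) y :=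
    HasFDerivAt.fun_sum fun j _ =>
      (((hW.contDiff_pou hψ j).differentiable (by simp) y).hasFDerivAt).smul_const (m j)
  rw [h.fderiv]
  simp

/-- The derivatives of the partition functions sum to zero, so every `m_j` may be replaced by `m_j -
m_k`: only differences of neighbouring values enter. -/
lemma norm_fderiv_wtrunc_le {y : SpaceTime n} {k : ι} (hy : y ∈ wc z r θ (1 / K) k)
    {e : SpaceTime n} {d Δ : ℝ} (hd : ∀ j ∈ hW.nb k, |fderiv ℝ (ψ j) y e| ≤ d)
    (hΔ : ∀ j ∈ hW.nb k, ‖m j - m k‖ ≤ Δ) :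
    ‖fderiv ℝ (wtrunc ψ m w) y e‖
      ≤ overlapConst n K κ * ((1 + overlapConst n K κ) * d * Δ) := by
  have hk := hW.self_mem_nb hψ k
  have hd0 : 0 ≤ d := (abs_nonneg _).trans (hd k hk)
  have hΔ0 : 0 ≤ Δ := (norm_nonneg _).trans (hΔ k hk)
  have h1 := hW.one_le_overlapConst (n := n)
  have e1 : fderiv ℝ (wtrunc ψ m w) y e
      = ∑ j ∈ hW.nb k, fderiv ℝ (Config.pou ψ j) y e • (m j - m k) := by
    simp_rw [smul_sub]
    rw [Finset.sum_sub_distrib, ← Finset.sum_smul, hW.sum_fderiv_pou hψ hy, zero_smul, sub_zero,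
      hW.fderiv_wtrunc hψ hy]
  rw [e1]
  calc ‖∑ j ∈ hW.nb k, fderiv ℝ (Config.pou ψ j) y e • (m j - m k)‖
      ≤ ∑ j ∈ hW.nb k, (1 + overlapConst n K κ) * d * Δ := by
        refine (norm_sum_le _ _).trans (Finset.sum_le_sum fun j hj => ?_)
        rw [norm_smul]
        exact mul_le_mul (hW.abs_fderiv_pou_le hψ hy hd hj) (hΔ j hj) (norm_nonneg _)
          (by positivity)
    _ ≤ _ := by
        rw [Finset.sum_const, nsmul_eq_mul]
        gcongr
        exact hW.card_nb_le k

lemma norm_wtrunc_sub_le {y : SpaceTime n} {k : ι} (hy : y ∈ wc z r θ (1 / K) k)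
    {c : Space N} {Δ : ℝ} (hΔ : ∀ j ∈ hW.nb k, ‖m j - c‖ ≤ Δ) : ‖wtrunc ψ m w y - c‖ ≤ Δ := by
  have e1 : wtrunc ψ m w y - c = ∑ j ∈ hW.nb k, Config.pou ψ j y • (m j - c) := by
    simp_rw [smul_sub]
    rw [Finset.sum_sub_distrib, ← Finset.sum_smul, hW.sum_pou hψ hy, one_smul,
      hW.wtrunc_eq hψ hy]
  rw [e1]
  calc ‖∑ j ∈ hW.nb k, Config.pou ψ j y • (m j - c)‖
      ≤ ∑ j ∈ hW.nb k, Config.pou ψ j y * Δ := by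
        refine (norm_sum_le _ _).trans (Finset.sum_le_sum fun j hj => ?_)
        rw [norm_smul, Real.norm_of_nonneg (hW.pou_nonneg hψ j y)]
        exact mul_le_mul_of_nonneg_left (hΔ j hj) (hW.pou_nonneg hψ j y)
    _ = Δ := by rw [← Finset.sum_mul, hW.sum_pou hψ hy, one_mul]

lemma abs_fderiv_psi_space_le {k j : ι} (hj : j ∈ hW.nb k) (y : SpaceTime n) (l : Fin n) :
    |fderiv ℝ (ψ j) y (EuclideanSpace.single l 1, 0)| ≤ 2 * K * κ * (r k)⁻¹ := by
  have hc := hW.comparable (hW.mem_nb.1 hj)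
  have hrj := hW.r_pos j
  have hrk := hW.r_pos k
  have hK := hW.K_pos
  rw [← dx_eq_fderiv ((hψ.smooth j).differentiable (by simp) y), dx, ← Real.norm_eq_abs]
  refine (ContinuousLinearMap.le_opNorm _ _).trans ?_
  rw [PiLp.norm_single, norm_one, mul_one]
  refine (hψ.grad_le j y).trans ?_
  rw [mul_assoc (2 * K)]
  gcongr
  rw [← div_eq_mul_inv, inv_le_comm₀ hrj (by have := hW.κ_pos; positivity), inv_div,
    div_le_iff₀ hW.κ_pos]
  linarith [hc.2.1]

lemma abs_fderiv_psi_time_le {k j : ι} (hj : j ∈ hW.nb k) (y : SpaceTime n) :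
    |fderiv ℝ (ψ j) y (0, 1)| ≤ 2 * K ^ 2 * κ ^ 3 * (r k ^ 2)⁻¹ * θ k := by
  have hc := hW.comparable (hW.mem_nb.1 hj)
  have hrj := hW.r_pos j
  have hrk := hW.r_pos k
  have hK := hW.K_pos
  have hκ := hW.κ_pos
  have hθk := hW.θ_pos k
  have hθj := hW.θ_pos j
  rw [← dt_eq_fderiv ((hψ.smooth j).differentiable (by simp) y)]
  refine (hψ.dt_le j y).trans ?_
  have h1 : (r j ^ 2)⁻¹ ≤ κ ^ 2 * (r k ^ 2)⁻¹ := by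
    rw [← div_eq_mul_inv, le_div_iff₀ (by positivity), ← div_eq_inv_mul,
      div_le_iff₀ (by positivity), ← mul_pow]
    exact pow_le_pow_left₀ hrk.le hc.2.1 2
  calc 2 * K ^ 2 * (r j ^ 2)⁻¹ * θ j
      ≤ 2 * K ^ 2 * (κ ^ 2 * (r k ^ 2)⁻¹) * (κ * θ k) := by
        gcongr
        exact hc.2.2.1
    _ = _ := by ring

end IsWhitneyFamily

end Truncation

/-! ### Comparison of the values on neighbouring cylinders -/

/-- A ball meeting another ball contains, near the common point, a ball inside the second one. -/
lemma exists_norm_sub_le_and {V : Type*} [NormedAddCommGroup V] [NormedSpace ℝ V] {x y : V}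
    {δ R : ℝ} (hδ : 0 ≤ δ) (hR : δ ≤ R) (h : ‖y - x‖ ≤ R) :
    ∃ x', ‖x' - y‖ ≤ δ ∧ ‖x' - x‖ ≤ R - δ := by
  by_cases h1 : ‖y - x‖ ≤ δ
  · exact ⟨x, by rwa [norm_sub_rev], by simpa using hR⟩
  · push Not at h1
    have h0 : 0 < ‖y - x‖ := hδ.trans_lt h1
    refine ⟨y - (δ / ‖y - x‖) • (y - x), ?_, ?_⟩
    · rw [sub_sub_cancel_left, norm_neg, norm_smul, Real.norm_of_nonneg (by positivity),
        div_mul_cancel₀ _ h0.ne']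
    · have e : y - (δ / ‖y - x‖) • (y - x) - x = (1 - δ / ‖y - x‖) • (y - x) := by
        rw [sub_smul, one_smul]; abel
      have h2 : δ / ‖y - x‖ ≤ 1 := by rw [div_le_one h0]; exact h1.le
      rw [e, norm_smul, Real.norm_of_nonneg (by linarith), sub_mul, one_mul,
        div_mul_cancel₀ _ h0.ne']
      linarith

section Truncation
variable {n N : ℕ} {ι : Type} {E : Set (SpaceTime n)} {K κ : ℝ} {z : ι → SpaceTime n}
  {r θ : ι → ℝ} {ψ : ι → SpaceTime n → ℝ} {m : ι → Space N} {w : SpaceTime n → Space N}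
  {A : ι → ℝ}

/-- Constant in the comparison of the values `m_j` on neighbouring cylinders. -/
noncomputable def meanConst (n : ℕ) (κ : ℝ) : ℝ :=
  κ * (4 * κ ^ 2) ^ n * (4 * κ ^ 7) + (4 * κ) ^ n * (4 * κ ^ 3)

/-- The approximation property `⨍_{2K⁻¹U_i} |w - m_i| ≤ A_i r_i`. -/
structure IsWhitneyApprox (K κ : ℝ) (z : ι → SpaceTime n) (r θ : ι → ℝ)
    (w : SpaceTime n → Space N) (m : ι → Space N) (A : ι → ℝ) : Prop where
  meas : AEStronglyMeasurable w
  nonneg : ∀ i, 0 ≤ A i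
  le : ∀ i, ∫⁻ y in wc z r θ (2 / K) i, ‖w y - m i‖ₑ
    ≤ ENNReal.ofReal (A i * r i) * volume (wc z r θ (2 / K) i)
  nbr : ∀ j k, j ∈ IsWhitneyFamily.nbrs K z r θ k → A j ≤ κ * A k

namespace IsWhitneyFamily
variable (hW : IsWhitneyFamily E K κ z r θ)
include hW

/-- A common point of `2K⁻¹U_j` and `K⁻¹U_k` has room around it inside the larger `2K⁻¹U_k`. Moving
it slightly towards the centre of `j`, separately in space and in time, gives room inside `2K⁻¹U_j`
as well. -/
lemma exists_cyl_subset_inter {j k : ι} (hj : j ∈ nbrs K z r θ k) :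
    ∃ p : SpaceTime n, cyl p (r k / (2 * K * κ)) ((r k / K) ^ 2 / (θ k * κ ^ 3))
      ⊆ wc z r θ (2 / K) j ∩ wc z r θ (2 / K) k := by
  obtain ⟨c1, c2, c3, c4⟩ := hW.comparable hj
  obtain ⟨y, hyj, hyk⟩ := hj
  rw [wc, mem_cyl] at hyj hyk
  have hK := hW.K_pos
  have hκ := hW.one_le_κ
  have hκ0 := hW.κ_pos
  have hrj := hW.r_pos j
  have hrk := hW.r_pos k
  have hθj := hW.θ_pos j
  have hθk := hW.θ_pos k
  set δ := r k / (2 * K * κ) with hδ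
  set δt := (r k / K) ^ 2 / (θ k * κ ^ 3) with hδt
  have hδ1 : δ ≤ 2 / K * r j := by
    rw [hδ, div_le_iff₀ (by positivity)]
    have : 2 / K * r j * (2 * K * κ) = 4 * (κ * r j) := by field_simp; ring
    rw [this]; linarith
  have hδ2 : 2 * δ ≤ 1 / K * r k := by
    have : 2 * δ = 1 / K * r k / κ := by rw [hδ]; field_simp
    rw [this]
    exact div_le_self (by positivity) hκ
  have hδt1 : δt ≤ (2 / K * r j) ^ 2 / θ j := by
    rw [hδt, div_le_div_iff₀ (by positivity) hθj]
    calc (r k / K) ^ 2 * θ j ≤ (κ * r j / K) ^ 2 * (κ * θ k) := by gcongr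
      _ = (1 / K * r j) ^ 2 * (θ k * κ ^ 3) := by ring
      _ ≤ _ := by gcongr; norm_num
  have hδt2 : 2 * δt ≤ 2 * ((r k / K) ^ 2 / θ k) := by
    rw [hδt, ← div_div]
    refine mul_le_mul_of_nonneg_left ?_ (by norm_num)
    exact div_le_self (by positivity) (one_le_pow₀ hκ)
  obtain ⟨x', hx1, hx2⟩ := exists_norm_sub_le_and (by positivity) hδ1 hyj.1.le
  obtain ⟨t', ht1, ht2⟩ := exists_norm_sub_le_and (V := ℝ) (x := (z j).2) (y := y.2)
    (δ := δt) (by positivity) hδt1 hyj.2.le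
  rw [Real.norm_eq_abs] at ht1 ht2
  refine ⟨(x', t'), subset_inter (cyl_subset_cyl ?_ ?_) (cyl_subset_cyl ?_ ?_)⟩
  · change ‖x' - (z j).1‖ + δ ≤ _
    linarith
  · change |t' - (z j).2| + δt ≤ _
    linarith
  · have := norm_sub_le_norm_sub_add_norm_sub x' y.1 (z k).1
    change ‖x' - (z k).1‖ + δ ≤ _
    have e : 2 / K * r k = 1 / K * r k + 1 / K * r k := by ring
    linarith [hyk.1]
  · have := abs_sub_le t' y.2 (z k).2
    change |t' - (z k).2| + δt ≤ _
    have e : (2 / K * r k) ^ 2 / θ k = (1 / K * r k) ^ 2 / θ k + 3 * ((r k / K) ^ 2 / θ k) := by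
      ring
    have e2 : 0 ≤ (r k / K) ^ 2 / θ k := by positivity
    linarith [hyk.2]

/-- Both `m_j` and `m_k` approximate `w` in mean on the common cylinder, whose volume is comparable
with those of `2K⁻¹U_j` and `2K⁻¹U_k`. The two terms of `meanConst` are the two volume ratios. -/
lemma norm_mean_sub_le (hP : IsWhitneyApprox K κ z r θ w m A) {j k : ι}
    (hj : j ∈ nbrs K z r θ k) : ‖m j - m k‖ ≤ meanConst n κ * (A k * r k) := by
  obtain ⟨p, hp⟩ := hW.exists_cyl_subset_inter hj
  obtain ⟨c1, c2, c3, c4⟩ := hW.comparable hj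
  have hK := hW.K_pos
  have hκ := hW.one_le_κ
  have hκ0 := hW.κ_pos
  have hrj := hW.r_pos j
  have hrk := hW.r_pos k
  have hθj := hW.θ_pos j
  have hθk := hW.θ_pos k
  have hV := unitVol_pos n
  have hAk := hP.nonneg k
  have hAj := hP.nonneg j
  have hAjk := hP.nbr j k hj
  set δ := r k / (2 * K * κ) with hδ
  set δt := (r k / K) ^ 2 / (θ k * κ ^ 3) with hδt
  have hδ0 : 0 < δ := by positivity
  have hδt0 : 0 < δt := by positivity
  set Q := cyl p δ δt with hQ
  have h1 : ‖m j - m k‖ₑ * volume Q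
      ≤ ENNReal.ofReal (A j * r j) * volume (wc z r θ (2 / K) j)
        + ENNReal.ofReal (A k * r k) * volume (wc z r θ (2 / K) k) := by
    rw [← setLIntegral_const]
    calc ∫⁻ y in Q, ‖m j - m k‖ₑ ≤ ∫⁻ y in Q, (‖w y - m j‖ₑ + ‖w y - m k‖ₑ) := by
          refine lintegral_mono fun y => ?_
          have e : m j - m k = -(w y - m j) + (w y - m k) := by abel
          rw [e]
          refine (enorm_add_le _ _).trans ?_
          rw [enorm_neg]
      _ = (∫⁻ y in Q, ‖w y - m j‖ₑ) + ∫⁻ y in Q, ‖w y - m k‖ₑ :=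
          lintegral_add_left' (hP.meas.restrict.sub aestronglyMeasurable_const).enorm _
      _ ≤ _ := add_le_add
          ((lintegral_mono_set (hp.trans inter_subset_left)).trans (hP.le j))
          ((lintegral_mono_set (hp.trans inter_subset_right)).trans (hP.le k))
  have v1 : volume (wc z r θ (2 / K) j)
      ≤ ENNReal.ofReal ((4 * κ ^ 2) ^ n * (4 * κ ^ 6) * (unitVol n * δ ^ n * (2 * δt))) := by
    rw [wc, volume_cyl _ (by positivity)]
    apply ENNReal.ofReal_le_ofReal
    have e1 : 2 / K * r j ≤ 4 * κ ^ 2 * δ := by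
      have : 4 * κ ^ 2 * δ = 2 / K * (κ * r k) := by rw [hδ]; field_simp; ring
      rw [this]; gcongr
    have e2 : (2 / K * r j) ^ 2 / θ j ≤ 4 * κ ^ 6 * δt := by
      have : 4 * κ ^ 6 * δt = (2 / K * (κ * r k)) ^ 2 * κ / θ k := by rw [hδt]; field_simp; ring
      rw [this, div_le_div_iff₀ hθj hθk]
      calc (2 / K * r j) ^ 2 * θ k ≤ (2 / K * (κ * r k)) ^ 2 * (κ * θ j) := by gcongr
        _ = _ := by ring
    calc unitVol n * (2 / K * r j) ^ n * (2 * ((2 / K * r j) ^ 2 / θ j))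
        ≤ unitVol n * (4 * κ ^ 2 * δ) ^ n * (2 * (4 * κ ^ 6 * δt)) := by gcongr
      _ = _ := by rw [mul_pow (4 * κ ^ 2) δ]; ring
  have v2 : volume (wc z r θ (2 / K) k)
      = ENNReal.ofReal ((4 * κ) ^ n * (4 * κ ^ 3) * (unitVol n * δ ^ n * (2 * δt))) := by
    rw [wc, volume_cyl _ (by positivity)]
    have e1 : 2 / K * r k = 4 * κ * δ := by rw [hδ]; field_simp; ring
    have e2 : (2 / K * r k) ^ 2 / θ k = 4 * κ ^ 3 * δt := by rw [hδt]; field_simp; ring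
    rw [e2, e1, mul_pow (4 * κ) δ]
    congr 1; ring
  have h2 := h1.trans (add_le_add (mul_le_mul_right v1 _) (mul_le_mul_right v2.le _))
  rw [hQ, volume_cyl _ hδ0, ← ofReal_norm, ← ENNReal.ofReal_mul (norm_nonneg _),
    ← ENNReal.ofReal_mul (by positivity), ← ENNReal.ofReal_mul (by positivity),
    ← ENNReal.ofReal_add (by positivity) (by positivity),
    ENNReal.ofReal_le_ofReal_iff (by positivity)] at h2
  have h3 : A j * r j ≤ κ ^ 2 * (A k * r k) := by
    calc A j * r j ≤ (κ * A k) * (κ * r k) := by gcongr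
      _ = _ := by ring
  have h4 : A j * r j * ((4 * κ ^ 2) ^ n * (4 * κ ^ 6) * (unitVol n * δ ^ n * (2 * δt)))
      ≤ κ ^ 2 * (A k * r k) * ((4 * κ ^ 2) ^ n * (4 * κ ^ 6) * (unitVol n * δ ^ n * (2 * δt))) := by
    gcongr
  refine le_of_mul_le_mul_right ((h2.trans (add_le_add h4 le_rfl)).trans (le_of_eq ?_))
    (show 0 < unitVol n * δ ^ n * (2 * δt) by positivity)
  rw [meanConst]; ring

variable (hψ : IsWhitneyCutoff K z r θ ψ) (hP : IsWhitneyApprox K κ z r θ w m A)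

/-- Constant in the derivative bounds for the truncation. -/
noncomputable def _root_.MultiPhase.truncConst (n : ℕ) (K κ : ℝ) : ℝ :=
  overlapConst n K κ * (1 + overlapConst n K κ) * (2 * K ^ 2 * κ ^ 3) * meanConst n κ

lemma meanConst_nonneg : 0 ≤ meanConst n κ := by
  have := hW.κ_pos
  rw [meanConst]; positivity

lemma truncConst_nonneg : 0 ≤ truncConst n K κ := by
  have := hW.κ_pos
  have := hW.K_pos
  have := hW.meanConst_nonneg (n := n)
  have := hW.one_le_overlapConst (n := n)
  rw [truncConst]; positivity

include hψ hP

lemma norm_wtrunc_sub_mean_le {y : SpaceTime n} {k : ι} (hy : y ∈ wc z r θ (1 / K) k) :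
    ‖wtrunc ψ m w y - m k‖ ≤ meanConst n κ * (A k * r k) :=
  hW.norm_wtrunc_sub_le hψ hy fun _ hj => hW.norm_mean_sub_le hP (hW.mem_nb.1 hj)

lemma norm_dx_wtrunc_le {y : SpaceTime n} {k : ι} (hy : y ∈ wc z r θ (1 / K) k) (l : Fin n) :
    ‖dx l (wtrunc ψ m w) y‖ ≤ truncConst n K κ * A k := by
  have hrk := hW.r_pos k
  have hK := hW.two_le_K
  have hκ := hW.one_le_κ
  have hκ0 := hW.κ_pos
  have hM := hW.one_le_overlapConst (n := n)
  have hD := hW.meanConst_nonneg (n := n)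
  have hA := hP.nonneg k
  rw [dx_eq_fderiv ((hW.contDiffAt_wtrunc hψ (hW.mem_compl hy)).differentiableAt (by simp))]
  refine (hW.norm_fderiv_wtrunc_le hψ hy (fun j hj => hW.abs_fderiv_psi_space_le hψ hj y l)
    fun j hj => hW.norm_mean_sub_le hP (hW.mem_nb.1 hj)).trans ?_
  have e : overlapConst n K κ * ((1 + overlapConst n K κ) * (2 * K * κ * (r k)⁻¹)
      * (meanConst n κ * (A k * r k)))
      = overlapConst n K κ * (1 + overlapConst n K κ) * (2 * (K * κ)) * meanConst n κ * A k := by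
    field_simp
  rw [e, truncConst, mul_assoc 2 (K ^ 2)]
  have e1 : K ≤ K ^ 2 := by nlinarith
  have e2 : κ ≤ κ ^ 3 := le_self_pow₀ hκ (by norm_num)
  gcongr

lemma norm_dt_wtrunc_le {y : SpaceTime n} {k : ι} (hy : y ∈ wc z r θ (1 / K) k) :
    ‖dt (wtrunc ψ m w) y‖ ≤ truncConst n K κ * (A k * θ k / r k) := by
  have hrk := hW.r_pos k
  rw [dt_eq_fderiv ((hW.contDiffAt_wtrunc hψ (hW.mem_compl hy)).differentiableAt (by simp))]
  refine (hW.norm_fderiv_wtrunc_le hψ hy (fun j hj => hW.abs_fderiv_psi_time_le hψ hj y)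
    fun j hj => hW.norm_mean_sub_le hP (hW.mem_nb.1 hj)).trans (le_of_eq ?_)
  rw [truncConst]
  field_simp

lemma lintegral_sub_wtrunc_le (k : ι) :
    ∫⁻ y in wc z r θ (1 / K) k, ‖w y - wtrunc ψ m w y‖ₑ
      ≤ ENNReal.ofReal ((1 + meanConst n κ) * (A k * r k)) * volume (wc z r θ (2 / K) k) := by
  have hsub := hW.wc_one_subset_two k
  have hD := hW.meanConst_nonneg (n := n)
  have hA := hP.nonneg k
  have hrk := hW.r_pos k
  calc ∫⁻ y in wc z r θ (1 / K) k, ‖w y - wtrunc ψ m w y‖ₑ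
      ≤ ∫⁻ y in wc z r θ (1 / K) k,
          (‖w y - m k‖ₑ + ENNReal.ofReal (meanConst n κ * (A k * r k))) := by
        refine setLIntegral_mono' (measurableSet_cyl _ _ _) fun y hy => ?_
        have e : w y - wtrunc ψ m w y = (w y - m k) - (wtrunc ψ m w y - m k) := by abel
        rw [e]
        refine (enorm_sub_le).trans (add_le_add le_rfl ?_)
        rw [← ofReal_norm]
        exact ENNReal.ofReal_le_ofReal (hW.norm_wtrunc_sub_mean_le hψ hP hy)
    _ = (∫⁻ y in wc z r θ (1 / K) k, ‖w y - m k‖ₑ)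
          + ENNReal.ofReal (meanConst n κ * (A k * r k)) * volume (wc z r θ (1 / K) k) := by
        rw [lintegral_add_right _ measurable_const, setLIntegral_const]
    _ ≤ ENNReal.ofReal (A k * r k) * volume (wc z r θ (2 / K) k)
          + ENNReal.ofReal (meanConst n κ * (A k * r k)) * volume (wc z r θ (2 / K) k) :=
        add_le_add ((lintegral_mono_set hsub).trans (hP.le k))
          (mul_le_mul_right (measure_mono hsub) _)
    _ = _ := by
        rw [← add_mul, ← ENNReal.ofReal_add (by positivity) (by positivity)]
        congr 2; ring

/-- The product of `w - w^Λ` and the time derivative of the truncation `w^Λ`. -/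
lemma lintegral_mul_dt_wtrunc_le [Countable ι] {L : ℝ} (hL : ∀ k, A k ^ 2 * θ k ≤ L) :
    ∫⁻ y in Eᶜ, ‖w y - wtrunc ψ m w y‖ₑ * ‖dt (wtrunc ψ m w) y‖ₑ
      ≤ ENNReal.ofReal ((12 * K ^ 5) ^ (n + 2) * (1 + meanConst n κ) * truncConst n K κ * L)
        * volume Eᶜ := by
  have hK := hW.K_pos
  have hD := hW.meanConst_nonneg (n := n)
  have hC := hW.truncConst_nonneg (n := n)
  have hk : ∀ k, ∫⁻ y in wc z r θ (1 / K) k, ‖w y - wtrunc ψ m w y‖ₑ * ‖dt (wtrunc ψ m w) y‖ₑ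
      ≤ ENNReal.ofReal ((1 + meanConst n κ) * truncConst n K κ * L)
        * volume (wc z r θ (2 / K) k) := by
    intro k
    have hA := hP.nonneg k
    have hrk := hW.r_pos k
    have hθk := hW.θ_pos k
    calc ∫⁻ y in wc z r θ (1 / K) k, ‖w y - wtrunc ψ m w y‖ₑ * ‖dt (wtrunc ψ m w) y‖ₑ
        ≤ ∫⁻ y in wc z r θ (1 / K) k, ‖w y - wtrunc ψ m w y‖ₑ *
            ENNReal.ofReal (truncConst n K κ * (A k * θ k / r k)) := by
          refine setLIntegral_mono' (measurableSet_cyl _ _ _) fun y hy => ?_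
          gcongr
          rw [← ofReal_norm]
          exact ENNReal.ofReal_le_ofReal (hW.norm_dt_wtrunc_le hψ hP hy)
      _ = (∫⁻ y in wc z r θ (1 / K) k, ‖w y - wtrunc ψ m w y‖ₑ) *
            ENNReal.ofReal (truncConst n K κ * (A k * θ k / r k)) :=
          lintegral_mul_const' _ _ ENNReal.ofReal_ne_top
      _ ≤ ENNReal.ofReal ((1 + meanConst n κ) * (A k * r k)) * volume (wc z r θ (2 / K) k) *
            ENNReal.ofReal (truncConst n K κ * (A k * θ k / r k)) := by
          gcongr
          exact hW.lintegral_sub_wtrunc_le hψ hP k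
      -- The radius cancels: `A_k r_k` from `w - w^Λ` against `A_k θ_k / r_k` from the time
      -- derivative.
      _ = ENNReal.ofReal ((1 + meanConst n κ) * truncConst n K κ * (A k ^ 2 * θ k)) *
            volume (wc z r θ (2 / K) k) := by
          rw [mul_right_comm, ← ENNReal.ofReal_mul (by positivity)]
          congr 2
          field_simp
      _ ≤ _ := by
          gcongr
          exact hL k
  calc ∫⁻ y in Eᶜ, ‖w y - wtrunc ψ m w y‖ₑ * ‖dt (wtrunc ψ m w) y‖ₑ
      ≤ ∫⁻ y in ⋃ k, wc z r θ (1 / K) k, ‖w y - wtrunc ψ m w y‖ₑ * ‖dt (wtrunc ψ m w) y‖ₑ :=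
        lintegral_mono_set hW.cover
    _ ≤ ∑' k, ∫⁻ y in wc z r θ (1 / K) k, ‖w y - wtrunc ψ m w y‖ₑ * ‖dt (wtrunc ψ m w) y‖ₑ :=
        lintegral_iUnion_le _ _
    _ ≤ ∑' k, ENNReal.ofReal ((1 + meanConst n κ) * truncConst n K κ * L)
        * volume (wc z r θ (2 / K) k) := ENNReal.tsum_le_tsum hk
    _ ≤ ENNReal.ofReal ((1 + meanConst n κ) * truncConst n K κ * L) *
          (ENNReal.ofReal ((12 * K ^ 5) ^ (n + 2)) * volume Eᶜ) := by
        rw [ENNReal.tsum_mul_left]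
        gcongr
        exact hW.tsum_volume_le
    _ = _ := by
        rw [← mul_assoc, mul_comm (ENNReal.ofReal _) (ENNReal.ofReal _),
          ← ENNReal.ofReal_mul (by positivity)]
        congr 2
        ring

end IsWhitneyFamily
end Truncation

/-! ### Campanato estimate for the truncation -/

section Truncation
variable {n N : ℕ} {ι : Type} {E : Set (SpaceTime n)} {K κ : ℝ} {z : ι → SpaceTime n}
  {r θ : ι → ℝ} {ψ : ι → SpaceTime n → ℝ} {m : ι → Space N} {w : SpaceTime n → Space N}
  {A : ι → ℝ}

/-- Bounds on the first derivatives in a convex set control increments. -/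
lemma norm_sub_le_of_dx_dt {g : SpaceTime n → Space N} {s : Set (SpaceTime n)}
    (hs : Convex ℝ s) {C₁ C₂ : ℝ} (hd : ∀ y ∈ s, DifferentiableAt ℝ g y)
    (h1 : ∀ y ∈ s, ∀ l, ‖dx l g y‖ ≤ C₁) (h2 : ∀ y ∈ s, ‖dt g y‖ ≤ C₂) {y x : SpaceTime n}
    (hy : y ∈ s) (hx : x ∈ s) :
    ‖g y - g x‖ ≤ n * C₁ * ‖y.1 - x.1‖ + C₂ * |y.2 - x.2| := by
  have hseg : ∀ t ∈ Icc (0 : ℝ) 1, x + t • (y - x) ∈ s := fun t ht => by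
    have := hs hx hy (sub_nonneg.2 ht.2) ht.1 (by ring)
    convert this using 1
    rw [smul_sub, sub_smul, one_smul]; abel
  have hder : ∀ t ∈ Icc (0 : ℝ) 1, HasDerivWithinAt (fun t : ℝ => g (x + t • (y - x)))
      (fderiv ℝ g (x + t • (y - x)) (y - x)) (Icc 0 1) t := by
    intro t ht
    have h1 : HasDerivAt (fun t : ℝ => x + t • (y - x)) (y - x) t := by
      simpa using ((hasDerivAt_id t).smul_const (y - x)).const_add x
    exact ((hd _ (hseg t ht)).hasFDerivAt.comp_hasDerivAt t h1).hasDerivWithinAt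
  have hb : ∀ t ∈ Ico (0 : ℝ) 1, ‖fderiv ℝ g (x + t • (y - x)) (y - x)‖
      ≤ n * C₁ * ‖y.1 - x.1‖ + C₂ * |y.2 - x.2| := by
    intro t ht
    have hp := hseg t (Ico_subset_Icc_self ht)
    set p := x + t • (y - x)
    have e1 : (y - x) = (y.1 - x.1, (0 : ℝ)) + (y.2 - x.2) • ((0 : Space n), (1 : ℝ)) := by
      ext <;> simp
    have e2 : fderiv ℝ g p (y.1 - x.1, (0 : ℝ))
        = fderiv ℝ (fun x : Space n => g (x, p.2)) p.1 (y.1 - x.1) := by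
      rw [(hasFDerivAt_slice_space (hd p hp)).fderiv]; simp
    rw [e1, map_add, map_smul, e2]
    refine (norm_add_le _ _).trans (add_le_add ?_ ?_)
    · refine (ContinuousLinearMap.le_opNorm _ _).trans ?_
      gcongr
      refine (opNorm_le_sum_single _).trans ((Finset.sum_le_sum fun l _ => h1 p hp l).trans ?_)
      simp
    · rw [norm_smul, Real.norm_eq_abs, mul_comm, ← dt_eq_fderiv (hd p hp)]
      gcongr
      exact h2 p hp
  have := norm_image_sub_le_of_norm_deriv_le_segment_01' hder hb
  simpa using this

/-- Position of the good set relative to the Whitney cylinders. -/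
structure IsWhitneyDistance (E : Set (SpaceTime n)) (z : ι → SpaceTime n) (r θ : ι → ℝ)
    (Θ : ℝ) : Prop where
  one_le_Θ : 1 ≤ Θ
  one_le : ∀ k, 1 ≤ θ k
  le : ∀ k, θ k ≤ Θ
  near : ∀ k, ∃ e ∈ E, ‖e.1 - (z k).1‖ ≤ 5 * r k ∧ |e.2 - (z k).2| ≤ 25 * r k ^ 2 / θ k
  far : ∀ k, ∀ e ∈ E, 4 * r k ≤ ‖e.1 - (z k).1‖ ∨ 16 * r k ^ 2 / θ k ≤ |e.2 - (z k).2|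

lemma convex_cyl (y : SpaceTime n) (ρ τ : ℝ) : Convex ℝ (cyl y ρ τ) :=
  (convex_ball _ _).prod (convex_Ioo _ _)

/-- Constant in the Campanato estimate for the truncation. -/
noncomputable def campConst (n : ℕ) (K κ Θ : ℝ) : ℝ :=
  1 + (1 + meanConst n κ) * (12 * K ^ 5) ^ (n + 2) * (Θ * (1 + 6 * K * Θ))
    * (1 + 2 * (Θ * (1 + 6 * K * Θ))) ^ (n + 2)
  + (n + κ * Θ) * truncConst n K κ

namespace IsWhitneyFamily
variable (hW : IsWhitneyFamily E K κ z r θ) (hψ : IsWhitneyCutoff K z r θ ψ) {Θ : ℝ}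
  (hd : IsWhitneyDistance E z r θ Θ)
include hW hd

/-- The good set stays outside `4U_k` while `y` lies in `K⁻¹U_k`, so `y` has distance at least of
order `r_k` from `E` in the intrinsic metric. Passing to the parabolic distance costs a power of
`θ_k ≤ Θ`. -/
lemma radius_le {k : ι} {y e : SpaceTime n} (hy : y ∈ wc z r θ (1 / K) k) (he : e ∈ E) :
    r k ≤ Θ * pdist y e := by
  have hrk := hW.r_pos k
  have hθk := hW.θ_pos k
  have hK := hW.two_le_K
  have h1 := hd.one_le k
  have h2 := hd.le k
  have hp := pdist_nonneg y e
  rw [wc, mem_cyl] at hy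
  have s1 : 1 / K ≤ 1 / 2 := one_div_le_one_div_of_le (by norm_num) hK
  have s0 : 0 ≤ 1 / K := by positivity
  have s2 : 1 / K * r k ≤ 1 / 2 * r k := by gcongr
  have h3 : pdist y e ≤ Θ * pdist y e := le_mul_of_one_le_left hp (h1.trans h2)
  rcases hd.far k e he with h | h
  · have a := norm_sub_le_norm_sub_add_norm_sub e.1 y.1 (z k).1
    have b := norm_fst_sub_le_pdist y e
    rw [norm_sub_rev] at b
    linarith [hy.1]
  · have a := abs_sub_le e.2 y.2 (z k).2
    have b := abs_snd_sub_le_pdist_sq y e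
    rw [abs_sub_comm] at b
    have c : (1 / K * r k) ^ 2 / θ k ≤ (1 / 2 * r k) ^ 2 / θ k := by gcongr
    have d : 16 * r k ^ 2 / θ k ≤ pdist y e ^ 2 + (1 / 2 * r k) ^ 2 / θ k := by
      linarith [hy.2]
    rw [← sub_le_iff_le_add, ← sub_div, div_le_iff₀ hθk] at d
    have f : r k ^ 2 ≤ (Θ * pdist y e) ^ 2 := by
      calc r k ^ 2 ≤ pdist y e ^ 2 * θ k := by nlinarith
        _ ≤ pdist y e ^ 2 * Θ ^ 2 := by
            gcongr
            nlinarith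
        _ = _ := by ring
    exact (abs_le_of_sq_le_sq' f (by nlinarith)).2

include hψ

/-- Campanato estimate for the truncation `w^Λ`. -/
lemma exists_lintegral_wtrunc_sub_le [Countable ι] {a : ℝ} (ha : 0 ≤ a)
    (hP : IsWhitneyApprox K κ z r θ w m fun _ => a)
    (hE : ∀ (y : SpaceTime n) (ρ : ℝ), 0 < ρ → (E ∩ pcyl y (6 * K * Θ * ρ)).Nonempty →
      ∃ c, ∫⁻ x in pcyl y ρ, ‖w x - c‖ₑ ≤ ENNReal.ofReal (a * ρ) * volume (pcyl y ρ))
    (y : SpaceTime n) {ρ : ℝ} (hρ : 0 < ρ) :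
    ∃ c, ∫⁻ x in pcyl y ρ, ‖wtrunc ψ m w x - c‖ₑ
      ≤ ENNReal.ofReal (campConst n K κ Θ * a * ρ) * volume (pcyl y ρ) := by
  have hK := hW.two_le_K
  have hK0 := hW.K_pos
  have hκ := hW.one_le_κ
  have hκ0 := hW.κ_pos
  have hD := hW.meanConst_nonneg (n := n)
  have hC := hW.truncConst_nonneg (n := n)
  have hΘ := hd.one_le_Θ
  have hΘ0 : 0 < Θ := by linarith
  -- `B` separates the two cases: is the good set within `B ρ` of the centre or not? In the first
  -- case every Whitney cylinder meeting `pcyl y ρ` has radius at most `R ρ`; in the second, `pcyl y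
  -- ρ` fits into one cylinder `2K⁻¹U_k`.
  set B := 6 * K * Θ with hB
  have hB0 : 0 < B := by positivity
  set R := Θ * (1 + B) with hR
  have hR0 : 0 < R := by positivity
  by_cases hm : (E ∩ pcyl y (B * ρ)).Nonempty
  · obtain ⟨c, hc⟩ := hE y ρ hρ hm
    obtain ⟨e, heE, he⟩ := hm
    rw [mem_pcyl (by positivity)] at he
    refine ⟨c, ?_⟩
    let S := {k // (wc z r θ (1 / K) k ∩ pcyl y ρ).Nonempty}
    have hrS : ∀ k : S, r k ≤ R * ρ := by
      rintro ⟨k, x, hxk, hx⟩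
      rw [mem_pcyl hρ] at hx
      refine (hW.radius_le hd hxk heE).trans ?_
      rw [hR, mul_assoc]
      gcongr
      have := pdist_triangle x y e
      rw [pdist_comm y e] at this
      linarith
    have hsub : ∀ k : S, wc z r θ (1 / (6 * K ^ 6)) k ⊆ pcyl y ((1 + 2 * R) * ρ) := by
      rintro ⟨k, x, hxk, hx⟩
      have hrk := hW.r_pos k
      have hθk := hW.θ_pos k
      have h1k := hd.one_le k
      have hrR := hrS ⟨k, x, hxk, hx⟩
      simp only at hrR
      rw [pcyl, mem_cyl] at hx
      rw [wc, mem_cyl] at hxk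
      have s1 : 1 / K * r k ≤ r k := by
        have : 1 / K ≤ 1 := by rw [div_le_one hK0]; linarith
        nlinarith
      have s2 : 1 / (6 * K ^ 6) * r k ≤ r k := by
        have : 1 / (6 * K ^ 6) ≤ 1 := by
          have : (1 : ℝ) ≤ K ^ 6 := one_le_pow₀ (by linarith)
          rw [div_le_one (by positivity)]; linarith
        nlinarith
      have s3 : (1 / K * r k) ^ 2 / θ k ≤ r k ^ 2 := by
        refine (div_le_self (by positivity) h1k).trans ?_
        gcongr
      have s4 : (1 / (6 * K ^ 6) * r k) ^ 2 / θ k ≤ r k ^ 2 := by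
        refine (div_le_self (by positivity) h1k).trans ?_
        gcongr
      apply cyl_subset_cyl
      · have := norm_sub_le_norm_sub_add_norm_sub (z k).1 x.1 y.1
        rw [norm_sub_rev (z k).1 x.1] at this
        simp only
        linarith [hx.1, hxk.1]
      · have := abs_sub_le (z k).2 x.2 y.2
        rw [abs_sub_comm (z k).2 x.2] at this
        simp only
        have h5 : r k ^ 2 ≤ (R * ρ) ^ 2 := by gcongr
        have h6 : ((1 + 2 * R) * ρ) ^ 2 = ρ ^ 2 + 4 * (R * ρ) ^ 2 + 4 * R * ρ ^ 2 := by ring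
        have h7 : 0 ≤ 4 * R * ρ ^ 2 := by positivity
        have h8 : 0 ≤ (R * ρ) ^ 2 := by positivity
        linarith [hx.2, hxk.2]
    have hvol : ∑' k : S, volume (wc z r θ (2 / K) k)
        ≤ ENNReal.ofReal ((12 * K ^ 5) ^ (n + 2) * (1 + 2 * R) ^ (n + 2)) * volume (pcyl y ρ) := by
      have h1 : ∀ k : S, volume (wc z r θ (2 / K) k)
          = ENNReal.ofReal ((12 * K ^ 5) ^ (n + 2)) * volume (wc z r θ (1 / (6 * K ^ 6)) k) :=
        fun k => hW.volume_two_eq k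
      simp_rw [h1]
      rw [ENNReal.tsum_mul_left, ← measure_iUnion (fun i j hij => hW.disj
        fun h => hij (Subtype.ext h)) fun k => measurableSet_cyl _ _ _]
      rw [ENNReal.ofReal_mul (by positivity), mul_assoc]
      gcongr
      refine (measure_mono (iUnion_subset hsub)).trans (le_of_eq ?_)
      rw [volume_pcyl _ (by positivity), volume_pcyl _ hρ, ← ENNReal.ofReal_mul (by positivity),
        mul_pow]
      congr 1; ring
    -- The truncation differs from `w` only on the Whitney cylinders in `S`. Their total volume is
    -- controlled by that of `pcyl y ρ`, and on each of them the error in mean is of order `a r_k ≤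
    -- a R ρ`.
    have hbad : ∫⁻ x in pcyl y ρ, ‖w x - wtrunc ψ m w x‖ₑ
        ≤ ENNReal.ofReal ((1 + meanConst n κ) * (a * (R * ρ)) *
          ((12 * K ^ 5) ^ (n + 2) * (1 + 2 * R) ^ (n + 2))) * volume (pcyl y ρ) := by
      calc ∫⁻ x in pcyl y ρ, ‖w x - wtrunc ψ m w x‖ₑ
          = ∫⁻ x in pcyl y ρ, (⋃ k : S, wc z r θ (1 / K) k).indicator
              (fun x => ‖w x - wtrunc ψ m w x‖ₑ) x := by
            refine setLIntegral_congr_fun (measurableSet_cyl _ _ _) fun x hx => ?_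
            by_cases hxE : x ∈ E
            · rw [hW.wtrunc_eq_of_mem hψ hxE]
              rw [sub_self, enorm_zero]
              by_cases h : x ∈ ⋃ k : S, wc z r θ (1 / K) k
              · rw [indicator_of_mem h, hW.wtrunc_eq_of_mem hψ hxE, sub_self, enorm_zero]
              · rw [indicator_of_notMem h]
            · obtain ⟨k, hk⟩ := hW.exists_mem hxE
              have hx' : x ∈ ⋃ k : S, wc z r θ (1 / K) k := mem_iUnion.2 ⟨⟨k, x, hk, hx⟩, hk⟩
              rw [indicator_of_mem hx']
        _ ≤ ∫⁻ x in ⋃ k : S, wc z r θ (1 / K) k, ‖w x - wtrunc ψ m w x‖ₑ := by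
            rw [← lintegral_indicator (MeasurableSet.iUnion fun k : S => measurableSet_wc _ _)]
            exact setLIntegral_le_lintegral _ _
        _ ≤ ∑' k : S, ∫⁻ x in wc z r θ (1 / K) k, ‖w x - wtrunc ψ m w x‖ₑ :=
            lintegral_iUnion_le _ _
        _ ≤ ∑' k : S, ENNReal.ofReal ((1 + meanConst n κ) * (a * (R * ρ)))
              * volume (wc z r θ (2 / K) k) := by
            refine ENNReal.tsum_le_tsum fun k => ?_
            refine (hW.lintegral_sub_wtrunc_le hψ hP k).trans ?_
            gcongr
            exact hrS k
        _ ≤ _ := by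
            rw [ENNReal.tsum_mul_left, ENNReal.ofReal_mul (p := (1 + meanConst n κ) * (a * (R * ρ)))
              (by positivity), mul_assoc (ENNReal.ofReal ((1 + meanConst n κ) * (a * (R * ρ))))]
            exact mul_le_mul_right hvol _
    have hmeas : AEMeasurable (fun x => ‖w x - c‖ₑ) (volume.restrict (pcyl y ρ)) :=
      (hP.meas.restrict.sub aestronglyMeasurable_const).enorm
    calc ∫⁻ x in pcyl y ρ, ‖wtrunc ψ m w x - c‖ₑ
        ≤ ∫⁻ x in pcyl y ρ, (‖w x - c‖ₑ + ‖w x - wtrunc ψ m w x‖ₑ) := by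
          refine lintegral_mono fun x => ?_
          have e : wtrunc ψ m w x - c = (w x - c) - (w x - wtrunc ψ m w x) := by abel
          rw [e]
          exact enorm_sub_le
      _ = (∫⁻ x in pcyl y ρ, ‖w x - c‖ₑ) + ∫⁻ x in pcyl y ρ, ‖w x - wtrunc ψ m w x‖ₑ :=
          lintegral_add_left' hmeas _
      _ ≤ _ := add_le_add hc hbad
      _ ≤ _ := by
          rw [← add_mul, ← ENNReal.ofReal_add (by positivity) (by positivity)]
          gcongr
          have h0 : 0 ≤ (n + κ * Θ) * truncConst n K κ * (a * ρ) := by positivity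
          rw [campConst, ← hB, ← hR]
          nlinarith
  -- The point of `E` near the Whitney cylinder containing `y` has distance at most `6 r_k` from
  -- `y`. Hence `B ρ ≤ 6 r_k`, that is `ρ ≤ r_k / (K Θ)`, and the derivative bounds hold on all of
  -- `pcyl y ρ`.
  · have hfar : ∀ e ∈ E, B * ρ ≤ pdist e y := by
      intro e he
      by_contra h
      push Not at h
      exact hm ⟨e, he, (mem_pcyl (by positivity)).2 h⟩
    have hyE : y ∈ Eᶜ := by
      intro h
      have := hfar y h
      have h2 : pdist y y = 0 := by simp [pdist]
      rw [h2] at this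
      have : 0 < B * ρ := by positivity
      linarith
    obtain ⟨k, hk⟩ := hW.exists_mem hyE
    have hrk := hW.r_pos k
    have hθk := hW.θ_pos k
    have h1k := hd.one_le k
    have hkΘ := hd.le k
    obtain ⟨e, heE, he1, he2⟩ := hd.near k
    have hyk := hk
    rw [wc, mem_cyl] at hyk
    have s1 : 1 / K * r k ≤ r k := by
      have : 1 / K ≤ 1 := by rw [div_le_one hK0]; linarith
      nlinarith
    have h6 : pdist e y ≤ 6 * r k := by
      rw [pdist_le_iff (by positivity)]
      constructor
      · have := norm_sub_le_norm_sub_add_norm_sub e.1 (z k).1 y.1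
        rw [norm_sub_rev (z k).1 y.1] at this
        linarith [hyk.1]
      · have := abs_sub_le e.2 (z k).2 y.2
        rw [abs_sub_comm (z k).2 y.2] at this
        have s3 : (1 / K * r k) ^ 2 / θ k ≤ r k ^ 2 := by
          refine (div_le_self (by positivity) h1k).trans ?_
          gcongr
        have s4 : 25 * r k ^ 2 / θ k ≤ 25 * r k ^ 2 := div_le_self (by positivity) h1k
        nlinarith [hyk.2]
    have hρr : ρ ≤ 1 / K * r k / Θ := by
      have := (hfar e heE).trans h6
      rw [le_div_iff₀ hΘ0, ← mul_le_mul_iff_of_pos_left (show 0 < 6 * K by positivity)]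
      calc 6 * K * (ρ * Θ) = B * ρ := by rw [hB]; ring
        _ ≤ 6 * r k := this
        _ = _ := by field_simp
    have hρr1 : ρ ≤ 1 / K * r k := hρr.trans (div_le_self (by positivity) hΘ)
    have hρ2 : ρ ^ 2 ≤ (1 / K * r k) ^ 2 / θ k := by
      calc ρ ^ 2 ≤ (1 / K * r k / Θ) ^ 2 := by gcongr
        _ = (1 / K * r k) ^ 2 / Θ ^ 2 := by rw [div_pow]
        _ ≤ _ := by
          gcongr
          nlinarith
    have hsub : pcyl y ρ ⊆ wc z r θ (2 / K) k := by
      apply cyl_subset_cyl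
      · have : 2 / K * r k = 1 / K * r k + 1 / K * r k := by ring
        linarith [hyk.1]
      · have : (2 / K * r k) ^ 2 / θ k = 4 * ((1 / K * r k) ^ 2 / θ k) := by ring
        have h0 : 0 ≤ (1 / K * r k) ^ 2 / θ k := by positivity
        linarith [hyk.2]
    have hptE : ∀ x ∈ pcyl y ρ, x ∈ Eᶜ := fun x hx => hW.subset k (hsub hx)
    have hyy : y ∈ pcyl y ρ := mem_cyl_self _ hρ (by positivity)
    have hbt : ∀ x ∈ pcyl y ρ, ‖dt (wtrunc ψ m w) x‖
        ≤ truncConst n K κ * (a * Θ * κ / r k) := by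
      intro x hx
      obtain ⟨l, hl⟩ := hW.exists_mem (hptE x hx)
      refine (hW.norm_dt_wtrunc_le hψ hP hl).trans ?_
      have hn := (hW.nbr k l ⟨x, hsub hx, hW.wc_one_subset_two l hl⟩).1
      have hrl := hW.r_pos l
      have h2 : a * θ l / r l ≤ a * Θ * κ / r k := by
        rw [div_le_div_iff₀ hrl hrk]
        calc a * θ l * r k ≤ a * Θ * (κ * r l) := by
              have := hd.le l
              have := hW.θ_pos l
              gcongr
          _ = _ := by ring
      gcongr
    have hbx : ∀ x ∈ pcyl y ρ, ∀ l, ‖dx l (wtrunc ψ m w) x‖ ≤ truncConst n K κ * a := by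
      intro x hx l
      obtain ⟨i, hi⟩ := hW.exists_mem (hptE x hx)
      exact hW.norm_dx_wtrunc_le hψ hP hi l
    refine ⟨wtrunc ψ m w y, ?_⟩
    rw [← setLIntegral_const]
    refine setLIntegral_mono' (measurableSet_cyl _ _ _) fun x hx => ?_
    rw [← ofReal_norm]
    apply ENNReal.ofReal_le_ofReal
    refine (norm_sub_le_of_dx_dt (convex_cyl _ _ _) (fun p hp =>
      (hW.contDiffAt_wtrunc hψ (hptE p hp)).differentiableAt (by simp)) hbx hbt hx hyy).trans ?_
    rw [pcyl, mem_cyl] at hx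
    -- The bound of the time derivative carries a factor `1 / r_k`; one factor `ρ` of the time
    -- length `ρ²` is spent on cancelling it, and the increment stays linear in `ρ`.
    have hρk : ρ ^ 2 ≤ ρ * r k := by nlinarith
    calc n * (truncConst n K κ * a) * ‖x.1 - y.1‖
          + truncConst n K κ * (a * Θ * κ / r k) * |x.2 - y.2|
        ≤ n * (truncConst n K κ * a) * ρ + truncConst n K κ * (a * Θ * κ / r k) * (ρ * r k) := by
          gcongr
          · exact hx.1.le
          · exact hx.2.le.trans hρk
      _ = (n + κ * Θ) * truncConst n K κ * (a * ρ) := by field_simp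
      _ ≤ _ := by
          rw [mul_assoc (campConst n K κ Θ)]
          gcongr
          rw [campConst]
          have : 0 ≤ (1 + meanConst n κ) * (12 * K ^ 5) ^ (n + 2) * (Θ * (1 + 6 * K * Θ))
            * (1 + 2 * (Θ * (1 + 6 * K * Θ))) ^ (n + 2) := by positivity
          linarith

end IsWhitneyFamily
end Truncation

/-! ### Calculus for compactly supported test functions -/

lemma integral_dx_eq_zero {n : ℕ} {φ : SpaceTime n → ℝ} (hφ : ContDiff ℝ ∞ φ)
    (hc : HasCompactSupport φ) (k : Fin n) : ∫ y, dx k φ y = 0 := by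
  have hd := hφ.differentiable (by simp)
  have h := integral_mul_fderiv_eq_neg_fderiv_mul_of_integrable (μ := (volume : Measure (SpaceTime n)))
    (f := fun _ => (1 : ℝ)) (g := φ) (v := (EuclideanSpace.single k 1, 0)) (by simp) ?_ ?_
    (fun _ _ => differentiableAt_const _) fun y _ => hd y
  · simpa [dx_eq_fderiv (hd _)] using h
  · simp only [one_mul]
    exact ((hφ.continuous_fderiv (by simp)).clm_apply continuous_const).integrable_of_hasCompactSupport
      (hc.fderiv_apply (𝕜 := ℝ) _)
  · simpa using hφ.continuous.integrable_of_hasCompactSupport hc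

lemma integral_dt_eq_zero {n : ℕ} {φ : SpaceTime n → ℝ} (hφ : ContDiff ℝ ∞ φ)
    (hc : HasCompactSupport φ) : ∫ y, dt φ y = 0 := by
  have hd := hφ.differentiable (by simp)
  have h := integral_mul_fderiv_eq_neg_fderiv_mul_of_integrable (μ := (volume : Measure (SpaceTime n)))
    (f := fun _ => (1 : ℝ)) (g := φ) (v := (0, 1)) (by simp) ?_ ?_
    (fun _ _ => differentiableAt_const _) fun y _ => hd y
  · simpa [dt_eq_fderiv (hd _)] using h
  · simp only [one_mul]
    exact ((hφ.continuous_fderiv (by simp)).clm_apply continuous_const).integrable_of_hasCompactSupport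
      (hc.fderiv_apply (𝕜 := ℝ) _)
  · simpa using hφ.continuous.integrable_of_hasCompactSupport hc

lemma dx_mul {n : ℕ} {f g : SpaceTime n → ℝ} (hf : Differentiable ℝ f) (hg : Differentiable ℝ g)
    (k : Fin n) (y : SpaceTime n) :
    dx k (fun y => f y * g y) y = f y * dx k g y + g y * dx k f y := by
  rw [dx_eq_fderiv (hf.fun_mul hg y), dx_eq_fderiv (hf y), dx_eq_fderiv (hg y),
    fderiv_fun_mul (hf y) (hg y)]
  simp

lemma dt_mul {n : ℕ} {f g : SpaceTime n → ℝ} (hf : Differentiable ℝ f) (hg : Differentiable ℝ g)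
    (y : SpaceTime n) :
    dt (fun y => f y * g y) y = f y * dt g y + g y * dt f y := by
  rw [dt_eq_fderiv (hf.fun_mul hg y), dt_eq_fderiv (hf y), dt_eq_fderiv (hg y),
    fderiv_fun_mul (hf y) (hg y)]
  simp

lemma hasCompactSupport_dx {n : ℕ} {φ : SpaceTime n → ℝ} (hφ : ContDiff ℝ ∞ φ)
    (hc : HasCompactSupport φ) (k : Fin n) : HasCompactSupport (dx k φ) := by
  have : dx k φ = fun y => fderiv ℝ φ y (EuclideanSpace.single k 1, 0) :=
    funext fun y => dx_eq_fderiv (hφ.differentiable (by simp) y) k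
  rw [this]
  exact hc.fderiv_apply (𝕜 := ℝ) _

lemma hasCompactSupport_dt {n : ℕ} {φ : SpaceTime n → ℝ} (hφ : ContDiff ℝ ∞ φ)
    (hc : HasCompactSupport φ) : HasCompactSupport (dt φ) := by
  have : dt φ = fun y => fderiv ℝ φ y (0, 1) :=
    funext fun y => dt_eq_fderiv (hφ.differentiable (by simp) y)
  rw [this]
  exact hc.fderiv_apply (𝕜 := ℝ) _

lemma summable_integral_norm_of_tsum_lintegral {α : Type*} [MeasurableSpace α] {μ : Measure α}
    {ι : Type*} {f : ι → α → ℝ} (hf : ∀ i, AEStronglyMeasurable (f i) μ)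
    (h : ∑' i, ∫⁻ x, ‖f i x‖ₑ ∂μ ≠ ⊤) : Summable fun i => ∫ x, ‖f i x‖ ∂μ := by
  refine (ENNReal.summable_toReal h).congr fun i => ?_
  exact (integral_norm_eq_lintegral_enorm (hf i)).symm

/-! ### Weak gradient of the truncation -/

section Truncation
variable {n N : ℕ} {ι : Type} {E : Set (SpaceTime n)} {K κ : ℝ} {z : ι → SpaceTime n}
  {r θ : ι → ℝ} {ψ : ι → SpaceTime n → ℝ} {m : ι → Space N} {w : SpaceTime n → Space N}
  {A : ι → ℝ} {Gw : SpaceTime n → Mat N n}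

/-- The gradient of the truncation: that of `w` in the good set, the classical one elsewhere. -/
noncomputable def wgrad (E : Set (SpaceTime n)) (ψ : ι → SpaceTime n → ℝ) (m : ι → Space N)
    (w : SpaceTime n → Space N) (Gw : SpaceTime n → Mat N n) (y : SpaceTime n) : Mat N n :=
  E.indicator Gw y + Eᶜ.indicator (grad (wtrunc ψ m w)) y

namespace IsWhitneyFamily
variable (hW : IsWhitneyFamily E K κ z r θ) (hψ : IsWhitneyCutoff K z r θ ψ)
include hW hψ

lemma abs_dx_pou_le (i : ι) (y : SpaceTime n) (k : Fin n) :
    |dx k (Config.pou ψ i) y| ≤ (1 + overlapConst n K κ) * (2 * K * κ ^ 2 * (r i)⁻¹) := by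
  have hri := hW.r_pos i
  have hK := hW.K_pos
  have hκ := hW.κ_pos
  have hM := hW.one_le_overlapConst (n := n)
  rw [dx_eq_fderiv ((hW.contDiff_pou hψ i).differentiable (by simp) y)]
  by_cases hy : y ∈ tsupport (ψ i)
  · obtain ⟨l, hl⟩ := hW.exists_mem (hW.subset i (hψ.supp i hy))
    have hi : i ∈ hW.nb l := hW.mem_nb.2 ⟨y, hψ.supp i hy, hl⟩
    have hrl := hW.r_pos l
    have hc := hW.comparable (hW.mem_nb.1 hi)
    refine (hW.abs_fderiv_pou_le hψ hl (fun j hj => hW.abs_fderiv_psi_space_le hψ hj y k) hi).trans ?_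
    gcongr (1 + overlapConst n K κ) * ?_
    have : (r l)⁻¹ ≤ κ * (r i)⁻¹ := by
      rw [← div_eq_mul_inv, le_div_iff₀ hri, ← div_eq_inv_mul, div_le_iff₀ hrl]
      exact hc.1
    calc 2 * K * κ * (r l)⁻¹ ≤ 2 * K * κ * (κ * (r i)⁻¹) := by gcongr
      _ = _ := by ring
  · rw [hW.fderiv_pou_eq_zero hψ hy]
    simp only [zero_apply, abs_zero]
    positivity

lemma pou_le_one (i : ι) (y : SpaceTime n) : Config.pou ψ i y ≤ 1 := by
  by_cases hy : y ∈ E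
  · rw [hW.pou_eq_zero_of_mem hψ hy]; exact zero_le_one
  · obtain ⟨l, hl⟩ := hW.exists_mem hy
    by_cases hi : i ∈ hW.nb l
    · rw [← hW.sum_pou hψ hl]
      exact Finset.single_le_sum (f := fun j => Config.pou ψ j y)
        (fun j _ => hW.pou_nonneg hψ j y) hi
    · rw [hW.pou_eq_zero_of_notMem_nb hψ hl hi]; exact zero_le_one

lemma tsum_enorm_pou_le (y : SpaceTime n) : ∑' i, ‖Config.pou ψ i y‖ₑ ≤ 1 := by
  by_cases hy : y ∈ E
  · simp [hW.pou_eq_zero_of_mem hψ hy]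
  · obtain ⟨l, hl⟩ := hW.exists_mem hy
    rw [tsum_eq_sum (s := hW.nb l) fun j hj => by
      rw [hW.pou_eq_zero_of_notMem_nb hψ hl hj, enorm_zero]]
    simp_rw [Real.enorm_of_nonneg (hW.pou_nonneg hψ _ y)]
    rw [← ENNReal.ofReal_sum_of_nonneg fun j _ => hW.pou_nonneg hψ j y, hW.sum_pou hψ hl,
      ENNReal.ofReal_one]

variable (hP : IsWhitneyApprox K κ z r θ w m A)

lemma aestronglyMeasurable_wtrunc (hw : AEStronglyMeasurable w) :
    AEStronglyMeasurable (wtrunc ψ m w) := by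
  have hE : MeasurableSet E := hW.closed.measurableSet
  rw [← Measure.restrict_univ (μ := volume), ← union_compl_self E,
    aestronglyMeasurable_union_iff]
  constructor
  · refine hw.restrict.congr ?_
    filter_upwards [ae_restrict_mem hE] with y hy using (hW.wtrunc_eq_of_mem hψ hy).symm
  · exact (hW.contDiffOn_wtrunc hψ).continuousOn.aestronglyMeasurable hE.compl

include hP

lemma integrable_wtrunc [Countable ι] {a R : ℝ} (hA : ∀ k, A k ≤ a) (hr : ∀ k, r k ≤ R)
    (hvol : volume Eᶜ ≠ ⊤) (hw : Integrable w) : Integrable (wtrunc ψ m w) := by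
  have hD := hW.meanConst_nonneg (n := n)
  have hm := hW.aestronglyMeasurable_wtrunc hψ (m := m) hw.aestronglyMeasurable
  have hfin : ∫⁻ y, ‖w y - wtrunc ψ m w y‖ₑ ≠ ⊤ := by
    have h1 : ∫⁻ y, ‖w y - wtrunc ψ m w y‖ₑ ≤ ∫⁻ y in Eᶜ, ‖w y - wtrunc ψ m w y‖ₑ := by
      rw [← lintegral_indicator hW.closed.measurableSet.compl]
      refine lintegral_mono fun y => ?_
      by_cases hy : y ∈ E
      · dsimp only
        rw [hW.wtrunc_eq_of_mem hψ hy, sub_self, enorm_zero]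
        exact zero_le
      · rw [indicator_of_mem hy]
    refine ne_top_of_le_ne_top ?_ (h1.trans ((lintegral_mono_set hW.cover).trans
      ((lintegral_iUnion_le _ _).trans (ENNReal.tsum_le_tsum fun k =>
        (hW.lintegral_sub_wtrunc_le hψ hP k).trans (mul_le_mul_left (ENNReal.ofReal_le_ofReal
          (show _ ≤ (1 + meanConst n κ) * (a * R) from ?_)) _)))))
    · rw [ENNReal.tsum_mul_left]
      refine ENNReal.mul_ne_top ENNReal.ofReal_ne_top (ne_top_of_le_ne_top ?_ hW.tsum_volume_le)
      exact ENNReal.mul_ne_top ENNReal.ofReal_ne_top hvol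
    · have := hP.nonneg k
      have hrk := hW.r_pos k
      have := this.trans (hA k)
      gcongr
      · exact hA k
      · exact hr k
  have hsub : Integrable fun y => w y - wtrunc ψ m w y :=
    ⟨hw.aestronglyMeasurable.sub hm, by rw [HasFiniteIntegral]; exact hfin.lt_top⟩
  have := hw.sub hsub
  refine this.congr (Eventually.of_forall fun y => ?_)
  simp

lemma norm_grad_wtrunc_le {y : SpaceTime n} {k : ι} (hy : y ∈ wc z r θ (1 / K) k) :
    ‖grad (wtrunc ψ m w) y‖ ≤ (N * n) * (truncConst n K κ * A k) := by
  have h1 : ‖grad (wtrunc ψ m w) y‖ ≤ ∑ p : Fin N × Fin n, ‖grad (wtrunc ψ m w) y p‖ := by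
    rw [EuclideanSpace.norm_eq]
    refine Real.sqrt_le_iff.2 ⟨Finset.sum_nonneg fun _ _ => norm_nonneg _, ?_⟩
    exact Finset.sum_sq_le_sq_sum_of_nonneg fun _ _ => norm_nonneg _
  calc ‖grad (wtrunc ψ m w) y‖ ≤ ∑ p : Fin N × Fin n, ‖grad (wtrunc ψ m w) y p‖ := h1
    _ ≤ ∑ _p : Fin N × Fin n, truncConst n K κ * A k := Finset.sum_le_sum fun p _ =>
        (PiLp.norm_apply_le (dx p.2 (wtrunc ψ m w) y) p.1).trans
          (hW.norm_dx_wtrunc_le hψ hP hy p.2)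
    _ = (N * n) * (truncConst n K κ * A k) := by simp

lemma integrable_wgrad [Countable ι] {a : ℝ} (hA : ∀ k, A k ≤ a)
    (hvol : volume Eᶜ ≠ ⊤) (hG : Integrable Gw) : Integrable (wgrad E ψ m w Gw) := by
  have hE : MeasurableSet E := hW.closed.measurableSet
  have hC := hW.truncConst_nonneg (n := n)
  refine (hG.indicator hE).add ?_
  rw [integrable_indicator_iff hE.compl]
  refine IntegrableOn.of_bound hvol.lt_top ?_ ((N * n) * (truncConst n K κ * a)) ?_
  · refine ContinuousOn.aestronglyMeasurable ?_ hE.compl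
    refine (PiLp.continuous_toLp 2 _).comp_continuousOn (continuousOn_pi.2 fun p => ?_)
    have h1 : ContinuousOn (fun y => fderiv ℝ (wtrunc ψ m w) y (EuclideanSpace.single p.2 1, 0)) Eᶜ :=
      ((hW.contDiffOn_wtrunc hψ).continuousOn_fderiv_of_isOpen hW.closed.isOpen_compl
        (by simp)).clm_apply continuousOn_const
    have h2 : ContinuousOn (dx p.2 (wtrunc ψ m w)) Eᶜ := h1.congr fun y hy =>
      dx_eq_fderiv ((hW.contDiffAt_wtrunc hψ hy).differentiableAt (by simp)) p.2
    exact (PiLp.continuous_apply 2 (fun _ : Fin N => ℝ) p.1).comp_continuousOn h2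
  · filter_upwards [ae_restrict_mem hE.compl] with y hy
    obtain ⟨k, hk⟩ := hW.exists_mem hy
    refine (hW.norm_grad_wtrunc_le hψ hP hk).trans ?_
    gcongr
    exact hA k

/-- The difference `w - w^Λ` is the series of the `(w - m_i) ω_i`. Each term is integrated by parts
with the smooth test function `ω_i φ`. The exchange of sum and integral is justified by absolute
summability: `|∂ω_i| ≤ c / r_i` is compensated by the integral of `|w - m_i|`, at most `A_i r_i`
times the volume of `2K⁻¹U_i`, and these volumes sum to a finite number. No boundary term on `∂E`
arises. -/
lemma hasWeakGradientOn_wtrunc [Countable ι] {a R : ℝ} (hA : ∀ k, A k ≤ a) (hr : ∀ k, r k ≤ R)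
    (hvol : volume Eᶜ ≠ ⊤) (hw : Integrable w) (hG : Integrable Gw)
    (hgrad : ∀ φ : SpaceTime n → ℝ, ContDiff ℝ ∞ φ → HasCompactSupport φ →
      ∀ (j : Fin N) (k : Fin n), ∫ y, w y j * dx k φ y = - ∫ y, Gw y (j, k) * φ y) :
    HasWeakGradientOn univ (wtrunc ψ m w) (wgrad E ψ m w Gw) := by
  have hK := hW.K_pos
  have hκ := hW.κ_pos
  have hM := hW.one_le_overlapConst (n := n)
  have hT := hW.integrable_wtrunc hψ hP hA hr hvol hw
  have hGT := hW.integrable_wgrad hψ hP hA hvol hG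
  refine ⟨hT.locallyIntegrable.locallyIntegrableOn _,
    hGT.locallyIntegrable.locallyIntegrableOn _, fun φ hφ hc _ j k => ?_⟩
  simp only [Measure.restrict_univ]
  have hwj : Integrable fun y => w y j := hw.eval_piLp j
  have hGj : Integrable fun y => Gw y (j, k) := hG.eval_piLp (j, k)
  have hdφ := continuous_dx (hφ.of_le (by simp)) k
  have hdφc := hasCompactSupport_dx hφ hc k
  obtain ⟨b, hb⟩ := hφ.continuous.bounded_above_of_compact_support hc
  obtain ⟨b', hb'⟩ := hdφ.bounded_above_of_compact_support hdφc
  have hb0 : 0 ≤ b := (norm_nonneg _).trans (hb 0)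
  have hb0' : 0 ≤ b' := (norm_nonneg _).trans (hb' 0)
  have mulb : ∀ {f g : SpaceTime n → ℝ}, Integrable f → Continuous g → HasCompactSupport g →
      Integrable fun y => f y * g y := by
    intro f g hf hg hgc
    obtain ⟨c, hc⟩ := hg.bounded_above_of_compact_support hgc
    exact hf.mul_bdd (c := c) hg.aestronglyMeasurable (Eventually.of_forall hc)
  set p := fun i => Config.pou ψ i with hp
  have hps : ∀ i, ContDiff ℝ ∞ (p i) := fun i => hW.contDiff_pou hψ i
  have hpc : ∀ i, HasCompactSupport (p i) := fun i => hW.hasCompactSupport_pou hψ i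
  have hdp : ∀ i, Continuous (dx k (p i)) := fun i => continuous_dx ((hps i).of_le (by simp)) k
  have hdpc : ∀ i, HasCompactSupport (dx k (p i)) := fun i => hasCompactSupport_dx (hps i) (hpc i) k
  -- `F i` is the `i`-th term of `w - w^Λ` against `∂_k φ`, and `H i` the `i`-th term of the
  -- difference of the gradients against `φ`.
  set F : ι → SpaceTime n → ℝ := fun i y => (w y j - m i j) * (p i y * dx k φ y) with hF
  set H : ι → SpaceTime n → ℝ := fun i y =>
    Gw y (j, k) * (p i y * φ y) + (w y j - m i j) * (dx k (p i) y * φ y) with hH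
  have sub_int : ∀ {g : SpaceTime n → ℝ} (i : ι), Continuous g → HasCompactSupport g →
      Integrable fun y => (w y j - m i j) * g y := by
    intro g i hg hgc
    simp_rw [sub_mul]
    exact (mulb hwj hg hgc).sub ((hg.integrable_of_hasCompactSupport hgc).const_mul _)
  have hFi : ∀ i, Integrable (F i) := fun i =>
    sub_int i ((hps i).continuous.mul hdφ) (hpc i).mul_right
  have hHi : ∀ i, Integrable (H i) := fun i =>
    (mulb hGj ((hps i).continuous.mul hφ.continuous) (hpc i).mul_right).add
      (sub_int i ((hdp i).mul hφ.continuous) (hdpc i).mul_right)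
  have hFH : ∀ i, ∫ y, F i y = - ∫ y, H i y := by
    intro i
    have h1 := hgrad (fun y => p i y * φ y) ((hps i).mul hφ) (hpc i).mul_right j k
    have h2 := integral_dx_eq_zero ((hps i).mul hφ) (hpc i).mul_right k
    have hcont : Continuous (dx k fun y => p i y * φ y) :=
      continuous_dx (((hps i).mul hφ).of_le (by simp)) k
    have hcs : HasCompactSupport (dx k fun y => p i y * φ y) :=
      hasCompactSupport_dx ((hps i).mul hφ) (hpc i).mul_right k
    have h3 : ∫ y, (w y j - m i j) * dx k (fun y => p i y * φ y) y
        = - ∫ y, Gw y (j, k) * (p i y * φ y) := by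
      simp_rw [sub_mul]
      rw [integral_sub (mulb hwj hcont hcs)
        ((hcont.integrable_of_hasCompactSupport hcs).const_mul _), h1, integral_const_mul, h2]
      simp
    have h4 : ∀ y, (w y j - m i j) * dx k (fun y => p i y * φ y) y
        = F i y + (w y j - m i j) * (dx k (p i) y * φ y) := by
      intro y
      rw [dx_mul ((hps i).differentiable (by simp)) (hφ.differentiable (by simp))]
      simp only [hF]
      ring
    simp_rw [h4] at h3
    have hI : Integrable fun y => (w y j - m i j) * (dx k (p i) y * φ y) :=
      sub_int i ((hdp i).mul hφ.continuous) (hdpc i).mul_right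
    have hI' : Integrable fun y => Gw y (j, k) * (p i y * φ y) :=
      mulb hGj ((hps i).continuous.mul hφ.continuous) (hpc i).mul_right
    rw [integral_add (hFi i) hI] at h3
    simp only [hH]
    rw [integral_add hI' hI]
    linarith
  have hvsum : ∑' i, volume (wc z r θ (2 / K) i) ≠ ⊤ :=
    ne_top_of_le_ne_top (ENNReal.mul_ne_top ENNReal.ofReal_ne_top hvol) hW.tsum_volume_le
  -- A factor of size `C / r_i` supported in `2K⁻¹U_i` is absorbed by the factor `r_i` of the
  -- approximation property.
  have gen : ∀ (q : ι → SpaceTime n → ℝ) (C : ℝ), 0 ≤ C → (∀ i y, y ∉ tsupport (ψ i) → q i y = 0) →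
      (∀ i y, |q i y| ≤ C * (r i)⁻¹) → ∀ i,
      ∫⁻ y, ‖(w y j - m i j) * q i y‖ₑ ≤ ENNReal.ofReal (C * a) * volume (wc z r θ (2 / K) i) := by
    intro q C hC hq0 hq i
    have hri := hW.r_pos i
    calc ∫⁻ y, ‖(w y j - m i j) * q i y‖ₑ
        ≤ ∫⁻ y, (wc z r θ (2 / K) i).indicator
            (fun y => ENNReal.ofReal (C * (r i)⁻¹) * ‖w y - m i‖ₑ) y := by
          refine lintegral_mono fun y => ?_
          by_cases hy : y ∈ wc z r θ (2 / K) i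
          · rw [indicator_of_mem hy, enorm_mul, mul_comm]
            refine mul_le_mul' ?_ ?_
            · rw [← ofReal_norm]
              exact ENNReal.ofReal_le_ofReal (hq i y)
            · rw [← ofReal_norm, ← ofReal_norm]
              exact ENNReal.ofReal_le_ofReal (PiLp.norm_apply_le (w y - m i) j)
          · dsimp only
            rw [hq0 i y fun h => hy (hψ.supp i h), mul_zero, enorm_zero]
            exact zero_le
      _ = ENNReal.ofReal (C * (r i)⁻¹) * ∫⁻ y in wc z r θ (2 / K) i, ‖w y - m i‖ₑ := by
          rw [lintegral_indicator (measurableSet_wc _ _), lintegral_const_mul' _ _ ENNReal.ofReal_ne_top]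
      _ ≤ ENNReal.ofReal (C * (r i)⁻¹) * (ENNReal.ofReal (A i * r i) *
            volume (wc z r θ (2 / K) i)) := by
          gcongr
          exact hP.le i
      _ = ENNReal.ofReal (C * A i) * volume (wc z r θ (2 / K) i) := by
          rw [← mul_assoc, ← ENNReal.ofReal_mul (by positivity)]
          congr 2
          field_simp
      _ ≤ _ := by
          gcongr
          exact hA i
  have tsum_gen : ∀ C : ℝ, ∑' i, ENNReal.ofReal C * volume (wc z r θ (2 / K) i) ≠ ⊤ := by
    intro C
    rw [ENNReal.tsum_mul_left]
    exact ENNReal.mul_ne_top ENNReal.ofReal_ne_top hvsum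
  have hFs : Summable fun i => ∫ y, ‖F i y‖ := by
    refine summable_integral_norm_of_tsum_lintegral (fun i => (hFi i).aestronglyMeasurable) ?_
    refine ne_top_of_le_ne_top (tsum_gen _) (ENNReal.tsum_le_tsum
      (gen (fun i y => p i y * dx k φ y) (b' * |R|) (by positivity) ?_ ?_))
    · intro i y hy
      have : p i y = 0 := image_eq_zero_of_notMem_tsupport fun h =>
        hy (hW.tsupport_pou_subset hψ i h)
      rw [this, zero_mul]
    · intro i y
      have hri := hW.r_pos i
      -- `ω_i ∂_k φ` is merely bounded; the uniform bound `R` of the radii brings it into the form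
      -- `C / r_i`.
      have h1 : 1 ≤ |R| * (r i)⁻¹ := by
        rw [← div_eq_mul_inv, le_div_iff₀ hri, one_mul]
        exact (hr i).trans (le_abs_self R)
      rw [abs_mul, abs_of_nonneg (hW.pou_nonneg hψ i y)]
      calc p i y * |dx k φ y| ≤ 1 * b' := by
            gcongr
            · exact hW.pou_le_one hψ i y
            · exact hb' y
        _ ≤ b' * (|R| * (r i)⁻¹) := by rw [one_mul]; exact le_mul_of_one_le_right hb0' h1
        _ = _ := by ring
  have hHs : Summable fun i => ∫ y, ‖H i y‖ := by
    refine summable_integral_norm_of_tsum_lintegral (fun i => (hHi i).aestronglyMeasurable) ?_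
    have h1 : ∀ i, ∫⁻ y, ‖H i y‖ₑ ≤ (∫⁻ y, ‖p i y‖ₑ * ‖Gw y (j, k) * φ y‖ₑ)
        + ENNReal.ofReal ((1 + overlapConst n K κ) * (2 * K * κ ^ 2) * b * a)
          * volume (wc z r θ (2 / K) i) := by
      intro i
      refine le_trans (lintegral_mono (g := fun y => ‖p i y‖ₑ * ‖Gw y (j, k) * φ y‖ₑ
        + ‖(w y j - m i j) * (dx k (p i) y * φ y)‖ₑ) fun y => ?_) ?_
      · simp only [hH]
        refine (enorm_add_le _ _).trans (add_le_add (le_of_eq ?_) le_rfl)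
        rw [← enorm_mul]
        congr 1; ring
      · rw [lintegral_add_right']
        · refine add_le_add le_rfl (gen (fun i y => dx k (p i) y * φ y) _ (by positivity) ?_ ?_ i)
          · intro i y hy
            rw [dx_eq_fderiv ((hps i).differentiable (by simp) y), hW.fderiv_pou_eq_zero hψ hy]
            simp
          · intro i y
            have hri := hW.r_pos i
            rw [abs_mul]
            calc |dx k (p i) y| * |φ y|
                ≤ (1 + overlapConst n K κ) * (2 * K * κ ^ 2 * (r i)⁻¹) * b := by
                  gcongr
                  · exact hW.abs_dx_pou_le hψ i y k
                  · exact hb y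
              _ = _ := by ring
        · exact (sub_int i ((hdp i).mul hφ.continuous)
            (hdpc i).mul_right).aestronglyMeasurable.enorm
    refine ne_top_of_le_ne_top ?_ (ENNReal.tsum_le_tsum h1)
    rw [ENNReal.tsum_add]
    refine ENNReal.add_ne_top.2 ⟨?_, tsum_gen _⟩
    have hGφ := mulb hGj hφ.continuous hc
    have hm : ∀ i, AEMeasurable (fun y => ‖p i y‖ₑ * ‖Gw y (j, k) * φ y‖ₑ) volume := fun i =>
      (hps i).continuous.measurable.enorm.aemeasurable.mul hGφ.aestronglyMeasurable.enorm
    rw [← lintegral_tsum hm]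
    refine ne_top_of_le_ne_top hGφ.2.ne (lintegral_mono fun y => ?_)
    rw [ENNReal.tsum_mul_right]
    exact mul_le_of_le_one_left' (hW.tsum_enorm_pou_le hψ y)
  have sF := hasSum_integral_of_summable_integral_norm hFi hFs
  have sH := hasSum_integral_of_summable_integral_norm hHi hHs
  have hFHs : ∫ y, ∑' i, F i y = - ∫ y, ∑' i, H i y := by
    rw [← sF.tsum_eq, ← sH.tsum_eq, ← tsum_neg]
    exact tsum_congr hFH
  have ptF : ∀ y, ∑' i, F i y = w y j * dx k φ y - wtrunc ψ m w y j * dx k φ y := by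
    intro y
    by_cases hy : y ∈ E
    · simp [hF, hp, hW.pou_eq_zero_of_mem hψ hy, hW.wtrunc_eq_of_mem hψ hy]
    · obtain ⟨l, hl⟩ := hW.exists_mem hy
      rw [tsum_eq_sum (s := hW.nb l) fun i hi => by
        simp [hF, hp, hW.pou_eq_zero_of_notMem_nb hψ hl hi], hW.wtrunc_eq hψ hl]
      have e1 : (∑ i ∈ hW.nb l, Config.pou ψ i y • m i) j
          = ∑ i ∈ hW.nb l, Config.pou ψ i y * m i j := by simp
      have e2 : w y j = ∑ i ∈ hW.nb l, Config.pou ψ i y * w y j := by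
        rw [← Finset.sum_mul, hW.sum_pou hψ hl, one_mul]
      rw [e1, ← sub_mul]
      conv_rhs => rw [e2]
      rw [← Finset.sum_sub_distrib, Finset.sum_mul]
      refine Finset.sum_congr rfl fun i _ => ?_
      simp only [hF, hp]
      ring
  -- On `E` all terms vanish with their derivatives. Off `E` the relations `∑ ω_i = 1` and `∑ ∂ω_i =
  -- 0` remove `w` and leave the classical derivative of the truncation.
  have ptH : ∀ y, ∑' i, H i y = Gw y (j, k) * φ y - wgrad E ψ m w Gw y (j, k) * φ y := by
    intro y
    by_cases hy : y ∈ E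
    · have h0 : ∀ i, H i y = 0 := by
        intro i
        have hn : y ∉ tsupport (ψ i) := fun h => hW.subset i (hψ.supp i h) hy
        simp only [hH, hp]
        rw [dx_eq_fderiv ((hps i).differentiable (by simp) y), hW.fderiv_pou_eq_zero hψ hn,
          hW.pou_eq_zero_of_mem hψ hy]
        simp
      simp [h0, wgrad, hy]
    · obtain ⟨l, hl⟩ := hW.exists_mem hy
      have hdx : ∀ i, dx k (p i) y = fderiv ℝ (Config.pou ψ i) y (EuclideanSpace.single k 1, 0) :=
        fun i => dx_eq_fderiv ((hps i).differentiable (by simp) y) k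
      rw [tsum_eq_sum (s := hW.nb l) fun i hi => by
        have hp0 : p i y = 0 := hW.pou_eq_zero_of_notMem_nb hψ hl hi
        simp only [hH]
        rw [hdx, hW.fderiv_pou_eq_zero hψ (hW.notMem_tsupport hψ hl hi), hp0]
        simp]
      have e0 : wgrad E ψ m w Gw y (j, k) = dx k (wtrunc ψ m w) y j := by
        simp [wgrad, hy, grad]
      have e1 : dx k (wtrunc ψ m w) y j = ∑ i ∈ hW.nb l, dx k (p i) y * m i j := by
        rw [dx_eq_fderiv ((hW.contDiffAt_wtrunc hψ hy).differentiableAt (by simp)),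
          hW.fderiv_wtrunc hψ hl]
        simp [hdx]
      have e2 : ∑ i ∈ hW.nb l, dx k (p i) y = 0 := by
        simp_rw [hdx]; exact hW.sum_fderiv_pou hψ hl _
      have e3 : ∑ i ∈ hW.nb l, p i y = 1 := hW.sum_pou hψ hl
      have e4 : ∀ i, H i y = p i y * (Gw y (j, k) * φ y) + dx k (p i) y * (w y j * φ y)
          - dx k (p i) y * m i j * φ y := by
        intro i
        simp only [hH]; ring
      simp_rw [e4]
      rw [Finset.sum_sub_distrib, Finset.sum_add_distrib, ← Finset.sum_mul, ← Finset.sum_mul,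
        ← Finset.sum_mul, e2, e3, e0, e1]
      ring
  have hTj : Integrable fun y => wtrunc ψ m w y j := hT.eval_piLp j
  have hGTj : Integrable fun y => wgrad E ψ m w Gw y (j, k) := hGT.eval_piLp (j, k)
  simp_rw [ptF, ptH] at hFHs
  rw [integral_sub (mulb hwj hdφ hdφc) (mulb hTj hdφ hdφc),
    integral_sub (mulb hGj hφ.continuous hc) (mulb hGTj hφ.continuous hc),
    hgrad φ hφ hc j k] at hFHs
  linarith

end IsWhitneyFamily
end Truncation

/-! ### Exponents and the intrinsic root -/

namespace Data
variable {D : Data} {n : ℕ} (hD : D.Admissible n)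
include hD

/-- For `n ≥ 2` and `β ≤ 1` the gap `2β/(n+2)` is at most 1/2. This places `d`, the midpoint of `s -
1` and `p`, strictly between them: `f^d` controls all powers in the flux, while `d/p < 1`. -/
lemma Admissible.s_lt : D.s < D.p + 1 := by
  have h1 := hD.s_le
  have h2 : 2 * D.β / (n + 2) ≤ 1 / 2 := by
    have := hD.two_le_n
    have hn : (2 : ℝ) ≤ n := by exact_mod_cast this
    rw [div_le_div_iff₀ (by linarith) (by norm_num)]
    linarith [hD.β_le]
  linarith

lemma Admissible.d_lt_p : D.d < D.p := by
  unfold d; linarith [hD.s_lt]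

lemma Admissible.s_sub_one_lt_d : D.s - 1 < D.d := by
  unfold d; linarith [hD.s_lt]

lemma Admissible.one_lt_d : 1 < D.d := by
  unfold d; linarith [hD.two_le_p, hD.p_lt_q, hD.q_lt_s]

lemma Hval_mono {A B x y : ℝ} (hA : 0 ≤ A) (hB : 0 ≤ B) (hx : 0 ≤ x) (hxy : x ≤ y) :
    D.Hval A B x ≤ D.Hval A B y := by
  have hp := hD.two_le_p
  have hq := hD.p_lt_q
  have hs := hD.q_lt_s
  unfold Hval
  have hq0 : 0 ≤ D.q := by linarith
  have hs0 : 0 ≤ D.s := by linarith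
  gcongr

lemma root_spec {A B Λ : ℝ} (hA : 0 ≤ A) (hB : 0 ≤ B) (hΛ : 1 + A + B < Λ) :
    1 < D.root A B Λ ∧ D.Hval A B (D.root A B Λ) = Λ := by
  have hp := hD.two_le_p
  have hq := hD.p_lt_q
  have hs := hD.q_lt_s
  have hΛ1 : 1 ≤ Λ := by linarith
  refine Classical.epsilon_spec (p := fun κ : ℝ => 1 < κ ∧ D.Hval A B κ = Λ) ?_
  have hc : ContinuousOn (D.Hval A B) (Icc 1 Λ) := by
    unfold Hval
    refine ContinuousOn.add (ContinuousOn.add ?_ (continuousOn_const.mul ?_))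
      (continuousOn_const.mul ?_) <;>
    exact continuousOn_id.rpow_const fun x hx => Or.inl (by simpa using (by linarith [hx.1] : 0 < x).ne')
  have h1 : D.Hval A B 1 = 1 + A + B := by simp [Hval]
  have h2 : Λ ≤ D.Hval A B Λ := by
    have h3 : Λ ≤ Λ ^ D.p := by
      simpa using Real.rpow_le_rpow_of_exponent_le hΛ1 (by linarith : (1 : ℝ) ≤ D.p)
    have h4 : 0 ≤ A * Λ ^ D.q := by positivity
    have h5 : 0 ≤ B * Λ ^ D.s := by positivity
    unfold Hval; linarith
  obtain ⟨κ, hκ, h⟩ := intermediate_value_Icc hΛ1 hc ⟨by rw [h1]; exact hΛ.le, h2⟩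
  refine ⟨κ, lt_of_le_of_ne hκ.1 ?_, h⟩
  rintro rfl
  rw [h1] at h
  exact hΛ.ne h

end Data

/-! ### Coefficients and the strong maximal function -/

lemma IsCoefficient.le {n : ℕ} {γ M A : ℝ} {a : SpaceTime n → ℝ} (h : IsCoefficient γ M A a)
    (z : SpaceTime n) : a z ≤ M := h.isLUB.1 ⟨z, rfl⟩

lemma IsCoefficient.bound_nonneg {n : ℕ} {γ M A : ℝ} {a : SpaceTime n → ℝ}
    (h : IsCoefficient γ M A a) : 0 ≤ M := (h.nonneg 0).trans (h.le 0)

lemma isOpen_lt_strongMax {n : ℕ} (g : SpaceTime n → ℝ) (t : ℝ≥0∞) :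
    IsOpen {z | t < strongMax g z} := by
  rw [isOpen_iff_mem_nhds]
  intro z hz
  simp only [mem_ofPred_eq, strongMax, lt_iSup_iff] at hz
  obtain ⟨y, r, τ, hr, hτ, hz, h⟩ := hz
  filter_upwards [(isOpen_cyl y r τ).mem_nhds hz] with x hx
  simp only [strongMax, lt_iSup_iff]
  exact ⟨y, r, τ, hr, hτ, hx, h⟩

/-- Decay of the oscillation of a Hölder continuous coefficient at intrinsic scale. -/
lemma holder_le_of_pow_le {n : ℕ} {A γ J K l m e X : ℝ} (hA : 0 ≤ A) (hγ : 0 < γ) (hγ1 : γ ≤ 1)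
    (hJ : 0 ≤ J) (hK : 800 * A * J ^ (γ / (n + 2)) ≤ K) (hm : 0 ≤ m)
    (h : m ^ (n + 2) * l ^ 2 ≤ J) (hl : 1 ≤ l) (he : e ≤ 2 * γ / (n + 2)) (hX : 0 ≤ X)
    (hXm : X ≤ 40 * m) : A * X ^ γ ≤ K / 20 * l ^ (-e) := by
  have hl0 : 0 < l := by linarith
  have hn : (0 : ℝ) < n + 2 := by positivity
  have h1 : X ^ γ ≤ 40 * m ^ γ := by
    calc X ^ γ ≤ (40 * m) ^ γ := by gcongr
      _ = 40 ^ γ * m ^ γ := Real.mul_rpow (by norm_num) hm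
      _ ≤ 40 * m ^ γ := by
        gcongr
        simpa using Real.rpow_le_rpow_of_exponent_le (by norm_num : (1 : ℝ) ≤ 40) hγ1
  -- The hypothesis reads `m^(n+2) ≤ J l⁻²`. Raised to the power `γ/(n+2)` it produces
  -- `l^(-2γ/(n+2))`, and this is where the gap condition `e ≤ 2γ/(n+2)` is used. The factor 40 and
  -- the target `K/20` account for the 800 in `K`.
  have h2 : m ^ γ ≤ J ^ (γ / (n + 2)) * l ^ (-e) := by
    have e1 : m ^ γ = (m ^ (n + 2)) ^ (γ / (n + 2)) := by
      rw [← Real.rpow_natCast, ← Real.rpow_mul hm]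
      congr 1
      push_cast
      field_simp
    have e2 : m ^ (n + 2) ≤ J * l ^ (-2 : ℝ) := by
      rw [Real.rpow_neg hl0.le, ← div_eq_mul_inv, le_div_iff₀ (by positivity)]
      simpa using h
    rw [e1]
    calc (m ^ (n + 2)) ^ (γ / (n + 2)) ≤ (J * l ^ (-2 : ℝ)) ^ (γ / (n + 2)) := by gcongr
      _ = J ^ (γ / (n + 2)) * l ^ (-(2 * γ / (n + 2))) := by
        rw [Real.mul_rpow hJ (by positivity), ← Real.rpow_mul hl0.le]
        congr 2; ring
      _ ≤ _ := by gcongr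
  calc A * X ^ γ ≤ A * (40 * (J ^ (γ / (n + 2)) * l ^ (-e))) := by
        gcongr
        exact h1.trans (by gcongr)
    _ = (800 * A * J ^ (γ / (n + 2))) / 20 * l ^ (-e) := by ring
    _ ≤ _ := by gcongr

/-! ### Intrinsic geometry at the level `Λ` -/

/-- The level `Λ` is admissible for the solution. -/
structure IsLevel {n N : ℕ} {D : Data} (C : Config n N D) (Λ : ℝ) : Prop where
  adm : D.Admissible n
  K_eq : D.K = C.Kval
  lt_Λ : 1 + D.normA + D.normB < Λ
  int_le : C.maxInt ≤ ENNReal.ofReal Λ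

namespace IsLevel
variable {n N : ℕ} {D : Data} {C : Config n N D} {Λ : ℝ} (hL : IsLevel C Λ)
include hL

lemma one_lt_Λ : 1 < Λ := by
  linarith [hL.lt_Λ, C.a_coeff.bound_nonneg, C.b_coeff.bound_nonneg]

lemma Λ_pos : 0 < Λ := by linarith [hL.one_lt_Λ]

lemma lam_spec (z : SpaceTime n) :
    1 < C.lam Λ z ∧ C.lam Λ z ^ D.p + C.a z * C.lam Λ z ^ D.q + C.b z * C.lam Λ z ^ D.s = Λ :=
  Data.root_spec hL.adm (C.a_coeff.nonneg z) (C.b_coeff.nonneg z)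
    (by linarith [hL.lt_Λ, C.a_coeff.le z, C.b_coeff.le z])

lemma one_lt_lam (z : SpaceTime n) : 1 < C.lam Λ z := (hL.lam_spec z).1

lemma lam_pos (z : SpaceTime n) : 0 < C.lam Λ z := by linarith [hL.one_lt_lam z]

lemma lam_eq (z : SpaceTime n) :
    C.lam Λ z ^ D.p + C.a z * C.lam Λ z ^ D.q + C.b z * C.lam Λ z ^ D.s = Λ := (hL.lam_spec z).2

omit hL in
lemma _root_.MultiPhase.scaledInt_nonneg (C : Config n N D) :
    0 ≤ (unitVol n)⁻¹ * C.maxInt.toReal :=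
  mul_nonneg (inv_nonneg.2 (unitVol_pos n).le) ENNReal.toReal_nonneg

lemma K_eq' : D.K = 2 + 800 * D.holA * ((unitVol n)⁻¹ * C.maxInt.toReal) ^ (D.α / (n + 2))
    + 800 * D.holB * ((unitVol n)⁻¹ * C.maxInt.toReal) ^ (D.β / (n + 2)) := hL.K_eq

lemma K_bounds : 2 ≤ D.K ∧
    800 * D.holA * ((unitVol n)⁻¹ * C.maxInt.toReal) ^ (D.α / (n + 2)) ≤ D.K ∧
    800 * D.holB * ((unitVol n)⁻¹ * C.maxInt.toReal) ^ (D.β / (n + 2)) ≤ D.K := by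
  have h := hL.K_eq'
  have hJ := scaledInt_nonneg C
  have h1 : 0 ≤ 800 * D.holA * ((unitVol n)⁻¹ * C.maxInt.toReal) ^ (D.α / (n + 2)) := by
    have := hL.adm.holA_pos
    positivity
  have h2 : 0 ≤ 800 * D.holB * ((unitVol n)⁻¹ * C.maxInt.toReal) ^ (D.β / (n + 2)) := by
    have := hL.adm.holB_pos
    positivity
  refine ⟨?_, ?_, ?_⟩ <;> linarith

lemma two_le_K : 2 ≤ D.K := hL.K_bounds.1

lemma lam_rpow_nonneg (z : SpaceTime n) (e : ℝ) : 0 ≤ C.lam Λ z ^ e :=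
  Real.rpow_nonneg (hL.lam_pos z).le e

/-- A term that is left out of the growth function is at most `K² λ^p`, and at most two are left
out. Hence the growth is comparable with `Λ` in all four phases, and the phases need not be
distinguished afterwards. -/
lemma growth_bounds (z : SpaceTime n) : C.lam Λ z ^ D.p ≤ C.growth Λ z ∧ C.growth Λ z ≤ Λ ∧
    Λ ≤ (1 + 2 * D.K ^ 2) * C.growth Λ z := by
  have h := hL.lam_eq z
  have h1 := hL.lam_rpow_nonneg z D.p
  have h2 := mul_nonneg (C.a_coeff.nonneg z) (hL.lam_rpow_nonneg z D.q)
  have h3 := mul_nonneg (C.b_coeff.nonneg z) (hL.lam_rpow_nonneg z D.s)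
  have hK : 1 ≤ D.K ^ 2 := one_le_pow₀ (by linarith [hL.two_le_K])
  have h4 := mul_nonneg (by linarith : 0 ≤ D.K ^ 2) h1
  have h5 := mul_nonneg (by linarith : 0 ≤ D.K ^ 2) h2
  have h6 := mul_nonneg (by linarith : 0 ≤ D.K ^ 2) h3
  unfold Config.growth
  split_ifs with ha hb hb <;> refine ⟨?_, ?_, ?_⟩ <;> nlinarith

lemma growth_pos (z : SpaceTime n) : 0 < C.growth Λ z :=
  (Real.rpow_pos_of_pos (hL.lam_pos z) _).trans_le (hL.growth_bounds z).1

lemma one_le_coef (z : SpaceTime n) : 1 ≤ C.coef Λ z := by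
  have h := hL.lam_pos z
  rw [Config.coef, one_le_div (by positivity)]
  refine le_trans ?_ (hL.growth_bounds z).1
  rw [← Real.rpow_natCast]
  exact Real.rpow_le_rpow_of_exponent_le (hL.one_lt_lam z).le (by simpa using hL.adm.two_le_p)

lemma coef_le (z : SpaceTime n) : C.coef Λ z ≤ Λ := by
  have h := hL.one_lt_lam z
  refine (div_le_self (hL.growth_pos z).le ?_).trans (hL.growth_bounds z).2.1
  exact one_le_pow₀ h.le

lemma coef_pos (z : SpaceTime n) : 0 < C.coef Λ z := by linarith [hL.one_le_coef z]

lemma lam_le (z : SpaceTime n) : C.lam Λ z ≤ Λ := by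
  have h := hL.one_lt_lam z
  have h1 : C.lam Λ z ≤ C.lam Λ z ^ D.p := by
    simpa using Real.rpow_le_rpow_of_exponent_le h.le
      (by linarith [hL.adm.two_le_p] : (1 : ℝ) ≤ D.p)
  exact h1.trans ((hL.growth_bounds z).1.trans (hL.growth_bounds z).2.1)

lemma isClosed_good : IsClosed (C.good Λ) := by
  have : C.good Λ = {z | ENNReal.ofReal (Λ ^ (D.d / D.p)) < C.maxF z}ᶜ := by
    ext z; simp [Config.good]
  rw [this]
  exact (isOpen_lt_strongMax _ _).isClosed_compl

lemma d_pos : 0 < D.d := by linarith [hL.adm.one_lt_d]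

lemma p_pos : 0 < D.p := by linarith [hL.adm.two_le_p]

/-- Chebyshev's inequality: on the bad set `maxF` to the power `p/d` exceeds `Λ`. -/
lemma volume_compl_good_le : ENNReal.ofReal Λ * volume (C.good Λ)ᶜ ≤ C.maxInt := by
  have hd := hL.d_pos
  have hp := hL.p_pos
  rw [← setLIntegral_const]
  refine (setLIntegral_mono' hL.isClosed_good.measurableSet.compl fun z hz => ?_).trans
    (setLIntegral_le_lintegral _ _)
  have hz' : ENNReal.ofReal (Λ ^ (D.d / D.p)) < C.maxF z := not_le.1 hz
  calc ENNReal.ofReal Λ = ENNReal.ofReal ((Λ ^ (D.d / D.p)) ^ (D.p / D.d)) := by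
        rw [← Real.rpow_mul hL.Λ_pos.le]
        congr 1
        rw [show D.d / D.p * (D.p / D.d) = 1 by field_simp, Real.rpow_one]
    _ = ENNReal.ofReal (Λ ^ (D.d / D.p)) ^ (D.p / D.d) :=
        (ENNReal.ofReal_rpow_of_nonneg (Real.rpow_nonneg hL.Λ_pos.le _) (by positivity)).symm
    _ ≤ _ := ENNReal.rpow_le_rpow hz'.le (by positivity)

lemma maxInt_ne_top : C.maxInt ≠ ⊤ := ne_top_of_le_ne_top ENNReal.ofReal_ne_top hL.int_le

lemma volume_compl_good_ne_top : volume (C.good Λ)ᶜ ≠ ⊤ := by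
  intro h
  have h1 := hL.volume_compl_good_le
  rw [h, ENNReal.mul_top (by simpa using hL.Λ_pos)] at h1
  exact hL.maxInt_ne_top (top_le_iff.1 h1)

/-- The bad set has finite volume, so it is not everything. Without this the infimum defining the
radii would run over the empty set. -/
lemma good_nonempty : (C.good Λ).Nonempty := by
  by_contra h
  rw [not_nonempty_iff_eq_empty] at h
  apply hL.volume_compl_good_ne_top
  rw [h, compl_empty]
  exact measure_univ_of_isAddLeftInvariant _

omit hL in
lemma dz_nonneg (z w w' : SpaceTime n) : 0 ≤ C.dz Λ z w w' :=
  (norm_nonneg _).trans (le_max_left _ _)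

lemma four_rad_le (z : SpaceTime n) {e : SpaceTime n} (he : e ∈ C.good Λ) :
    4 * C.rad Λ z ≤ C.dz Λ z z e := by
  have : (⨅ w : C.good Λ, C.dz Λ z z w) ≤ C.dz Λ z z e :=
    ciInf_le (f := fun w : C.good Λ => C.dz Λ z z w)
      ⟨0, by rintro _ ⟨w, rfl⟩; exact dz_nonneg _ _ _⟩ ⟨e, he⟩
  unfold Config.rad
  linarith

lemma far (z : SpaceTime n) {e : SpaceTime n} (he : e ∈ C.good Λ) :
    4 * C.rad Λ z ≤ ‖e.1 - z.1‖ ∨ 16 * C.rad Λ z ^ 2 / C.coef Λ z ≤ |e.2 - z.2| := by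
  have h := hL.four_rad_le z he
  have hr : 0 ≤ C.rad Λ z :=
    div_nonneg (Real.iInf_nonneg fun w => dz_nonneg _ _ _) (by norm_num)
  rw [Config.dz, le_max_iff] at h
  refine h.imp (fun h => by rwa [norm_sub_rev]) fun h => ?_
  have h2 := Real.le_sqrt' (x := 4 * C.rad Λ z) (y := C.coef Λ z * |z.2 - e.2|)
  rw [div_le_iff₀ (hL.coef_pos z), abs_sub_comm e.2 z.2, mul_comm |z.2 - e.2|]
  rcases hr.eq_or_lt with h0 | h0
  · rw [← h0]
    have := hL.coef_pos z
    simp only [ne_eq, OfNat.ofNat_ne_zero, not_false_eq_true, zero_pow, mul_zero]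
    positivity
  · have := (h2 (by positivity)).1 h
    linarith

lemma rad_pos {z : SpaceTime n} (hz : z ∈ (C.good Λ)ᶜ) : 0 < C.rad Λ z := by
  obtain ⟨ε, hε, hball⟩ := Metric.isOpen_iff.1 hL.isClosed_good.isOpen_compl z hz
  have hne := hL.good_nonempty.to_subtype
  have : min ε √ε ≤ ⨅ w : C.good Λ, C.dz Λ z z w := by
    refine le_ciInf fun w => ?_
    have hw : ε ≤ dist (w : SpaceTime n) z := by
      by_contra hlt
      exact hball (Metric.mem_ball.2 (not_le.1 hlt)) w.2
    rw [Prod.dist_eq, le_max_iff] at hw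
    rcases hw with hw | hw
    · refine (min_le_left _ _).trans (le_trans ?_ (le_max_left _ _))
      rwa [dist_comm, dist_eq_norm] at hw
    · refine (min_le_right _ _).trans (le_trans ?_ (le_max_right _ _))
      apply Real.sqrt_le_sqrt
      rw [dist_comm, Real.dist_eq] at hw
      have := hL.one_le_coef z
      nlinarith [abs_nonneg (z.2 - (w : SpaceTime n).2)]
  have h2 : 0 < min ε √ε := lt_min hε (Real.sqrt_pos.2 hε)
  unfold Config.rad
  linarith

lemma near {z : SpaceTime n} (hz : z ∈ (C.good Λ)ᶜ) : ∃ e ∈ C.good Λ,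
    ‖e.1 - z.1‖ ≤ 5 * C.rad Λ z ∧ |e.2 - z.2| ≤ 25 * C.rad Λ z ^ 2 / C.coef Λ z := by
  have hr := hL.rad_pos hz
  have hne := hL.good_nonempty.to_subtype
  have : (⨅ w : C.good Λ, C.dz Λ z z w) < 5 * C.rad Λ z := by
    have : (⨅ w : C.good Λ, C.dz Λ z z w) = 4 * C.rad Λ z := by unfold Config.rad; ring
    linarith
  obtain ⟨e, he⟩ := exists_lt_of_ciInf_lt this
  rw [Config.dz, max_lt_iff] at he
  refine ⟨e, e.2, by rw [norm_sub_rev]; exact he.1.le, ?_⟩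
  have h2 := (Real.sqrt_lt' (by positivity)).1 he.2
  rw [le_div_iff₀ (hL.coef_pos z), abs_sub_comm]
  linarith

lemma wcyl_four_subset (z : SpaceTime n) :
    C.wcyl Λ 4 z ⊆ (C.good Λ)ᶜ := by
  intro w hw hg
  rw [Config.wcyl, mem_cyl] at hw
  rcases hL.far z hg with h | h
  · linarith [hw.1]
  · rw [mul_pow] at hw
    norm_num at hw
    linarith [hw.2]

/-- The cylinder `4U_z` lies in the bad set, so `Λ` times its volume is at most `maxInt`. Its volume
is `2 |B₁| (4r)^(n+2) λ² / γ` and `γ ≤ Λ`, so `Λ` disappears and a bound free of `Λ` remains. All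
control of oscillations rests on this estimate. -/
lemma rad_pow_le {z : SpaceTime n} (hz : z ∈ (C.good Λ)ᶜ) :
    (4 * C.rad Λ z) ^ (n + 2) * C.lam Λ z ^ 2 ≤ (unitVol n)⁻¹ * C.maxInt.toReal := by
  have hr := hL.rad_pos hz
  have hl := hL.lam_pos z
  have hu := unitVol_pos n
  have hγ := hL.growth_pos z
  have h1 := (mul_le_mul_right (measure_mono (hL.wcyl_four_subset z)) (ENNReal.ofReal Λ)).trans
    hL.volume_compl_good_le
  rw [Config.wcyl, volume_cyl _ (by positivity), ← ENNReal.ofReal_mul hL.Λ_pos.le] at h1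
  have h2 := (ENNReal.ofReal_le_iff_le_toReal hL.maxInt_ne_top).1 h1
  rw [← div_eq_inv_mul, le_div_iff₀ hu]
  refine le_trans ?_ h2
  rw [Config.coef]
  have hg := (hL.growth_bounds z).2.1
  have : Λ * (unitVol n * (4 * C.rad Λ z) ^ n * (2 * ((4 * C.rad Λ z) ^ 2 /
      (C.growth Λ z / C.lam Λ z ^ 2)))) = ((4 * C.rad Λ z) ^ (n + 2) * C.lam Λ z ^ 2 * unitVol n)
      * (2 * (Λ / C.growth Λ z)) := by
    field_simp
    ring
  rw [this]
  refine le_mul_of_one_le_right (by positivity) ?_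
  have : 1 ≤ Λ / C.growth Λ z := (one_le_div hγ).2 hg
  linarith

/-- A bound for the radii in terms of the data. -/
noncomputable def _root_.MultiPhase.Data.radBound (D : Data) : ℝ :=
  (D.K / (800 * D.holA)) ^ (1 / D.α)

/-- By its definition `K` bounds the scaled `maxInt` to the power `α/(n+2)`, up to `800 [a]_α`. So
`rad_pow_le`, with `λ ≥ 1` and the factor 4 dropped, bounds the radius by the data alone. -/
lemma rad_le {z : SpaceTime n} (hz : z ∈ (C.good Λ)ᶜ) : C.rad Λ z ≤ D.radBound := by
  have hr := hL.rad_pos hz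
  have hα := hL.adm.α_pos
  have hA := hL.adm.holA_pos
  have hK := hL.two_le_K
  have hn : (0 : ℝ) < n + 2 := by positivity
  have h1 : C.rad Λ z ^ (n + 2) ≤ (unitVol n)⁻¹ * C.maxInt.toReal := by
    refine le_trans ?_ (hL.rad_pow_le hz)
    have : 1 ≤ C.lam Λ z ^ 2 := one_le_pow₀ (hL.one_lt_lam z).le
    calc C.rad Λ z ^ (n + 2) ≤ (4 * C.rad Λ z) ^ (n + 2) * 1 := by
          rw [mul_one]; gcongr; linarith
      _ ≤ _ := by gcongr
  have h2 : C.rad Λ z ^ D.α ≤ D.K / (800 * D.holA) := by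
    rw [le_div_iff₀ (by positivity), mul_comm]
    refine le_trans ?_ hL.K_bounds.2.1
    gcongr
    calc C.rad Λ z ^ D.α = (C.rad Λ z ^ (n + 2)) ^ (D.α / (n + 2)) := by
          rw [← Real.rpow_natCast, ← Real.rpow_mul hr.le]
          congr 1
          push_cast
          field_simp
      _ ≤ _ := by gcongr
  calc C.rad Λ z = (C.rad Λ z ^ D.α) ^ (1 / D.α) := by
        rw [← Real.rpow_mul hr.le, mul_one_div_cancel hα.ne', Real.rpow_one]
    _ ≤ _ := Real.rpow_le_rpow (by positivity) h2 (by positivity)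

/-- At distances up to `40 m` the oscillation of `a` times `l^q`, and of `b` times `l^s`, is at most
`K/20 · l^p`. The coefficients may therefore be frozen at the price of a multiple of the `p`-term.
-/
lemma osc_le {z z' : SpaceTime n} {l m : ℝ} (hm : 0 ≤ m)
    (h : m ^ (n + 2) * l ^ 2 ≤ (unitVol n)⁻¹ * C.maxInt.toReal) (hl : 1 ≤ l)
    (hX : ‖z.1 - z'.1‖ + √|z.2 - z'.2| ≤ 40 * m) :
    |C.a z - C.a z'| ≤ D.K / 20 * l ^ (-(D.q - D.p)) ∧
      |C.b z - C.b z'| ≤ D.K / 20 * l ^ (-(D.s - D.p)) :=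
  ⟨(C.a_coeff.holder z z').trans (holder_le_of_pow_le hL.adm.holA_pos.le hL.adm.α_pos hL.adm.α_le
    (scaledInt_nonneg C) hL.K_bounds.2.1 hm h hl (by linarith [hL.adm.q_le]) (by positivity) hX),
  (C.b_coeff.holder z z').trans (holder_le_of_pow_le hL.adm.holB_pos.le hL.adm.β_pos hL.adm.β_le
    (scaledInt_nonneg C) hL.K_bounds.2.2 hm h hl (by linarith [hL.adm.s_le]) (by positivity) hX)⟩

lemma dist_le_of_nonempty {z z' : SpaceTime n} (hz : z ∈ (C.good Λ)ᶜ) (hz' : z' ∈ (C.good Λ)ᶜ)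
    (h : (C.wcyl Λ (2 / D.K) z ∩ C.wcyl Λ (2 / D.K) z').Nonempty) :
    ‖z.1 - z'.1‖ ≤ C.rad Λ z + C.rad Λ z' ∧
      |z.2 - z'.2| ≤ C.rad Λ z ^ 2 / C.coef Λ z + C.rad Λ z' ^ 2 / C.coef Λ z' := by
  obtain ⟨y, hy, hy'⟩ := h
  have hK : 2 / D.K ≤ 1 := by rw [div_le_one (by linarith [hL.two_le_K])]; exact hL.two_le_K
  have hK0 : 0 ≤ 2 / D.K := div_nonneg (by norm_num) (by linarith [hL.two_le_K])
  have key : ∀ {z : SpaceTime n}, z ∈ (C.good Λ)ᶜ → y ∈ C.wcyl Λ (2 / D.K) z →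
      ‖y.1 - z.1‖ ≤ C.rad Λ z ∧ |y.2 - z.2| ≤ C.rad Λ z ^ 2 / C.coef Λ z := by
    intro z hz hy
    have hr := hL.rad_pos hz
    have hc := hL.coef_pos z
    rw [Config.wcyl, mem_cyl] at hy
    have : 2 / D.K * C.rad Λ z ≤ C.rad Λ z := mul_le_of_le_one_left hr.le hK
    refine ⟨hy.1.le.trans this, hy.2.le.trans ?_⟩
    gcongr
  obtain ⟨h1, h2⟩ := key hz hy
  obtain ⟨h1', h2'⟩ := key hz' hy'
  constructor
  · have := norm_sub_le_norm_sub_add_norm_sub z.1 y.1 z'.1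
    rw [norm_sub_rev z.1 y.1] at this
    linarith
  · have := abs_sub_le z.2 y.2 z'.2
    rw [abs_sub_comm z.2 y.2] at this
    linarith

/-- Suppose `λ_{z'}` were larger. Replacing the coefficients at `z` by those at `z'` gives `Λ ≤ (1 +
K/10) λ_z^p + a(z') λ_{z'}^q + b(z') λ_{z'}^s`. As `(1 + 2K) λ_z^p < λ_{z'}^p`, the right side is
smaller than the value at `z'`, which is also `Λ`. -/
lemma lam_le_mul {z z' : SpaceTime n} (hz : z ∈ (C.good Λ)ᶜ) (hz' : z' ∈ (C.good Λ)ᶜ)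
    (h : (C.wcyl Λ (2 / D.K) z ∩ C.wcyl Λ (2 / D.K) z').Nonempty) :
    C.lam Λ z' ≤ (1 + 2 * D.K) * C.lam Λ z := by
  obtain ⟨h1, h2⟩ := hL.dist_le_of_nonempty hz hz' h
  have hr := hL.rad_pos hz
  have hr' := hL.rad_pos hz'
  have hl := hL.one_lt_lam z
  have hl' := hL.one_lt_lam z'
  have hK := hL.two_le_K
  by_contra hlt
  rw [not_le] at hlt
  have hll : C.lam Λ z ≤ C.lam Λ z' := by nlinarith
  -- The points may be as far apart as the larger of the two radii. If that radius belongs to `z'`,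
  -- the bound at `z'` still serves for `λ_z`, because `λ_z ≤ λ_{z'}` in this argument by
  -- contradiction.
  set m := max (4 * C.rad Λ z) (4 * C.rad Λ z') with hm
  have hm1 : 4 * C.rad Λ z ≤ m := le_max_left _ _
  have hm2 : 4 * C.rad Λ z' ≤ m := le_max_right _ _
  have hm0 : 0 ≤ m := by linarith
  have hmJ : m ^ (n + 2) * C.lam Λ z ^ 2 ≤ (unitVol n)⁻¹ * C.maxInt.toReal := by
    rcases max_choice (4 * C.rad Λ z) (4 * C.rad Λ z') with h | h <;> rw [← hm] at h <;> rw [h]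
    · exact hL.rad_pow_le hz
    · refine le_trans ?_ (hL.rad_pow_le hz')
      gcongr
  have hX : ‖z.1 - z'.1‖ + √|z.2 - z'.2| ≤ 40 * m := by
    have h3 : √|z.2 - z'.2| ≤ C.rad Λ z + C.rad Λ z' := by
      rw [Real.sqrt_le_left (by positivity)]
      refine h2.trans ?_
      have a1 := div_le_self (sq_nonneg (C.rad Λ z)) (hL.one_le_coef z)
      have a2 := div_le_self (sq_nonneg (C.rad Λ z')) (hL.one_le_coef z')
      nlinarith
    linarith
  obtain ⟨ha, hb⟩ := hL.osc_le hm0 hmJ hl.le hX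
  have ha' := (abs_le.1 ha).2
  have hb' := (abs_le.1 hb).2
  have hl0 := hL.lam_pos z
  have eq1 : C.lam Λ z ^ (-(D.q - D.p)) * C.lam Λ z ^ D.q = C.lam Λ z ^ D.p := by
    rw [← Real.rpow_add hl0]; congr 1; ring
  have eq2 : C.lam Λ z ^ (-(D.s - D.p)) * C.lam Λ z ^ D.s = C.lam Λ z ^ D.p := by
    rw [← Real.rpow_add hl0]; congr 1; ring
  have hp := hL.adm.two_le_p
  have hq := hL.adm.p_lt_q
  have hs := hL.adm.q_lt_s
  have hpow : (1 + 2 * D.K) * C.lam Λ z ^ D.p < C.lam Λ z' ^ D.p := by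
    calc (1 + 2 * D.K) * C.lam Λ z ^ D.p ≤ (1 + 2 * D.K) ^ D.p * C.lam Λ z ^ D.p := by
          gcongr
          simpa using Real.rpow_le_rpow_of_exponent_le (by linarith : 1 ≤ 1 + 2 * D.K)
            (by linarith : (1 : ℝ) ≤ D.p)
      _ = ((1 + 2 * D.K) * C.lam Λ z) ^ D.p := (Real.mul_rpow (by linarith) hl0.le).symm
      _ < _ := Real.rpow_lt_rpow (by positivity) hlt (by linarith)
  have e := hL.lam_eq z
  have e' := hL.lam_eq z'
  have lp := hL.lam_rpow_nonneg z D.p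
  have b1 : C.a z * C.lam Λ z ^ D.q ≤ C.a z' * C.lam Λ z' ^ D.q + D.K / 20 * C.lam Λ z ^ D.p := by
    calc C.a z * C.lam Λ z ^ D.q
        ≤ (C.a z' + D.K / 20 * C.lam Λ z ^ (-(D.q - D.p))) * C.lam Λ z ^ D.q := by
          gcongr; linarith
      _ = C.a z' * C.lam Λ z ^ D.q + D.K / 20 * C.lam Λ z ^ D.p := by rw [add_mul, mul_assoc, eq1]
      _ ≤ _ := by
          have := C.a_coeff.nonneg z'
          gcongr
          linarith
  have b2 : C.b z * C.lam Λ z ^ D.s ≤ C.b z' * C.lam Λ z' ^ D.s + D.K / 20 * C.lam Λ z ^ D.p := by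
    calc C.b z * C.lam Λ z ^ D.s
        ≤ (C.b z' + D.K / 20 * C.lam Λ z ^ (-(D.s - D.p))) * C.lam Λ z ^ D.s := by
          gcongr; linarith
      _ = C.b z' * C.lam Λ z ^ D.s + D.K / 20 * C.lam Λ z ^ D.p := by rw [add_mul, mul_assoc, eq2]
      _ ≤ _ := by
          have := C.b_coeff.nonneg z'
          gcongr
          linarith
  nlinarith

/-- Ratio of the time coefficients of neighbouring cylinders. -/
noncomputable def _root_.MultiPhase.Data.ratio (D : Data) : ℝ :=
  (1 + 2 * D.K ^ 2) * (1 + 2 * D.K) ^ 2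

lemma one_add_le_ratio : 1 + 2 * D.K ≤ D.ratio := by
  have hK := hL.two_le_K
  unfold Data.ratio
  nlinarith [sq_nonneg D.K, mul_nonneg (sq_nonneg D.K) (sq_nonneg (1 + 2 * D.K))]

lemma one_le_ratio : 1 ≤ D.ratio := by linarith [hL.one_add_le_ratio, hL.two_le_K]

/-- The growth at both points is comparable with the same `Λ`, whatever the phases, so only the
ratio of the two values of `λ` matters. -/
lemma coef_le_mul {z z' : SpaceTime n} (hz : z ∈ (C.good Λ)ᶜ) (hz' : z' ∈ (C.good Λ)ᶜ)
    (h : (C.wcyl Λ (2 / D.K) z ∩ C.wcyl Λ (2 / D.K) z').Nonempty) :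
    C.coef Λ z ≤ D.ratio * C.coef Λ z' := by
  have h1 := hL.lam_le_mul hz hz' h
  have hl := hL.lam_pos z
  have hl' := hL.lam_pos z'
  have hg : C.growth Λ z ≤ (1 + 2 * D.K ^ 2) * C.growth Λ z' :=
    (hL.growth_bounds z).2.1.trans (hL.growth_bounds z').2.2
  have hg0 := hL.growth_pos z'
  have hK := hL.two_le_K
  unfold Config.coef Data.ratio
  rw [div_le_iff₀ (by positivity)]
  calc C.growth Λ z ≤ (1 + 2 * D.K ^ 2) * C.growth Λ z' := hg
    _ = (1 + 2 * D.K ^ 2) * (C.growth Λ z' / C.lam Λ z' ^ 2) * C.lam Λ z' ^ 2 := by field_simp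
    _ ≤ (1 + 2 * D.K ^ 2) * (C.growth Λ z' / C.lam Λ z' ^ 2)
        * ((1 + 2 * D.K) * C.lam Λ z) ^ 2 := by gcongr
    _ = _ := by ring

/-- A good point within about `5 r_{z'}` of `z'` must have intrinsic distance at least `4 r_z` from
`z`. If this is seen in space, `4 r_z ≤ r_z + 6 r_{z'}`. If it is seen in time, the same comparison
holds for squared radii over the time coefficients, and `coef_le_mul` removes these. -/
lemma rad_le_mul {z z' : SpaceTime n} (hz : z ∈ (C.good Λ)ᶜ) (hz' : z' ∈ (C.good Λ)ᶜ)
    (h : (C.wcyl Λ (2 / D.K) z ∩ C.wcyl Λ (2 / D.K) z').Nonempty) :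
    C.rad Λ z ≤ 2 * D.ratio * C.rad Λ z' := by
  obtain ⟨h1, h2⟩ := hL.dist_le_of_nonempty hz hz' h
  obtain ⟨e, he, e1, e2⟩ := hL.near hz'
  have hr := hL.rad_pos hz
  have hr' := hL.rad_pos hz'
  have hc := hL.coef_pos z
  have hc' := hL.coef_pos z'
  have hκ := hL.one_le_ratio
  have hcc := hL.coef_le_mul hz hz' h
  have hκr : C.rad Λ z' ≤ D.ratio * C.rad Λ z' := le_mul_of_one_le_left hr'.le hκ
  rcases hL.far z he with h3 | h3
  · have := norm_sub_le_norm_sub_add_norm_sub e.1 z'.1 z.1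
    rw [norm_sub_rev z'.1 z.1] at this
    linarith
  · have h4 := abs_sub_le e.2 z'.2 z.2
    rw [abs_sub_comm z'.2 z.2] at h4
    have h5 : 16 * C.rad Λ z ^ 2 / C.coef Λ z
        ≤ C.rad Λ z ^ 2 / C.coef Λ z + 26 * (C.rad Λ z' ^ 2 / C.coef Λ z') := by
      have : 25 * C.rad Λ z' ^ 2 / C.coef Λ z' = 25 * (C.rad Λ z' ^ 2 / C.coef Λ z') := by ring
      linarith
    have h6 : 15 * C.rad Λ z ^ 2 ≤ 26 * D.ratio * C.rad Λ z' ^ 2 := by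
      have h7 : 15 * C.rad Λ z ^ 2 / C.coef Λ z ≤ 26 * (C.rad Λ z' ^ 2 / C.coef Λ z') := by
        have : 16 * C.rad Λ z ^ 2 / C.coef Λ z
          = 15 * C.rad Λ z ^ 2 / C.coef Λ z + C.rad Λ z ^ 2 / C.coef Λ z := by ring
        linarith
      rw [div_le_iff₀ hc] at h7
      refine h7.trans ?_
      calc 26 * (C.rad Λ z' ^ 2 / C.coef Λ z') * C.coef Λ z
          ≤ 26 * (C.rad Λ z' ^ 2 / C.coef Λ z') * (D.ratio * C.coef Λ z') := by gcongr
        _ = _ := by field_simp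
    refine abs_le_of_sq_le_sq' (b := 2 * D.ratio * C.rad Λ z') ?_ (by positivity) |>.2
    have : D.ratio ≤ D.ratio ^ 2 := by nlinarith
    have h8 : D.ratio * C.rad Λ z' ^ 2 ≤ D.ratio ^ 2 * C.rad Λ z' ^ 2 := by gcongr
    nlinarith

section Cover
variable {ι : Type} {z : ι → SpaceTime n} (hz : C.IsWhitney Λ z)
include hz

lemma isWhitneyFamily : IsWhitneyFamily (C.good Λ) D.K (2 * D.ratio) z
    (fun i => C.rad Λ (z i)) (fun i => C.coef Λ (z i)) where
  two_le_K := hL.two_le_K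
  one_le_κ := by linarith [hL.one_le_ratio]
  closed := hL.isClosed_good
  r_pos i := hL.rad_pos (hz.mem i)
  θ_pos i := hL.coef_pos _
  subset i := by
    have hr := hL.rad_pos (hz.mem i)
    have hc := hL.coef_pos (z i)
    have hK := hL.two_le_K
    have h4 : 2 / D.K ≤ 4 := by rw [div_le_iff₀ (by linarith)]; linarith
    refine Subset.trans ?_ (hL.wcyl_four_subset (z i))
    refine cyl_subset_cyl ?_ ?_
    · simp only [sub_self, norm_zero, zero_add]
      gcongr
    · simp only [sub_self, abs_zero, zero_add]
      gcongr
  cover := hz.cover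
  disj := hz.disj
  nbr i j h := by
    refine ⟨hL.rad_le_mul (hz.mem i) (hz.mem j) h, ?_⟩
    refine (hL.coef_le_mul (hz.mem i) (hz.mem j) h).trans ?_
    have := hL.coef_pos (z j)
    have := hL.one_le_ratio
    nlinarith

lemma isWhitneyDistance : IsWhitneyDistance (C.good Λ) z
    (fun i => C.rad Λ (z i)) (fun i => C.coef Λ (z i)) Λ where
  one_le_Θ := hL.one_lt_Λ.le
  one_le _ := hL.one_le_coef _
  le _ := hL.coef_le _
  near i := hL.near (hz.mem i)
  far i _ he := hL.far (z i) he

lemma lam_nbr {j k : ι} (h : j ∈ IsWhitneyFamily.nbrs D.K z (fun i => C.rad Λ (z i))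
    (fun i => C.coef Λ (z i)) k) : C.lam Λ (z j) ≤ 2 * D.ratio * C.lam Λ (z k) := by
  obtain ⟨y, h1, h2⟩ := h
  have h2' := (hL.isWhitneyFamily hz).wc_one_subset_two k h2
  refine (hL.lam_le_mul (hz.mem k) (hz.mem j) ⟨y, h2', h1⟩).trans ?_
  have := hL.lam_pos (z k)
  have := hL.one_add_le_ratio
  have := hL.two_le_K
  gcongr
  linarith

end Cover

omit hL in
lemma _root_.MultiPhase.Config.IsCutoffFamily.isWhitneyCutoff {ι : Type} {z : ι → SpaceTime n}
    {ψ : ι → SpaceTime n → ℝ} (h : C.IsCutoffFamily Λ z ψ) :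
    IsWhitneyCutoff D.K z (fun i => C.rad Λ (z i)) (fun i => C.coef Λ (z i)) ψ where
  smooth := h.smooth
  compact := h.compact
  supp := h.supp
  nonneg := h.nonneg
  le_one := h.le_one
  eq_one := h.eq_one
  grad_le := h.grad_le
  dt_le := h.dt_le

end IsLevel

/-! ### Measurability of Carathéodory fields -/

/-- Substituting a measurable function into a Carathéodory function. -/
lemma aestronglyMeasurable_caratheodory {α X Y : Type*} [MeasurableSpace α] {μ : Measure α}
    [TopologicalSpace X] [NormedAddCommGroup Y] {A : α → X → Y}
    (hm : ∀ ξ, AEStronglyMeasurable (fun z => A z ξ) μ) (hc : ∀ᵐ z ∂μ, Continuous (A z))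
    {g : α → X} (hg : AEStronglyMeasurable g μ) :
    AEStronglyMeasurable (fun z => A z (g z)) μ := by
  -- For a simple function the substitution is a finite sum over its values. The general case
  -- follows by pointwise approximation and continuity in the second variable.
  have hs : ∀ s : SimpleFunc α X, AEStronglyMeasurable (fun z => A z (s z)) μ := by
    classical
    intro s
    have : (fun z => A z (s z))
        = fun z => ∑ x ∈ s.range, (s ⁻¹' {x}).indicator (fun z => A z x) z := by
      funext z
      rw [Finset.sum_eq_single (s z)]
      · rw [indicator_of_mem (by simp)]
      · intro x _ hx
        exact indicator_of_notMem (fun h => hx (by simpa using h.symm)) _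
      · intro h; simp at h
    rw [this]
    exact Finset.aestronglyMeasurable_fun_sum _ fun x _ =>
      (hm x).indicator (s.measurableSet_fiber x)
  have hlim := hg.stronglyMeasurable_mk.tendsto_approx
  refine (aestronglyMeasurable_of_tendsto_ae atTop (fun i => hs (hg.stronglyMeasurable_mk.approx i))
    ?_ : AEStronglyMeasurable (fun z => A z (hg.mk g z)) μ).congr ?_
  · filter_upwards [hc] with z hz
    exact (hz.tendsto _).comp (hlim z)
  · filter_upwards [hg.ae_eq_mk] with z hz
    rw [hz]

/-! ### Steklov averages and cutoffs of weak solutions -/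

section Steklov
variable {n : ℕ} {V : Type*} [NormedAddCommGroup V] [NormedSpace ℝ V]

/-- Forward Steklov average. -/
noncomputable def stek (h : ℝ) (F : SpaceTime n → V) (y : SpaceTime n) : V :=
  h⁻¹ • ∫ σ in Ioc 0 h, F (y + (0, σ))

lemma steklov_eq_stek {N : ℕ} {h : ℝ} (hh : 0 < h) (w : SpaceTime n → Space N) :
    steklov h w = stek h w := by
  funext y
  unfold steklov stek
  rw [← intervalIntegral.integral_of_le hh.le]
  congr 1
  have := intervalIntegral.integral_comp_add_left (a := 0) (b := h) (fun τ => w (y.1, τ)) y.2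
  rw [add_zero] at this
  rw [← this]
  refine intervalIntegral.integral_congr fun σ _ => ?_
  simp [Prod.add_def]

/-- For each fixed `σ` the map is a translation. This transfers integrability and almost everywhere
bounds to the shifted functions jointly in `(σ, y)`, so the null sets arising for different `σ` need
no separate treatment. -/
lemma measurePreserving_shift (h : ℝ) :
    MeasurePreserving (fun p : ℝ × SpaceTime n => (p.1, p.2 + ((0 : Space n), p.1)))
      ((volume.restrict (Ioc 0 h)).prod volume) ((volume.restrict (Ioc 0 h)).prod volume) := by
  refine (MeasurePreserving.id _).skew_product (g := fun σ y => y + ((0 : Space n), σ)) ?_ ?_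
  · exact (by fun_prop : Continuous fun p : ℝ × SpaceTime n => p.2 + ((0 : Space n), p.1)).measurable
  · exact Eventually.of_forall fun σ => map_add_right_eq_self volume ((0 : Space n), σ)

lemma integrable_shift {F : SpaceTime n → V} (hF : Integrable F) (h : ℝ) :
    Integrable (fun p : ℝ × SpaceTime n => F (p.2 + (0, p.1)))
      ((volume.restrict (Ioc 0 h)).prod volume) :=
  (measurePreserving_shift h).integrable_comp_of_integrable (hF.comp_snd _)

lemma integrable_stek {F : SpaceTime n → V} (hF : Integrable F) (h : ℝ) :
    Integrable (stek h F) :=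
  ((integrable_shift hF h).integral_prod_right).smul _

lemma ae_integrable_shift {F : SpaceTime n → V} (hF : Integrable F) (h : ℝ) :
    ∀ᵐ y : SpaceTime n, IntegrableOn (fun σ => F (y + (0, σ))) (Ioc 0 h) :=
  (integrable_shift hF h).prod_left_ae

lemma stek_apply {ι : Type*} [Fintype ι] {F : SpaceTime n → EuclideanSpace ℝ ι}
    (hF : Integrable F) (h : ℝ) (j : ι) :
    (fun y => stek h F y j) =ᵐ[volume] stek h fun y => F y j := by
  filter_upwards [ae_integrable_shift hF h] with y hy
  simp only [stek, PiLp.smul_apply]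
  congr 1
  exact (ContinuousLinearMap.integral_comp_comm (EuclideanSpace.proj j : EuclideanSpace ℝ ι →L[ℝ] ℝ)
    hy).symm

lemma enorm_stek_le {h : ℝ} (hh : 0 < h) (F : SpaceTime n → V) (y : SpaceTime n) :
    ‖stek h F y‖ₑ ≤ ENNReal.ofReal h⁻¹ * ∫⁻ σ in Ioc 0 h, ‖F (y + (0, σ))‖ₑ := by
  rw [stek, enorm_smul, Real.enorm_of_nonneg (inv_nonneg.2 hh.le)]
  gcongr
  exact enorm_integral_le_lintegral_enorm _

lemma norm_stek_le {h : ℝ} (hh : 0 < h) {F : SpaceTime n → V} {f : SpaceTime n → ℝ}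
    (hf : Integrable f) (hFf : ∀ᵐ y, ‖F y‖ ≤ f y) :
    ∀ᵐ y : SpaceTime n, ‖stek h F y‖ ≤ stek h f y := by
  have hae : ∀ᵐ p : ℝ × SpaceTime n ∂((volume.restrict (Ioc 0 h)).prod volume),
      ‖F (p.2 + (0, p.1))‖ ≤ f (p.2 + (0, p.1)) := by
    have h1 : ∀ᵐ p : ℝ × SpaceTime n ∂((volume.restrict (Ioc 0 h)).prod volume),
        ‖F p.2‖ ≤ f p.2 := Measure.quasiMeasurePreserving_snd.ae hFf
    exact (measurePreserving_shift h).quasiMeasurePreserving.ae h1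
  have h2 := Measure.ae_ae_of_ae_prod
    ((Measure.measurePreserving_swap (μ := (volume : Measure (SpaceTime n)))
      (ν := volume.restrict (Ioc 0 h))).quasiMeasurePreserving.ae hae)
  filter_upwards [ae_integrable_shift hf h, h2] with y hy hy2
  rw [stek, stek, norm_smul, Real.norm_of_nonneg (inv_nonneg.2 hh.le), smul_eq_mul]
  refine mul_le_mul_of_nonneg_left ?_ (inv_nonneg.2 hh.le)
  exact norm_integral_le_of_norm_le hy hy2

lemma integrable_shift_mul {F Ψ : SpaceTime n → ℝ} (hF : Integrable F) (hΨ : Continuous Ψ)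
    (hc : HasCompactSupport Ψ) (h : ℝ) :
    Integrable (fun p : ℝ × SpaceTime n => F (p.2 + (0, p.1)) * Ψ p.2)
      ((volume.restrict (Ioc 0 h)).prod volume) := by
  obtain ⟨c, hc⟩ := hΨ.bounded_above_of_compact_support hc
  exact (integrable_shift hF h).mul_bdd (c := c) (hΨ.comp continuous_snd).aestronglyMeasurable
    (Eventually.of_forall fun p => hc p.2)

lemma integral_shift_mul (F Ψ : SpaceTime n → ℝ) (σ : ℝ) :
    ∫ y, F (y + (0, σ)) * Ψ y = ∫ y, F y * Ψ (y - (0, σ)) := by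
  rw [← integral_add_right_eq_self (fun y => F y * Ψ (y - (0, σ))) ((0 : Space n), σ)]
  simp

lemma integrableOn_integral_shift {F Ψ : SpaceTime n → ℝ} (hF : Integrable F) (hΨ : Continuous Ψ)
    (hc : HasCompactSupport Ψ) (h : ℝ) :
    IntegrableOn (fun σ => ∫ y, F y * Ψ (y - (0, σ))) (Ioc 0 h) := by
  have := (integrable_shift_mul hF hΨ hc h).integral_prod_left
  rw [IntegrableOn]
  simpa only [integral_shift_mul] using this

lemma integral_stek_mul {F Ψ : SpaceTime n → ℝ} (hF : Integrable F) (hΨ : Continuous Ψ)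
    (hc : HasCompactSupport Ψ) (h : ℝ) :
    ∫ y, stek h F y * Ψ y = h⁻¹ * ∫ σ in Ioc 0 h, ∫ y, F y * Ψ (y - (0, σ)) := by
  have hi := integrable_shift_mul hF hΨ hc h
  have h1 := integral_integral_swap (f := fun (σ : ℝ) (y : SpaceTime n) => F (y + (0, σ)) * Ψ y) hi
  simp only [integral_shift_mul] at h1
  rw [h1, ← integral_const_mul]
  congr 1
  funext y
  rw [integral_mul_const, stek, smul_eq_mul, mul_assoc]

lemma contDiff_shift {φ : SpaceTime n → ℝ} (hφ : ContDiff ℝ ∞ φ) (σ : ℝ) :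
    ContDiff ℝ ∞ fun y => φ (y - (0, σ)) := hφ.comp (contDiff_id.sub contDiff_const)

lemma hasCompactSupport_shift {φ : SpaceTime n → ℝ} (hc : HasCompactSupport φ) (σ : ℝ) :
    HasCompactSupport fun y => φ (y - (0, σ)) :=
  hc.comp_homeomorph (Homeomorph.subRight ((0 : Space n), σ))

lemma tsupport_shift_subset (φ : SpaceTime n → ℝ) (σ : ℝ) :
    tsupport (fun y => φ (y - (0, σ))) ⊆ {y | y - (0, σ) ∈ tsupport φ} := by
  refine closure_minimal (fun y hy => subset_tsupport _ hy) ?_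
  exact (isClosed_tsupport φ).preimage (by fun_prop)

lemma dx_shift {φ : SpaceTime n → ℝ} (hφ : ContDiff ℝ ∞ φ) (σ : ℝ) (k : Fin n) (y : SpaceTime n) :
    dx k (fun y => φ (y - (0, σ))) y = dx k φ (y - (0, σ)) := by
  rw [dx_eq_fderiv ((contDiff_shift hφ σ).differentiable (by simp) y),
    dx_eq_fderiv (hφ.differentiable (by simp) _), fderiv_comp_sub]

lemma dt_shift {φ : SpaceTime n → ℝ} (hφ : ContDiff ℝ ∞ φ) (σ : ℝ) (y : SpaceTime n) :
    dt (fun y => φ (y - (0, σ))) y = dt φ (y - (0, σ)) := by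
  rw [dt_eq_fderiv ((contDiff_shift hφ σ).differentiable (by simp) y),
    dt_eq_fderiv (hφ.differentiable (by simp) _), fderiv_comp_sub]

namespace WeakPair
variable {O O' : Set (SpaceTime n)} {w : SpaceTime n → ℝ} {G S : Fin n → SpaceTime n → ℝ}
  {g : SpaceTime n → ℝ}

/-- Averaging the solution over forward shifts is dual to averaging over backward shifts of the test
function, and each shifted test function is admissible in `O` by `hO`. -/
lemma stek (H : WeakPair O w G S g) {h : ℝ}
    (hO : ∀ y ∈ O', ∀ σ ∈ Ioc 0 h, y + (0, σ) ∈ O) :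
    WeakPair O' (MultiPhase.stek h w) (fun k => MultiPhase.stek h (G k))
      (fun k => MultiPhase.stek h (S k)) (MultiPhase.stek h g) where
  int_w := integrable_stek H.int_w h
  int_G k := integrable_stek (H.int_G k) h
  int_S k := integrable_stek (H.int_S k) h
  int_g := integrable_stek H.int_g h
  grad φ hφ hc hs k := by
    rw [integral_stek_mul H.int_w (continuous_dx (hφ.of_le (by simp)) k)
      (hasCompactSupport_dx hφ hc k), integral_stek_mul (H.int_G k) hφ.continuous hc, ← mul_neg,
      ← integral_neg]
    congr 1
    refine setIntegral_congr_fun measurableSet_Ioc fun σ hσ => ?_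
    have := H.grad _ (contDiff_shift hφ σ) (hasCompactSupport_shift hc σ) (fun y hy => ?_) k
    · simpa only [dx_shift hφ] using this
    · simpa using hO _ (hs (tsupport_shift_subset φ σ hy)) σ hσ
  time φ hφ hc hs := by
    have hdx := fun k => continuous_dx (hφ.of_le (by simp)) k
    have hdxc := fun k => hasCompactSupport_dx hφ hc k
    rw [integral_stek_mul H.int_w (continuous_dt (hφ.of_le (by simp))) (hasCompactSupport_dt hφ hc),
      integral_stek_mul H.int_g hφ.continuous hc]
    simp_rw [fun k => integral_stek_mul (H.int_S k) (hdx k) (hdxc k) h]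
    rw [← Finset.mul_sum, ← mul_sub, ← integral_finsetSum _ fun k _ =>
      integrableOn_integral_shift (H.int_S k) (hdx k) (hdxc k) h, ← integral_sub
      (integrable_finsetSum _ fun k _ => integrableOn_integral_shift (H.int_S k) (hdx k) (hdxc k) h)
      (integrableOn_integral_shift H.int_g hφ.continuous hc h)]
    congr 1
    refine setIntegral_congr_fun measurableSet_Ioc fun σ hσ => ?_
    have := H.time _ (contDiff_shift hφ σ) (hasCompactSupport_shift hc σ) (fun y hy => ?_)
    · simpa only [dx_shift hφ, dt_shift hφ] using this
    · simpa using hO _ (hs (tsupport_shift_subset φ σ hy)) σ hσ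

lemma congr {w' : SpaceTime n → ℝ} (H : WeakPair O w G S g) (h : w =ᵐ[volume] w') :
    WeakPair O w' G S g where
  int_w := H.int_w.congr h
  int_G := H.int_G
  int_S := H.int_S
  int_g := H.int_g
  grad φ hφ hc hs k := by
    rw [← H.grad φ hφ hc hs k]
    exact integral_congr_ae (h.mono fun y hy => by dsimp only; rw [hy])
  time φ hφ hc hs := by
    rw [← H.time φ hφ hc hs]
    exact integral_congr_ae (h.mono fun y hy => by dsimp only; rw [hy])

/-- The test function `χ φ` is used in the equation of `w`. The product rule leaves `χ S` as the new
flux and moves `-S · ∇χ + w ∂ₜχ` into the source. The result holds on the whole space because `χ` is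
compactly supported in `O`. -/
lemma cutoff (H : WeakPair O w G S g) {χ : SpaceTime n → ℝ} (hχ : ContDiff ℝ ∞ χ)
    (hχc : HasCompactSupport χ) (hχs : tsupport χ ⊆ O) :
    WeakPair univ (fun y => χ y * w y) (fun k y => χ y * G k y + w y * dx k χ y)
      (fun k y => χ y * S k y)
      (fun y => χ y * g y - (∑ k, S k y * dx k χ y) + w y * dt χ y) := by
  have hdx := fun k => continuous_dx (hχ.of_le (by simp)) k
  have hdxc := fun k => hasCompactSupport_dx hχ hχc k
  have hdt : Continuous (dt χ) := continuous_dt (hχ.of_le (by simp))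
  have hdtc := hasCompactSupport_dt hχ hχc
  have mulb : ∀ {f g : SpaceTime n → ℝ}, Integrable f → Continuous g → HasCompactSupport g →
      Integrable fun y => f y * g y := by
    intro f g hf hg hgc
    obtain ⟨c, hc⟩ := hg.bounded_above_of_compact_support hgc
    exact hf.mul_bdd (c := c) hg.aestronglyMeasurable (Eventually.of_forall hc)
  have mulb' : ∀ {f g : SpaceTime n → ℝ}, Integrable f → Continuous g → HasCompactSupport g →
      Integrable fun y => g y * f y := fun hf hg hgc => by
    simpa only [mul_comm] using mulb hf hg hgc
  have iw := mulb' H.int_w hχ.continuous hχc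
  have iwdt := mulb H.int_w hdt hdtc
  have iS := fun k => mulb' (H.int_S k) hχ.continuous hχc
  have iSdx := fun k => mulb (H.int_S k) (hdx k) (hdxc k)
  have iSs : Integrable fun y => ∑ k, S k y * dx k χ y := integrable_finsetSum _ fun k _ => iSdx k
  have ig := mulb' H.int_g hχ.continuous hχc
  have iG := fun k => mulb' (H.int_G k) hχ.continuous hχc
  have iwdx := fun k => mulb H.int_w (hdx k) (hdxc k)
  refine ⟨iw, fun k => (iG k).add (iwdx k), iS, (ig.sub iSs).add iwdt, fun φ hφ hc _ k => ?_,
    fun φ hφ hc _ => ?_⟩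
  · have h1 := H.grad _ (hχ.mul hφ) hχc.mul_right
      ((tsupport_mul_subset_left (f := χ) (g := φ)).trans hχs) k
    have e1 : ∀ y, w y * dx k (fun y => χ y * φ y) y
        = χ y * w y * dx k φ y + w y * dx k χ y * φ y := fun y => by
      rw [dx_mul (hχ.differentiable (by simp)) (hφ.differentiable (by simp))]; ring
    have e2 : ∀ y, (χ y * G k y + w y * dx k χ y) * φ y
        = G k y * (χ y * φ y) + w y * dx k χ y * φ y := fun y => by ring
    have j1 : Integrable fun y => χ y * w y * dx k φ y :=
      mulb iw (continuous_dx (hφ.of_le (by simp)) k) (hasCompactSupport_dx hφ hc k)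
    have j2 : Integrable fun y => w y * dx k χ y * φ y := mulb (iwdx k) hφ.continuous hc
    have j3 : Integrable fun y => G k y * (χ y * φ y) :=
      mulb (H.int_G k) (hχ.mul hφ).continuous hχc.mul_right
    simp_rw [e2]
    rw [integral_add j3 j2]
    have h1' : ∫ y, w y * dx k (fun y => χ y * φ y) y = - ∫ y, G k y * (χ y * φ y) := h1
    simp_rw [e1] at h1'
    rw [integral_add j1 j2] at h1'
    linarith
  · have h1 := H.time _ (hχ.mul hφ) hχc.mul_right
      ((tsupport_mul_subset_left (f := χ) (g := φ)).trans hχs)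
    have dφ := fun k => continuous_dx (hφ.of_le (by simp)) k
    have dφc := fun k => hasCompactSupport_dx hφ hc k
    have e1 : ∀ y, w y * dt (fun y => χ y * φ y) y
        = χ y * w y * dt φ y + w y * dt χ y * φ y := fun y => by
      rw [dt_mul (hχ.differentiable (by simp)) (hφ.differentiable (by simp))]; ring
    have e2 : ∀ k y, S k y * dx k (fun y => χ y * φ y) y
        = χ y * S k y * dx k φ y + S k y * dx k χ y * φ y := fun k y => by
      rw [dx_mul (hχ.differentiable (by simp)) (hφ.differentiable (by simp))]; ring
    have e3 : ∀ y, (χ y * g y - (∑ k, S k y * dx k χ y) + w y * dt χ y) * φ y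
        = (g y * (χ y * φ y) - ∑ k, S k y * dx k χ y * φ y) + w y * dt χ y * φ y := fun y => by
      rw [add_mul, sub_mul, Finset.sum_mul]; ring
    have j1 : Integrable fun y => χ y * w y * dt φ y :=
      mulb iw (continuous_dt (hφ.of_le (by simp))) (hasCompactSupport_dt hφ hc)
    have j2 : Integrable fun y => w y * dt χ y * φ y := mulb iwdt hφ.continuous hc
    have j3 : ∀ k, Integrable fun y => χ y * S k y * dx k φ y := fun k => mulb (iS k) (dφ k) (dφc k)
    have j4 : ∀ k, Integrable fun y => S k y * dx k χ y * φ y := fun k =>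
      mulb (iSdx k) hφ.continuous hc
    have j5 : Integrable fun y => g y * (χ y * φ y) :=
      mulb H.int_g (hχ.mul hφ).continuous hχc.mul_right
    have j6 : Integrable fun y => ∑ k, S k y * dx k χ y * φ y :=
      integrable_finsetSum _ fun k _ => j4 k
    simp_rw [e3]
    have j7 : Integrable fun y => g y * (χ y * φ y) - ∑ k, S k y * dx k χ y * φ y := j5.sub j6
    rw [integral_add j7 j2, integral_sub j5 j6, integral_finsetSum _ fun k _ => j4 k]
    have h1' : ∫ y, w y * dt (fun y => χ y * φ y) y
      = (∑ k, ∫ y, S k y * dx k (fun y => χ y * φ y) y) - ∫ y, g y * (χ y * φ y) := h1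
    simp_rw [e1, e2] at h1'
    rw [integral_add j1 j2] at h1'
    simp_rw [fun k => integral_add (j3 k) (j4 k)] at h1'
    rw [Finset.sum_add_distrib] at h1'
    linarith

end WeakPair
end Steklov

/-! ### Growth of the vector fields and cutoff functions -/

lemma IsCoefficient.continuous {n : ℕ} {γ M A : ℝ} {a : SpaceTime n → ℝ}
    (h : IsCoefficient γ M A a) (hγ : 0 < γ) : Continuous a := by
  refine continuous_iff_continuousAt.2 fun w => ?_
  rw [ContinuousAt, tendsto_iff_norm_sub_tendsto_zero]
  have hc : Continuous fun z : SpaceTime n => A * (‖z.1 - w.1‖ + √|z.2 - w.2|) ^ γ :=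
    continuous_const.mul ((by fun_prop : Continuous fun z : SpaceTime n =>
      ‖z.1 - w.1‖ + √|z.2 - w.2|).rpow_const fun _ => Or.inr hγ.le)
  have h0 := hc.tendsto w
  simp only [sub_self, norm_zero, abs_zero, Real.sqrt_zero, add_zero,
    Real.zero_rpow hγ.ne', mul_zero] at h0
  exact squeeze_zero (fun z => norm_nonneg _) (fun z => h.holder z w) h0

/-- The growth of the vector fields: `κ^{p-1} + A κ^{q-1} + B κ^{s-1}`. -/
noncomputable def Data.flux (D : Data) (A B κ : ℝ) : ℝ :=
  κ ^ (D.p - 1) + A * κ ^ (D.q - 1) + B * κ ^ (D.s - 1)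

namespace Data.Admissible
variable {D : Data} {n : ℕ} (hD : D.Admissible n)
include hD

lemma exponents : 1 ≤ D.p - 1 ∧ 1 ≤ D.q - 1 ∧ 1 ≤ D.s - 1 := by
  have := hD.two_le_p
  have := hD.p_lt_q
  have := hD.q_lt_s
  exact ⟨by linarith, by linarith, by linarith⟩

lemma flux_mono {A B x y : ℝ} (hA : 0 ≤ A) (hB : 0 ≤ B) (hx : 0 ≤ x) (hxy : x ≤ y) :
    D.flux A B x ≤ D.flux A B y := by
  obtain ⟨h1, h2, h3⟩ := hD.exponents
  have h1' : 0 ≤ D.p - 1 := by linarith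
  have h2' : 0 ≤ D.q - 1 := by linarith
  have h3' : 0 ≤ D.s - 1 := by linarith
  unfold Data.flux
  gcongr

/-- For `ξ ≠ 0` the growth condition is divided by `‖ξ‖`; at `ξ = 0` it carries no information, and
the bound follows by continuity. The hypothesis `hVW` covers the degenerate case `V = 0`, in which
there are no nonzero vectors to approximate by. -/
lemma norm_le_flux {V W : Type*} [NormedAddCommGroup V] [NormedSpace ℝ V] [NormedAddCommGroup W]
    {T : V → W} (hT : Continuous T) {A B : ℝ} {L : ℝ} (hVW : Subsingleton V → Subsingleton W)
    (hL : 0 ≤ L) (hA : 0 ≤ A) (hB : 0 ≤ B) (h : ∀ ξ, ‖T ξ‖ * ‖ξ‖ ≤ L * D.Hval A B ‖ξ‖) (ξ : V) :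
    ‖T ξ‖ ≤ L * D.flux A B ‖ξ‖ := by
  obtain ⟨h1, h2, h3⟩ := hD.exponents
  have hne : ∀ ξ : V, ξ ≠ 0 → ‖T ξ‖ ≤ L * D.flux A B ‖ξ‖ := by
    intro ξ hξ
    have hn := norm_pos_iff.2 hξ
    have e := h ξ
    rw [← le_div_iff₀ hn] at e
    refine e.trans (le_of_eq ?_)
    unfold Data.flux Data.Hval
    rw [Real.rpow_sub_one hn.ne', Real.rpow_sub_one hn.ne', Real.rpow_sub_one hn.ne']
    ring
  rcases subsingleton_or_nontrivial V with hV | hV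
  · have := hVW hV
    rw [Subsingleton.elim (T ξ) 0, norm_zero]
    unfold Data.flux
    positivity
  · have hcl : IsClosed {ξ : V | ‖T ξ‖ ≤ L * D.flux A B ‖ξ‖} := by
      refine isClosed_le hT.norm (continuous_const.mul ?_)
      unfold Data.flux
      refine ((continuous_norm.rpow_const fun _ => Or.inr (by linarith)).add
        (continuous_const.mul (continuous_norm.rpow_const fun _ => Or.inr (by linarith)))).add
        (continuous_const.mul (continuous_norm.rpow_const fun _ => Or.inr (by linarith)))
    have hd : Dense ({0}ᶜ : Set V) := dense_compl_singleton 0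
    have := hcl.closure_subset_iff.2 (fun ξ hξ => hne ξ hξ : ({0}ᶜ : Set V) ⊆ _)
    rw [hd.closure_eq] at this
    exact this (mem_univ ξ)

/-- Powers with exponents up to `d` are controlled by `1 + κ^d`. -/
lemma rpow_le_one_add {t e : ℝ} (ht : 0 ≤ t) (he : 0 ≤ e) (hed : e ≤ D.d) :
    t ^ e ≤ 1 + t ^ D.d := by
  rcases le_total t 1 with h | h
  · have := Real.rpow_le_one ht h he
    have := Real.rpow_nonneg ht D.d
    linarith
  · have := Real.rpow_le_rpow_of_exponent_le h hed
    linarith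

lemma flux_le {A B t : ℝ} (hA : 0 ≤ A) (hB : 0 ≤ B) (ht : 0 ≤ t) :
    D.flux A B t ≤ (1 + A + B) * (1 + t ^ D.d) := by
  obtain ⟨h1, h2, h3⟩ := hD.exponents
  have h4 := hD.s_sub_one_lt_d
  have h5 := hD.p_lt_q
  have h6 := hD.q_lt_s
  have a := hD.rpow_le_one_add ht (by linarith : 0 ≤ D.p - 1) (by linarith)
  have b := mul_le_mul_of_nonneg_left
    (hD.rpow_le_one_add ht (by linarith : 0 ≤ D.q - 1) (by linarith)) hA
  have c := mul_le_mul_of_nonneg_left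
    (hD.rpow_le_one_add ht (by linarith : 0 ≤ D.s - 1) (by linarith)) hB
  unfold Data.flux
  linarith

end Data.Admissible

namespace Config
variable {n N : ℕ} {D : Data} (C : Config n N D)

/-- The integrand of the strong maximal function. -/
noncomputable def dens (z : SpaceTime n) : ℝ :=
  C.f z ^ D.d + (C.a z * C.f z ^ D.q) ^ (D.d / D.p) + (C.b z * C.f z ^ D.s) ^ (D.d / D.p)

/-- `f^{p-1} + a f^{q-1} + b f^{s-1}`. -/
noncomputable def fluxF (z : SpaceTime n) : ℝ := D.flux (C.a z) (C.b z) (C.f z)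

/-- The space-time cutoff function. -/
def cut {n : ℕ} (η : Space n → ℝ) (ζ : ℝ → ℝ) (y : SpaceTime n) : ℝ := η y.1 * ζ y.2

variable {C}

lemma f_nonneg (z : SpaceTime n) : 0 ≤ C.f z :=
  indicator_nonneg (fun _ _ => by positivity) z

lemma dens_nonneg (z : SpaceTime n) : 0 ≤ C.dens z := by
  have h1 := f_nonneg (C := C) z
  have h2 := C.a_coeff.nonneg z
  have h3 := C.b_coeff.nonneg z
  unfold dens
  positivity

lemma fluxF_nonneg (z : SpaceTime n) : 0 ≤ C.fluxF z := by
  have h1 := f_nonneg (C := C) z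
  have h2 := C.a_coeff.nonneg z
  have h3 := C.b_coeff.nonneg z
  unfold fluxF Data.flux
  positivity

lemma rpow_d_le_dens (z : SpaceTime n) : C.f z ^ D.d ≤ C.dens z := by
  have h1 := f_nonneg (C := C) z
  have h2 := C.a_coeff.nonneg z
  have h3 := C.b_coeff.nonneg z
  have h4 : 0 ≤ (C.a z * C.f z ^ D.q) ^ (D.d / D.p) := by positivity
  have h5 : 0 ≤ (C.b z * C.f z ^ D.s) ^ (D.d / D.p) := by positivity
  unfold dens
  linarith

lemma measurableSet_U : MeasurableSet C.U := measurableSet_cyl _ _ _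

lemma U_subset : C.U ⊆ C.Ω ×ˢ Ioo 0 C.T := C.cyl_subset

section Cutoff
variable {h₀ : ℝ} {η : Space n → ℝ} {ζ : ℝ → ℝ} (hηζ : C.IsCutoffPair h₀ η ζ)
include hηζ

lemma contDiff_cut : ContDiff ℝ ∞ (cut η ζ) :=
  (hηζ.η_smooth.comp contDiff_fst).mul (hηζ.ζ_smooth.comp contDiff_snd)

omit hηζ in
lemma tsupport_cut_subset : tsupport (cut (n := n) η ζ) ⊆ tsupport η ×ˢ tsupport ζ := by
  refine closure_minimal (fun y hy => ?_) ((isClosed_tsupport η).prod (isClosed_tsupport ζ))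
  have : η y.1 * ζ y.2 ≠ 0 := hy
  exact ⟨subset_tsupport _ (left_ne_zero_of_mul this), subset_tsupport _ (right_ne_zero_of_mul this)⟩

lemma hasCompactSupport_cut : HasCompactSupport (cut (n := n) η ζ) :=
  (hηζ.η_compact.isCompact.prod hηζ.ζ_compact.isCompact).of_isClosed_subset
    (isClosed_tsupport _) tsupport_cut_subset

lemma tsupport_cut_subset_cyl : tsupport (cut η ζ) ⊆ cyl C.z₀ D.R₂ (D.S₂ - h₀) :=
  tsupport_cut_subset.trans (prod_mono hηζ.η_supp hηζ.ζ_supp)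

lemma abs_cut_le (y : SpaceTime n) : |cut η ζ y| ≤ ζ y.2 := by
  rw [cut, abs_mul, abs_of_nonneg (hηζ.η_nonneg _), abs_of_nonneg (hηζ.ζ_nonneg _)]
  exact mul_le_of_le_one_left (hηζ.ζ_nonneg _) (hηζ.η_le_one _)

lemma abs_cut_le_one (y : SpaceTime n) : |cut η ζ y| ≤ 1 :=
  (abs_cut_le hηζ y).trans (hηζ.ζ_le_one _)

lemma abs_dx_cut_le (k : Fin n) (y : SpaceTime n) :
    |dx k (cut η ζ) y| ≤ 3 / (D.R₂ - D.R₁) := by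
  have hd := (hηζ.η_smooth.differentiable (by simp)) y.1
  have : dx k (cut η ζ) y = fderiv ℝ η y.1 (EuclideanSpace.single k 1) * ζ y.2 := by
    have : HasFDerivAt (fun x => cut η ζ (x, y.2)) (ζ y.2 • fderiv ℝ η y.1) y.1 :=
      hd.hasFDerivAt.mul_const (ζ y.2)
    rw [dx, this.fderiv, smul_apply, smul_eq_mul, mul_comm]
  rw [this, abs_mul, abs_of_nonneg (hηζ.ζ_nonneg _)]
  refine (mul_le_of_le_one_right (abs_nonneg _) (hηζ.ζ_le_one _)).trans
    (((fderiv ℝ η y.1).le_opNorm _).trans ?_)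
  rw [PiLp.norm_single, norm_one, mul_one]
  exact hηζ.η_grad _

lemma abs_dt_cut_le (y : SpaceTime n) : |dt (cut η ζ) y| ≤ 3 / (D.S₂ - D.S₁) := by
  have : dt (cut η ζ) y = η y.1 * deriv ζ y.2 := by
    have : HasDerivAt (fun τ => cut η ζ (y.1, τ)) (η y.1 * deriv ζ y.2) y.2 :=
      ((hηζ.ζ_smooth.differentiable (by simp)) y.2).hasDerivAt.const_mul (η y.1)
    exact this.deriv
  rw [this, abs_mul, abs_of_nonneg (hηζ.η_nonneg _)]
  exact (mul_le_of_le_one_left (abs_nonneg _) (hηζ.η_le_one _)).trans (hηζ.ζ_deriv _)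

/-- `ζ` vanishes at `t₁` and has a bounded derivative. This makes the localized functions small on
cylinders that leave `U` through its top or bottom. -/
lemma ζ_le_of_notMem {t t₁ : ℝ} (ht₁ : t₁ ∉ Ioo (C.z₀.2 - D.S₂) (C.z₀.2 + D.S₂)) (h₀_nonneg : 0 ≤ h₀) :
    ζ t ≤ 3 / (D.S₂ - D.S₁) * |t - t₁| := by
  have h1 : ζ t₁ = 0 := image_eq_zero_of_notMem_tsupport fun h => ht₁
    ⟨by linarith [(hηζ.ζ_supp h).1], by linarith [(hηζ.ζ_supp h).2]⟩
  have := Convex.norm_image_sub_le_of_norm_deriv_le (s := univ) (f := ζ)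
    (fun x _ => (hηζ.ζ_smooth.differentiable (by simp)) x) (fun x _ => hηζ.ζ_deriv x)
    convex_univ (mem_univ t₁) (mem_univ t)
  rw [h1, sub_zero] at this
  exact (le_abs_self _).trans this

end Cutoff

end Config

lemma dx_eq_zero_of_notMem_tsupport {n : ℕ} {φ : SpaceTime n → ℝ} (hφ : ContDiff ℝ ∞ φ) (k : Fin n)
    {y : SpaceTime n} (hy : y ∉ tsupport φ) : dx k φ y = 0 := by
  rw [dx_eq_fderiv (hφ.differentiable (by simp) y), fderiv_of_notMem_tsupport ℝ hy]
  simp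

lemma dt_eq_zero_of_notMem_tsupport {n : ℕ} {φ : SpaceTime n → ℝ} (hφ : ContDiff ℝ ∞ φ)
    {y : SpaceTime n} (hy : y ∉ tsupport φ) : dt φ y = 0 := by
  rw [dt_eq_fderiv (hφ.differentiable (by simp) y), fderiv_of_notMem_tsupport ℝ hy]
  simp

lemma dx_smul_const {n : ℕ} {V : Type*} [NormedAddCommGroup V] [NormedSpace ℝ V]
    {φ : SpaceTime n → ℝ} (hφ : ContDiff ℝ ∞ φ) (e : V) (k : Fin n)
    (y : SpaceTime n) : dx k (fun y => φ y • e) y = dx k φ y • e := by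
  have hd : DifferentiableAt ℝ (fun x => φ (x, y.2)) y.1 :=
    (hasFDerivAt_slice_space (hφ.differentiable (by simp) y)).differentiableAt
  rw [dx, (hd.hasFDerivAt.smul_const e).fderiv]
  rfl

lemma dt_smul_const {n : ℕ} {V : Type*} [NormedAddCommGroup V] [NormedSpace ℝ V]
    {φ : SpaceTime n → ℝ} (hφ : ContDiff ℝ ∞ φ) (e : V)
    (y : SpaceTime n) : dt (fun y => φ y • e) y = dt φ y • e := by
  have hd : DifferentiableAt ℝ (fun τ => φ (y.1, τ)) y.2 :=
    (hasDerivAt_slice_time (hφ.differentiable (by simp) y)).differentiableAt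
  rw [dt, (hd.hasDerivAt.smul_const e).deriv]
  rfl

/-! ### The system in the cylinder `U` -/

namespace Config
variable {n N : ℕ} {D : Data} (C : Config n N D)

/-- `χ_U (u - u₀)`. -/
noncomputable def uU : SpaceTime n → Space N := C.U.indicator fun z => C.u z - C.u₀

/-- `χ_U ∇u`. -/
noncomputable def DuU : SpaceTime n → Mat N n := C.U.indicator C.Du

/-- `χ_U 𝒜(z, u, ∇u)`. -/
noncomputable def fluxA : SpaceTime n → Mat N n := C.U.indicator fun z => C.𝒜 z (C.u z) (C.Du z)

/-- `χ_U ℬ(z, F)`. -/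
noncomputable def fluxB : SpaceTime n → Mat N n := C.U.indicator fun z => C.ℬ z (C.F z)

end Config

namespace IsLevel
variable {n N : ℕ} {D : Data} {C : Config n N D} {Λ : ℝ} (hL : IsLevel C Λ)
include hL

/-- Averages of the integrand over cylinders meeting the good set. -/
lemma lintegral_dens_le {z e : SpaceTime n} {ρ τ : ℝ} (hρ : 0 < ρ) (hτ : 0 < τ)
    (he : e ∈ cyl z ρ τ) (heE : e ∈ C.good Λ) :
    ∫⁻ y in cyl z ρ τ, ENNReal.ofReal (C.dens y)
      ≤ ENNReal.ofReal (Λ ^ (D.d / D.p)) * volume (cyl z ρ τ) := by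
  have h : C.maxF e ≤ ENNReal.ofReal (Λ ^ (D.d / D.p)) := heE
  have h1 : ⨍⁻ y in cyl z ρ τ, ENNReal.ofReal |C.dens y| ∂volume ≤ C.maxF e := by
    unfold Config.maxF strongMax
    exact le_iSup_of_le z (le_iSup_of_le ρ (le_iSup_of_le τ (le_iSup_of_le hρ (le_iSup_of_le hτ
      (le_iSup_of_le he le_rfl)))))
  have h2 := h1.trans h
  have hu := unitVol_pos n
  have hv : volume (cyl z ρ τ) ≠ ⊤ := by rw [volume_cyl z hρ]; exact ENNReal.ofReal_ne_top
  have hv0 : volume (cyl z ρ τ) ≠ 0 := by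
    rw [volume_cyl z hρ]; simpa using (by positivity : 0 < unitVol n * ρ ^ n * (2 * τ))
  rw [setLAverage_eq, ENNReal.div_le_iff hv0 hv] at h2
  refine le_trans (lintegral_mono fun y => ?_) h2
  exact ENNReal.ofReal_le_ofReal (le_abs_self _)

lemma f_le (y : SpaceTime n) : C.f y ≤ 1 + C.dens y := by
  have h := hL.adm.rpow_le_one_add (Config.f_nonneg (C := C) y) zero_le_one hL.adm.one_lt_d.le
  rw [Real.rpow_one] at h
  linarith [Config.rpow_d_le_dens (C := C) y]

lemma fluxF_le (y : SpaceTime n) : C.fluxF y ≤ (1 + D.normA + D.normB) * (1 + C.dens y) := by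
  have ha := C.a_coeff.nonneg y
  have hb := C.b_coeff.nonneg y
  have hf := Config.f_nonneg (C := C) y
  refine (hL.adm.flux_le ha hb hf).trans ?_
  have h1 := C.a_coeff.le y
  have h2 := C.b_coeff.le y
  have h3 := Config.rpow_d_le_dens (C := C) y
  have h4 : 0 ≤ C.f y ^ D.d := Real.rpow_nonneg hf _
  gcongr
  · linarith [C.a_coeff.bound_nonneg, C.b_coeff.bound_nonneg]

lemma volume_U_ne_top : volume C.U ≠ ⊤ := by
  rw [Config.U, volume_cyl _ hL.adm.R₂_pos]; exact ENNReal.ofReal_ne_top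

lemma aestronglyMeasurable_f : AEStronglyMeasurable C.f := by
  have hm : volume.restrict C.U ≤ volume.restrict (C.Ω ×ˢ Ioo 0 C.T) :=
    Measure.restrict_mono Config.U_subset le_rfl
  refine (aestronglyMeasurable_indicator_iff Config.measurableSet_U).2 ?_
  exact ((C.Du_int.aestronglyMeasurable.mono_measure hm).norm.add
    ((C.u_int.aestronglyMeasurable.mono_measure hm).sub aestronglyMeasurable_const).norm).add
    (C.F_meas.mono_measure hm).norm

lemma aestronglyMeasurable_fluxF : AEStronglyMeasurable C.fluxF := by
  obtain ⟨h1, h2, h3⟩ := hL.adm.exponents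
  have hf := hL.aestronglyMeasurable_f
  have ha := (C.a_coeff.continuous hL.adm.α_pos).aestronglyMeasurable (μ := volume)
  have hb := (C.b_coeff.continuous hL.adm.β_pos).aestronglyMeasurable (μ := volume)
  have hpow : ∀ e : ℝ, 0 ≤ e → AEStronglyMeasurable fun y => C.f y ^ e := fun e he =>
    (Real.continuous_rpow_const he).comp_aestronglyMeasurable hf
  exact ((hpow _ (by linarith)).add (ha.mul (hpow _ (by linarith)))).add
    (hb.mul (hpow _ (by linarith)))

/-- A cylinder large enough to contain both `U` and one good point has finite mean, by the bound of
the maximal function at that point. -/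
lemma lintegral_U_dens_ne_top : ∫⁻ y in C.U, ENNReal.ofReal (C.dens y) ≠ ⊤ := by
  obtain ⟨e, he⟩ := hL.good_nonempty
  have hR := hL.adm.R₂_pos
  have hS := hL.adm.S₂_pos
  have he' : e ∈ cyl C.z₀ (D.R₂ + ‖e.1 - C.z₀.1‖) (D.S₂ + |e.2 - C.z₀.2|) := by
    rw [mem_cyl]; constructor <;> linarith
  have h := hL.lintegral_dens_le (by positivity) (by positivity) he' he
  refine ne_top_of_le_ne_top ?_ ((lintegral_mono_set ?_).trans h)
  · rw [volume_cyl _ (by positivity)]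
    exact ENNReal.mul_ne_top ENNReal.ofReal_ne_top ENNReal.ofReal_ne_top
  · refine cyl_subset_cyl ?_ ?_ <;> simp

omit hL in
lemma _root_.MultiPhase.Config.f_eq_zero {y : SpaceTime n} (hy : y ∉ C.U) : C.f y = 0 :=
  indicator_of_notMem hy _

lemma fluxF_eq_zero {y : SpaceTime n} (hy : y ∉ C.U) : C.fluxF y = 0 := by
  obtain ⟨h1, h2, h3⟩ := hL.adm.exponents
  rw [Config.fluxF, Config.f_eq_zero hy, Data.flux, Real.zero_rpow (by linarith),
    Real.zero_rpow (by linarith), Real.zero_rpow (by linarith)]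
  simp

lemma integrable_of_le_dens {g : SpaceTime n → ℝ} (hg : AEStronglyMeasurable g) {c : ℝ}
    (hc : 0 ≤ c) (h0 : ∀ y, 0 ≤ g y) (hU : ∀ y ∉ C.U, g y = 0) (h : ∀ y, g y ≤ c * (1 + C.dens y)) :
    Integrable g := by
  refine ⟨hg, lt_top_iff_ne_top.2 (ne_top_of_le_ne_top (b := ENNReal.ofReal c *
    (volume C.U + ∫⁻ y in C.U, ENNReal.ofReal (C.dens y))) ?_ ?_)⟩
  · exact ENNReal.mul_ne_top ENNReal.ofReal_ne_top
      (ENNReal.add_ne_top.2 ⟨hL.volume_U_ne_top, hL.lintegral_U_dens_ne_top⟩)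
  · calc ∫⁻ y, ‖g y‖ₑ = ∫⁻ y in C.U, ‖g y‖ₑ := by
          rw [← lintegral_indicator Config.measurableSet_U]
          refine lintegral_congr fun y => ?_
          by_cases hy : y ∈ C.U
          · rw [indicator_of_mem hy]
          · rw [indicator_of_notMem hy, hU y hy, enorm_zero]
      _ ≤ ∫⁻ y in C.U, ENNReal.ofReal c * (1 + ENNReal.ofReal (C.dens y)) := by
          refine lintegral_mono fun y => ?_
          rw [Real.enorm_of_nonneg (h0 y), ← ENNReal.ofReal_one, ← ENNReal.ofReal_add zero_le_one
            (Config.dens_nonneg y), ← ENNReal.ofReal_mul hc]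
          exact ENNReal.ofReal_le_ofReal (h y)
      _ = _ := by
          rw [lintegral_const_mul' _ _ ENNReal.ofReal_ne_top, lintegral_add_left measurable_const,
            setLIntegral_one]

lemma integrable_f : Integrable C.f :=
  hL.integrable_of_le_dens hL.aestronglyMeasurable_f zero_le_one (fun y => Config.f_nonneg y)
    (fun _ hy => Config.f_eq_zero hy) fun y => by rw [one_mul]; exact hL.f_le y

lemma integrable_fluxF : Integrable C.fluxF :=
  hL.integrable_of_le_dens hL.aestronglyMeasurable_fluxF
    (by linarith [C.a_coeff.bound_nonneg, C.b_coeff.bound_nonneg]) (fun y => Config.fluxF_nonneg y)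
    (fun _ hy => hL.fluxF_eq_zero hy) hL.fluxF_le

lemma norm_uU_le (y : SpaceTime n) : ‖C.uU y‖ ≤ C.f y := by
  by_cases hy : y ∈ C.U
  · simp only [Config.uU, Config.f, indicator_of_mem hy]
    linarith [norm_nonneg (C.Du y), norm_nonneg (C.F y)]
  · simp [Config.uU, Config.f, indicator_of_notMem hy]

lemma norm_DuU_le (y : SpaceTime n) : ‖C.DuU y‖ ≤ C.f y := by
  by_cases hy : y ∈ C.U
  · simp only [Config.DuU, Config.f, indicator_of_mem hy]
    linarith [norm_nonneg (C.u y - C.u₀), norm_nonneg (C.F y)]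
  · simp [Config.DuU, Config.f, indicator_of_notMem hy]

lemma L_pos : 0 < D.L := hL.adm.ν_pos.trans_le hL.adm.ν_le

omit hL in
lemma _root_.MultiPhase.ae_restrict_U {P : SpaceTime n → Prop}
    (h : ∀ᵐ y ∂(volume.restrict (C.Ω ×ˢ Ioo 0 C.T)), P y) : ∀ᵐ y, y ∈ C.U → P y :=
  (ae_restrict_iff' Config.measurableSet_U).1 (ae_restrict_of_ae_restrict_of_subset Config.U_subset h)

lemma norm_fluxA_le : ∀ᵐ y, ‖C.fluxA y‖ ≤ D.L * C.fluxF y := by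
  filter_upwards [ae_restrict_U C.𝒜_car.cont] with y hc
  by_cases hy : y ∈ C.U
  · have ha := C.a_coeff.nonneg y
    have hb := C.b_coeff.nonneg y
    have h := hL.adm.norm_le_flux (T := fun ξ => C.𝒜 y (C.u y) ξ)
      ((hc hy).comp (by fun_prop : Continuous fun ξ : Mat N n => (C.u y, ξ))) id hL.L_pos.le ha hb
      (fun ξ => C.𝒜_growth y (Config.U_subset hy) _ ξ) (C.Du y)
    rw [Config.fluxA, indicator_of_mem hy]
    refine h.trans ?_
    have := hL.L_pos
    have h2 := hL.norm_DuU_le y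
    rw [Config.DuU, indicator_of_mem hy] at h2
    exact mul_le_mul_of_nonneg_left (hL.adm.flux_mono ha hb (norm_nonneg _) h2) this.le
  · rw [Config.fluxA, indicator_of_notMem hy, norm_zero]
    exact mul_nonneg hL.L_pos.le (Config.fluxF_nonneg y)

lemma norm_fluxB_le : ∀ᵐ y, ‖C.fluxB y‖ ≤ D.L * C.fluxF y := by
  filter_upwards [ae_restrict_U C.ℬ_car.cont] with y hc
  by_cases hy : y ∈ C.U
  · have ha := C.a_coeff.nonneg y
    have hb := C.b_coeff.nonneg y
    have h := hL.adm.norm_le_flux (hc hy) id hL.L_pos.le ha hb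
      (fun ξ => C.ℬ_growth y (Config.U_subset hy) ξ) (C.F y)
    rw [Config.fluxB, indicator_of_mem hy]
    refine h.trans ?_
    have := hL.L_pos
    have h2 : ‖C.F y‖ ≤ C.f y := by
      rw [Config.f, indicator_of_mem hy]
      linarith [norm_nonneg (C.Du y), norm_nonneg (C.u y - C.u₀)]
    exact mul_le_mul_of_nonneg_left (hL.adm.flux_mono ha hb (norm_nonneg _) h2) this.le
  · rw [Config.fluxB, indicator_of_notMem hy, norm_zero]
    exact mul_nonneg hL.L_pos.le (Config.fluxF_nonneg y)

lemma integrable_uU : Integrable C.uU := by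
  refine (integrable_indicator_iff Config.measurableSet_U).2 ((C.u_int.mono_set
    Config.U_subset).sub (integrableOn_const hL.volume_U_ne_top))

lemma integrable_DuU : Integrable C.DuU :=
  (integrable_indicator_iff Config.measurableSet_U).2 (C.Du_int.mono_set Config.U_subset)

lemma integrable_fluxA : Integrable C.fluxA := by
  have hm : volume.restrict C.U ≤ volume.restrict (C.Ω ×ˢ Ioo 0 C.T) :=
    Measure.restrict_mono Config.U_subset le_rfl
  refine (hL.integrable_fluxF.const_mul D.L).mono' ?_ hL.norm_fluxA_le
  refine (aestronglyMeasurable_indicator_iff Config.measurableSet_U).2 ?_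
  exact (aestronglyMeasurable_caratheodory C.𝒜_car.meas C.𝒜_car.cont
    (C.u_int.aestronglyMeasurable.prodMk C.Du_int.aestronglyMeasurable)).mono_measure hm

lemma integrable_fluxB : Integrable C.fluxB := by
  have hm : volume.restrict C.U ≤ volume.restrict (C.Ω ×ˢ Ioo 0 C.T) :=
    Measure.restrict_mono Config.U_subset le_rfl
  refine (hL.integrable_fluxF.const_mul D.L).mono' ?_ hL.norm_fluxB_le
  refine (aestronglyMeasurable_indicator_iff Config.measurableSet_U).2 ?_
  exact (aestronglyMeasurable_caratheodory C.ℬ_car.meas C.ℬ_car.cont C.F_meas).mono_measure hm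

/-- The system in the cylinder `U`, componentwise. -/
lemma weakPair (j : Fin N) : WeakPair C.U (fun y => C.uU y j) (fun k y => C.DuU y (j, k))
    (fun k y => C.fluxA y (j, k) - C.fluxB y (j, k)) 0 := by
  have mulb : ∀ {f g : SpaceTime n → ℝ}, Integrable f → Continuous g → HasCompactSupport g →
      Integrable fun y => f y * g y := by
    intro f g hf hg hgc
    obtain ⟨c, hc⟩ := hg.bounded_above_of_compact_support hgc
    exact hf.mul_bdd (c := c) hg.aestronglyMeasurable (Eventually.of_forall hc)
  have iu : Integrable fun y => C.uU y j := hL.integrable_uU.eval_piLp j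
  have iA : ∀ k, Integrable fun y => C.fluxA y (j, k) := fun k => hL.integrable_fluxA.eval_piLp (j, k)
  have iB : ∀ k, Integrable fun y => C.fluxB y (j, k) := fun k => hL.integrable_fluxB.eval_piLp (j, k)
  refine ⟨iu, fun k => hL.integrable_DuU.eval_piLp (j, k), fun k => (iA k).sub (iB k),
    integrable_zero _ _ _, fun φ hφ hc hs k => ?_, fun φ hφ hc hs => ?_⟩
  · have hz : ∀ y ∉ C.U, φ y = 0 := fun y hy => image_eq_zero_of_notMem_tsupport fun h => hy (hs h)
    have hdz : ∀ y ∉ C.U, dx k φ y = 0 := fun y hy =>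
      dx_eq_zero_of_notMem_tsupport hφ k fun h => hy (hs h)
    have h := C.u_grad.2.2 φ hφ hc (hs.trans Config.U_subset) j k
    have hdx : Continuous (dx k φ) := continuous_dx (hφ.of_le (by simp)) k
    have hdxc := hasCompactSupport_dx hφ hc k
    -- Subtracting the constant `u₀` is harmless, because derivatives of compactly supported
    -- functions have integral zero.
    have e1 : ∀ y, C.u y j * dx k φ y = C.uU y j * dx k φ y + C.u₀ j * dx k φ y := by
      intro y
      by_cases hy : y ∈ C.U
      · rw [Config.uU, indicator_of_mem hy, PiLp.sub_apply]; ring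
      · rw [hdz y hy]; ring
    have e2 : ∀ y, C.Du y (j, k) * φ y = C.DuU y (j, k) * φ y := by
      intro y
      by_cases hy : y ∈ C.U
      · rw [Config.DuU, indicator_of_mem hy]
      · rw [hz y hy]; ring
    rw [setIntegral_eq_integral_of_forall_compl_eq_zero fun y hy => by
        rw [hdz y fun h => hy (Config.U_subset h), mul_zero],
      setIntegral_eq_integral_of_forall_compl_eq_zero fun y hy => by
        rw [hz y fun h => hy (Config.U_subset h), mul_zero]] at h
    simp_rw [e1, e2] at h
    rw [integral_add (mulb iu hdx hdxc) ((hdx.integrable_of_hasCompactSupport hdxc).const_mul _),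
      integral_const_mul, integral_dx_eq_zero hφ hc, mul_zero, add_zero] at h
    exact h
  · have hdz : ∀ k, ∀ y ∉ C.U, dx k φ y = 0 := fun k y hy =>
      dx_eq_zero_of_notMem_tsupport hφ k fun h => hy (hs h)
    have hdtz : ∀ y ∉ C.U, dt φ y = 0 := fun y hy =>
      dt_eq_zero_of_notMem_tsupport hφ fun h => hy (hs h)
    have hdt : Continuous (dt φ) := continuous_dt (hφ.of_le (by simp))
    have hdtc := hasCompactSupport_dt hφ hc
    have hdx := fun k => continuous_dx (hφ.of_le (by simp)) k
    have hdxc := fun k => hasCompactSupport_dx hφ hc k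
    -- The test function `φ e_j` isolates the `j`-th equation of the system.
    have h := C.weak (fun y => φ y • EuclideanSpace.single j 1) (hφ.smul contDiff_const)
      hc.smul_right ((tsupport_smul_subset_left φ _).trans (hs.trans Config.U_subset))
    have ig : ∀ (M : Mat N n) (y : SpaceTime n),
        inner ℝ M (grad (fun y => φ y • EuclideanSpace.single j (1 : ℝ)) y)
          = ∑ k, M (j, k) * dx k φ y := by
      intro M y
      rw [PiLp.inner_apply, Fintype.sum_prod_type, Finset.sum_eq_single j]
      · refine Finset.sum_congr rfl fun k _ => ?_
        simp only [grad, dx_smul_const hφ]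
        simp [mul_comm]
      · intro i _ hi
        refine Finset.sum_eq_zero fun k _ => ?_
        simp only [grad, dx_smul_const hφ]
        simp [hi]
      · simp
    have it : ∀ y, inner ℝ (C.u y) (dt (fun y => φ y • EuclideanSpace.single j (1 : ℝ)) y)
        = C.u y j * dt φ y := by
      intro y
      rw [dt_smul_const hφ, inner_smul_right, EuclideanSpace.inner_single_right]
      simp [mul_comm]
    simp_rw [ig, it] at h
    have e1 : ∀ y, -(C.u y j * dt φ y) + ∑ k, C.𝒜 y (C.u y) (C.Du y) (j, k) * dx k φ y
        = -(C.uU y j * dt φ y) - C.u₀ j * dt φ y + ∑ k, C.fluxA y (j, k) * dx k φ y := by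
      intro y
      by_cases hy : y ∈ C.U
      · rw [Config.uU, Config.fluxA, indicator_of_mem hy, indicator_of_mem hy, PiLp.sub_apply]; ring
      · simp [hdtz y hy, hdz _ y hy]
    have e2 : ∀ y, ∑ k, C.ℬ y (C.F y) (j, k) * dx k φ y = ∑ k, C.fluxB y (j, k) * dx k φ y := by
      intro y
      by_cases hy : y ∈ C.U
      · rw [Config.fluxB, indicator_of_mem hy]
      · simp [hdz _ y hy]
    rw [setIntegral_eq_integral_of_forall_compl_eq_zero fun y hy => by
        have hy' : y ∉ C.U := fun h => hy (Config.U_subset h)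
        simp [hdtz y hy', hdz _ y hy'],
      setIntegral_eq_integral_of_forall_compl_eq_zero fun y hy => by
        have hy' : y ∉ C.U := fun h => hy (Config.U_subset h)
        simp [hdz _ y hy']] at h
    simp_rw [e1, e2] at h
    have j1 : Integrable fun y => C.uU y j * dt φ y := mulb iu hdt hdtc
    have j2 : Integrable fun y => C.u₀ j * dt φ y :=
      (hdt.integrable_of_hasCompactSupport hdtc).const_mul _
    have j3 : ∀ k, Integrable fun y => C.fluxA y (j, k) * dx k φ y := fun k =>
      mulb (iA k) (hdx k) (hdxc k)
    have j4 : ∀ k, Integrable fun y => C.fluxB y (j, k) * dx k φ y := fun k =>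
      mulb (iB k) (hdx k) (hdxc k)
    have j6 : Integrable fun y => -(C.uU y j * dt φ y) := j1.neg
    have j5 : Integrable fun y => -(C.uU y j * dt φ y) - C.u₀ j * dt φ y := j6.sub j2
    rw [integral_add j5 (integrable_finsetSum _ fun k _ => j3 k), integral_sub j6 j2,
      integral_neg, integral_const_mul, integral_dt_eq_zero hφ hc,
      integral_finsetSum _ fun k _ => j3 k, integral_finsetSum _ fun k _ => j4 k] at h
    simp_rw [sub_mul]
    rw [Finset.sum_congr rfl fun k _ => integral_sub (j3 k) (j4 k), Finset.sum_sub_distrib]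
    simp only [Pi.zero_apply, zero_mul, integral_zero, sub_zero]
    linarith

end IsLevel

/-! ### Poincaré estimates for localized functions -/

section Averages
variable {n N : ℕ}

lemma enorm_le_sum {x : Space N} : ‖x‖ₑ ≤ ∑ j, ‖x j‖ₑ := by
  have h : ‖x‖ ≤ ∑ j, ‖x j‖ := by
    rw [EuclideanSpace.norm_eq]
    refine Real.sqrt_le_iff.2 ⟨Finset.sum_nonneg fun _ _ => norm_nonneg _, ?_⟩
    exact Finset.sum_sq_le_sq_sum_of_nonneg fun _ _ => norm_nonneg _
  simp_rw [← ofReal_norm]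
  rw [← ENNReal.ofReal_sum_of_nonneg fun _ _ => norm_nonneg _]
  exact ENNReal.ofReal_le_ofReal h

/-- Multiplied by the measure of `Q`, the deviation from the mean is the integral of `w(y) - w(x)`
over `x` in `Q`. -/
lemma lintegral_sub_mean_mul_le {α V : Type*} [MeasurableSpace α] {μ : Measure α}
    [NormedAddCommGroup V] [NormedSpace ℝ V] [CompleteSpace V] {w : α → V} {Q : Set α}
    (hQ : μ Q ≠ ⊤) (hQ0 : μ Q ≠ 0) (hw : IntegrableOn w Q μ) :
    (∫⁻ y in Q, ‖w y - ⨍ x in Q, w x ∂μ‖ₑ ∂μ) * μ Q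
      ≤ ∫⁻ y in Q, ∫⁻ y' in Q, ‖w y - w y'‖ₑ ∂μ ∂μ := by
  rw [← lintegral_mul_const' _ _ hQ]
  refine lintegral_mono fun y => ?_
  have hpos : 0 < μ.real Q := ENNReal.toReal_pos hQ0 hQ
  have e : μ.real Q • (w y - ⨍ x in Q, w x ∂μ) = ∫ x in Q, (w y - w x) ∂μ := by
    have hcst : Integrable (fun _ => w y) (μ.restrict Q) := integrableOn_const hQ
    rw [integral_sub hcst hw, setIntegral_const, smul_sub, setAverage_eq,
      smul_inv_smul₀ hpos.ne']
  calc ‖w y - ⨍ x in Q, w x ∂μ‖ₑ * μ Q = ‖μ.real Q • (w y - ⨍ x in Q, w x ∂μ)‖ₑ := by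
        rw [enorm_smul, Real.enorm_of_nonneg hpos.le, measureReal_def, ENNReal.ofReal_toReal hQ,
          mul_comm]
    _ ≤ _ := by
        rw [e]
        exact enorm_integral_le_lintegral_enorm _

/-- Where `w` vanishes, `w(y) = w(y) - w(y')`. So on a set of substantial measure where `w = 0`, the
double integral controls `w` itself, without subtracting a mean. -/
lemma lintegral_mul_volume_zero_le {α V : Type*} [MeasurableSpace α] {μ : Measure α}
    [NormedAddCommGroup V] {w : α → V} {Q Z P : Set α} (hZ : MeasurableSet Z)
    (hZtop : μ Z ≠ ⊤) (hQP : Q ⊆ P) (hZP : Z ⊆ P)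
    (h0 : ∀ᵐ y ∂μ, y ∈ Z → w y = 0) :
    (∫⁻ y in Q, ‖w y‖ₑ ∂μ) * μ Z ≤ ∫⁻ y in P, ∫⁻ y' in P, ‖w y - w y'‖ₑ ∂μ ∂μ := by
  rw [← lintegral_mul_const' _ _ hZtop]
  refine (lintegral_mono_set hQP).trans (lintegral_mono fun y => ?_)
  calc ‖w y‖ₑ * μ Z = ∫⁻ _ in Z, ‖w y‖ₑ ∂μ := (setLIntegral_const _ _).symm
    _ = ∫⁻ y' in Z, ‖w y - w y'‖ₑ ∂μ := by
        refine lintegral_congr_ae ((ae_restrict_iff' hZ).2 (h0.mono fun y' hy' hz => ?_))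
        dsimp only
        rw [hy' hz, sub_zero]
    _ ≤ _ := lintegral_mono_set hZP

/-- A function with weak gradient and weak time derivative controlled by two majorants,
localized by a cutoff function. -/
structure IsLocalized (w : SpaceTime n → Space N) (χ m₁ m₂ : SpaceTime n → ℝ) (c : ℝ) : Prop where
  c_nonneg : 0 ≤ c
  int_w : Integrable w
  int₁ : Integrable m₁
  pair : ∀ j : Fin N, ∃ G S g, WeakPair univ (fun y => w y j) G S g ∧
    (∀ k, ∀ᵐ y, ‖G k y‖ ≤ c * m₁ y) ∧ (∀ k, ∀ᵐ y, ‖S k y‖ ≤ c * m₂ y) ∧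
    ∀ᵐ y, ‖g y‖ ≤ c * (m₁ y + m₂ y)
  norm_le : ∀ᵐ y, ‖w y‖ ≤ |χ y| * m₁ y

lemma lintegral_enorm_le_of_norm_le {α : Type*} [MeasurableSpace α] {μ : Measure α} {f m : α → ℝ}
    {c : ℝ} (hc : 0 ≤ c) (h : ∀ᵐ y ∂μ, ‖f y‖ ≤ c * m y) (Q : Set α) :
    ∫⁻ y in Q, ‖f y‖ₑ ∂μ ≤ ENNReal.ofReal c * ∫⁻ y in Q, ‖m y‖ₑ ∂μ := by
  rw [← lintegral_const_mul' _ _ ENNReal.ofReal_ne_top]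
  refine lintegral_mono_ae (ae_restrict_of_ae (h.mono fun y hy => ?_))
  rw [← ofReal_norm, ← ofReal_norm, ← ENNReal.ofReal_mul hc]
  refine ENNReal.ofReal_le_ofReal (hy.trans ?_)
  gcongr
  exact le_abs_self _

lemma exists_poincare_localized (n N : ℕ) : ∃ c₀ : ℝ, 0 < c₀ ∧
    ∀ (w : SpaceTime n → Space N) (χ m₁ m₂ : SpaceTime n → ℝ) (c : ℝ), IsLocalized w χ m₁ m₂ c →
      ∀ (z : SpaceTime n) (ρ τ : ℝ), 0 < ρ → 0 < τ →
      ∫⁻ y in cyl z ρ τ, ∫⁻ y' in cyl z ρ τ, ‖w y - w y'‖ₑ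
        ≤ ENNReal.ofReal (c₀ * c) * volume (cyl z ρ τ) *
          (ENNReal.ofReal (ρ + τ) * (∫⁻ y in cyl z (2 * ρ) (2 * τ), ‖m₁ y‖ₑ)
            + ENNReal.ofReal (τ / ρ + τ) * ∫⁻ y in cyl z (2 * ρ) (2 * τ), ‖m₂ y‖ₑ) := by
  obtain ⟨c₀, hc₀, H⟩ := exists_weak_poincare n
  refine ⟨c₀ * (N + 1) * (n + 1), by positivity, fun w χ m₁ m₂ c hw z ρ τ hρ hτ => ?_⟩
  have hc := hw.c_nonneg
  set Q := cyl z ρ τ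
  set Q' := cyl z (2 * ρ) (2 * τ)
  set N₁ := ∫⁻ y in Q', ‖m₁ y‖ₑ
  set N₂ := ∫⁻ y in Q', ‖m₂ y‖ₑ
  have hwm := hw.int_w.aestronglyMeasurable
  have hjm : ∀ j, AEStronglyMeasurable (fun y => w y j) (volume.restrict Q) := fun j =>
    (hw.int_w.eval_piLp j).aestronglyMeasurable.restrict
  have hjoint : ∀ j, AEMeasurable (fun q : SpaceTime n × SpaceTime n => ‖w q.1 j - w q.2 j‖ₑ)
      ((volume.restrict Q).prod (volume.restrict Q)) := fun j =>
    ((hjm j).comp_fst.sub (hjm j).comp_snd).enorm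
  have hj : ∀ j : Fin N, ∫⁻ y in Q, ∫⁻ y' in Q, ‖w y j - w y' j‖ₑ ≤
      ENNReal.ofReal (c₀ * c * (n + 1)) * volume Q *
        (ENNReal.ofReal (ρ + τ) * N₁ + ENNReal.ofReal (τ / ρ + τ) * N₂) := by
    intro j
    obtain ⟨G, S, g, hp, hG, hS, hg⟩ := hw.pair j
    refine (H _ _ _ _ hp z ρ τ hρ hτ).trans ?_
    have h1 : ∑ k, ∫⁻ y in Q', ‖G k y‖ₑ ≤ ENNReal.ofReal (n * c) * N₁ := by
      refine (Finset.sum_le_sum fun k _ => lintegral_enorm_le_of_norm_le hc (hG k) Q').trans ?_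
      rw [Finset.sum_const, Finset.card_univ, Fintype.card_fin, nsmul_eq_mul,
        ENNReal.ofReal_mul (by positivity), ENNReal.ofReal_natCast, mul_assoc]
    have h2 : ∑ k, ∫⁻ y in Q', ‖S k y‖ₑ ≤ ENNReal.ofReal (n * c) * N₂ := by
      refine (Finset.sum_le_sum fun k _ => lintegral_enorm_le_of_norm_le hc (hS k) Q').trans ?_
      rw [Finset.sum_const, Finset.card_univ, Fintype.card_fin, nsmul_eq_mul,
        ENNReal.ofReal_mul (by positivity), ENNReal.ofReal_natCast, mul_assoc]
    have h3 : ∫⁻ y in Q', ‖g y‖ₑ ≤ ENNReal.ofReal c * (N₁ + N₂) := by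
      refine (lintegral_enorm_le_of_norm_le hc hg Q').trans (mul_le_mul_right ?_ _)
      refine (lintegral_mono fun y => enorm_add_le _ _).trans (le_of_eq ?_)
      exact lintegral_add_left' hw.int₁.aestronglyMeasurable.enorm.restrict _
    calc _ ≤ ENNReal.ofReal c₀ * volume Q *
          ((ENNReal.ofReal ρ * (ENNReal.ofReal (n * c) * N₁))
            + (ENNReal.ofReal (τ / ρ) * (ENNReal.ofReal (n * c) * N₂))
            + ENNReal.ofReal τ * (ENNReal.ofReal c * (N₁ + N₂))) :=
          mul_le_mul_right (add_le_add (add_le_add (mul_le_mul_right h1 _) (mul_le_mul_right h2 _))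
            (mul_le_mul_right h3 _)) _
      _ ≤ ENNReal.ofReal c₀ * volume Q *
          ((ENNReal.ofReal ρ * (ENNReal.ofReal ((n + 1) * c) * N₁))
            + (ENNReal.ofReal (τ / ρ) * (ENNReal.ofReal ((n + 1) * c) * N₂))
            + ENNReal.ofReal τ * (ENNReal.ofReal ((n + 1) * c) * (N₁ + N₂))) := by
          have a1 : ENNReal.ofReal (n * c) ≤ ENNReal.ofReal ((n + 1) * c) :=
            ENNReal.ofReal_le_ofReal (by nlinarith)
          have a2 : ENNReal.ofReal c ≤ ENNReal.ofReal ((n + 1) * c) :=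
            ENNReal.ofReal_le_ofReal (by nlinarith [(Nat.cast_nonneg n : (0 : ℝ) ≤ n)])
          exact mul_le_mul_right (add_le_add (add_le_add
            (mul_le_mul_right (mul_le_mul_left a1 _) _) (mul_le_mul_right (mul_le_mul_left a1 _) _))
            (mul_le_mul_right (mul_le_mul_left a2 _) _)) _
      _ = _ := by
          rw [show c₀ * c * (n + 1) = c₀ * ((n + 1) * c) by ring, ENNReal.ofReal_mul hc₀.le,
            ENNReal.ofReal_add hρ.le hτ.le, ENNReal.ofReal_add (by positivity) hτ.le]
          ring
  calc ∫⁻ y in Q, ∫⁻ y' in Q, ‖w y - w y'‖ₑ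
      ≤ ∫⁻ y in Q, ∫⁻ y' in Q, ∑ j, ‖w y j - w y' j‖ₑ :=
        lintegral_mono fun y => lintegral_mono fun y' => enorm_le_sum
    _ = ∫⁻ y in Q, ∑ j, ∫⁻ y' in Q, ‖w y j - w y' j‖ₑ := by
        refine lintegral_congr fun y => lintegral_finsetSum' _ fun j _ => ?_
        exact (aestronglyMeasurable_const.sub (hjm j)).enorm
    _ = ∑ j, ∫⁻ y in Q, ∫⁻ y' in Q, ‖w y j - w y' j‖ₑ :=
        lintegral_finsetSum' _ fun j _ => (hjoint j).lintegral_prod_right'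
    _ ≤ ∑ _j : Fin N, ENNReal.ofReal (c₀ * c * (n + 1)) * volume Q *
        (ENNReal.ofReal (ρ + τ) * N₁ + ENNReal.ofReal (τ / ρ + τ) * N₂) :=
        Finset.sum_le_sum fun j _ => hj j
    _ = ENNReal.ofReal (N * (c₀ * c * (n + 1))) * volume Q *
        (ENNReal.ofReal (ρ + τ) * N₁ + ENNReal.ofReal (τ / ρ + τ) * N₂) := by
        rw [Finset.sum_const, Finset.card_univ, Fintype.card_fin, nsmul_eq_mul,
          ENNReal.ofReal_mul (p := (N : ℝ)) (by positivity), ENNReal.ofReal_natCast]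
        ring
    _ ≤ _ := by
        refine mul_le_mul_left (mul_le_mul_left (ENNReal.ofReal_le_ofReal ?_) _) _
        have : 0 ≤ c₀ * c * (n + 1) := by positivity
        nlinarith

/-- Poincaré type estimate at a scale where the majorants have controlled averages. -/
lemma exists_poincare_localized_of_le (n N : ℕ) : ∃ c₀ : ℝ, 0 < c₀ ∧
    ∀ (w : SpaceTime n → Space N) (χ m₁ m₂ : SpaceTime n → ℝ) (c : ℝ), IsLocalized w χ m₁ m₂ c →
      ∀ (z : SpaceTime n) (σ ρ τ A R : ℝ), 1 ≤ σ → 0 < ρ → 0 < τ → 0 ≤ A → τ ≤ ρ ^ 2 → ρ ≤ R →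
      (∫⁻ y in cyl z (2 * (σ * ρ)) (2 * τ), ‖m₁ y‖ₑ) ≤ ENNReal.ofReal A * volume (cyl z ρ τ) →
      ENNReal.ofReal τ * (∫⁻ y in cyl z (2 * (σ * ρ)) (2 * τ), ‖m₂ y‖ₑ)
        ≤ ENNReal.ofReal (ρ ^ 2 * A) * volume (cyl z ρ τ) →
      ∫⁻ y in cyl z (σ * ρ) τ, ∫⁻ y' in cyl z (σ * ρ) τ, ‖w y - w y'‖ₑ
        ≤ ENNReal.ofReal (c₀ * c * (2 * σ * (1 + R)) * A * ρ) * volume (cyl z ρ τ)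
          * volume (cyl z (σ * ρ) τ) := by
  obtain ⟨c₀, hc₀, H⟩ := exists_poincare_localized n N
  refine ⟨c₀, hc₀, fun w χ m₁ m₂ c hw z σ ρ τ A R hσ hρ hτ hA hτρ hR h1 h2 => ?_⟩
  have hc := hw.c_nonneg
  have hσ0 : 0 < σ := by linarith
  refine (H w χ m₁ m₂ c hw z (σ * ρ) τ (by positivity) hτ).trans ?_
  set V := volume (cyl z ρ τ)
  set N₂ := ∫⁻ y in cyl z (2 * (σ * ρ)) (2 * τ), ‖m₂ y‖ₑ
  have b1 : ENNReal.ofReal (σ * ρ + τ) * (∫⁻ y in cyl z (2 * (σ * ρ)) (2 * τ), ‖m₁ y‖ₑ)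
      ≤ ENNReal.ofReal (σ * (1 + R) * A * ρ) * V := by
    refine (mul_le_mul_right h1 _).trans ?_
    rw [← mul_assoc, ← ENNReal.ofReal_mul (by positivity)]
    refine mul_le_mul_left (ENNReal.ofReal_le_ofReal ?_) _
    have h3 : σ * ρ + τ ≤ σ * (1 + R) * ρ := by nlinarith [mul_nonneg hρ.le (by linarith : 0 ≤ R - ρ), mul_nonneg (by linarith : 0 ≤ σ - 1) (mul_nonneg (by linarith : 0 ≤ R) hρ.le)]
    calc (σ * ρ + τ) * A ≤ σ * (1 + R) * ρ * A := by gcongr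
      _ = _ := by ring
  have b2 : ENNReal.ofReal (τ / (σ * ρ) + τ) * N₂ ≤ ENNReal.ofReal (σ * (1 + R) * A * ρ) * V := by
    have e : τ / (σ * ρ) + τ = (1 / (σ * ρ) + 1) * τ := by ring
    rw [e, ENNReal.ofReal_mul (by positivity), mul_assoc]
    refine (mul_le_mul_right h2 _).trans ?_
    rw [← mul_assoc, ← ENNReal.ofReal_mul (by positivity)]
    refine mul_le_mul_left (ENNReal.ofReal_le_ofReal ?_) _
    have h3 : 1 / (σ * ρ) + 1 ≤ 1 / ρ + 1 := by
      gcongr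
      exact le_mul_of_one_le_left hρ.le hσ
    calc (1 / (σ * ρ) + 1) * (ρ ^ 2 * A) ≤ (1 / ρ + 1) * (ρ ^ 2 * A) := by gcongr
      _ = (1 + ρ) * (A * ρ) := by field_simp
      _ ≤ σ * (1 + R) * (A * ρ) := by
          gcongr
          nlinarith
      _ = _ := by ring
  calc _ ≤ ENNReal.ofReal (c₀ * c) * volume (cyl z (σ * ρ) τ) *
        (ENNReal.ofReal (σ * (1 + R) * A * ρ) * V + ENNReal.ofReal (σ * (1 + R) * A * ρ) * V) :=
        mul_le_mul_right (add_le_add b1 b2) _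
    _ = _ := by
        have hR0 : 0 < 1 + R := by linarith
        rw [← add_mul, ← ENNReal.ofReal_add (by positivity) (by positivity),
          show c₀ * c * (2 * σ * (1 + R)) * A * ρ
            = (c₀ * c) * (σ * (1 + R) * A * ρ + σ * (1 + R) * A * ρ) by ring,
          ENNReal.ofReal_mul (by positivity : 0 ≤ c₀ * c)]
        ring

end Averages

/-- A point outside the ball around `x₀` is moved radially outwards by `ρ`; the ball of radius `ρ`
around the new point then stays outside. -/
lemma exists_ball_sub_of_le_norm {V : Type*} [NormedAddCommGroup V] [NormedSpace ℝ V] {x x₀ : V}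
    {ρ R : ℝ} (hρ : 0 < ρ) (hR : 0 < R) (h : R ≤ ‖x - x₀‖) :
    ∃ x', ‖x' - x‖ ≤ ρ ∧ ∀ y, ‖y - x'‖ < ρ → R ≤ ‖y - x₀‖ := by
  have h0 : 0 < ‖x - x₀‖ := hR.trans_le h
  refine ⟨x + (ρ / ‖x - x₀‖) • (x - x₀), ?_, fun y hy => ?_⟩
  · rw [add_sub_cancel_left, norm_smul, Real.norm_of_nonneg (by positivity), div_mul_cancel₀ _ h0.ne']
  · have e : x + (ρ / ‖x - x₀‖) • (x - x₀) - x₀ = (1 + ρ / ‖x - x₀‖) • (x - x₀) := by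
      rw [add_smul, one_smul]; abel
    have h1 : ‖x + (ρ / ‖x - x₀‖) • (x - x₀) - x₀‖ = ‖x - x₀‖ + ρ := by
      rw [e, norm_smul, Real.norm_of_nonneg (by positivity), add_mul, one_mul,
        div_mul_cancel₀ _ h0.ne']
    have h2 := norm_sub_le_norm_sub_add_norm_sub (x + (ρ / ‖x - x₀‖) • (x - x₀)) y x₀
    rw [norm_sub_rev _ y] at h2
    linarith

/-- Poincaré type estimate for the localized function, also near the boundary of `U`. -/
lemma exists_localMean_estimate (n N : ℕ) (D : Data) (hD : D.Admissible n) {c₁ R : ℝ}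
    (hc₁ : 0 ≤ c₁) (hR : 0 ≤ R) : ∃ c : ℝ, 0 ≤ c ∧
    ∀ (C : Config n N D) (h₀ : ℝ) (η : Space n → ℝ) (ζ : ℝ → ℝ), 0 ≤ h₀ → C.IsCutoffPair h₀ η ζ →
    ∀ (w : SpaceTime n → Space N) (m₁ m₂ : SpaceTime n → ℝ),
      IsLocalized w (Config.cut η ζ) m₁ m₂ c₁ →
    ∀ (z : SpaceTime n) (ρ τ A : ℝ) (m : Space N), 0 < ρ → ρ ≤ R → 0 < τ → τ ≤ ρ ^ 2 → 0 ≤ A →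
      (∫⁻ y in cyl z (6 * ρ) (6 * τ), ‖m₁ y‖ₑ) ≤ ENNReal.ofReal A * volume (cyl z ρ τ) →
      ENNReal.ofReal τ * (∫⁻ y in cyl z (6 * ρ) (6 * τ), ‖m₂ y‖ₑ)
        ≤ ENNReal.ofReal (ρ ^ 2 * A) * volume (cyl z ρ τ) →
      (cyl z ρ τ ⊆ C.U → m = ⨍ y in cyl z ρ τ, w y) → (¬ cyl z ρ τ ⊆ C.U → m = 0) →
      ∫⁻ y in cyl z ρ τ, ‖w y - m‖ₑ ≤ ENNReal.ofReal (c * A * ρ) * volume (cyl z ρ τ) := by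
  obtain ⟨c₀, hc₀, H⟩ := exists_poincare_localized_of_le n N
  have hS : 0 < D.S₂ - D.S₁ := by linarith [hD.S₁_lt]
  refine ⟨c₀ * c₁ * (2 * 3 * (1 + R)) * 3 ^ n + 6 * R / (D.S₂ - D.S₁), by positivity, ?_⟩
  intro C h₀ η ζ hh₀ hηζ w m₁ m₂ hw z ρ τ A m hρ hρR hτ hτρ hA h1 h2 hm hm0
  have hu := unitVol_pos n
  set V := volume (cyl z ρ τ) with hV
  have hVtop : V ≠ ⊤ := by rw [hV, volume_cyl z hρ]; exact ENNReal.ofReal_ne_top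
  have hV0 : V ≠ 0 := by
    rw [hV, volume_cyl z hρ]; simpa using (by positivity : 0 < unitVol n * ρ ^ n * (2 * τ))
  -- `σ` is used with the values 1 and 3. The Poincaré inequality doubles the cylinder, which
  -- explains the factor 6 in the hypotheses on the majorants.
  have key : ∀ σ : ℝ, 1 ≤ σ → σ ≤ 3 →
      ∫⁻ y in cyl z (σ * ρ) τ, ∫⁻ y' in cyl z (σ * ρ) τ, ‖w y - w y'‖ₑ
        ≤ ENNReal.ofReal (c₀ * c₁ * (2 * σ * (1 + R)) * A * ρ) * V * volume (cyl z (σ * ρ) τ) := by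
    intro σ hσ hσ3
    have hsub : cyl z (2 * (σ * ρ)) (2 * τ) ⊆ cyl z (6 * ρ) (6 * τ) := by
      refine cyl_subset_cyl ?_ ?_
      · simp only [sub_self, norm_zero, zero_add]; nlinarith
      · simp only [sub_self, abs_zero, zero_add]; linarith
    exact H w _ m₁ m₂ c₁ hw z σ ρ τ A R hσ hρ hτ hA hτρ hρR
      ((lintegral_mono_set hsub).trans h1)
      ((mul_le_mul_right (lintegral_mono_set hsub) _).trans h2)
  have cancel : ∀ {I X : ℝ≥0∞}, I * V ≤ X * V * V → I ≤ X * V := fun h =>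
    (ENNReal.mul_le_mul_iff_left hV0 hVtop).1 h
  -- Three cases: the cylinder lies in `U` and `m` is the mean; it leaves `U` in time, where `ζ` is
  -- small; or it leaves `U` in space, where `w` vanishes on a neighbouring cylinder of the same
  -- volume.
  by_cases hsub : cyl z ρ τ ⊆ C.U
  · rw [hm hsub]
    have k1 := key 1 le_rfl (by norm_num)
    rw [one_mul] at k1
    have k2 := cancel ((lintegral_sub_mean_mul_le hVtop hV0 hw.int_w.integrableOn).trans k1)
    refine k2.trans (mul_le_mul_left (ENNReal.ofReal_le_ofReal ?_) _)
    have : (1 : ℝ) ≤ 3 ^ n := one_le_pow₀ (by norm_num)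
    calc c₀ * c₁ * (2 * 1 * (1 + R)) * A * ρ ≤ c₀ * c₁ * (2 * 3 * (1 + R)) * 3 ^ n * A * ρ := by
          rw [mul_assoc _ A, mul_assoc _ A]
          refine mul_le_mul_of_nonneg_right ?_ (by positivity)
          have : 0 ≤ c₀ * c₁ * (1 + R) := by positivity
          calc c₀ * c₁ * (2 * 1 * (1 + R)) ≤ c₀ * c₁ * (2 * 3 * (1 + R)) * 1 := by linarith
            _ ≤ _ := by gcongr
      _ ≤ _ := by
          gcongr
          have : 0 ≤ 6 * R / (D.S₂ - D.S₁) := by positivity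
          linarith
  · rw [hm0 hsub]
    simp only [sub_zero]
    obtain ⟨y₁, hy₁, hyU⟩ := not_subset.1 hsub
    rw [mem_cyl] at hy₁
    by_cases hball : ‖y₁.1 - C.z₀.1‖ < D.R₂
    · have ht : y₁.2 ∉ Ioo (C.z₀.2 - D.S₂) (C.z₀.2 + D.S₂) := by
        intro ht
        apply hyU
        rw [Config.U, mem_cyl]
        exact ⟨hball, abs_lt.2 ⟨by linarith [ht.1], by linarith [ht.2]⟩⟩
      -- All times in the cylinder are within `2τ` of a time outside the interval of `U`, so the
      -- cutoff is at most `6τ / (S₂ - S₁)`, and `τ ≤ ρ² ≤ R ρ` supplies the factor `ρ`.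
      have hw1 : ∀ᵐ y, y ∈ cyl z ρ τ →
          ‖w y‖ₑ ≤ ENNReal.ofReal (6 * τ / (D.S₂ - D.S₁)) * ‖m₁ y‖ₑ := by
        filter_upwards [hw.norm_le] with y hy hyQ
        rw [mem_cyl] at hyQ
        have e1 := Config.ζ_le_of_notMem hηζ (t := y.2) ht hh₀
        have e2 : |y.2 - y₁.2| ≤ 2 * τ := by
          have := abs_sub_le y.2 z.2 y₁.2
          rw [abs_sub_comm z.2 y₁.2] at this
          linarith [hyQ.2, hy₁.2]
        have e3 : |Config.cut η ζ y| ≤ 6 * τ / (D.S₂ - D.S₁) := by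
          refine (Config.abs_cut_le hηζ y).trans (e1.trans ?_)
          calc 3 / (D.S₂ - D.S₁) * |y.2 - y₁.2| ≤ 3 / (D.S₂ - D.S₁) * (2 * τ) := by gcongr
            _ = _ := by ring
        rw [← ofReal_norm, ← ofReal_norm, ← ENNReal.ofReal_mul (by positivity)]
        refine ENNReal.ofReal_le_ofReal (hy.trans ?_)
        calc |Config.cut η ζ y| * m₁ y ≤ |Config.cut η ζ y| * ‖m₁ y‖ := by
              gcongr; exact le_abs_self _
          _ ≤ _ := by gcongr
      calc ∫⁻ y in cyl z ρ τ, ‖w y‖ₑ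
          ≤ ∫⁻ y in cyl z ρ τ, ENNReal.ofReal (6 * τ / (D.S₂ - D.S₁)) * ‖m₁ y‖ₑ :=
            lintegral_mono_ae ((ae_restrict_iff' (measurableSet_cyl _ _ _)).2 hw1)
        _ = ENNReal.ofReal (6 * τ / (D.S₂ - D.S₁)) * ∫⁻ y in cyl z ρ τ, ‖m₁ y‖ₑ :=
            lintegral_const_mul' _ _ ENNReal.ofReal_ne_top
        _ ≤ ENNReal.ofReal (6 * τ / (D.S₂ - D.S₁)) * (ENNReal.ofReal A * V) := by
            refine mul_le_mul_right ((lintegral_mono_set (cyl_subset_cyl ?_ ?_)).trans h1) _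
            · simp only [sub_self, norm_zero, zero_add]; linarith
            · simp only [sub_self, abs_zero, zero_add]; linarith
        _ = ENNReal.ofReal (6 * τ / (D.S₂ - D.S₁) * A) * V := by
            rw [← mul_assoc, ← ENNReal.ofReal_mul (by positivity)]
        _ ≤ _ := by
            refine mul_le_mul_left (ENNReal.ofReal_le_ofReal ?_) _
            calc 6 * τ / (D.S₂ - D.S₁) * A ≤ 6 * (R * ρ) / (D.S₂ - D.S₁) * A := by
                  have : τ ≤ R * ρ := by nlinarith
                  gcongr
              _ = 0 + 6 * R / (D.S₂ - D.S₁) * A * ρ := by ring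
              _ ≤ c₀ * c₁ * (2 * 3 * (1 + R)) * 3 ^ n * A * ρ
                  + 6 * R / (D.S₂ - D.S₁) * A * ρ := by gcongr; positivity
              _ = _ := by ring
    · rw [not_lt] at hball
      -- The cylinder `Z` over the ball pushed outside `B_{R₂}` is contained in the cylinder tripled
      -- in space. The volume of the latter is the origin of the factor `3 ^ n`.
      obtain ⟨x', hx', hx⟩ := exists_ball_sub_of_le_norm hρ hD.R₂_pos hball
      set Z := cyl (x', z.2) ρ τ with hZ
      have hVZ : volume Z = V := by rw [hZ, hV, volume_cyl _ hρ, volume_cyl _ hρ]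
      have hP : volume (cyl z (3 * ρ) τ) = ENNReal.ofReal (3 ^ n) * V := by
        rw [hV, volume_cyl _ (by positivity), volume_cyl _ hρ, ← ENNReal.ofReal_mul (by positivity)]
        congr 1; ring
      have hw0 : ∀ᵐ y, y ∈ Z → w y = 0 := by
        filter_upwards [hw.norm_le] with y hy hyZ
        rw [hZ, mem_cyl] at hyZ
        have h3 := hx y.1 hyZ.1
        have h4 : Config.cut η ζ y = 0 := by
          rw [Config.cut, image_eq_zero_of_notMem_tsupport (f := η), zero_mul]
          intro h5
          have := hηζ.η_supp h5
          rw [Metric.mem_ball, dist_eq_norm] at this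
          linarith
        rw [h4, abs_zero, zero_mul] at hy
        exact norm_le_zero_iff.1 hy
      have h3 := lintegral_mul_volume_zero_le (μ := volume) (w := w) (Q := cyl z ρ τ)
        (P := cyl z (3 * ρ) τ) (measurableSet_cyl _ _ _) (hVZ ▸ hVtop)
        (cyl_subset_cyl (by simp only [sub_self, norm_zero, zero_add]; linarith) (by simp))
        (cyl_subset_cyl (by
          have h5 := norm_sub_le_norm_sub_add_norm_sub x' y₁.1 z.1
          simp only
          linarith [hy₁.1]) (by simp)) hw0
      rw [hVZ] at h3
      have h4 := h3.trans (key 3 (by norm_num) le_rfl)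
      rw [hP, ← mul_assoc, mul_right_comm _ V, ← ENNReal.ofReal_mul (by positivity)] at h4
      refine (cancel h4).trans (mul_le_mul_left (ENNReal.ofReal_le_ofReal ?_) _)
      have : 0 ≤ 6 * R / (D.S₂ - D.S₁) * A * ρ := by positivity
      calc _ = c₀ * c₁ * (2 * 3 * (1 + R)) * 3 ^ n * A * ρ := by ring
        _ ≤ c₀ * c₁ * (2 * 3 * (1 + R)) * 3 ^ n * A * ρ + 6 * R / (D.S₂ - D.S₁) * A * ρ := by
            linarith
        _ = _ := by ring

/-! ### The localized solution and its Steklov average -/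

namespace IsLevel
variable {n N : ℕ} {D : Data} {C : Config n N D} {Λ : ℝ} (hL : IsLevel C Λ)

/-- Constant relating the localized functions to their majorants. -/
noncomputable def _root_.MultiPhase.Data.locConst (D : Data) (n : ℕ) : ℝ :=
  1 + 3 / (D.R₂ - D.R₁) + 2 * D.L + n * (2 * D.L) * (3 / (D.R₂ - D.R₁)) + 3 / (D.S₂ - D.S₁)

include hL

/-- The cutoff turns the homogeneous equation into one with source `-S · ∇χ + y₀ ∂ₜχ`, which brings
`1/(R₂ - R₁)` and `1/(S₂ - S₁)` into the constant. The set `O` is left open because the equation for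
the Steklov average is available only in the cylinder shortened by `h₀`. -/
lemma isLocalized_of_weakPair {h₀ : ℝ} {η : Space n → ℝ} {ζ : ℝ → ℝ}
    (hηζ : C.IsCutoffPair h₀ η ζ) {O : Set (SpaceTime n)} {y₀ w : SpaceTime n → Space N}
    {G S : Fin N → Fin n → SpaceTime n → ℝ} {m₁ m₂ : SpaceTime n → ℝ}
    (hO : cyl C.z₀ D.R₂ (D.S₂ - h₀) ⊆ O)
    (hpair : ∀ j, WeakPair O (fun y => y₀ y j) (G j) (S j) 0) (hy₀ : Integrable y₀)
    (int₁ : Integrable m₁)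
    (hy : ∀ᵐ y, ‖y₀ y‖ ≤ m₁ y) (hG : ∀ j k, ∀ᵐ y, ‖G j k y‖ ≤ m₁ y)
    (hS : ∀ j k, ∀ᵐ y, ‖S j k y‖ ≤ 2 * D.L * m₂ y)
    (hw : ∀ᵐ y, w y = Config.cut η ζ y • y₀ y) :
    IsLocalized w (Config.cut η ζ) m₁ m₂ (D.locConst n) := by
  have hR : 0 < D.R₂ - D.R₁ := by linarith [hL.adm.R₁_lt]
  have hT : 0 < D.S₂ - D.S₁ := by linarith [hL.adm.S₁_lt]
  have hLp := hL.L_pos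
  have t1 : 0 ≤ 3 / (D.R₂ - D.R₁) := by positivity
  have t2 : 0 ≤ 3 / (D.S₂ - D.S₁) := by positivity
  have t3 : 0 ≤ n * (2 * D.L) * (3 / (D.R₂ - D.R₁)) := by positivity
  have hc : 0 ≤ D.locConst n := by unfold Data.locConst; positivity
  have hn1 : ∀ᵐ y, 0 ≤ m₁ y := hy.mono fun y h => (norm_nonneg _).trans h
  have hcut := Config.contDiff_cut hηζ
  refine ⟨hc, ?_, int₁, fun j => ?_, ?_⟩
  · obtain ⟨b, hb⟩ := hcut.continuous.bounded_above_of_compact_support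
      (Config.hasCompactSupport_cut hηζ)
    exact (hy₀.bdd_smul b hcut.continuous.aestronglyMeasurable
      (Eventually.of_forall hb)).congr (hw.mono fun y h => h.symm)
  · refine ⟨_, _, _, ((hpair j).cutoff hcut (Config.hasCompactSupport_cut hηζ)
      ((Config.tsupport_cut_subset_cyl hηζ).trans hO)).congr ?_, fun k => ?_, fun k => ?_, ?_⟩
    · filter_upwards [hw] with y h
      rw [h, PiLp.smul_apply, smul_eq_mul]
    · filter_upwards [hy, hG j k, hn1] with y h1 h2 h3
      have a := Config.abs_cut_le_one hηζ y
      have b := Config.abs_dx_cut_le hηζ k y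
      calc _ ≤ ‖Config.cut η ζ y * G j k y‖ + ‖y₀ y j * dx k (Config.cut η ζ) y‖ := norm_add_le _ _
        _ = |Config.cut η ζ y| * ‖G j k y‖ + ‖y₀ y j‖ * |dx k (Config.cut η ζ) y| := by
            rw [norm_mul, norm_mul]; rfl
        _ ≤ 1 * m₁ y + m₁ y * (3 / (D.R₂ - D.R₁)) := by
            gcongr
            exact (PiLp.norm_apply_le _ _).trans h1
        _ = (1 + 3 / (D.R₂ - D.R₁)) * m₁ y := by ring
        _ ≤ _ := by
            gcongr
            unfold Data.locConst
            linarith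
    · filter_upwards [hS j k] with y h1
      have h2 : 0 ≤ m₂ y := by
        have := (norm_nonneg _).trans h1
        exact nonneg_of_mul_nonneg_right this (by positivity)
      have a := Config.abs_cut_le_one hηζ y
      calc _ = |Config.cut η ζ y| * ‖S j k y‖ := norm_mul _ _
        _ ≤ 1 * (2 * D.L * m₂ y) := by gcongr
        _ = 2 * D.L * m₂ y := one_mul _
        _ ≤ _ := by
            gcongr
            unfold Data.locConst
            linarith
    · filter_upwards [hy, hn1, ae_all_iff.2 (hS j)] with y h1 h2 h3
      have hk : ∀ k, ‖S j k y * dx k (Config.cut η ζ) y‖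
          ≤ 2 * D.L * m₂ y * (3 / (D.R₂ - D.R₁)) := fun k => by
        rw [norm_mul]
        exact mul_le_mul (h3 k) (Config.abs_dx_cut_le hηζ k y) (norm_nonneg _)
          ((norm_nonneg _).trans (h3 k))
      have d1 : ‖y₀ y j * dt (Config.cut η ζ) y‖ ≤ m₁ y * (3 / (D.S₂ - D.S₁)) := by
        rw [norm_mul]
        exact mul_le_mul ((PiLp.norm_apply_le _ _).trans h1) (Config.abs_dt_cut_le hηζ y)
          (norm_nonneg _) h2
      have d2 : ‖∑ k, S j k y * dx k (Config.cut η ζ) y‖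
          ≤ n * (2 * D.L * m₂ y * (3 / (D.R₂ - D.R₁))) := by
        refine (norm_sum_le_of_le _ fun k _ => hk k).trans (le_of_eq ?_)
        simp
      have d3 : 0 ≤ n * (m₂ y) := by
        rcases Nat.eq_zero_or_pos n with h0 | h0
        · simp [h0]
        · have := (norm_nonneg _).trans (h3 ⟨0, h0⟩)
          exact mul_nonneg (Nat.cast_nonneg _) (nonneg_of_mul_nonneg_right this (by positivity))
      have d4 : 0 ≤ m₂ y := by
        have hn : 0 < n := by linarith [hL.adm.two_le_n]
        exact nonneg_of_mul_nonneg_right d3 (by exact_mod_cast hn)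
      simp only [Pi.zero_apply, mul_zero, zero_sub]
      calc _ ≤ ‖-∑ k, S j k y * dx k (Config.cut η ζ) y‖ + ‖y₀ y j * dt (Config.cut η ζ) y‖ :=
            norm_add_le _ _
        _ ≤ n * (2 * D.L * m₂ y * (3 / (D.R₂ - D.R₁))) + m₁ y * (3 / (D.S₂ - D.S₁)) := by
            rw [norm_neg]; exact add_le_add d2 d1
        _ = (n * (2 * D.L) * (3 / (D.R₂ - D.R₁))) * m₂ y + 3 / (D.S₂ - D.S₁) * m₁ y := by ring
        _ ≤ D.locConst n * m₂ y + D.locConst n * m₁ y := by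
            gcongr <;> · unfold Data.locConst; linarith
        _ = _ := by ring
  · filter_upwards [hw, hy] with y h1 h2
    rw [h1, norm_smul, Real.norm_eq_abs]
    gcongr

lemma isLocalized_v {h₀ : ℝ} {η : Space n → ℝ} {ζ : ℝ → ℝ} (hh₀ : 0 ≤ h₀)
    (hηζ : C.IsCutoffPair h₀ η ζ) :
    IsLocalized (C.v η ζ) (Config.cut η ζ) C.f C.fluxF (D.locConst n) := by
  refine hL.isLocalized_of_weakPair hηζ (O := C.U) (cyl_subset_cyl (by simp) ?_)
    hL.weakPair hL.integrable_uU hL.integrable_f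
    (Eventually.of_forall hL.norm_uU_le) (fun j k => Eventually.of_forall fun y => ?_)
    (fun j k => ?_) (Eventually.of_forall fun y => ?_)
  · simp only [sub_self, abs_zero, zero_add]; linarith
  · exact (PiLp.norm_apply_le _ _).trans (hL.norm_DuU_le y)
  · filter_upwards [hL.norm_fluxA_le, hL.norm_fluxB_le] with y h1 h2
    refine (norm_sub_le _ _).trans ?_
    have h3 := (PiLp.norm_apply_le (C.fluxA y) (j, k)).trans h1
    have h4 := (PiLp.norm_apply_le (C.fluxB y) (j, k)).trans h2
    linarith
  · by_cases hy : y ∈ C.U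
    · rw [Config.v, Config.uU, indicator_of_mem hy]; rfl
    · have : Config.cut η ζ y = 0 := image_eq_zero_of_notMem_tsupport fun h =>
        hy (cyl_subset_cyl (by simp) (by simp only [sub_self, abs_zero, zero_add]; linarith)
          (Config.tsupport_cut_subset_cyl hηζ h))
      have h2 : η y.1 * ζ y.2 = 0 := this
      rw [this, Config.v, h2, zero_smul, zero_smul]

lemma isLocalized_vh {h₀ h : ℝ} {η : Space n → ℝ} {ζ : ℝ → ℝ} (hh : 0 < h) (hhh : h < h₀)
    (hηζ : C.IsCutoffPair h₀ η ζ) :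
    IsLocalized (C.vh η ζ h) (Config.cut η ζ) (stek h C.f) (stek h C.fluxF) (D.locConst n) := by
  -- This is where `h < h₀` is needed: forward shifts by at most `h` of the shortened cylinder stay
  -- in `U`.
  have hmem : ∀ y ∈ cyl C.z₀ D.R₂ (D.S₂ - h₀), ∀ σ ∈ Ioc 0 h, y + (0, σ) ∈ C.U := by
    intro y hy σ hσ
    rw [mem_cyl, abs_lt] at hy
    rw [Config.U, mem_cyl, abs_lt]
    simp only [Prod.fst_add, Prod.snd_add, add_zero]
    exact ⟨hy.1, by linarith [hy.2.1, hσ.1], by linarith [hy.2.2, hσ.2]⟩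
  refine hL.isLocalized_of_weakPair hηζ (O := cyl C.z₀ D.R₂ (D.S₂ - h₀)) (y₀ := stek h C.uU)
    (G := fun j k => stek h fun y => C.DuU y (j, k))
    (S := fun j k => stek h fun y => C.fluxA y (j, k) - C.fluxB y (j, k)) subset_rfl
    (fun j => ?_) (integrable_stek hL.integrable_uU h) (integrable_stek hL.integrable_f h)
    (norm_stek_le hh hL.integrable_f (Eventually.of_forall hL.norm_uU_le)) (fun j k => ?_)
    (fun j k => ?_) (Eventually.of_forall fun y => ?_)
  · have h1 := ((hL.weakPair j).stek hmem).congr (stek_apply hL.integrable_uU h j).symm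
    have h2 : stek h (0 : SpaceTime n → ℝ) = 0 := by
      funext y; simp [stek]
    rwa [h2] at h1
  · exact norm_stek_le hh hL.integrable_f (Eventually.of_forall fun y =>
      (PiLp.norm_apply_le _ _).trans (hL.norm_DuU_le y))
  · have h1 : ∀ᵐ y, ‖C.fluxA y (j, k) - C.fluxB y (j, k)‖ ≤ 2 * D.L * C.fluxF y := by
      filter_upwards [hL.norm_fluxA_le, hL.norm_fluxB_le] with y h1 h2
      refine (norm_sub_le _ _).trans ?_
      have h3 := (PiLp.norm_apply_le (C.fluxA y) (j, k)).trans h1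
      have h4 := (PiLp.norm_apply_le (C.fluxB y) (j, k)).trans h2
      linarith
    refine (norm_stek_le hh (hL.integrable_fluxF.const_mul (2 * D.L)) h1).mono fun y hy =>
      hy.trans (le_of_eq ?_)
    simp only [stek, smul_eq_mul]
    rw [integral_const_mul]
    ring
  · by_cases hy : y ∈ tsupport (Config.cut (n := n) η ζ)
    · rw [Config.vh, steklov_eq_stek hh]
      change Config.cut η ζ y • _ = _
      congr 1
      unfold stek
      congr 1
      refine setIntegral_congr_fun measurableSet_Ioc fun σ hσ => ?_
      dsimp only
      rw [Config.uU, indicator_of_mem (hmem y (Config.tsupport_cut_subset_cyl hηζ hy) σ hσ)]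
    · have : Config.cut η ζ y = 0 := image_eq_zero_of_notMem_tsupport hy
      have h2 : η y.1 * ζ y.2 = 0 := this
      rw [this, Config.vh, h2, zero_smul, zero_smul]

end IsLevel

/-! ### Averages of the majorants -/

/-- Averages of a Steklov average over cylinders meeting `E`. -/
lemma lintegral_stek_le {n : ℕ} {E : Set (SpaceTime n)} {g : SpaceTime n → ℝ}
    (hg : AEStronglyMeasurable g) {B h : ℝ} (hB : 0 ≤ B) (hh : 0 < h)
    (hE : ∀ (z : SpaceTime n) (ρ τ : ℝ), 0 < ρ → 0 < τ → (E ∩ cyl z ρ τ).Nonempty →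
      ∫⁻ y in cyl z ρ τ, ‖g y‖ₑ ≤ ENNReal.ofReal B * volume (cyl z ρ τ))
    {z : SpaceTime n} {ρ τ : ℝ} (hρ : 0 < ρ) (hτ : 0 < τ) (hne : (E ∩ cyl z ρ τ).Nonempty) :
    ∫⁻ y in cyl z ρ τ, ‖stek h g y‖ₑ ≤ ENNReal.ofReal (2 * B) * volume (cyl z ρ τ) := by
  set Q := cyl z ρ τ with hQ
  have hQm : MeasurableSet Q := measurableSet_cyl _ _ _
  -- `P` is the union of `Q` with its forward shifts, up to the endpoints. It contains `Q`, so it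
  -- still meets `E`. Each point of `P` is hit for a set of shifts of length at most `min h (2τ)`.
  set P := cyl (z.1, z.2 + h / 2) ρ (τ + h / 2) with hP
  have hPm : MeasurableSet P := measurableSet_cyl _ _ _
  have hu := unitVol_pos n
  have hQP : Q ⊆ P := by
    refine cyl_subset_cyl (by simp) ?_
    simp only [sub_add_cancel_left, abs_neg]
    rw [abs_of_pos (by positivity)]
    linarith
  have hgE : AEMeasurable (fun y => ‖g y‖ₑ) := hg.enorm
  have hshift : AEMeasurable (fun p : ℝ × SpaceTime n => ‖g (p.2 + (0, p.1))‖ₑ)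
      ((volume.restrict (Ioc 0 h)).prod volume) := by
    have h1 : AEMeasurable (fun p : ℝ × SpaceTime n => ‖g p.2‖ₑ)
      ((volume.restrict (Ioc 0 h)).prod volume) := hgE.comp_snd
    exact h1.comp_quasiMeasurePreserving (measurePreserving_shift h).quasiMeasurePreserving
  have step1 : ∫⁻ y in Q, ∫⁻ σ in Ioc 0 h, ‖g (y + (0, σ))‖ₑ
      = ∫⁻ σ in Ioc 0 h, ∫⁻ y in Q, ‖g (y + (0, σ))‖ₑ := by
    refine (lintegral_lintegral_swap ?_).symm
    exact hshift.mono_ac (Measure.AbsolutelyContinuous.rfl.prod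
      Measure.restrict_le_self.absolutelyContinuous)
  have step2 : ∀ σ : ℝ, ∫⁻ y in Q, ‖g (y + (0, σ))‖ₑ
      = ∫⁻ y, Q.indicator 1 (y - (0, σ)) * ‖g y‖ₑ := by
    intro σ
    rw [← lintegral_indicator hQm, ← lintegral_add_right_eq_self
      (fun y => Q.indicator 1 (y - (0, σ)) * ‖g y‖ₑ) ((0 : Space n), σ)]
    refine lintegral_congr fun y => ?_
    by_cases hy : y ∈ Q <;> simp [hy]
  have step3 : ∫⁻ σ in Ioc 0 h, ∫⁻ y, Q.indicator 1 (y - (0, σ)) * ‖g y‖ₑ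
      = ∫⁻ y, ∫⁻ σ in Ioc 0 h, Q.indicator 1 (y - (0, σ)) * ‖g y‖ₑ := by
    refine lintegral_lintegral_swap (AEMeasurable.mul ?_ hgE.comp_snd)
    refine ((measurable_one.indicator hQm).comp ?_).aemeasurable
    exact (by fun_prop : Continuous fun p : ℝ × SpaceTime n => p.2 - ((0 : Space n), p.1)).measurable
  have step4 : ∀ y, ∫⁻ σ in Ioc 0 h, Q.indicator 1 (y - (0, σ)) * ‖g y‖ₑ
      ≤ P.indicator (fun y => ENNReal.ofReal (min h (2 * τ)) * ‖g y‖ₑ) y := by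
    intro y
    have hsl : ∀ σ : ℝ, y - (0, σ) ∈ Q → σ ∈ Ioo (y.2 - z.2 - τ) (y.2 - z.2 + τ) := by
      intro σ hσ
      rw [hQ, mem_cyl, abs_lt] at hσ
      simp only [Prod.snd_sub] at hσ
      exact ⟨by linarith [hσ.2.2], by linarith [hσ.2.1]⟩
    by_cases hy : y ∈ P
    · have hind : Measurable fun σ : ℝ => Q.indicator (1 : SpaceTime n → ℝ≥0∞) (y - (0, σ)) :=
        (measurable_one.indicator hQm).comp (by fun_prop)
      rw [indicator_of_mem hy, lintegral_mul_const _ hind]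
      refine mul_le_mul_left ?_ _
      calc ∫⁻ σ in Ioc 0 h, Q.indicator 1 (y - (0, σ))
          ≤ ∫⁻ σ in Ioc 0 h, (Ioo (y.2 - z.2 - τ) (y.2 - z.2 + τ)).indicator 1 σ := by
            refine lintegral_mono fun σ => ?_
            by_cases hσ : y - (0, σ) ∈ Q
            · rw [indicator_of_mem hσ, indicator_of_mem (hsl σ hσ)]; rfl
            · rw [indicator_of_notMem hσ]; exact zero_le
        _ = volume (Ioo (y.2 - z.2 - τ) (y.2 - z.2 + τ) ∩ Ioc 0 h) := by
            rw [lintegral_indicator_one measurableSet_Ioo, Measure.restrict_apply measurableSet_Ioo]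
        _ ≤ _ := by
            rcases min_choice h (2 * τ) with hm | hm <;> rw [hm]
            · refine (measure_mono inter_subset_right).trans ?_
              rw [Real.volume_Ioc, sub_zero]
            · refine (measure_mono inter_subset_left).trans ?_
              rw [Real.volume_Ioo]
              exact ENNReal.ofReal_le_ofReal (by linarith)
    · rw [indicator_of_notMem hy]
      refine le_of_eq ((setLIntegral_congr_fun measurableSet_Ioc fun σ hσ => ?_).trans
        lintegral_zero)
      rw [indicator_of_notMem, zero_mul]
      intro hyQ
      apply hy
      rw [hQ, mem_cyl, abs_lt] at hyQ
      simp only [Prod.fst_sub, Prod.snd_sub, sub_zero] at hyQ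
      rw [hP, mem_cyl, abs_lt]
      exact ⟨hyQ.1, by dsimp only; linarith [hyQ.2.1, hσ.1], by dsimp only; linarith [hyQ.2.2, hσ.2]⟩
  have hEP := hE (z.1, z.2 + h / 2) ρ (τ + h / 2) hρ (by positivity)
    (hne.mono (inter_subset_inter_right _ hQP))
  calc ∫⁻ y in Q, ‖stek h g y‖ₑ
      ≤ ∫⁻ y in Q, ENNReal.ofReal h⁻¹ * ∫⁻ σ in Ioc 0 h, ‖g (y + (0, σ))‖ₑ :=
        lintegral_mono fun y => enorm_stek_le hh g y
    _ = ENNReal.ofReal h⁻¹ * ∫⁻ y, ∫⁻ σ in Ioc 0 h, Q.indicator 1 (y - (0, σ)) * ‖g y‖ₑ := by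
        rw [lintegral_const_mul' _ _ ENNReal.ofReal_ne_top, step1]
        simp_rw [step2]
        rw [step3]
    _ ≤ ENNReal.ofReal h⁻¹ * (ENNReal.ofReal (min h (2 * τ)) * (ENNReal.ofReal B * volume P)) := by
        refine mul_le_mul_right ((lintegral_mono step4).trans ?_) _
        rw [lintegral_indicator hPm, lintegral_const_mul' _ _ ENNReal.ofReal_ne_top]
        exact mul_le_mul_right hEP _
    _ ≤ _ := by
        have hmin : 0 ≤ min h (2 * τ) := le_min hh.le (by positivity)
        rw [hP, hQ, volume_cyl _ hρ, volume_cyl _ hρ, ← ENNReal.ofReal_mul hB,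
          ← ENNReal.ofReal_mul hmin, ← ENNReal.ofReal_mul (by positivity),
          ← ENNReal.ofReal_mul (by positivity)]
        refine ENNReal.ofReal_le_ofReal ?_
        -- `min x y · (x + y) ≤ 2xy` with `x = h` and `y = 2τ`. The constant 2 is thus uniform in
        -- `h`, whether `h` is small or large compared with `τ`.
        have key : h⁻¹ * min h (2 * τ) * (2 * τ + h) ≤ 2 * (2 * τ) := by
          rw [mul_assoc, inv_mul_le_iff₀ hh]
          rcases le_total h (2 * τ) with hm | hm
          · rw [min_eq_left hm]; nlinarith
          · rw [min_eq_right hm]; nlinarith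
        calc h⁻¹ * (min h (2 * τ) * (B * (unitVol n * ρ ^ n * (2 * (τ + h / 2)))))
            = (B * (unitVol n * ρ ^ n)) * (h⁻¹ * min h (2 * τ) * (2 * τ + h)) := by ring
          _ ≤ (B * (unitVol n * ρ ^ n)) * (2 * (2 * τ)) := by gcongr
          _ = _ := by ring

namespace IsLevel
variable {n N : ℕ} {D : Data} {C : Config n N D} {Λ : ℝ} (hL : IsLevel C Λ)
include hL

lemma lintegral_le_of_le_dens {g : SpaceTime n → ℝ} {z : SpaceTime n} {ρ τ B₀ B₁ : ℝ}
    (hB₀ : 0 ≤ B₀) (hB₁ : 0 ≤ B₁) (hρ : 0 < ρ) (hτ : 0 < τ)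
    (hne : (C.good Λ ∩ cyl z ρ τ).Nonempty)
    (hg : ∀ y ∈ cyl z ρ τ, |g y| ≤ B₀ + B₁ * C.dens y) :
    ∫⁻ y in cyl z ρ τ, ‖g y‖ₑ
      ≤ ENNReal.ofReal (B₀ + B₁ * Λ ^ (D.d / D.p)) * volume (cyl z ρ τ) := by
  obtain ⟨e, heE, he⟩ := hne
  have h := hL.lintegral_dens_le hρ hτ he heE
  have hΛ := Real.rpow_nonneg hL.Λ_pos.le (D.d / D.p)
  calc ∫⁻ y in cyl z ρ τ, ‖g y‖ₑ
      ≤ ∫⁻ y in cyl z ρ τ, (ENNReal.ofReal B₀ + ENNReal.ofReal B₁ * ENNReal.ofReal (C.dens y)) := by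
        refine setLIntegral_mono' (measurableSet_cyl _ _ _) fun y hy => ?_
        rw [← ofReal_norm, ← ENNReal.ofReal_mul hB₁, ← ENNReal.ofReal_add hB₀
          (mul_nonneg hB₁ (Config.dens_nonneg y))]
        exact ENNReal.ofReal_le_ofReal (hg y hy)
    _ = ENNReal.ofReal B₀ * volume (cyl z ρ τ)
          + ENNReal.ofReal B₁ * ∫⁻ y in cyl z ρ τ, ENNReal.ofReal (C.dens y) := by
        rw [lintegral_add_left measurable_const, setLIntegral_const,
          lintegral_const_mul' _ _ ENNReal.ofReal_ne_top]
    _ ≤ ENNReal.ofReal B₀ * volume (cyl z ρ τ) + ENNReal.ofReal B₁ *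
          (ENNReal.ofReal (Λ ^ (D.d / D.p)) * volume (cyl z ρ τ)) :=
        add_le_add le_rfl (mul_le_mul_right h _)
    _ = _ := by
        rw [ENNReal.ofReal_add hB₀ (by positivity), ENNReal.ofReal_mul hB₁]
        ring

/-- One of the three terms of `λ_z^p + a(z) λ_z^q + b(z) λ_z^s = Λ` carries a fixed share of `Λ`,
and by `osc_le` it does so also with the coefficients at `y`. For `t = f/λ_z ≥ 1` the corresponding
term of `H(y, f)` is then at least `Λ t^p / (6K)`, and raising this to the power `d/p` gives the
bound by `dens`. -/
lemma rpow_d_div_le {z y : SpaceTime n} (hz : z ∈ (C.good Λ)ᶜ)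
    (hy : y ∈ cyl z (20 * C.rad Λ z) (400 * C.rad Λ z ^ 2 / C.coef Λ z)) :
    (C.f y / C.lam Λ z) ^ D.d ≤ 1 + 6 * D.K * (C.dens y / Λ ^ (D.d / D.p)) ∧
      C.a y * C.lam Λ z ^ D.q + C.b y * C.lam Λ z ^ D.s ≤ (1 + D.K) * Λ := by
  have hr := hL.rad_pos hz
  have hl := hL.one_lt_lam z
  have hl0 := hL.lam_pos z
  have hΛ := hL.Λ_pos
  have hK := hL.two_le_K
  have hd := hL.d_pos
  have hp := hL.p_pos
  rw [mem_cyl] at hy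
  have hX : ‖y.1 - z.1‖ + √|y.2 - z.2| ≤ 40 * C.rad Λ z := by
    have h3 : √|y.2 - z.2| ≤ 20 * C.rad Λ z := by
      rw [Real.sqrt_le_left (by positivity)]
      refine hy.2.le.trans ?_
      have a1 := div_le_self (by positivity : 0 ≤ 400 * C.rad Λ z ^ 2) (hL.one_le_coef z)
      linarith
    linarith [hy.1]
  have hmJ : C.rad Λ z ^ (n + 2) * C.lam Λ z ^ 2 ≤ (unitVol n)⁻¹ * C.maxInt.toReal := by
    refine le_trans ?_ (hL.rad_pow_le hz)
    gcongr
    linarith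
  obtain ⟨ha, hb⟩ := hL.osc_le hr.le hmJ hl.le hX
  have ha' := abs_le.1 ha
  have hb' := abs_le.1 hb
  have eq1 : C.lam Λ z ^ (-(D.q - D.p)) * C.lam Λ z ^ D.q = C.lam Λ z ^ D.p := by
    rw [← Real.rpow_add hl0]; congr 1; ring
  have eq2 : C.lam Λ z ^ (-(D.s - D.p)) * C.lam Λ z ^ D.s = C.lam Λ z ^ D.p := by
    rw [← Real.rpow_add hl0]; congr 1; ring
  have hlp : 0 < C.lam Λ z ^ D.p := Real.rpow_pos_of_pos hl0 _
  have hlq : 0 < C.lam Λ z ^ D.q := Real.rpow_pos_of_pos hl0 _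
  have hls : 0 < C.lam Λ z ^ D.s := Real.rpow_pos_of_pos hl0 _
  have a1 : C.a y * C.lam Λ z ^ D.q ≤ C.a z * C.lam Λ z ^ D.q + D.K / 20 * C.lam Λ z ^ D.p := by
    rw [← eq1, ← mul_assoc, ← add_mul]
    exact mul_le_mul_of_nonneg_right (by linarith) hlq.le
  have a2 : C.a z * C.lam Λ z ^ D.q - D.K / 20 * C.lam Λ z ^ D.p ≤ C.a y * C.lam Λ z ^ D.q := by
    rw [← eq1, ← mul_assoc, ← sub_mul]
    exact mul_le_mul_of_nonneg_right (by linarith) hlq.le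
  have b1 : C.b y * C.lam Λ z ^ D.s ≤ C.b z * C.lam Λ z ^ D.s + D.K / 20 * C.lam Λ z ^ D.p := by
    rw [← eq2, ← mul_assoc, ← add_mul]
    exact mul_le_mul_of_nonneg_right (by linarith) hls.le
  have b2 : C.b z * C.lam Λ z ^ D.s - D.K / 20 * C.lam Λ z ^ D.p ≤ C.b y * C.lam Λ z ^ D.s := by
    rw [← eq2, ← mul_assoc, ← sub_mul]
    exact mul_le_mul_of_nonneg_right (by linarith) hls.le
  have e := hL.lam_eq z
  have hlpΛ := (hL.growth_bounds z).1.trans (hL.growth_bounds z).2.1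
  refine ⟨?_, by nlinarith⟩
  have hf := Config.f_nonneg (C := C) y
  set t := C.f y / C.lam Λ z with ht
  have ht0 : 0 ≤ t := by positivity
  have hX0 := Config.dens_nonneg (C := C) y
  have hΛd : 0 < Λ ^ (D.d / D.p) := Real.rpow_pos_of_pos hΛ _
  rcases le_total t 1 with h1 | h1
  · have := Real.rpow_le_one ht0 h1 hd.le
    have h2 : 0 ≤ 6 * D.K * (C.dens y / Λ ^ (D.d / D.p)) := by positivity
    linarith
  · have ft : ∀ m : ℝ, C.f y ^ m = C.lam Λ z ^ m * t ^ m := fun m => by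
      rw [ht, Real.div_rpow hf hl0.le, mul_div_cancel₀ _ (Real.rpow_pos_of_pos hl0 m).ne']
    have hay := C.a_coeff.nonneg y
    have hby := C.b_coeff.nonneg y
    have hM : ∃ M : ℝ, M ^ (D.d / D.p) ≤ C.dens y ∧ Λ / (6 * D.K) * t ^ D.p ≤ M := by
      have x1 : 0 ≤ C.f y ^ D.d := by positivity
      have x2 : 0 ≤ (C.a y * C.f y ^ D.q) ^ (D.d / D.p) := by positivity
      have x3 : 0 ≤ (C.b y * C.f y ^ D.s) ^ (D.d / D.p) := by positivity
      -- If the `p`-term is small, then `λ_z^p ≤ Λ/12`. So the larger of the other two terms is at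
      -- least `11Λ/24`; changing its coefficient from `z` to `y` loses at most `K λ_z^p / 20 ≤
      -- Λ/120`, and more than `Λ/3` is left.
      by_cases hA : Λ / (6 * D.K) ≤ C.lam Λ z ^ D.p
      · refine ⟨C.f y ^ D.p, ?_, ?_⟩
        · rw [← Real.rpow_mul hf, mul_div_cancel₀ _ hp.ne']
          exact Config.rpow_d_le_dens y
        · rw [ft]; gcongr
      · rw [not_le] at hA
        have hA' : D.K * C.lam Λ z ^ D.p ≤ Λ / 6 := by
          rw [lt_div_iff₀ (by positivity)] at hA
          linarith
        have hA2 : C.lam Λ z ^ D.p ≤ Λ / 12 := by nlinarith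
        have hc : Λ / (6 * D.K) ≤ Λ / 3 := by
          gcongr
          linarith
        have tq : t ^ D.p ≤ t ^ D.q := Real.rpow_le_rpow_of_exponent_le h1 hL.adm.p_lt_q.le
        have ts : t ^ D.p ≤ t ^ D.s :=
          Real.rpow_le_rpow_of_exponent_le h1 (hL.adm.p_lt_q.trans hL.adm.q_lt_s).le
        rcases le_total (C.b z * C.lam Λ z ^ D.s) (C.a z * C.lam Λ z ^ D.q) with hab | hab
        · refine ⟨C.a y * C.f y ^ D.q, by unfold Config.dens; linarith, ?_⟩
          rw [ft, ← mul_assoc]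
          have : Λ / (6 * D.K) ≤ C.a y * C.lam Λ z ^ D.q := by linarith
          gcongr
        · refine ⟨C.b y * C.f y ^ D.s, by unfold Config.dens; linarith, ?_⟩
          rw [ft, ← mul_assoc]
          have : Λ / (6 * D.K) ≤ C.b y * C.lam Λ z ^ D.s := by linarith
          gcongr
    obtain ⟨M, hM1, hM2⟩ := hM
    have h2 : (Λ / (6 * D.K) * t ^ D.p) ^ (D.d / D.p) ≤ C.dens y :=
      (Real.rpow_le_rpow (by positivity) hM2 (by positivity)).trans hM1
    rw [Real.mul_rpow (by positivity) (by positivity), ← Real.rpow_mul ht0,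
      mul_div_cancel₀ _ hp.ne', Real.div_rpow hΛ.le (by positivity)] at h2
    have h3 : (6 * D.K) ^ (D.d / D.p) ≤ 6 * D.K := by
      have : D.d / D.p ≤ 1 := (div_le_one hp).2 hL.adm.d_lt_p.le
      simpa using Real.rpow_le_rpow_of_exponent_le (by linarith : 1 ≤ 6 * D.K) this
    have h4 : 0 < (6 * D.K) ^ (D.d / D.p) := by positivity
    rw [div_mul_eq_mul_div, div_le_iff₀ h4, mul_comm, ← le_div_iff₀ hΛd] at h2
    calc t ^ D.d ≤ C.dens y * (6 * D.K) ^ (D.d / D.p) / Λ ^ (D.d / D.p) := h2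
      _ ≤ C.dens y * (6 * D.K) / Λ ^ (D.d / D.p) := by gcongr
      _ = 6 * D.K * (C.dens y / Λ ^ (D.d / D.p)) := by ring
      _ ≤ _ := by linarith

/-- All exponents in the flux are at most `s - 1 < d`, so the powers of `t = f/λ_z` are bounded by
`1 + t^d`. In the flux the powers of `λ_z` with their coefficients add up to at most `(2 + K) Λ /
λ_z`. -/
lemma f_fluxF_le {z y : SpaceTime n} (hz : z ∈ (C.good Λ)ᶜ)
    (hy : y ∈ cyl z (20 * C.rad Λ z) (400 * C.rad Λ z ^ 2 / C.coef Λ z)) :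
    C.f y ≤ C.lam Λ z * (2 + 6 * D.K * (C.dens y / Λ ^ (D.d / D.p))) ∧
      C.fluxF y ≤ (2 + D.K) * (Λ / C.lam Λ z) * (2 + 6 * D.K * (C.dens y / Λ ^ (D.d / D.p))) := by
  obtain ⟨h1, h2⟩ := hL.rpow_d_div_le hz hy
  have hl0 := hL.lam_pos z
  have hf := Config.f_nonneg (C := C) y
  have hΛ := hL.Λ_pos
  have hK := hL.two_le_K
  set t := C.f y / C.lam Λ z with ht
  have ht0 : 0 ≤ t := by positivity
  have hft : C.f y = C.lam Λ z * t := by rw [ht]; field_simp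
  set X := 2 + 6 * D.K * (C.dens y / Λ ^ (D.d / D.p)) with hX
  have hpow : ∀ e : ℝ, 0 ≤ e → e ≤ D.d → t ^ e ≤ X := fun e he hed =>
    (hL.adm.rpow_le_one_add ht0 he hed).trans (by linarith)
  obtain ⟨q1, q2, q3⟩ := hL.adm.exponents
  have q4 := hL.adm.s_sub_one_lt_d
  have q5 := hL.adm.p_lt_q
  have q6 := hL.adm.q_lt_s
  constructor
  · rw [hft]
    have := hpow 1 zero_le_one hL.adm.one_lt_d.le
    rw [Real.rpow_one] at this
    gcongr
  · have hX0 : 0 ≤ X := (Real.rpow_nonneg ht0 0).trans (hpow 0 le_rfl hL.d_pos.le)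
    have ha := C.a_coeff.nonneg y
    have hb := C.b_coeff.nonneg y
    have hle : ∀ e : ℝ, 0 ≤ e - 1 → e - 1 ≤ D.d →
        C.lam Λ z * C.f y ^ (e - 1) ≤ C.lam Λ z ^ e * X := by
      intro e he hed
      rw [hft, Real.mul_rpow hl0.le ht0, ← mul_assoc]
      have : C.lam Λ z * C.lam Λ z ^ (e - 1) = C.lam Λ z ^ e := by
        rw [Real.rpow_sub_one hl0.ne', mul_div_cancel₀ _ hl0.ne']
      rw [this]
      gcongr
      exact hpow _ he hed
    have b0 := hle D.p (by linarith) (by linarith)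
    have b1 := mul_le_mul_of_nonneg_left (hle D.q (by linarith) (by linarith)) ha
    have b2 := mul_le_mul_of_nonneg_left (hle D.s (by linarith) (by linarith)) hb
    have hlpΛ := (hL.growth_bounds z).1.trans (hL.growth_bounds z).2.1
    have hmain : C.lam Λ z * C.fluxF y ≤ (2 + D.K) * Λ * X := by
      calc C.lam Λ z * C.fluxF y = C.lam Λ z * C.f y ^ (D.p - 1)
            + C.a y * (C.lam Λ z * C.f y ^ (D.q - 1))
            + C.b y * (C.lam Λ z * C.f y ^ (D.s - 1)) := by
            unfold Config.fluxF Data.flux; ring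
        _ ≤ (C.lam Λ z ^ D.p + (C.a y * C.lam Λ z ^ D.q + C.b y * C.lam Λ z ^ D.s)) * X := by
            linarith
        _ ≤ _ := by
            gcongr
            linarith
    rw [← mul_div_assoc, div_mul_eq_mul_div, le_div_iff₀ hl0]
    linarith

/-- Constant in the average bounds at intrinsic scale. -/
noncomputable def _root_.MultiPhase.Data.avgConst (D : Data) (n : ℕ) : ℝ :=
  (2 + D.K) * (1 + 2 * D.K ^ 2) * (2 + 6 * D.K) * (10 * D.K) ^ (n + 2)

lemma avgConst_nonneg : 0 ≤ D.avgConst n := by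
  have := hL.two_le_K
  unfold Data.avgConst
  positivity

/-- The enlarged cylinder `20 U_z` meets the good set. -/
lemma enlarged {z : SpaceTime n} (hz : z ∈ (C.good Λ)ᶜ) {ρ τ : ℝ}
    (hρ : ρ = 2 / D.K * C.rad Λ z) (hτ : τ = ρ ^ 2 / C.coef Λ z) :
    0 < ρ ∧ 0 < τ ∧ ρ ≤ C.rad Λ z ∧ τ ≤ ρ ^ 2 ∧
    cyl z (6 * ρ) (6 * τ) ⊆ cyl z (20 * C.rad Λ z) (400 * C.rad Λ z ^ 2 / C.coef Λ z) ∧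
    (C.good Λ ∩ cyl z (20 * C.rad Λ z) (400 * C.rad Λ z ^ 2 / C.coef Λ z)).Nonempty ∧
    volume (cyl z (20 * C.rad Λ z) (400 * C.rad Λ z ^ 2 / C.coef Λ z))
      = ENNReal.ofReal ((10 * D.K) ^ (n + 2)) * volume (cyl z ρ τ) := by
  have hr := hL.rad_pos hz
  have hK := hL.two_le_K
  have hK0 : 0 < D.K := by linarith
  have hθ := hL.coef_pos z
  have hρ0 : 0 < ρ := by rw [hρ]; positivity
  have hτ0 : 0 < τ := by rw [hτ]; positivity
  have er : C.rad Λ z = D.K / 2 * ρ := by rw [hρ]; field_simp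
  set P := cyl z (20 * C.rad Λ z) (400 * C.rad Λ z ^ 2 / C.coef Λ z) with hP
  refine ⟨hρ0, hτ0, by rw [er]; nlinarith, ?_, ?_, ?_, ?_⟩
  · rw [hτ]; exact div_le_self (sq_nonneg _) (hL.one_le_coef z)
  · refine cyl_subset_cyl ?_ ?_
    · simp only [sub_self, norm_zero, zero_add]
      rw [er]; nlinarith
    · simp only [sub_self, abs_zero, zero_add]
      rw [er, hτ, ← mul_div_assoc]
      refine div_le_div_of_nonneg_right ?_ hθ.le
      have : 4 ≤ D.K ^ 2 := by nlinarith
      nlinarith [sq_nonneg ρ, mul_nonneg (sub_nonneg.2 this) (sq_nonneg ρ)]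
  · obtain ⟨e, he, h1, h2⟩ := hL.near hz
    refine ⟨e, he, ?_⟩
    rw [hP, mem_cyl]
    refine ⟨by linarith, h2.trans_lt ?_⟩
    gcongr
    norm_num
  · rw [hP, volume_cyl _ (by positivity), volume_cyl _ hρ0, ← ENNReal.ofReal_mul (by positivity)]
    congr 1
    rw [er, hτ]
    ring

/-- The bounds of `f_fluxF_le` are linear in `dens`, whose mean over `20U_z` is at most `Λ^(d/p)`
because that cylinder meets the good set. This gives means `c λ_z` for `f` and `c Λ/λ_z` for the
flux. -/
lemma average_le {z : SpaceTime n} (hz : z ∈ (C.good Λ)ᶜ) {ρ τ : ℝ}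
    (hρ : ρ = 2 / D.K * C.rad Λ z) (hτ : τ = ρ ^ 2 / C.coef Λ z) :
    (∫⁻ y in cyl z (6 * ρ) (6 * τ), ‖C.f y‖ₑ)
        ≤ ENNReal.ofReal (D.avgConst n * C.lam Λ z) * volume (cyl z ρ τ) ∧
      ENNReal.ofReal τ * (∫⁻ y in cyl z (6 * ρ) (6 * τ), ‖C.fluxF y‖ₑ)
        ≤ ENNReal.ofReal (ρ ^ 2 * (D.avgConst n * C.lam Λ z)) * volume (cyl z ρ τ) := by
  have hr := hL.rad_pos hz
  have hl0 := hL.lam_pos z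
  have hΛ := hL.Λ_pos
  have hK := hL.two_le_K
  have hθ := hL.coef_pos z
  have hγ := hL.growth_pos z
  have hΛd : 0 < Λ ^ (D.d / D.p) := Real.rpow_pos_of_pos hΛ _
  obtain ⟨hρ0, hτ0, -, -, hsub, hne, hvol⟩ := hL.enlarged hz hρ hτ
  set P := cyl z (20 * C.rad Λ z) (400 * C.rad Λ z ^ 2 / C.coef Λ z) with hP
  have gen : ∀ {g : SpaceTime n → ℝ} {B : ℝ}, 0 ≤ B → (∀ y ∈ P, |g y| ≤
      B * (2 + 6 * D.K * (C.dens y / Λ ^ (D.d / D.p)))) →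
      ∫⁻ y in cyl z (6 * ρ) (6 * τ), ‖g y‖ₑ
        ≤ ENNReal.ofReal (B * ((2 + 6 * D.K) * (10 * D.K) ^ (n + 2))) * volume (cyl z ρ τ) := by
    intro g B hB hg
    have h1 := hL.lintegral_le_of_le_dens (g := g) (B₀ := B * 2)
      (B₁ := B * (6 * D.K) / Λ ^ (D.d / D.p)) (by positivity) (by positivity)
      (by positivity) (by positivity) hne fun y hy => (hg y hy).trans (le_of_eq (by ring))
    refine (lintegral_mono_set hsub).trans (h1.trans (le_of_eq ?_))
    rw [div_mul_cancel₀ _ hΛd.ne', ← hP, hvol, ← mul_assoc, ← ENNReal.ofReal_mul (by positivity)]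
    congr 2
    ring
  have c1 : 0 ≤ (2 + 6 * D.K) * (10 * D.K) ^ (n + 2) := by positivity
  constructor
  · refine (gen hl0.le fun y hy => ?_).trans (mul_le_mul_left (ENNReal.ofReal_le_ofReal ?_) _)
    · rw [abs_of_nonneg (Config.f_nonneg y)]
      exact (hL.f_fluxF_le hz hy).1
    · have : 1 ≤ (2 + D.K) * (1 + 2 * D.K ^ 2) := by nlinarith [sq_nonneg D.K]
      unfold Data.avgConst
      calc C.lam Λ z * ((2 + 6 * D.K) * (10 * D.K) ^ (n + 2))
          = 1 * (((2 + 6 * D.K) * (10 * D.K) ^ (n + 2)) * C.lam Λ z) := by ring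
        _ ≤ (2 + D.K) * (1 + 2 * D.K ^ 2) * (((2 + 6 * D.K) * (10 * D.K) ^ (n + 2)) * C.lam Λ z) := by
            gcongr
        _ = _ := by ring
  · have h1 := gen (g := C.fluxF) (B := (2 + D.K) * (Λ / C.lam Λ z)) (by positivity) fun y hy => by
      rw [abs_of_nonneg (Config.fluxF_nonneg y)]
      exact (hL.f_fluxF_le hz hy).2
    refine (mul_le_mul_right h1 _).trans ?_
    rw [← mul_assoc, ← ENNReal.ofReal_mul hτ0.le]
    refine mul_le_mul_left (ENNReal.ofReal_le_ofReal ?_) _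
    have hg := (hL.growth_bounds z).2.2
    -- Intrinsic scaling: the length `τ = ρ² λ² / γ` and `Λ ≤ (1 + 2K²) γ` convert the size `Λ/λ` of
    -- the flux into `ρ² λ`.
    have h2 : τ * (Λ / C.lam Λ z) ≤ ρ ^ 2 * ((1 + 2 * D.K ^ 2) * C.lam Λ z) := by
      calc τ * (Λ / C.lam Λ z) = ρ ^ 2 * (Λ / C.growth Λ z * C.lam Λ z) := by
            rw [hτ, Config.coef]; field_simp
        _ ≤ _ := by
            gcongr
            rwa [div_le_iff₀ hγ]
    unfold Data.avgConst
    calc _ = (2 + D.K) * ((2 + 6 * D.K) * (10 * D.K) ^ (n + 2)) * (τ * (Λ / C.lam Λ z)) := by ring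
      _ ≤ (2 + D.K) * ((2 + 6 * D.K) * (10 * D.K) ^ (n + 2))
          * (ρ ^ 2 * ((1 + 2 * D.K ^ 2) * C.lam Λ z)) := by gcongr
      _ = _ := by ring

/-- Bound for averages over cylinders meeting the good set. -/
noncomputable def _root_.MultiPhase.Data.goodAvg (D : Data) (Λ : ℝ) : ℝ :=
  2 * ((1 + D.normA + D.normB) * (1 + Λ ^ (D.d / D.p)))

lemma goodAvg_nonneg : 0 ≤ D.goodAvg Λ := by
  have := C.a_coeff.bound_nonneg
  have := C.b_coeff.bound_nonneg
  have := hL.Λ_pos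
  unfold Data.goodAvg
  positivity

lemma lintegral_stek_f_le {h : ℝ} (hh : 0 < h) {z : SpaceTime n} {ρ τ : ℝ} (hρ : 0 < ρ)
    (hτ : 0 < τ) (hne : (C.good Λ ∩ cyl z ρ τ).Nonempty) :
    ∫⁻ y in cyl z ρ τ, ‖stek h C.f y‖ₑ
        ≤ ENNReal.ofReal (D.goodAvg Λ) * volume (cyl z ρ τ) ∧
      ∫⁻ y in cyl z ρ τ, ‖stek h C.fluxF y‖ₑ
        ≤ ENNReal.ofReal (D.goodAvg Λ) * volume (cyl z ρ τ) := by
  have hA := C.a_coeff.bound_nonneg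
  have hB := C.b_coeff.bound_nonneg
  have hΛ := hL.Λ_pos
  have hB0 : 0 ≤ (1 + D.normA + D.normB) * (1 + Λ ^ (D.d / D.p)) := by positivity
  have gen : ∀ {g : SpaceTime n → ℝ}, (∀ y, |g y| ≤ (1 + D.normA + D.normB) * (1 + C.dens y)) →
      ∀ (z : SpaceTime n) (ρ τ : ℝ), 0 < ρ → 0 < τ → (C.good Λ ∩ cyl z ρ τ).Nonempty →
      ∫⁻ y in cyl z ρ τ, ‖g y‖ₑ ≤ ENNReal.ofReal ((1 + D.normA + D.normB)
        * (1 + Λ ^ (D.d / D.p))) * volume (cyl z ρ τ) := by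
    intro g hg z ρ τ hρ hτ hne
    have := hL.lintegral_le_of_le_dens (g := g) (B₀ := 1 + D.normA + D.normB)
      (B₁ := 1 + D.normA + D.normB) (by positivity) (by positivity) hρ hτ hne
      fun y _ => (hg y).trans (le_of_eq (by ring))
    rwa [mul_add, mul_one]
  refine ⟨lintegral_stek_le hL.aestronglyMeasurable_f hB0 hh (gen fun y => ?_) hρ hτ hne,
    lintegral_stek_le hL.aestronglyMeasurable_fluxF hB0 hh (gen fun y => ?_) hρ hτ hne⟩
  · rw [abs_of_nonneg (Config.f_nonneg y)]
    refine (hL.f_le y).trans ?_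
    have := Config.dens_nonneg (C := C) y
    nlinarith
  · rw [abs_of_nonneg (Config.fluxF_nonneg y)]
    exact hL.fluxF_le y

end IsLevel

/-! ### Approximation by local means and the Campanato bound for `v_h` -/

/-- The majorants and the sizes `A_i` are kept general, so that the same argument serves `v`, with
`A_i` proportional to `λ_{z_i}`, and `v_h`, with a constant depending on `Λ`. The radius bound in
terms of the data keeps the constant free of the solution. -/
lemma exists_isWhitneyApprox (n N : ℕ) (D : Data) (hD : D.Admissible n) : ∃ c : ℝ, 0 ≤ c ∧
    ∀ (C : Config n N D) (Λ : ℝ), IsLevel C Λ → ∀ {ι : Type} (z : ι → SpaceTime n),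
      C.IsWhitney Λ z → ∀ (h₀ : ℝ) (η : Space n → ℝ) (ζ : ℝ → ℝ), 0 ≤ h₀ →
      C.IsCutoffPair h₀ η ζ → ∀ (w : SpaceTime n → Space N) (m₁ m₂ : SpaceTime n → ℝ),
      IsLocalized w (Config.cut η ζ) m₁ m₂ (D.locConst n) → ∀ A : ι → ℝ, (∀ i, 0 ≤ A i) →
      (∀ i (ρ τ : ℝ), ρ = 2 / D.K * C.rad Λ (z i) → τ = ρ ^ 2 / C.coef Λ (z i) →
        (∫⁻ y in cyl (z i) (6 * ρ) (6 * τ), ‖m₁ y‖ₑ)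
            ≤ ENNReal.ofReal (A i) * volume (cyl (z i) ρ τ) ∧
          ENNReal.ofReal τ * (∫⁻ y in cyl (z i) (6 * ρ) (6 * τ), ‖m₂ y‖ₑ)
            ≤ ENNReal.ofReal (ρ ^ 2 * A i) * volume (cyl (z i) ρ τ)) →
      (∀ j k, j ∈ IsWhitneyFamily.nbrs D.K z (fun i => C.rad Λ (z i))
        (fun i => C.coef Λ (z i)) k → A j ≤ 2 * D.ratio * A k) →
      IsWhitneyApprox D.K (2 * D.ratio) z (fun i => C.rad Λ (z i)) (fun i => C.coef Λ (z i)) w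
        (fun i => C.localMean Λ w (z i)) fun i => c * A i := by
  have hloc : 0 ≤ D.locConst n := by
    have h1 : 0 < D.R₂ - D.R₁ := by linarith [hD.R₁_lt]
    have h2 : 0 < D.S₂ - D.S₁ := by linarith [hD.S₁_lt]
    have h3 : 0 < D.L := hD.ν_pos.trans_le hD.ν_le
    unfold Data.locConst
    positivity
  obtain ⟨c, hc, H⟩ := exists_localMean_estimate n N D hD hloc (abs_nonneg D.radBound)
  refine ⟨c, hc, fun C Λ hL ι z hz h₀ η ζ hh₀ hηζ w m₁ m₂ hw A hA hm hnbr => ?_⟩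
  refine ⟨hw.int_w.aestronglyMeasurable, fun i => mul_nonneg hc (hA i), fun i => ?_,
    fun j k hjk => ?_⟩
  · have hzi := hz.mem i
    obtain ⟨hρ0, hτ0, hρr, hτρ, -, -, -⟩ := hL.enlarged hzi rfl rfl
    obtain ⟨h1, h2⟩ := hm i _ _ rfl rfl
    have hrad := (hρr.trans (hL.rad_le hzi)).trans (le_abs_self D.radBound)
    refine (H C h₀ η ζ hh₀ hηζ w m₁ m₂ hw (z i) _ _ (A i) (C.localMean Λ w (z i)) hρ0 hrad hτ0 hτρ
      (hA i) h1 h2 (fun h => if_pos h) fun h => if_neg h).trans (mul_le_mul_left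
        (ENNReal.ofReal_le_ofReal ?_) _)
    have := mul_nonneg hc (hA i)
    gcongr
  · have := mul_le_mul_of_nonneg_left (hnbr j k hjk) hc
    calc c * A j ≤ c * (2 * D.ratio * A k) := this
      _ = _ := by ring

namespace IsLevel
variable {n N : ℕ} {D : Data} {C : Config n N D} {Λ : ℝ} (hL : IsLevel C Λ)
include hL

lemma average_stek_le {h : ℝ} (hh : 0 < h) {z : SpaceTime n} (hz : z ∈ (C.good Λ)ᶜ) {ρ τ : ℝ}
    (hρ : ρ = 2 / D.K * C.rad Λ z) (hτ : τ = ρ ^ 2 / C.coef Λ z) :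
    (∫⁻ y in cyl z (6 * ρ) (6 * τ), ‖stek h C.f y‖ₑ)
        ≤ ENNReal.ofReal ((10 * D.K) ^ (n + 2) * D.goodAvg Λ) * volume (cyl z ρ τ) ∧
      ENNReal.ofReal τ * (∫⁻ y in cyl z (6 * ρ) (6 * τ), ‖stek h C.fluxF y‖ₑ)
        ≤ ENNReal.ofReal (ρ ^ 2 * ((10 * D.K) ^ (n + 2) * D.goodAvg Λ)) * volume (cyl z ρ τ) := by
  obtain ⟨hρ0, hτ0, -, hτρ, hsub, hne, hvol⟩ := hL.enlarged hz hρ hτ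
  have hr := hL.rad_pos hz
  have hθ := hL.coef_pos z
  have hA := hL.goodAvg_nonneg
  have hK := hL.two_le_K
  obtain ⟨h1, h2⟩ := hL.lintegral_stek_f_le hh (by positivity) (by positivity) hne
  have e : ENNReal.ofReal (D.goodAvg Λ) * volume (cyl z (20 * C.rad Λ z)
      (400 * C.rad Λ z ^ 2 / C.coef Λ z))
      = ENNReal.ofReal ((10 * D.K) ^ (n + 2) * D.goodAvg Λ) * volume (cyl z ρ τ) := by
    rw [hvol, ← mul_assoc, ← ENNReal.ofReal_mul hA, mul_comm (D.goodAvg Λ)]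
  rw [e] at h1 h2
  refine ⟨(lintegral_mono_set hsub).trans h1,
    (mul_le_mul_right ((lintegral_mono_set hsub).trans h2) _).trans ?_⟩
  rw [← mul_assoc, ← ENNReal.ofReal_mul hτ0.le]
  refine mul_le_mul_left (ENNReal.ofReal_le_ofReal ?_) _
  gcongr

end IsLevel

/-- Since the cylinder dilated by `6KΛ` meets the good set, the averages of the majorants on it are
bounded, at the cost of a volume ratio. This is exactly the first case in the Campanato estimate of
the truncation, with `Θ = Λ`. -/
lemma exists_campanato_vh (n N : ℕ) (D : Data) : ∃ c : ℝ, 0 ≤ c ∧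
    ∀ (C : Config n N D) (Λ : ℝ), IsLevel C Λ → ∀ (h₀ h : ℝ) (η : Space n → ℝ) (ζ : ℝ → ℝ),
      0 < h → h < h₀ → C.IsCutoffPair h₀ η ζ → ∀ (y : SpaceTime n) (ρ : ℝ), 0 < ρ →
      (C.good Λ ∩ pcyl y (6 * D.K * Λ * ρ)).Nonempty →
      ∃ m, ∫⁻ x in pcyl y ρ, ‖C.vh η ζ h x - m‖ₑ
        ≤ ENNReal.ofReal (c * ((6 * D.K * Λ) ^ (n + 2) * D.goodAvg Λ) * ρ) * volume (pcyl y ρ) := by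
  obtain ⟨c₀, hc₀, H⟩ := exists_poincare_localized_of_le n N
  refine ⟨c₀ * |D.locConst n| * 4 + 1, by positivity, ?_⟩
  intro C Λ hL h₀ h η ζ hh hhh hηζ y ρ hρ hne
  have hw := hL.isLocalized_vh hh hhh hηζ
  have hK := hL.two_le_K
  have hΛ := hL.one_lt_Λ
  have hG := hL.goodAvg_nonneg
  have hloc := hw.c_nonneg
  rw [abs_of_nonneg hloc]
  have hKΛ : 2 ≤ D.K * Λ := by nlinarith
  set t := 6 * D.K * Λ with ht
  have ht12 : 12 ≤ t := by rw [ht]; linarith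
  set A := t ^ (n + 2) * D.goodAvg Λ with hA
  have hA0 : 0 ≤ A := by positivity
  obtain ⟨h1, h2⟩ := hL.lintegral_stek_f_le hh (by positivity : 0 < t * ρ)
    (by positivity : 0 < (t * ρ) ^ 2) hne
  have hvol : volume (pcyl y (t * ρ)) = ENNReal.ofReal (t ^ (n + 2)) * volume (pcyl y ρ) := by
    rw [volume_pcyl _ (by positivity), volume_pcyl _ hρ, ← ENNReal.ofReal_mul (by positivity)]
    congr 1; ring
  have e : ENNReal.ofReal (D.goodAvg Λ) * volume (cyl y (t * ρ) ((t * ρ) ^ 2))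
      = ENNReal.ofReal A * volume (pcyl y ρ) := by
    rw [← pcyl, hvol, ← mul_assoc, ← ENNReal.ofReal_mul hG, mul_comm (D.goodAvg Λ)]
  rw [e] at h1 h2
  have hV0 : volume (pcyl y ρ) ≠ 0 := by
    have := unitVol_pos n
    rw [volume_pcyl _ hρ]; simpa using (by positivity : 0 < 2 * unitVol n * ρ ^ (n + 2))
  have hVtop : volume (pcyl y ρ) ≠ ⊤ := by rw [volume_pcyl _ hρ]; exact ENNReal.ofReal_ne_top
  rcases le_total ρ 1 with hρ1 | hρ1
  · refine ⟨⨍ x in pcyl y ρ, C.vh η ζ h x, ?_⟩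
    have hsub : cyl y (2 * (1 * ρ)) (2 * ρ ^ 2) ⊆ cyl y (t * ρ) ((t * ρ) ^ 2) := by
      refine cyl_subset_cyl ?_ ?_
      · simp only [sub_self, norm_zero, zero_add]; nlinarith
      · simp only [sub_self, abs_zero, zero_add]
        rw [mul_pow]
        have : 2 ≤ t ^ 2 := by nlinarith
        gcongr
    have k := H _ _ _ _ _ hw y 1 ρ (ρ ^ 2) A 1 le_rfl hρ (by positivity) hA0 le_rfl hρ1
      ((lintegral_mono_set hsub).trans h1) (by
        rw [ENNReal.ofReal_mul (by positivity), mul_assoc]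
        exact mul_le_mul_right ((lintegral_mono_set hsub).trans h2) _)
    rw [one_mul, ← pcyl] at k
    have k2 := (ENNReal.mul_le_mul_iff_left hV0 hVtop).1
      ((lintegral_sub_mean_mul_le hVtop hV0 hw.int_w.integrableOn).trans k)
    refine k2.trans (mul_le_mul_left (ENNReal.ofReal_le_ofReal ?_) _)
    have : 0 ≤ A * ρ := by positivity
    nlinarith
  -- For `ρ ≥ 1` no Poincaré inequality is needed: the mean of `|v_h|` is at most `A`, and `A ≤ A
  -- ρ`.
  · refine ⟨0, ?_⟩
    simp only [sub_zero]
    have hsub : pcyl y ρ ⊆ cyl y (t * ρ) ((t * ρ) ^ 2) := by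
      refine cyl_subset_cyl ?_ ?_
      · simp only [sub_self, norm_zero, zero_add]; nlinarith
      · simp only [sub_self, abs_zero, zero_add]
        gcongr
        nlinarith
    calc ∫⁻ x in pcyl y ρ, ‖C.vh η ζ h x‖ₑ ≤ ∫⁻ x in pcyl y ρ, ‖stek h C.f x‖ₑ := by
          refine lintegral_mono_ae (ae_restrict_of_ae (hw.norm_le.mono fun x hx => ?_))
          rw [← ofReal_norm, ← ofReal_norm]
          refine ENNReal.ofReal_le_ofReal (hx.trans ?_)
          calc _ ≤ |Config.cut η ζ x| * ‖stek h C.f x‖ :=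
                mul_le_mul_of_nonneg_left (le_abs_self _) (abs_nonneg _)
            _ ≤ 1 * ‖stek h C.f x‖ :=
                mul_le_mul_of_nonneg_right (Config.abs_cut_le_one hηζ x) (norm_nonneg _)
            _ = _ := one_mul _
      _ ≤ ENNReal.ofReal A * volume (pcyl y ρ) := (lintegral_mono_set hsub).trans h1
      _ ≤ _ := by
          refine mul_le_mul_left (ENNReal.ofReal_le_ofReal ?_) _
          have : 0 ≤ c₀ * D.locConst n * 4 * A * ρ := by positivity
          nlinarith

/-! ### Pointwise bounds in the good set -/

namespace IsLevel
variable {n N : ℕ} {D : Data} {C : Config n N D} {Λ : ℝ} (hL : IsLevel C Λ)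
include hL

lemma dens_eq_zero {y : SpaceTime n} (hy : y ∉ C.U) : C.dens y = 0 := by
  have hd := hL.d_pos
  have hp := hL.p_pos
  have hq : D.q ≠ 0 := by linarith [hL.adm.p_lt_q]
  have hs : D.s ≠ 0 := by linarith [hL.adm.p_lt_q, hL.adm.q_lt_s]
  have hdp : D.d / D.p ≠ 0 := by positivity
  rw [Config.dens, Config.f_eq_zero hy, Real.zero_rpow hd.ne', Real.zero_rpow hq,
    Real.zero_rpow hs, mul_zero, mul_zero, Real.zero_rpow hdp]
  norm_num

lemma integrable_dens : Integrable C.dens := by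
  have hd := hL.d_pos
  have hp := hL.p_pos
  have hq : 0 ≤ D.q := by linarith [hL.adm.p_lt_q]
  have hs : 0 ≤ D.s := by linarith [hL.adm.p_lt_q, hL.adm.q_lt_s]
  have hf := hL.aestronglyMeasurable_f
  have ha := (C.a_coeff.continuous hL.adm.α_pos).aestronglyMeasurable (μ := volume)
  have hb := (C.b_coeff.continuous hL.adm.β_pos).aestronglyMeasurable (μ := volume)
  have hpow : ∀ {g : SpaceTime n → ℝ} {e : ℝ}, AEStronglyMeasurable g → 0 ≤ e →
      AEStronglyMeasurable fun y => g y ^ e := fun hg he =>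
    (Real.continuous_rpow_const he).comp_aestronglyMeasurable hg
  refine hL.integrable_of_le_dens ?_ zero_le_one (fun y => Config.dens_nonneg y)
    (fun y hy => hL.dens_eq_zero hy) fun y => by linarith
  exact ((hpow hf hd.le).add (hpow (ha.mul (hpow hf hq)) (by positivity))).add
    (hpow (hb.mul (hpow hf hs)) (by positivity))

/-- Lebesgue's differentiation theorem in the good set. -/
lemma ae_dens_le : ∀ᵐ y, y ∈ C.good Λ → C.dens y ≤ Λ ^ (D.d / D.p) := by
  have hΛ := Real.rpow_nonneg hL.Λ_pos.le (D.d / D.p)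
  have hint := hL.integrable_dens
  filter_upwards [IsUnifLocDoublingMeasure.ae_tendsto_average (μ := (volume : Measure (SpaceTime n)))
    hint.locallyIntegrable 1] with y hy hyE
  have hδ : Tendsto (fun i : ℕ => (1 : ℝ) / (i + 1)) atTop (𝓝[>] 0) :=
    tendsto_nhdsWithin_iff.2 ⟨tendsto_one_div_add_atTop_nhds_zero_nat,
      Eventually.of_forall fun i => by simp only [mem_Ioi]; positivity⟩
  have h := hy (fun _ => y) _ hδ (Eventually.of_forall fun i => by
    apply Metric.mem_closedBall_self; positivity)
  refine le_of_tendsto h (Eventually.of_forall fun i => ?_)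
  set δ : ℝ := 1 / ((i : ℝ) + 1) with hδi
  have hδ0 : 0 < δ := by positivity
  -- Balls of the product metric are cylinders with equal space and time size, so the maximal
  -- function controls the averages in Lebesgue's theorem.
  have hball : Metric.ball y δ = cyl y δ δ := by
    rw [cyl, ← Real.ball_eq_Ioo, ball_prod_same]
  have hae : (Metric.closedBall y δ : Set (SpaceTime n)) =ᵐ[volume] Metric.ball y δ := by
    refine (ae_eq_of_subset_of_measure_ge Metric.ball_subset_closedBall
      (Measure.addHaar_closedBall_eq_addHaar_ball _ _ _).le
      measurableSet_ball.nullMeasurableSet ?_).symm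
    exact measure_closedBall_lt_top.ne
  rw [setAverage_congr hae, hball, setAverage_eq, smul_eq_mul]
  have hV := volume_cyl y hδ0 δ
  have hu := unitVol_pos n
  have hVpos : 0 < volume.real (cyl y δ δ) := by
    rw [measureReal_def, hV, ENNReal.toReal_ofReal (by positivity)]
    positivity
  rw [inv_mul_le_iff₀ hVpos, integral_eq_lintegral_of_nonneg_ae
    (Eventually.of_forall fun y => Config.dens_nonneg y) hint.aestronglyMeasurable.restrict]
  refine ENNReal.toReal_le_of_le_ofReal (by positivity) ?_
  refine (hL.lintegral_dens_le hδ0 hδ0 (mem_cyl_self y hδ0 hδ0) hyE).trans (le_of_eq ?_)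
  rw [ENNReal.ofReal_mul' hΛ, mul_comm, measureReal_def, ENNReal.ofReal_toReal]
  rw [hV]; exact ENNReal.ofReal_ne_top

lemma H_f_le {y : SpaceTime n} (hy : C.dens y ≤ Λ ^ (D.d / D.p)) : C.H y (C.f y) ≤ 3 * Λ := by
  have hd := hL.d_pos
  have hp := hL.p_pos
  have hΛ := hL.Λ_pos
  have h1 := Config.f_nonneg (C := C) y
  have h2 := C.a_coeff.nonneg y
  have h3 := C.b_coeff.nonneg y
  have x1 : 0 ≤ C.f y ^ D.d := by positivity
  have x2 : 0 ≤ (C.a y * C.f y ^ D.q) ^ (D.d / D.p) := by positivity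
  have x3 : 0 ≤ (C.b y * C.f y ^ D.s) ^ (D.d / D.p) := by positivity
  have key : ∀ {x : ℝ}, 0 ≤ x → x ^ (D.d / D.p) ≤ Λ ^ (D.d / D.p) → x ≤ Λ := fun hx h =>
    (Real.rpow_le_rpow_iff hx hΛ.le (by positivity)).1 h
  have k1 : C.f y ^ D.p ≤ Λ := key (by positivity) (by
    rw [← Real.rpow_mul h1, mul_div_cancel₀ _ hp.ne']
    exact (Config.rpow_d_le_dens y).trans hy)
  have k2 : C.a y * C.f y ^ D.q ≤ Λ := key (by positivity) (by unfold Config.dens at hy; linarith)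
  have k3 : C.b y * C.f y ^ D.s ≤ Λ := key (by positivity) (by unfold Config.dens at hy; linarith)
  unfold Config.H Data.Hval
  linarith

lemma H_mul_le (y : SpaceTime n) {κ x : ℝ} (hκ : 1 ≤ κ) (hx : 0 ≤ x) :
    C.H y (κ * x) ≤ κ ^ D.s * C.H y x := by
  have h2 := C.a_coeff.nonneg y
  have h3 := C.b_coeff.nonneg y
  have hq := hL.adm.p_lt_q
  have hs := hL.adm.q_lt_s
  have hκ0 : 0 ≤ κ := by linarith
  have k1 : κ ^ D.p ≤ κ ^ D.s := Real.rpow_le_rpow_of_exponent_le hκ (by linarith)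
  have k2 : κ ^ D.q ≤ κ ^ D.s := Real.rpow_le_rpow_of_exponent_le hκ (by linarith)
  have x1 : 0 ≤ x ^ D.p := by positivity
  have x2 : 0 ≤ C.a y * x ^ D.q := by positivity
  unfold Config.H Data.Hval
  rw [Real.mul_rpow hκ0 hx, Real.mul_rpow hκ0 hx, Real.mul_rpow hκ0 hx]
  nlinarith [mul_le_mul_of_nonneg_right k1 x1, mul_le_mul_of_nonneg_right k2 x2]

lemma H_mono (y : SpaceTime n) {x x' : ℝ} (hx : 0 ≤ x) (h : x ≤ x') : C.H y x ≤ C.H y x' :=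
  Data.Hval_mono hL.adm (C.a_coeff.nonneg y) (C.b_coeff.nonneg y) hx h

end IsLevel

lemma IsLocalized.exists_grad {n N : ℕ} {w : SpaceTime n → Space N} {χ m₁ m₂ : SpaceTime n → ℝ}
    {c : ℝ} (hw : IsLocalized w χ m₁ m₂ c) : ∃ Gw : SpaceTime n → Mat N n, Integrable Gw ∧
      (∀ᵐ y, ‖Gw y‖ ≤ (N * n) * (c * m₁ y)) ∧
      ∀ φ : SpaceTime n → ℝ, ContDiff ℝ ∞ φ → HasCompactSupport φ →
        ∀ (j : Fin N) (k : Fin n), ∫ y, w y j * dx k φ y = - ∫ y, Gw y (j, k) * φ y := by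
  choose G S g hp hG _ _ using hw.pair
  refine ⟨fun y => WithLp.toLp 2 fun q => G q.1 q.2 y,
    Integrable.of_eval_piLp fun q => (hp q.1).int_G q.2, ?_,
    fun φ hφ hc j k => (hp j).grad φ hφ hc (subset_univ _) k⟩
  filter_upwards [ae_all_iff.2 fun j => ae_all_iff.2 (hG j)] with y hy
  calc ‖(WithLp.toLp 2 fun q => G q.1 q.2 y : Mat N n)‖
      ≤ ∑ q : Fin N × Fin n, ‖G q.1 q.2 y‖ := by
        rw [EuclideanSpace.norm_eq]
        refine Real.sqrt_le_iff.2 ⟨Finset.sum_nonneg fun _ _ => norm_nonneg _, ?_⟩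
        exact Finset.sum_sq_le_sq_sum_of_nonneg fun _ _ => norm_nonneg _
    _ ≤ ∑ _q : Fin N × Fin n, c * m₁ y := Finset.sum_le_sum fun q _ => hy q.1 q.2
    _ = _ := by simp

/-! ### The two truncations -/

/-- Constant in the estimate of `∬ |w - w^Λ| |∂ₜ w^Λ|`. -/
noncomputable def dtConst (n : ℕ) (D : Data) : ℝ :=
  (12 * D.K ^ 5) ^ (n + 2) * (1 + meanConst n (2 * D.ratio)) * truncConst n D.K (2 * D.ratio)

/-- Constants may depend on `Λ` here, so a single approximation constant is used for all cylinders
and the time coefficients are only estimated by `Λ`. The Steklov averages of the majorants no longer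
see the intrinsic scale of a cylinder, which rules out the finer choice made for `v`. -/
lemma exists_steklov_truncation (n N : ℕ) (D : Data) (hD : D.Admissible n) : ∃ cΛ : ℝ → ℝ,
    ∀ (C : Config n N D) (Λ : ℝ), IsLevel C Λ → ∀ {ι : Type} [Countable ι] (z : ι → SpaceTime n)
      (ψ : ι → SpaceTime n → ℝ), C.IsWhitney Λ z → C.IsCutoffFamily Λ z ψ →
      ∀ (h₀ : ℝ) (η : Space n → ℝ) (ζ : ℝ → ℝ), 0 < h₀ → C.IsCutoffPair h₀ η ζ →
      ∀ h : ℝ, 0 < h → h < h₀ →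
        (∃ g : SpaceTime n → Space N, g =ᵐ[volume] C.trunc Λ z ψ (C.vh η ζ h) ∧
          EqOn g (C.trunc Λ z ψ (C.vh η ζ h)) (C.good Λ)ᶜ ∧
          ∀ y w : SpaceTime n, ‖g y - g w‖ ≤ cΛ Λ * D.dLam Λ y w) ∧
        ContDiffOn ℝ ∞ (C.trunc Λ z ψ (C.vh η ζ h)) (C.good Λ)ᶜ ∧
        ∫⁻ y in (C.good Λ)ᶜ, ‖C.vh η ζ h y - C.trunc Λ z ψ (C.vh η ζ h) y‖ₑ *
            ‖dt (C.trunc Λ z ψ (C.vh η ζ h)) y‖ₑ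
          ≤ ENNReal.ofReal (cΛ Λ) * volume (C.good Λ)ᶜ := by
  obtain ⟨c₁, hc₁, H₁⟩ := exists_isWhitneyApprox n N D hD
  obtain ⟨c₂, hc₂, H₂⟩ := exists_campanato_vh n N D
  -- The sum dominates both the constant in the Whitney approximation and that in the Campanato
  -- estimate near the good set.
  set a : ℝ → ℝ := fun Λ => c₁ * ((10 * D.K) ^ (n + 2) * D.goodAvg Λ)
    + c₂ * ((6 * D.K * Λ) ^ (n + 2) * D.goodAvg Λ) with ha
  refine ⟨fun Λ => max (2 ^ (n + 6) * (campConst n D.K (2 * D.ratio) Λ * a Λ))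
    (dtConst n D * (a Λ ^ 2 * Λ)), ?_⟩
  intro C Λ hL ι _ z ψ hz hψ h₀ η ζ hh₀ hηζ h hh hhh
  have hK := hL.two_le_K
  have hΛ := hL.one_lt_Λ
  have hG := hL.goodAvg_nonneg
  have hW := hL.isWhitneyFamily hz
  have hd := hL.isWhitneyDistance hz
  have hψ' := hψ.isWhitneyCutoff
  have hw := hL.isLocalized_vh hh hhh hηζ
  have hκ := hL.one_le_ratio
  have ha1 : c₁ * ((10 * D.K) ^ (n + 2) * D.goodAvg Λ) ≤ a Λ := by
    have : 0 ≤ c₂ * ((6 * D.K * Λ) ^ (n + 2) * D.goodAvg Λ) := by positivity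
    simp only [ha]; linarith
  have ha10 : 0 ≤ c₁ * ((10 * D.K) ^ (n + 2) * D.goodAvg Λ) := by positivity
  have ha2 : c₂ * ((6 * D.K * Λ) ^ (n + 2) * D.goodAvg Λ) ≤ a Λ := by simp only [ha]; linarith
  have ha0 : 0 ≤ a Λ := ha10.trans ha1
  have hP₀ := H₁ C Λ hL z hz h₀ η ζ hh₀.le hηζ _ _ _ hw
    (fun _ => (10 * D.K) ^ (n + 2) * D.goodAvg Λ) (fun _ => by positivity)
    (fun i ρ τ hρ hτ => hL.average_stek_le hh (hz.mem i) hρ hτ) fun j k _ =>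
      le_mul_of_one_le_left (by positivity) (by linarith)
  have hP : IsWhitneyApprox D.K (2 * D.ratio) z (fun i => C.rad Λ (z i))
      (fun i => C.coef Λ (z i)) (C.vh η ζ h) (fun i => C.localMean Λ (C.vh η ζ h) (z i))
      fun _ => a Λ := by
    refine ⟨hP₀.meas, fun _ => ha0, fun i => (hP₀.le i).trans (mul_le_mul_left
      (ENNReal.ofReal_le_ofReal ?_) _), fun j k _ => le_mul_of_one_le_left ha0 (by linarith)⟩
    exact mul_le_mul_of_nonneg_right ha1 (hW.r_pos i).le
  have htr : C.trunc Λ z ψ (C.vh η ζ h)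
      = wtrunc ψ (fun i => C.localMean Λ (C.vh η ζ h) (z i)) (C.vh η ζ h) := rfl
  rw [htr]
  have hsm := hW.contDiffOn_wtrunc hψ' (m := fun i => C.localMean Λ (C.vh η ζ h) (z i))
    (w := C.vh η ζ h)
  refine ⟨?_, hsm, ?_⟩
  · have hcamp := fun (y : SpaceTime n) (ρ : ℝ) (hρ : 0 < ρ) =>
      hW.exists_lintegral_wtrunc_sub_le hψ' hd ha0 hP (fun y ρ hρ hne => by
        obtain ⟨m, hm⟩ := H₂ C Λ hL h₀ h η ζ hh hhh hηζ y ρ hρ hne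
        refine ⟨m, hm.trans (mul_le_mul_left (ENNReal.ofReal_le_ofReal ?_) _)⟩
        gcongr) y hρ
    classical
    -- Campanato constants are chosen for positive radii; the value 0 at other radii is never used.
    set m : SpaceTime n → ℝ → Space N := fun y ρ =>
      if hρ : 0 < ρ then (hcamp y ρ hρ).choose else 0 with hm
    have hcc : 0 ≤ campConst n D.K (2 * D.ratio) Λ := by
      have h1 : 0 ≤ 1 + meanConst n (2 * D.ratio) := by
        linarith [hW.meanConst_nonneg (n := n)]
      have h2 := hL.Λ_pos
      have h3 : 0 < D.K := hW.K_pos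
      have h4 : 0 < D.ratio := by linarith
      unfold campConst
      have h5 : 0 ≤ truncConst n D.K (2 * D.ratio) := hW.truncConst_nonneg
      generalize 1 + meanConst n (2 * D.ratio) = x at h1
      generalize truncConst n D.K (2 * D.ratio) = y at h5
      positivity
    obtain ⟨g, hg, hlip⟩ := exists_lipschitz_of_campanato (c := m)
      (A := campConst n D.K (2 * D.ratio) Λ * a Λ) (by positivity) (fun y ρ hρ => by
        simp only [hm, dif_pos hρ]
        exact (hcamp y ρ hρ).choose_spec)
      (hW.aestronglyMeasurable_wtrunc hψ' hw.int_w.aestronglyMeasurable)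
    have hgc : Continuous g := continuous_of_pdist_le hlip
    refine ⟨g, hg, ?_, fun y w => (hlip y w).trans ?_⟩
    -- Two functions that are continuous on the open bad set and agree almost everywhere agree there
    -- at every point, so the redefinition only affects the good set.
    · exact Measure.eqOn_open_of_ae_eq (ae_restrict_of_ae hg) hL.isClosed_good.isOpen_compl
        hgc.continuousOn hsm.continuousOn
    -- As `λ > 1` and `p ≥ 2`, the parabolic distance is dominated by the distance `dLam`.
    · have hroot := (Data.root_spec hD C.a_coeff.bound_nonneg C.b_coeff.bound_nonneg hL.lt_Λ).1
      have h1 : 1 ≤ D.root D.normA D.normB Λ ^ (D.p - 2) :=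
        Real.one_le_rpow hroot.le (by linarith [hD.two_le_p])
      have h2 : pdist y w ≤ D.dLam Λ y w := by
        refine max_le_max le_rfl (Real.sqrt_le_sqrt ?_)
        exact le_mul_of_one_le_left (abs_nonneg _) h1
      exact mul_le_mul (le_max_left _ _) h2 (pdist_nonneg _ _)
        (le_max_of_le_left (by positivity))
  · refine (hW.lintegral_mul_dt_wtrunc_le hψ' hP (L := a Λ ^ 2 * Λ) fun k => ?_).trans
      (mul_le_mul_left (ENNReal.ofReal_le_ofReal (le_max_right _ _)) _)
    exact mul_le_mul_of_nonneg_left (hL.coef_le _) (sq_nonneg _)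

/-- Here the approximation constant is proportional to `λ_{z_k}`. Therefore `A_k² θ_k` is a multiple
of the growth function, hence of `Λ`, and the values and gradients on the bad set are bounded by `c
λ_{z_k}`, at which `H` is at most `(2 + K) Λ`. -/
lemma exists_truncation (n N : ℕ) (D : Data) (hD : D.Admissible n) : ∃ c : ℝ,
    ∀ (C : Config n N D) (Λ : ℝ), IsLevel C Λ → ∀ {ι : Type} [Countable ι] (z : ι → SpaceTime n)
      (ψ : ι → SpaceTime n → ℝ), C.IsWhitney Λ z → C.IsCutoffFamily Λ z ψ →
      ∀ (h₀ : ℝ) (η : Space n → ℝ) (ζ : ℝ → ℝ), 0 < h₀ → C.IsCutoffPair h₀ η ζ →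
        ContDiffOn ℝ ∞ (C.trunc Λ z ψ (C.v η ζ)) (C.good Λ)ᶜ ∧
        ∫⁻ y in (C.good Λ)ᶜ,
            ‖C.v η ζ y - C.trunc Λ z ψ (C.v η ζ) y‖ₑ * ‖dt (C.trunc Λ z ψ (C.v η ζ)) y‖ₑ
          ≤ ENNReal.ofReal (c * Λ) * volume (C.good Λ)ᶜ ∧
        ∃ G : SpaceTime n → Mat N n,
          HasWeakGradientOn univ (C.trunc Λ z ψ (C.v η ζ)) G ∧
          ∀ᵐ y : SpaceTime n,
            C.H y ‖C.trunc Λ z ψ (C.v η ζ) y‖ + C.H y ‖G y‖ ≤ c * Λ := by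
  obtain ⟨c₁, hc₁, H₁⟩ := exists_isWhitneyApprox n N D hD
  set a := c₁ * D.avgConst n with ha
  -- `κ` dominates four multipliers: those of `|v|` and `|∇v|` relative to `f` in the good set, and
  -- those of the truncation and its gradient relative to `λ_{z_k}` in the bad set. `H` grows by at
  -- most `κ^s` under the factor `κ`, and the final 2 accounts for the two summands.
  set κ := 1 + N * n * |D.locConst n| + N * n * (truncConst n D.K (2 * D.ratio) * a)
    + (meanConst n (2 * D.ratio) * (a * |D.radBound|) + D.avgConst n) with hκdef
  refine ⟨max (dtConst n D * a ^ 2) (2 * (κ ^ D.s * (3 + D.K))), ?_⟩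
  intro C Λ hL ι _ z ψ hz hψ h₀ η ζ hh₀ hηζ
  have hK := hL.two_le_K
  have hΛ := hL.one_lt_Λ
  have hΛ0 := hL.Λ_pos
  have hW := hL.isWhitneyFamily hz
  have hψ' := hψ.isWhitneyCutoff
  have hw := hL.isLocalized_v hh₀.le hηζ
  have hratio := hL.one_le_ratio
  have havg := hL.avgConst_nonneg
  have ha0 : 0 ≤ a := mul_nonneg hc₁ havg
  have hloc := hw.c_nonneg
  have hP : IsWhitneyApprox D.K (2 * D.ratio) z (fun i => C.rad Λ (z i))
      (fun i => C.coef Λ (z i)) (C.v η ζ) (fun i => C.localMean Λ (C.v η ζ) (z i))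
      fun i => c₁ * (D.avgConst n * C.lam Λ (z i)) :=
    H₁ C Λ hL z hz h₀ η ζ hh₀.le hηζ _ _ _ hw
      (fun i => D.avgConst n * C.lam Λ (z i)) (fun i => mul_nonneg havg (hL.lam_pos _).le)
      (fun i ρ τ hρ hτ => hL.average_le (hz.mem i) hρ hτ) fun j k hjk => by
        calc D.avgConst n * C.lam Λ (z j) ≤ D.avgConst n * (2 * D.ratio * C.lam Λ (z k)) :=
              mul_le_mul_of_nonneg_left (hL.lam_nbr hz hjk) havg
          _ = _ := by ring
  have hPa : ∀ i, c₁ * (D.avgConst n * C.lam Λ (z i)) = a * C.lam Λ (z i) := fun i => by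
    rw [ha, mul_assoc]
  simp_rw [hPa] at hP
  have htr : C.trunc Λ z ψ (C.v η ζ)
      = wtrunc ψ (fun i => C.localMean Λ (C.v η ζ) (z i)) (C.v η ζ) := rfl
  rw [htr]
  set T := wtrunc ψ (fun i => C.localMean Λ (C.v η ζ) (z i)) (C.v η ζ) with hT
  have hmc := hW.meanConst_nonneg (n := n)
  have htc := hW.truncConst_nonneg (n := n)
  have t1 : 0 ≤ N * n * |D.locConst n| := by positivity
  have t2 : 0 ≤ N * n * (truncConst n D.K (2 * D.ratio) * a) := by positivity
  have t3 : 0 ≤ meanConst n (2 * D.ratio) * (a * |D.radBound|) := by positivity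
  have hκ1 : 1 ≤ κ := by rw [hκdef]; linarith
  have hκ0 : 0 < κ := by linarith
  refine ⟨hW.contDiffOn_wtrunc hψ', ?_, ?_⟩
  · refine (hW.lintegral_mul_dt_wtrunc_le hψ' hP (L := a ^ 2 * Λ) fun k => ?_).trans
      (mul_le_mul_left (ENNReal.ofReal_le_ofReal ?_) _)
    · have hl := hL.lam_pos (z k)
      -- The factor `λ²` cancels against the `λ⁻²` of the time coefficient.
      calc (a * C.lam Λ (z k)) ^ 2 * C.coef Λ (z k) = a ^ 2 * C.growth Λ (z k) := by
            rw [Config.coef]; field_simp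
        _ ≤ _ := mul_le_mul_of_nonneg_left (hL.growth_bounds _).2.1 (sq_nonneg _)
    · calc _ = dtConst n D * a ^ 2 * Λ := by rw [dtConst]; ring
        _ ≤ _ := mul_le_mul_of_nonneg_right (le_max_left _ _) hΛ0.le
  · obtain ⟨Gw, hGint, hGle, hGrad⟩ := hw.exists_grad
    refine ⟨wgrad (C.good Λ) ψ (fun i => C.localMean Λ (C.v η ζ) (z i)) (C.v η ζ) Gw,
      hW.hasWeakGradientOn_wtrunc hψ' hP (a := a * Λ) (R := D.radBound)
        (fun k => mul_le_mul_of_nonneg_left (hL.lam_le _) ha0) (fun k => hL.rad_le (hz.mem k))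
        hL.volume_compl_good_ne_top hw.int_w hGint hGrad, ?_⟩
    have fin : ∀ (y : SpaceTime n) (x b : ℝ), 0 ≤ x → 0 ≤ b → x ≤ κ * b →
        C.H y b ≤ (3 + D.K) * Λ → C.H y x ≤ κ ^ D.s * (3 + D.K) * Λ := by
      intro y x b hx hb hxb hH
      calc C.H y x ≤ C.H y (κ * b) := hL.H_mono y hx hxb
        _ ≤ κ ^ D.s * C.H y b := hL.H_mul_le y hκ1 hb
        _ ≤ κ ^ D.s * ((3 + D.K) * Λ) := by gcongr
        _ = _ := by ring
    have goal : ∀ (y : SpaceTime n) (x x' b : ℝ), 0 ≤ x → 0 ≤ x' → 0 ≤ b → x ≤ κ * b →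
        x' ≤ κ * b → C.H y b ≤ (3 + D.K) * Λ →
        C.H y x + C.H y x' ≤ max (dtConst n D * a ^ 2) (2 * (κ ^ D.s * (3 + D.K))) * Λ := by
      intro y x x' b hx hx' hb h1 h2 hH
      have f1 := fin y x b hx hb h1 hH
      have f2 := fin y x' b hx' hb h2 hH
      calc _ ≤ 2 * (κ ^ D.s * (3 + D.K)) * Λ := by linarith
        _ ≤ _ := mul_le_mul_of_nonneg_right (le_max_right _ _) hΛ0.le
    filter_upwards [hL.ae_dens_le, hw.norm_le, hGle] with y h1 h2 h3
    by_cases hy : y ∈ C.good Λ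
    · have hf := Config.f_nonneg (C := C) y
      have e : T y = C.v η ζ y := hW.wtrunc_eq_of_mem hψ' hy
      have e' : wgrad (C.good Λ) ψ (fun i => C.localMean Λ (C.v η ζ) (z i)) (C.v η ζ) Gw y
          = Gw y := by simp [wgrad, hy]
      rw [e, e']
      refine goal y _ _ (C.f y) (norm_nonneg _) (norm_nonneg _) hf ?_ ?_ ?_
      · refine h2.trans ?_
        have := Config.abs_cut_le_one hηζ y
        gcongr
        linarith
      · refine h3.trans ?_
        rw [← mul_assoc]
        gcongr
        rw [hκdef, abs_of_nonneg hloc]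
        rw [abs_of_nonneg hloc] at t1
        linarith
      · refine (hL.H_f_le (h1 hy)).trans ?_
        gcongr
        linarith
    · obtain ⟨k, hk⟩ := hW.exists_mem hy
      have hzk := hz.mem k
      have hl := hL.lam_pos (z k)
      have hr := hL.rad_pos hzk
      have hθ := hL.coef_pos (z k)
      have e' : wgrad (C.good Λ) ψ (fun i => C.localMean Λ (C.v η ζ) (z i)) (C.v η ζ) Gw y
          = grad T y := by simp [wgrad, hy, hT]
      rw [e']
      refine goal y _ _ (C.lam Λ (z k)) (norm_nonneg _) (norm_nonneg _) hl.le ?_ ?_ ?_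
      · have b1 := hW.norm_wtrunc_sub_mean_le hψ' hP hk
        -- The mean itself is bounded by the average of `f`, since `|v| ≤ f`; when the cylinder
        -- leaves `U` the value is 0.
        have b2 : ‖C.localMean Λ (C.v η ζ) (z k)‖ ≤ D.avgConst n * C.lam Λ (z k) := by
          have hnn : 0 ≤ D.avgConst n * C.lam Λ (z k) := by positivity
          unfold Config.localMean
          split_ifs with hU
          · obtain ⟨hρ0, hτ0, -, -, -, -, -⟩ := hL.enlarged hzk rfl rfl
            have hu := unitVol_pos n
            have b3 := (hL.average_le hzk rfl rfl).1
            have hV := volume_cyl (z k) hρ0 ((2 / D.K * C.rad Λ (z k)) ^ 2 / C.coef Λ (z k))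
            set Q := C.wcyl Λ (2 / D.K) (z k) with hQ
            have hVtop : volume Q ≠ ⊤ := by rw [hQ, Config.wcyl, hV]; exact ENNReal.ofReal_ne_top
            have hVpos : 0 < volume.real Q := by
              rw [measureReal_def, hQ, Config.wcyl, hV, ENNReal.toReal_ofReal (by positivity)]
              positivity
            rw [setAverage_eq, norm_smul, norm_inv, Real.norm_of_nonneg hVpos.le,
              inv_mul_le_iff₀ hVpos]
            refine (norm_integral_le_lintegral_norm _).trans
              (ENNReal.toReal_le_of_le_ofReal (by positivity) ?_)
            calc ∫⁻ x in Q, ENNReal.ofReal ‖C.v η ζ x‖ ≤ ∫⁻ x in Q, ‖C.f x‖ₑ := by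
                  refine lintegral_mono_ae (ae_restrict_of_ae (hw.norm_le.mono fun x hx => ?_))
                  rw [Real.enorm_of_nonneg (Config.f_nonneg x)]
                  refine ENNReal.ofReal_le_ofReal (hx.trans ?_)
                  exact mul_le_of_le_one_left (Config.f_nonneg x) (Config.abs_cut_le_one hηζ x)
              _ ≤ ENNReal.ofReal (D.avgConst n * C.lam Λ (z k)) * volume Q := by
                  refine (lintegral_mono_set (cyl_subset_cyl ?_ ?_)).trans b3
                  · simp only [sub_self, norm_zero, zero_add]; linarith
                  · simp only [sub_self, abs_zero, zero_add]; linarith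
              _ = _ := by
                  rw [mul_comm (volume.real Q), ENNReal.ofReal_mul hnn, measureReal_def,
                    ENNReal.ofReal_toReal hVtop]
          · rwa [norm_zero]
        have b4 : ‖T y‖ ≤ ‖T y - C.localMean Λ (C.v η ζ) (z k)‖
            + ‖C.localMean Λ (C.v η ζ) (z k)‖ := by
          simpa using norm_add_le (T y - C.localMean Λ (C.v η ζ) (z k))
            (C.localMean Λ (C.v η ζ) (z k))
        have hrad : C.rad Λ (z k) ≤ |D.radBound| := (hL.rad_le hzk).trans (le_abs_self _)
        calc ‖T y‖ ≤ meanConst n (2 * D.ratio) * (a * C.lam Λ (z k) * C.rad Λ (z k))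
              + D.avgConst n * C.lam Λ (z k) := b4.trans (add_le_add b1 b2)
          _ ≤ meanConst n (2 * D.ratio) * (a * C.lam Λ (z k) * |D.radBound|)
              + D.avgConst n * C.lam Λ (z k) := by gcongr
          _ = (meanConst n (2 * D.ratio) * (a * |D.radBound|) + D.avgConst n)
              * C.lam Λ (z k) := by ring
          _ ≤ κ * C.lam Λ (z k) := by
              gcongr
              rw [hκdef]
              linarith
      · refine (hW.norm_grad_wtrunc_le hψ' hP hk).trans ?_
        calc (N * n) * (truncConst n D.K (2 * D.ratio) * (a * C.lam Λ (z k)))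
            = N * n * (truncConst n D.K (2 * D.ratio) * a) * C.lam Λ (z k) := by ring
          _ ≤ _ := by
              gcongr
              rw [hκdef]
              linarith
      -- The coefficients at `y` are compared with `λ` at the centre `z k`, which is legitimate
      -- because `y` lies in `20U_k`, where `rpow_d_div_le` applies.
      · have hmem : y ∈ cyl (z k) (20 * C.rad Λ (z k))
            (400 * C.rad Λ (z k) ^ 2 / C.coef Λ (z k)) := by
          have hK1 : 1 / D.K ≤ 1 := by rw [div_le_one (by linarith)]; linarith
          have hK2 : 0 ≤ 1 / D.K := by positivity
          have hK3 : 1 / D.K * C.rad Λ (z k) ≤ C.rad Λ (z k) := mul_le_of_le_one_left hr.le hK1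
          refine cyl_subset_cyl ?_ ?_ hk
          · simp only [sub_self, norm_zero, zero_add]; linarith
          · simp only [sub_self, abs_zero, zero_add]
            refine div_le_div_of_nonneg_right ?_ hθ.le
            calc (1 / D.K * C.rad Λ (z k)) ^ 2 ≤ C.rad Λ (z k) ^ 2 := by gcongr
              _ ≤ _ := by nlinarith [sq_nonneg (C.rad Λ (z k))]
        have b1 := (hL.rpow_d_div_le hzk hmem).2
        have b2 := (hL.growth_bounds (z k)).1.trans (hL.growth_bounds (z k)).2.1
        unfold Config.H Data.Hval
        nlinarith

end MultiPhase

theorem lemma3p9 {n N : ℕ} (D : Data) (hD : D.Admissible n) :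
    ∃ (c : ℝ) (cΛ : ℝ → ℝ),
      ∀ (C : Config n N D), D.K = C.Kval →
      -- the level `Λ`
      ∀ Λ₀ Λ : ℝ, 1 + D.normA + D.normB < Λ₀ → C.maxInt ≤ ENNReal.ofReal Λ₀ → Λ₀ < Λ →
      -- the Whitney cover and the cutoff functions generating the partition of unity
      ∀ {ι : Type} [Countable ι] (z : ι → SpaceTime n) (ψ : ι → SpaceTime n → ℝ),
      C.IsWhitney Λ z → C.IsCutoffFamily Λ z ψ →
      -- the localization
      ∀ (h₀ : ℝ) (η : Space n → ℝ) (ζ : ℝ → ℝ), 0 < h₀ → h₀ < (D.S₂ - D.S₁) / 4 →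
      C.IsCutoffPair h₀ η ζ →
        -- the Steklov averaged truncation, for every `0 < h < h₀`
        (∀ h : ℝ, 0 < h → h < h₀ →
          (∃ g : SpaceTime n → Space N,
            g =ᵐ[volume] C.trunc Λ z ψ (C.vh η ζ h) ∧
            EqOn g (C.trunc Λ z ψ (C.vh η ζ h)) (C.good Λ)ᶜ ∧
            ∀ y w : SpaceTime n, ‖g y - g w‖ ≤ cΛ Λ * D.dLam Λ y w) ∧
          ContDiffOn ℝ ∞ (C.trunc Λ z ψ (C.vh η ζ h)) (C.good Λ)ᶜ ∧
          ∫⁻ y in (C.good Λ)ᶜ,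
              ‖C.vh η ζ h y - C.trunc Λ z ψ (C.vh η ζ h) y‖ₑ *
                ‖dt (C.trunc Λ z ψ (C.vh η ζ h)) y‖ₑ
            ≤ ENNReal.ofReal (cΛ Λ) * volume (C.good Λ)ᶜ) ∧
        -- the truncation of the localized solution itself
        ContDiffOn ℝ ∞ (C.trunc Λ z ψ (C.v η ζ)) (C.good Λ)ᶜ ∧
        ∫⁻ y in (C.good Λ)ᶜ,
            ‖C.v η ζ y - C.trunc Λ z ψ (C.v η ζ) y‖ₑ * ‖dt (C.trunc Λ z ψ (C.v η ζ)) y‖ₑ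
          ≤ ENNReal.ofReal (c * Λ) * volume (C.good Λ)ᶜ ∧
        ∃ G : SpaceTime n → Mat N n,
          HasWeakGradientOn univ (C.trunc Λ z ψ (C.v η ζ)) G ∧
          ∀ᵐ y : SpaceTime n,
            C.H y ‖C.trunc Λ z ψ (C.v η ζ) y‖ + C.H y ‖G y‖ ≤ c * Λ := by
  obtain ⟨cΛ, H₁⟩ := exists_steklov_truncation n N D hD
  obtain ⟨c, H₂⟩ := exists_truncation n N D hD
  refine ⟨c, cΛ, fun C hK Λ₀ Λ hΛ₀ hint hΛ ι _ z ψ hz hψ h₀ η ζ hh₀ _ hηζ => ?_⟩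
  have hL : IsLevel C Λ :=
    ⟨hD, hK, hΛ₀.trans hΛ, hint.trans (ENNReal.ofReal_le_ofReal hΛ.le)⟩
  exact ⟨fun h hh hhh => H₁ C Λ hL z ψ hz hψ h₀ η ζ hh₀ hηζ h hh hhh,
    H₂ C Λ hL z ψ hz hψ h₀ η ζ hh₀ hηζ⟩
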